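/- **Model.** Fix $K\in\mathbb N$, $\tau\in(0,1]$ and constants $(\mu_p)_{p\ge 2}$. For each $N$ let $(x_{ij})_{1\le i\le j\le N}$ be centered real random variables (on a probability space that may depend on $N$) such that: * ($K$-dependence) for all sets $S,T$ of index pairs with $|i-k|\vee|j-l|>K$ for all $(i,j)\in S$, $(k,l)\in T$, the families $(x_a)_{a\in S}$ and $(x_b)_{b\in T}$ are independent; * (moments) with $q=N^\tau$, $\mathbb E|x_{ij}|^p\le (N/q)^{p/2-1}\mu_p^p$ for all integers $p\ge2$ and all $i\le j$; * (covariances) there are a constant $C$ and a function $\psi:[0,1)^2\times\mathbb Z^2\to\mathbb R$ such that for all $i\le j$, $k\le l$ with $i/N,j/N\in[0,1)$, $$\big|\mathbb E[x_{ij}x_{kl}]-\psi(i/N,j/N,k-i,l-j)\big|\le C/N,$$ unless $(i/N,j/N)$ lies in the $K/N$-neighbourhood of a discontinuity of $\psi(\cdot,\cdot,k-i,l-j)$. Here $[0,1)$ is a finite disjoint union of intervals $I_\alpha$ such that each $\psi(\cdot,\cdot,k,l)$ is Lipschitz on every $I_\alpha\times I_{\alpha'}$, and $\psi(\theta,\phi,k,l)=\psi(\theta,\phi,-k,-l)=\psi(\phi,\theta,l,k)$.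 Let $X$ be the symmetric matrix with upper triangular part $(x_{ij})$, $H=N^{-1/2}X$, and $G(z)=(H-z)^{-1}$ for $z\in\mathbb C^+=\{z:\operatorname{Im}z>0\}$. Let $\Phi=\Phi(N,z)=(N\operatorname{Im}z)^{-1/2}+q^{-1/2}$. **Finite equation.** Put $\xi_{ijkl}=\mathbb E[x_{ij}x_{kl}]$ if $i\le j$, $k\le l$; $\xi_{ijkl}=\xi_{jilk}$ if $i>j$, $k>l$; and $\xi_{ijkl}=0$ otherwise. Let $\Xi(M)_{ik}=\frac1N\sum_{j,l}\xi_{ijkl}M_{jl}$. Then $M=M(N,z)\in\mathbb C^{N\times N}$ denotes a solution of $M(-z-\Xi(M))=I$ with $\frac1{2\mathrm i}(M-M^*)$ positive definite. **Limiting equation.** Let $\mathcal K$ be the algebra of sequences $(a(k))_{k\in\mathbb Z}$ that act as bounded convolution operators on $\ell^2(\mathbb Z)$, with the operator norm, and let $\mathcal T=L^\infty([0,1),\mathcal K)$ (functions $f(\theta,k)$, measurable in $\theta$ for each $k$). For $f\in\mathcal T$ let $\check f(\theta,\zeta)=\sum_k f(\theta,k)e^{2\pi\mathrm i k\zeta}$,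 $\operatorname{tr}f=\int_0^1 f(\theta,0)\,d\theta$, and $\Psi(f)(\theta,k)=\sum_l\int_0^1\psi(\theta,\phi,k,l)f(\phi,l)\,d\phi$. Then $m=m(z)\in\mathcal T$ denotes a solution of $m=(-z-\Psi(m))^{-1}$ (the inverse is taken in $\mathcal K$, for almost every $\theta$; $z$ is identified with $z\delta_{k0}$) such that the essential infimum of $\operatorname{Im}\check m$ is positive. **Theorem (global law).** Let $\mathcal D$ be compactly contained in $\mathbb C^+$. 1. For all $\nu>0$ and $p\in\mathbb N$ there is $N_0$, depending only on $\mathcal D,\nu,p,K,\tau,(\mu_p)$, such that for all $N\ge N_0$, if $M(N,z)$ is as above for $z\in\mathcal D$, $$\mathbb P\Big(\sup_{1\le i,j\le N,\ z\in\mathcal D}\Phi(N,z)^{-1}\,|G_{ij}(z)-M_{ij}(N,z)|\ge N^\nu\Big)\le N^{-\nu p}.$$ 2. For all $\nu>0$ and $p\in\mathbb N$ there is $N_0$, depending only on $\mathcal D,\nu,p,K,\tau,(\mu_p),\psi,C$, such that for all $N\ge N_0$, if $m(z)$ is as above for $z\in\mathcal D$, $$\mathbb P\Big(\sup_{z\in\mathcal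 D}\Phi(N,z)^{-1}\,\big|\tfrac1N\operatorname{tr}G(z)-\operatorname{tr}m(z)\big|\ge N^\nu\Big)\le N^{-\nu p}.$$ 3. Consequently, if $m(z)$ is as above for all $z\in\mathbb C^+$, there is a probability measure $\rho$ on $\mathbb R$ with $\operatorname{tr}m(z)=\int\frac{\rho(dt)}{t-z}$ for all $z\in\mathbb C^+$, and the empirical spectral measures $\mu_N=\frac1N\sum_i\delta_{\lambda_i(H)}$ converge weakly to $\rho$ with very high probability: for every bounded continuous $f:\mathbb R\to\mathbb R$, $\varepsilon>0$ and $A>0$ there is $N_0$ with $\mathbb P\big(|\int f\,d\mu_N-\int f\,d\rho|\ge\varepsilon\big)\le N^{-A}$ for all $N\ge N_0$. -/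

import Mathlib

open MeasureTheory ProbabilityTheory
open scoped BoundedContinuousFunction

noncomputable section

namespace CorrelatedRM

/-! ### The random matrix model -/

/-- Index pairs `(i, j)` with `i ≤ j`. An element `i : Fin N` stands for the index `i + 1` of
`{1, …, N}`. -/
abbrev UpperIndex (N : ℕ) : Type := {a : Fin N × Fin N // a.1 ≤ a.2}

/-- The distance `|i - k| ∨ |j - l|` between index pairs `(i, j)` and `(k, l)`. -/
def indexDist {N : ℕ} (a b : UpperIndex N) : ℤ :=
  max |((a.1.1 : ℕ) : ℤ) - ((b.1.1 : ℕ) : ℤ)| |((a.1.2 : ℕ) : ℤ) - ((b.1.2 : ℕ) : ℤ)|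

/-- `K`-dependence: subfamilies whose index sets are more than `K` apart are independent. -/
def IsKDependent {N : ℕ} {Ω : Type*} [MeasurableSpace Ω] (K : ℕ) (P : Measure Ω)
    (x : UpperIndex N → Ω → ℝ) : Prop :=
  ∀ S T : Set (UpperIndex N), (∀ a ∈ S, ∀ b ∈ T, (K : ℤ) < indexDist a b) →
    IndepFun (fun ω (a : S) => x a ω) (fun ω (b : T) => x b ω) P

/-- The point `i / N` for the one-based index `i` (represented by `i - 1 : Fin N`). -/
def gridPoint {N : ℕ} (i : Fin N) : ℝ := (((i : ℕ) : ℝ) + 1) / (N : ℝ)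

/-- The symmetric matrix `X` whose upper triangular part is the array `x`. -/
def symMatrix {N : ℕ} (x : UpperIndex N → ℝ) : Matrix (Fin N) (Fin N) ℝ :=
  fun i j => x ⟨(min i j, max i j), min_le_max⟩

/-- The normalized matrix `H = N^{-1/2} X`. -/
def normMatrix {N : ℕ} (x : UpperIndex N → ℝ) : Matrix (Fin N) (Fin N) ℝ :=
  (1 / Real.sqrt (N : ℝ)) • symMatrix x

theorem normMatrix_isHermitian {N : ℕ} (x : UpperIndex N → ℝ) :
    (normMatrix x).IsHermitian := by
  ext i j
  simp [normMatrix, symMatrix, Matrix.conjTranspose_apply, min_comm, max_comm]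

/-- The Green's function `G(z) = (H - z)⁻¹`. -/
def green {N : ℕ} (x : UpperIndex N → ℝ) (z : ℂ) : Matrix (Fin N) (Fin N) ℂ :=
  ((normMatrix x).map (fun r : ℝ => (r : ℂ)) - z • (1 : Matrix (Fin N) (Fin N) ℂ))⁻¹

/-- The empirical spectral measure `N⁻¹ ∑ δ_{λ_i(H)}`. -/
def empiricalMeasure {N : ℕ} (x : UpperIndex N → ℝ) : Measure ℝ :=
  (N : ENNReal)⁻¹ • ∑ i : Fin N, Measure.dirac ((normMatrix_isHermitian x).eigenvalues i)

/-- The extended covariance tensor: `E[x_{ij} x_{kl}]` if `i ≤ j`, `k ≤ l`; `E[x_{ji} x_{lk}]` if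
`i > j`, `k > l`; and `0` otherwise. -/
def covTensor {N : ℕ} {Ω : Type*} [MeasurableSpace Ω] (P : Measure Ω)
    (x : UpperIndex N → Ω → ℝ) (i j k l : Fin N) : ℝ :=
  if (i ≤ j ∧ k ≤ l) ∨ (j < i ∧ l < k) then
    ∫ ω, symMatrix (fun a => x a ω) i j * symMatrix (fun a => x a ω) k l ∂P
  else 0

/-- Admissible profiles `ψ : [0,1)² × ℤ² → ℝ` (only the values at `θ, φ ∈ [0,1)` matter):
piecewise Lipschitz with respect to a finite partition of `[0,1)` into intervals, with the
symmetries of a real symmetric matrix. -/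
structure IsProfile (ψ : ℝ → ℝ → ℤ → ℤ → ℝ) : Prop where
  piecewise_lipschitz : ∃ (n : ℕ) (I : Fin n → Set ℝ),
    (∀ α, (I α).OrdConnected) ∧ Pairwise (fun α β => Disjoint (I α) (I β)) ∧
    (⋃ α, I α) = Set.Ico (0 : ℝ) 1 ∧
    ∀ (α β : Fin n) (k l : ℤ), ∃ L : NNReal,
      LipschitzOnWith L (fun p : ℝ × ℝ => ψ p.1 p.2 k l) (I α ×ˢ I β)
  symm_neg : ∀ θ ∈ Set.Ico (0 : ℝ) 1, ∀ φ ∈ Set.Ico (0 : ℝ) 1, ∀ k l : ℤ,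
    ψ θ φ k l = ψ θ φ (-k) (-l)
  symm_swap : ∀ θ ∈ Set.Ico (0 : ℝ) 1, ∀ φ ∈ Set.Ico (0 : ℝ) 1, ∀ k l : ℤ,
    ψ θ φ k l = ψ φ θ l k

/-- `(a, b)` lies in the `r`-neighbourhood of a point of discontinuity of the function `g` on
`[0,1)²`. -/
def NearDiscontinuity (g : ℝ × ℝ → ℝ) (r a b : ℝ) : Prop :=
  ∃ θ ∈ Set.Ico (0 : ℝ) 1, ∃ φ ∈ Set.Ico (0 : ℝ) 1,
    ¬ ContinuousWithinAt g (Set.Ico (0 : ℝ) 1 ×ˢ Set.Ico (0 : ℝ) 1) (θ, φ) ∧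
    |a - θ| ≤ r ∧ |b - φ| ≤ r

/-- `ξ_{ijkl} = ψ(i/N, j/N, k - i, l - j) + O(1/N)` for `i ≤ j`, `k ≤ l`, with implied constant
`C`, unless `(i/N, j/N)` is in the `K/N`-neighbourhood of a discontinuity of
`ψ(·, ·, k - i, l - j)`. The condition is imposed where `ψ` is defined, that is for
`i/N, j/N ∈ [0,1)`. -/
def IsDiscretization {N : ℕ} (K : ℕ) (C : ℝ) (ψ : ℝ → ℝ → ℤ → ℤ → ℝ)
    (ξ : Fin N → Fin N → Fin N → Fin N → ℝ) : Prop :=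
  ∀ i j k l : Fin N, i ≤ j → k ≤ l → gridPoint i < 1 → gridPoint j < 1 →
    ¬ NearDiscontinuity
        (fun p => ψ p.1 p.2 (((k : ℕ) : ℤ) - ((i : ℕ) : ℤ)) (((l : ℕ) : ℤ) - ((j : ℕ) : ℤ)))
        ((K : ℝ) / (N : ℝ)) (gridPoint i) (gridPoint j) →
    |ξ i j k l - ψ (gridPoint i) (gridPoint j)
        (((k : ℕ) : ℤ) - ((i : ℕ) : ℤ)) (((l : ℕ) : ℤ) - ((j : ℕ) : ℤ))| ≤ C / (N : ℝ)

/-- A sequence (in `N`) of arrays `(x_{ij})_{i ≤ j}` of centered `K`-dependent real random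
variables with `E|x_{ij}|^p ≤ (N/q)^{p/2-1} μ_p^p`, `q = N^τ`, whose covariance tensor is the
discretization of `ψ`. The arrays for different `N` may live on different probability spaces. -/
structure CorrelatedModel (K : ℕ) (τ : ℝ) (μ : ℕ → ℝ) (ψ : ℝ → ℝ → ℤ → ℤ → ℝ) (C : ℝ) where
  Ω : ℕ → Type*
  [mΩ : ∀ N, MeasurableSpace (Ω N)]
  P : ∀ N, Measure (Ω N)
  isProb : ∀ N, IsProbabilityMeasure (P N)
  x : ∀ N, UpperIndex N → Ω N → ℝ
  measurable_x : ∀ N a, Measurable (x N a)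
  centered : ∀ N a, ∫ ω, x N a ω ∂(P N) = 0
  moments : ∀ (p : ℕ), 2 ≤ p → ∀ N a,
    Integrable (fun ω => |x N a ω| ^ p) (P N) ∧
    ∫ ω, |x N a ω| ^ p ∂(P N) ≤ ((N : ℝ) / (N : ℝ) ^ τ) ^ ((p : ℝ) / 2 - 1) * μ p ^ p
  kDependent : ∀ N, IsKDependent K (P N) (x N)
  discretization : ∀ N, IsDiscretization K C ψ (covTensor (P N) (x N))

attribute [instance] CorrelatedModel.mΩ

/-! ### The finite self-consistent equation -/

/-- `Ξ(M)_{ik} = N⁻¹ ∑_{j,l} ξ_{ijkl} M_{jl}`. -/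
def Xi {N : ℕ} (ξ : Fin N → Fin N → Fin N → Fin N → ℝ) (M : Matrix (Fin N) (Fin N) ℂ) :
    Matrix (Fin N) (Fin N) ℂ :=
  fun i k => (1 / (N : ℂ)) * ∑ j, ∑ l, (ξ i j k l : ℂ) * M j l

open scoped ComplexOrder in
/-- `M` solves `M(-z - Ξ(M)) = I` in the class of matrices with positive definite imaginary part
`(M - M^*)/(2i)`. -/
def SolvesFinite {N : ℕ} (ξ : Fin N → Fin N → Fin N → Fin N → ℝ) (z : ℂ)
    (M : Matrix (Fin N) (Fin N) ℂ) : Prop :=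
  ((1 / (2 * Complex.I)) • (M - M.conjTranspose)).PosDef ∧
    M * (-(z • (1 : Matrix (Fin N) (Fin N) ℂ)) - Xi ξ M) = 1

/-! ### The limiting self-consistent equation -/

/-- Lebesgue measure on `[0,1)`. -/
abbrev unitMeasure : Measure ℝ := volume.restrict (Set.Ico (0 : ℝ) 1)

/-- The convolution `a * v` is defined and equals `w`. -/
def ConvolvesTo (a v w : ℤ → ℂ) : Prop :=
  ∀ n : ℤ, HasSum (fun k : ℤ => a (n - k) * v k) (w n)

/-- The space `𝒦` of sequences `a` such that `a * v ∈ ℓ²(ℤ)` for all `v ∈ ℓ²(ℤ)`. -/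
def MemK (a : ℤ → ℂ) : Prop :=
  ∀ v : lp (fun _ : ℤ => ℂ) 2, ∃ w : lp (fun _ : ℤ => ℂ) 2, ConvolvesTo a v w

/-- `a ∈ 𝒦` has norm at most `c` as a convolution operator on `ℓ²(ℤ)`. -/
def NormKLe (a : ℤ → ℂ) (c : ℝ) : Prop :=
  ∀ v w : lp (fun _ : ℤ => ℂ) 2, ConvolvesTo a v w → ‖w‖ ≤ c * ‖v‖

/-- `f` represents an element of `𝒯 = L^∞([0,1), 𝒦)` (measurability is coordinatewise). -/
def MemT (f : ℝ → ℤ → ℂ) : Prop :=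
  (∀ k, AEStronglyMeasurable (fun θ => f θ k) unitMeasure) ∧
    ∃ c : ℝ, ∀ᵐ θ ∂unitMeasure, MemK (f θ) ∧ NormKLe (f θ) c

open Classical in
/-- The inverse Fourier transform `ζ ↦ ∑_k a(k) e^{2π i k ζ}` of `a ∈ ℓ²(ℤ)`, an `L²` function on
the circle `ℝ/ℤ` (every `a ∈ 𝒦` is in `ℓ²(ℤ)`). -/
def invFourier (a : ℤ → ℂ) : Lp ℂ 2 (@AddCircle.haarAddCircle (1 : ℝ) _) :=
  if h : Memℓp a 2 then (fourierBasis (T := (1 : ℝ))).repr.symm ⟨a, h⟩ else 0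

/-- `f ∈ 𝒯₊`: `f ∈ 𝒯` and the (essential) infimum of `Im f̌(θ, ζ)` is positive. -/
def MemTPlus (f : ℝ → ℤ → ℂ) : Prop :=
  MemT f ∧ ∃ c : ℝ, 0 < c ∧ ∀ᵐ θ ∂unitMeasure,
    ∀ᵐ ζ ∂(@AddCircle.haarAddCircle (1 : ℝ) _), c ≤ (invFourier (f θ) ζ).im

/-- `Ψ(f)(θ, k) = ∑_l ∫₀¹ ψ(θ, φ, k, l) f(φ, l) dφ`. -/
def Psi (ψ : ℝ → ℝ → ℤ → ℤ → ℝ) (f : ℝ → ℤ → ℂ) (θ : ℝ) (k : ℤ) : ℂ :=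
  ∑' l : ℤ, ∫ φ in Set.Ico (0 : ℝ) 1, (ψ θ φ k l : ℂ) * f φ l

/-- `-z - Ψ(f)(θ)`, where `z` is identified with the sequence `z δ_{k0}`. -/
def limitOperand (ψ : ℝ → ℝ → ℤ → ℤ → ℝ) (z : ℂ) (f : ℝ → ℤ → ℂ) (θ : ℝ) (k : ℤ) : ℂ :=
  -(if k = 0 then z else 0) - Psi ψ f θ k

/-- `m ∈ 𝒯₊` solves `m = (-z - Ψ(m))⁻¹`: for almost all `θ`, `m(θ)` is the inverse of
`-z - Ψ(m)(θ)` in the convolution algebra `𝒦`. -/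
def SolvesLimit (ψ : ℝ → ℝ → ℤ → ℤ → ℝ) (z : ℂ) (m : ℝ → ℤ → ℂ) : Prop :=
  MemTPlus m ∧ ∀ᵐ θ ∂unitMeasure,
    MemK (limitOperand ψ z m θ) ∧
      ConvolvesTo (m θ) (limitOperand ψ z m θ) (fun k => if k = 0 then 1 else 0)

/-- `tr f = ∫₀¹ f(θ, 0) dθ`. -/
def limitTrace (f : ℝ → ℤ → ℂ) : ℂ := ∫ θ in Set.Ico (0 : ℝ) 1, f θ 0

/-- The control parameter `Φ = (N η)^{-1/2} + q^{-1/2}`, `η = Im z`, `q = N^τ`. -/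
def controlPhi (τ : ℝ) (N : ℕ) (z : ℂ) : ℝ :=
  1 / Real.sqrt ((N : ℝ) * z.im) + 1 / Real.sqrt ((N : ℝ) ^ τ)

end CorrelatedRM

end

/-! The resolvent nearly solves the finite equation, and that equation is stable with constants
independent of $N$. Since $1+zG=HG$, the residual is $R=HG+\Xi(G)G$. In $R_{ij}$, write
$H_{ik}G_{kj}$ and set to zero all entries within distance $2K$ of $(i,k)$: what remains of $G$ is
independent of $H_{ik}$, and the first-order term of the resolvent expansion in the removed entries
gives $-\mathbb E[H_{ik}H_{uv}]\,G_{ku}G_{vj}$, which $\Xi(G)G$ cancels. Carried out inside $\mathbb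
E|R_{ij}|^{2q+2}$, this leaves an error of order $\phi\,\mathbb E(|R_{ij}|+\phi)^{2q+1}$, because
rows and columns of $G$ are bounded in $\ell^2$ and so typical entries of $G$ are small. Young's
inequality closes the recursion (`exists_moment_residual_le`). Truncation of the entries, Markov's
inequality and a net in $z$ then make $R$ small uniformly with very high probability
(`exists_residual_prob_le`).

Stability (`stability`) uses that the covariance tensor is a Gram matrix, so that $\Xi$ is
completely positive. It therefore preserves inequalities of the form $2|\langle u,Xv\rangle|\le
c\,(\operatorname{Im}\langle u,M_1u\rangle+\operatorname{Im}\langle v,M_2v\rangle)$. For $X=M_1-M_2$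
the equation improves $c$ by a fixed factor below one, up to the size of the perturbation. An
entrywise small residual is turned into a small perturbation by passing from $G$ to $A^{-1}$ with
$A=-z-\Xi(G)$: as $A$ is banded, its inverse has bounded row sums (`col_sum_le_of_banded`), so
$A^{-1}$ is entrywise close to $G$ and solves the equation with perturbation $\Xi(G-A^{-1})$
(`exists_close_of_residual`).

For the limiting equation, the profile inherits boundedness, finite range and a nonnegative symbol
from the covariance kernels (`IsProfile.exists_isLimitProfile`). Hence $m(\theta)$ consists of the
Fourier coefficients of the reciprocal of a trigonometric polynomial whose modulus is at least
$\operatorname{Im}z$, and it is Lipschitz in $\theta$ between break points. A block Toeplitz matrix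
with blocks of length about $\sqrt N$, filled with sampled values of $m$, satisfies the finite
equation up to $O(N^{-1/2})$ outside $O(\sqrt N)$ rows. Since $\Xi$ sees a matrix only through band
averages, this yields a genuine approximate solution with almost the same trace
(`IsLimitProfile.exists_discretization`), and stability applies again.

Finally $N^{-1}\operatorname{tr}G$ is the Stieltjes transform of the empirical measure. The bound
$|1+\mathrm iy\operatorname{tr}m(\mathrm iy)|=O(y^{-2})$ gives tightness, so compactness together
with uniqueness of Stieltjes transforms produces $\rho$ and turns closeness of transforms into weak
convergence. -/

noncomputable section

namespace CorrelatedRM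

section

/-! ### Sesquilinear forms of complex matrices -/

section Forms

variable {n : Type*} [Fintype n]

/-- The sesquilinear form `⟨u, A v⟩`. -/
def form (u : n → ℂ) (A : Matrix n n ℂ) (v : n → ℂ) : ℂ := star u ⬝ᵥ A.mulVec v

/-- The squared Euclidean norm. -/
def nsq (u : n → ℂ) : ℝ := ∑ i, ‖u i‖ ^ 2

theorem nsq_nonneg (u : n → ℂ) : 0 ≤ nsq u := Finset.sum_nonneg fun _ _ => by positivity

theorem form_eq_sum (u : n → ℂ) (A : Matrix n n ℂ) (v : n → ℂ) :
    form u A v = ∑ i, ∑ j, star (u i) * A i j * v j := by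
  simp [form, dotProduct, Matrix.mulVec, Finset.mul_sum, mul_assoc]

theorem form_add (u : n → ℂ) (A B : Matrix n n ℂ) (v : n → ℂ) :
    form u (A + B) v = form u A v + form u B v := by
  simp [form, Matrix.add_mulVec]

theorem form_sub (u : n → ℂ) (A B : Matrix n n ℂ) (v : n → ℂ) :
    form u (A - B) v = form u A v - form u B v := by
  simp [form, Matrix.sub_mulVec]

theorem form_neg (u : n → ℂ) (A : Matrix n n ℂ) (v : n → ℂ) :
    form u (-A) v = -form u A v := by
  simp [form, Matrix.neg_mulVec]

theorem form_smul (u : n → ℂ) (c : ℂ) (A : Matrix n n ℂ) (v : n → ℂ) :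
    form u (c • A) v = c * form u A v := by
  simp [form, Matrix.smul_mulVec]

theorem dotProduct_star_self (u : n → ℂ) : star u ⬝ᵥ u = (nsq u : ℂ) := by
  simp [dotProduct, nsq, Complex.conj_mul']

theorem norm_dotProduct_sq_le (u v : n → ℂ) : ‖star u ⬝ᵥ v‖ ^ 2 ≤ nsq u * nsq v := by
  have h : ‖star u ⬝ᵥ v‖ ≤ ∑ i, ‖u i‖ * ‖v i‖ := by
    refine (norm_sum_le _ _).trans (Finset.sum_le_sum fun i _ => ?_)
    simp
  calc ‖star u ⬝ᵥ v‖ ^ 2 ≤ (∑ i, ‖u i‖ * ‖v i‖) ^ 2 := by gcongr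
    _ ≤ nsq u * nsq v := Finset.sum_mul_sq_le_sq_mul_sq _ _ _

theorem two_norm_dotProduct_le (u v : n → ℂ) : 2 * ‖star u ⬝ᵥ v‖ ≤ nsq u + nsq v := by
  have h := norm_dotProduct_sq_le u v
  have := nsq_nonneg u
  have := nsq_nonneg v
  nlinarith [sq_nonneg (nsq u - nsq v), norm_nonneg (star u ⬝ᵥ v)]

theorem nsq_smul (c : ℝ) (u : n → ℂ) : nsq ((c : ℂ) • u) = c ^ 2 * nsq u := by
  simp [nsq, mul_pow, Finset.mul_sum]

theorem form_mul_mul (u : n → ℂ) (A X B : Matrix n n ℂ) (v : n → ℂ) :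
    form u (A * X * B) v = form (A.conjTranspose.mulVec u) X (B.mulVec v) := by
  simp only [form, Matrix.star_mulVec, Matrix.conjTranspose_conjTranspose,
    ← Matrix.mulVec_mulVec, Matrix.dotProduct_mulVec, mul_assoc]

theorem form_conjTranspose (u : n → ℂ) (A : Matrix n n ℂ) (v : n → ℂ) :
    form u A.conjTranspose v = star (form v A u) := by
  simp only [form_eq_sum, star_sum, star_mul', star_star, Matrix.conjTranspose_apply]
  rw [Finset.sum_comm]
  exact Finset.sum_congr rfl fun i _ => Finset.sum_congr rfl fun j _ => by ring

/-- A bound on the operator norm, expressed through the sesquilinear form. -/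
def FormLe (X : Matrix n n ℂ) (ε : ℝ) : Prop :=
  ∀ u v, 2 * ‖form u X v‖ ≤ ε * (nsq u + nsq v)

theorem FormLe.add {X Y : Matrix n n ℂ} {a b : ℝ} (hX : FormLe X a) (hY : FormLe Y b) :
    FormLe (X + Y) (a + b) := fun u v => by
  rw [form_add]
  linarith [hX u v, hY u v, norm_add_le (form u X v) (form u Y v)]

theorem FormLe.neg {X : Matrix n n ℂ} {a : ℝ} (hX : FormLe X a) : FormLe (-X) a :=
  fun u v => by simpa [form_neg] using hX u v

theorem FormLe.sub {X Y : Matrix n n ℂ} {a b : ℝ} (hX : FormLe X a) (hY : FormLe Y b) :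
    FormLe (X - Y) (a + b) := by
  rw [sub_eq_add_neg]; exact hX.add hY.neg

theorem FormLe.mono {X : Matrix n n ℂ} {a b : ℝ} (hX : FormLe X a) (hab : a ≤ b) : FormLe X b :=
  fun u v => (hX u v).trans
    (mul_le_mul_of_nonneg_right hab (add_nonneg (nsq_nonneg u) (nsq_nonneg v)))

theorem FormLe.conjTranspose {X : Matrix n n ℂ} {a : ℝ} (hX : FormLe X a) :
    FormLe X.conjTranspose a := fun u v => by
  rw [form_conjTranspose, norm_star, add_comm]; exact hX v u

theorem formLe_zero : FormLe (0 : Matrix n n ℂ) 0 := fun u v => by simp [form]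

theorem formLe_smul_one [DecidableEq n] (z : ℂ) : FormLe (z • (1 : Matrix n n ℂ)) ‖z‖ :=
  fun u v => by
  rw [form_smul, norm_mul]
  have := two_norm_dotProduct_le u v
  simp only [form, Matrix.one_mulVec]
  nlinarith [norm_nonneg z]

theorem FormLe.nsq_mulVec_le {X : Matrix n n ℂ} {b : ℝ} (hX : FormLe X b) (hb : 0 < b)
    (v : n → ℂ) : nsq (X.mulVec v) ≤ b ^ 2 * nsq v := by
  -- The scale $1/b$ balances the two terms, so that the arithmetic-mean bound in `FormLe` becomes
  -- an operator norm bound.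
  have h := hX (((1 / b : ℝ) : ℂ) • X.mulVec v) v
  have h1 : form (((1 / b : ℝ) : ℂ) • X.mulVec v) X v = ((1 / b * nsq (X.mulVec v) : ℝ) : ℂ) := by
    simp only [form, star_smul, smul_dotProduct, dotProduct_star_self]
    simp
  rw [h1, nsq_smul, Complex.norm_real, Real.norm_of_nonneg
    (mul_nonneg (by positivity) (nsq_nonneg _))] at h
  have h2 : 2 * (1 / b * nsq (X.mulVec v)) * b ≤
      b * ((1 / b) ^ 2 * nsq (X.mulVec v) + nsq v) * b := by gcongr
  have e1 : 2 * (1 / b * nsq (X.mulVec v)) * b = 2 * nsq (X.mulVec v) := by field_simp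
  have e2 : b * ((1 / b) ^ 2 * nsq (X.mulVec v) + nsq v) * b
      = nsq (X.mulVec v) + b ^ 2 * nsq v := by field_simp
  linarith

theorem nsq_single [DecidableEq n] (i : n) : nsq (Pi.single i (1 : ℂ)) = 1 := by
  unfold nsq
  rw [Finset.sum_eq_single i] <;> simp +contextual

theorem form_single [DecidableEq n] (X : Matrix n n ℂ) (i j : n) :
    form (Pi.single i 1) X (Pi.single j 1) = X i j := by
  rw [form_eq_sum, Finset.sum_eq_single i, Finset.sum_eq_single j] <;> simp +contextual

theorem FormLe.norm_apply_le [DecidableEq n] {X : Matrix n n ℂ} {b : ℝ} (hX : FormLe X b)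
    (i j : n) : ‖X i j‖ ≤ b := by
  have := hX (Pi.single i 1) (Pi.single j 1)
  rw [form_single, nsq_single, nsq_single] at this
  linarith

/-! ### Dissipative matrices -/

/-- The imaginary part of `A` is at most `-η`. -/
def Dissipative (η : ℝ) (A : Matrix n n ℂ) : Prop := ∀ w, η * nsq w ≤ -(form w A w).im

theorem nsq_le_of_form_im {η : ℝ} (hη : 0 < η) {A : Matrix n n ℂ} {w : n → ℂ}
    (h : η * nsq w ≤ |(form w A w).im|) : η ^ 2 * nsq w ≤ nsq (A.mulVec w) := by
  have h1 : η * nsq w ≤ ‖form w A w‖ := h.trans (Complex.abs_im_le_norm _)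
  have h2 : ‖form w A w‖ ^ 2 ≤ nsq w * nsq (A.mulVec w) := norm_dotProduct_sq_le _ _
  rcases (nsq_nonneg w).eq_or_lt with h0 | h0
  · rw [← h0]; simpa using nsq_nonneg _
  · have h3 : (η * nsq w) ^ 2 ≤ nsq w * nsq (A.mulVec w) :=
      (pow_le_pow_left₀ (by positivity) h1 2).trans h2
    have h4 : nsq w * (η ^ 2 * nsq w) ≤ nsq w * nsq (A.mulVec w) := by linarith
    exact le_of_mul_le_mul_left h4 h0

theorem nsq_eq_zero {u : n → ℂ} (h : nsq u = 0) : u = 0 := by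
  funext i
  have := (Finset.sum_eq_zero_iff_of_nonneg (fun i _ => by positivity)).1 h i (Finset.mem_univ i)
  simpa using this

variable [DecidableEq n]

theorem Dissipative.isUnit {η : ℝ} (hη : 0 < η) {A : Matrix n n ℂ} (hA : Dissipative η A) :
    IsUnit A := by
  rw [← Matrix.mulVec_injective_iff_isUnit]
  intro x y hxy
  have h0 : A.mulVec (x - y) = 0 := by rw [Matrix.mulVec_sub]; exact sub_eq_zero.2 hxy
  have h1 := nsq_le_of_form_im hη (A := A) (w := x - y) ((hA _).trans (neg_le_abs _))
  rw [h0] at h1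
  have h2 : nsq (0 : n → ℂ) = 0 := by simp [nsq]
  rw [h2] at h1
  have h3 : nsq (x - y) = 0 :=
    le_antisymm (by nlinarith [nsq_nonneg (x - y), pow_pos hη 2]) (nsq_nonneg _)
  exact sub_eq_zero.1 (nsq_eq_zero h3)

theorem Dissipative.inv_mul {η : ℝ} (hη : 0 < η) {A : Matrix n n ℂ} (hA : Dissipative η A) :
    A⁻¹ * A = 1 :=
  Matrix.nonsing_inv_mul _ ((Matrix.isUnit_iff_isUnit_det A).1 (hA.isUnit hη))

/-- This transfers information on the imaginary part of a matrix to its inverse; the conjugation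
flips the sign. The version with $M^*$ is needed because in a product $M_1XM_2$ the left vector is
acted on by $M_1^*$ and the right one by $M_2$. -/
theorem form_eq_star_of_mul_eq_one {M A : Matrix n n ℂ} (h : M * A = 1) (u : n → ℂ) :
    form u M u = star (form (M.mulVec u) A (M.mulVec u)) := by
  have h' : A * M = 1 := mul_eq_one_comm.1 h
  have : form (M.mulVec u) A (M.mulVec u) = star (M.mulVec u) ⬝ᵥ u := by
    rw [form, Matrix.mulVec_mulVec, h', Matrix.one_mulVec]
  rw [this, form, Matrix.star_dotProduct]

theorem form_eq_star_of_mul_eq_one' {M A : Matrix n n ℂ} (h : M * A = 1) (u : n → ℂ) :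
    form u M u = star (form (M.conjTranspose.mulVec u) A (M.conjTranspose.mulVec u)) := by
  have h' : M.conjTranspose * A.conjTranspose = 1 := by
    rw [← Matrix.conjTranspose_mul, mul_eq_one_comm.1 h, Matrix.conjTranspose_one]
  have := form_eq_star_of_mul_eq_one h' u
  rw [form_conjTranspose, form_conjTranspose, star_star] at this
  rw [← this, star_star]

/-- The properties of the inverse of a dissipative matrix. -/
structure IsDissipativeInverse (η : ℝ) (M : Matrix n n ℂ) : Prop where
  nsq_le : ∀ v, η ^ 2 * nsq (M.mulVec v) ≤ nsq v
  nsq_conjTranspose_le : ∀ v, η ^ 2 * nsq (M.conjTranspose.mulVec v) ≤ nsq v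
  im_nonneg : ∀ v, 0 ≤ (form v M v).im

theorem Dissipative.of_mul_eq_one {η : ℝ} (hη : 0 < η) {M A : Matrix n n ℂ} (h : M * A = 1)
    (hA : Dissipative η A) : IsDissipativeInverse η M := by
  have h' : A * M = 1 := mul_eq_one_comm.1 h
  refine ⟨fun v => ?_, fun v => ?_, fun v => ?_⟩
  · have := nsq_le_of_form_im hη (A := A) (w := M.mulVec v) ((hA _).trans (neg_le_abs _))
    rwa [Matrix.mulVec_mulVec, h', Matrix.one_mulVec] at this
  · have h2 : A.conjTranspose * M.conjTranspose = 1 := by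
      rw [← Matrix.conjTranspose_mul, h, Matrix.conjTranspose_one]
    have := nsq_le_of_form_im hη (A := A.conjTranspose) (w := M.conjTranspose.mulVec v)
      (by
        rw [form_conjTranspose]
        refine (hA _).trans ?_
        rw [RCLike.star_def, Complex.conj_im]
        exact le_abs_self _)
    rwa [Matrix.mulVec_mulVec, h2, Matrix.one_mulVec] at this
  · rw [form_eq_star_of_mul_eq_one h]
    have := hA (M.mulVec v)
    have h3 := mul_nonneg hη.le (nsq_nonneg (M.mulVec v))
    simp only [RCLike.star_def, Complex.conj_im]
    linarith

theorem Dissipative.inv {η : ℝ} (hη : 0 < η) {A : Matrix n n ℂ} (hA : Dissipative η A) :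
    IsDissipativeInverse η A⁻¹ := hA.of_mul_eq_one hη (hA.inv_mul hη)

/-- A column is the image of a basis vector. This dimension-free $\ell^2$ bound plays the role of
the Ward identity: a typical entry of the resolvent is of order $N^{-1/2}$. -/
theorem sum_col_sq_le {η : ℝ} (hη : 0 < η) {M : Matrix n n ℂ}
    (hM : ∀ v, η ^ 2 * nsq (M.mulVec v) ≤ nsq v) (j : n) : ∑ k, ‖M k j‖ ^ 2 ≤ 1 / η ^ 2 := by
  have h := hM (Pi.single j 1)
  rw [nsq_single, Matrix.mulVec_single_one] at h
  rw [le_div_iff₀ (by positivity), mul_comm]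
  exact h

theorem IsDissipativeInverse.col_le {η : ℝ} (hη : 0 < η) {M : Matrix n n ℂ}
    (hM : IsDissipativeInverse η M) (j : n) : ∑ k, ‖M k j‖ ^ 2 ≤ 1 / η ^ 2 :=
  sum_col_sq_le hη hM.nsq_le j

theorem IsDissipativeInverse.row_le {η : ℝ} (hη : 0 < η) {M : Matrix n n ℂ}
    (hM : IsDissipativeInverse η M) (i : n) : ∑ k, ‖M i k‖ ^ 2 ≤ 1 / η ^ 2 := by
  have h := hM.nsq_conjTranspose_le (Pi.single i 1)
  rw [nsq_single, Matrix.mulVec_single_one] at h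
  rw [le_div_iff₀ (by positivity), mul_comm]
  simpa [nsq, Matrix.col] using h

theorem IsDissipativeInverse.norm_apply_le {η : ℝ} (hη : 0 < η) {M : Matrix n n ℂ}
    (hM : IsDissipativeInverse η M) (i j : n) : ‖M i j‖ ≤ 1 / η := by
  have h1 : ‖M i j‖ ^ 2 ≤ (1 / η) ^ 2 := by
    refine le_trans ?_ ((hM.col_le hη j).trans_eq (by rw [div_pow, one_pow]))
    exact Finset.single_le_sum (f := fun k => ‖M k j‖ ^ 2) (fun k _ => by positivity)
      (Finset.mem_univ i)
  exact (pow_le_pow_iff_left₀ (norm_nonneg _) (by positivity) two_ne_zero).1 h1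

end Forms

end

section

/-! ### The self-energy map -/

/-- The kernel `ξ` is positive semidefinite as a matrix indexed by pairs. -/
def IsGram {ι κ : Type*} (ξ : ι → κ → ι → κ → ℝ) : Prop :=
  ∃ (m : ℕ) (B : Fin m → ι → κ → ℝ), ∀ i j k l, ξ i j k l = ∑ s, B s i j * B s k l

open scoped MatrixOrder Matrix.Norms.L2Operator in
theorem isGram_of_nonneg {ι κ : Type*} [Fintype ι] [Fintype κ] {ξ : ι → κ → ι → κ → ℝ}
    (hsymm : ∀ i j k l, ξ i j k l = ξ k l i j)
    (hpos : ∀ c : ι → κ → ℝ, 0 ≤ ∑ i, ∑ j, ∑ k, ∑ l, c i j * c k l * ξ i j k l) : IsGram ξ := by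
  classical
  have hP : (Matrix.of fun a b : ι × κ => ξ a.1 a.2 b.1 b.2).PosSemidef := by
    refine Matrix.PosSemidef.of_dotProduct_mulVec_nonneg ?_ fun x => ?_
    · ext a b
      simp [hsymm b.1 b.2]
    · have := hpos fun i j => x (i, j)
      simp only [dotProduct, Matrix.mulVec, Finset.mul_sum, Fintype.sum_prod_type,
        Matrix.of_apply, Pi.star_apply, star_trivial]
      refine this.trans_eq (Finset.sum_congr rfl fun i _ => Finset.sum_congr rfl fun j _ =>
        Finset.sum_congr rfl fun k _ => Finset.sum_congr rfl fun l _ => by ring)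
  -- The rows of any factor `B` with `star B * B` equal to the kernel serve as the vectors of the
  -- Gram representation.
  obtain ⟨B, hB⟩ := CStarAlgebra.nonneg_iff_eq_star_mul_self.mp hP.nonneg
  let e := Fintype.equivFin (ι × κ)
  refine ⟨Fintype.card (ι × κ), fun s i j => B (e.symm s) (i, j), fun i j k l => ?_⟩
  have h1 := congrFun (congrFun hB (i, j)) (k, l)
  simp only [Matrix.of_apply, Matrix.star_eq_conjTranspose, Matrix.mul_apply,
    Matrix.conjTranspose_apply, star_trivial] at h1
  rw [h1]
  exact (Equiv.sum_comp e.symm fun a => B a (i, j) * B a (k, l)).symm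

/-- The map `X ↦ ∑_{j,l} ξ_{ijkl} X_{jl}` without normalization. -/
def kernelMap {ι κ : Type*} [Fintype κ] (ξ : ι → κ → ι → κ → ℝ) (X : Matrix κ κ ℂ) :
    Matrix ι ι ℂ := fun i k => ∑ j, ∑ l, (ξ i j k l : ℂ) * X j l

/-- A Gram factorization puts the map in Kraus form $X\mapsto\sum_sB_sXB_s^{\mathsf T}$ with real
$B_s$, which exhibits its complete positivity. -/
theorem form_kernelMap {ι κ : Type*} [Fintype ι] [Fintype κ] {m : ℕ} {ξ : ι → κ → ι → κ → ℝ}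
    {B : Fin m → ι → κ → ℝ} (hB : ∀ i j k l, ξ i j k l = ∑ s, B s i j * B s k l)
    (u v : ι → ℂ) (X : Matrix κ κ ℂ) :
    form u (kernelMap ξ X) v =
      ∑ s, form (fun j => ∑ i, (B s i j : ℂ) * u i) X (fun j => ∑ i, (B s i j : ℂ) * v i) := by
  simp only [form_eq_sum, kernelMap, hB, star_sum, star_mul', Complex.ofReal_sum,
    Complex.ofReal_mul, Finset.sum_mul, Finset.mul_sum]
  have h1 : ∀ i k : ι, (∑ j : κ, ∑ l : κ, ∑ s : Fin m,
      star (u i) * ((B s i j : ℂ) * (B s k l : ℂ) * X j l) * v k) =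
      ∑ s : Fin m, ∑ j : κ, ∑ l : κ,
        star (u i) * ((B s i j : ℂ) * (B s k l : ℂ) * X j l) * v k := fun i k => by
    rw [Finset.sum_comm (s := (Finset.univ : Finset (Fin m)))]
    exact Finset.sum_congr rfl fun j _ => Finset.sum_comm
  simp only [h1]
  have h2 : ∀ f : ι → ι → Fin m → κ → κ → ℂ,
      (∑ i, ∑ k, ∑ s, ∑ j, ∑ l, f i k s j l) = ∑ s, ∑ j, ∑ l, ∑ k, ∑ i, f i k s j l := fun f => by
    simp only [← Finset.sum_product']
    exact Finset.sum_nbij' (fun x => (x.2.2.1, x.2.2.2.1, x.2.2.2.2, x.2.1, x.1))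
      (fun x => (x.2.2.2.2, x.2.2.2.1, x.1, x.2.1, x.2.2.1))
      (by simp) (by simp) (by simp) (by simp) (by simp)
  rw [h2]
  refine Finset.sum_congr rfl fun s _ => Finset.sum_congr rfl fun j _ =>
    Finset.sum_congr rfl fun l _ => Finset.sum_congr rfl fun k _ =>
    Finset.sum_congr rfl fun i _ => ?_
  simp only [RCLike.star_def, Complex.conj_ofReal]
  ring

theorem IsGram.im_form_kernelMap_nonneg {ι κ : Type*} [Fintype ι] [Fintype κ]
    {ξ : ι → κ → ι → κ → ℝ} (hξ : IsGram ξ) {X : Matrix κ κ ℂ}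
    (hX : ∀ u, 0 ≤ (form u X u).im) (u : ι → ℂ) : 0 ≤ (form u (kernelMap ξ X) u).im := by
  obtain ⟨m, B, hB⟩ := hξ
  rw [form_kernelMap hB, Complex.im_sum]
  exact Finset.sum_nonneg fun s _ => hX _

/-- The hypothesis is available for all pairs of vectors, hence for each summand of the Kraus form.
The constant is unchanged, which is what allows the estimate to be iterated in `stability`. -/
theorem IsGram.form_kernelMap_le {ι κ : Type*} [Fintype ι] [Fintype κ]
    {ξ : ι → κ → ι → κ → ℝ} (hξ : IsGram ξ) {X M₁ M₂ : Matrix κ κ ℂ} {c : ℝ}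
    (hX : ∀ u v, 2 * ‖form u X v‖ ≤ c * ((form u M₁ u).im + (form v M₂ v).im)) (u v : ι → ℂ) :
    2 * ‖form u (kernelMap ξ X) v‖ ≤
      c * ((form u (kernelMap ξ M₁) u).im + (form v (kernelMap ξ M₂) v).im) := by
  obtain ⟨m, B, hB⟩ := hξ
  rw [form_kernelMap hB, form_kernelMap hB, form_kernelMap hB, Complex.im_sum, Complex.im_sum,
    ← Finset.sum_add_distrib, Finset.mul_sum]
  refine (mul_le_mul_of_nonneg_left (norm_sum_le _ _) zero_le_two).trans ?_
  rw [Finset.mul_sum]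
  exact Finset.sum_le_sum fun s _ => hX _ _

section

variable {N : ℕ} {ξ : Fin N → Fin N → Fin N → Fin N → ℝ}

theorem Xi_eq (X : Matrix (Fin N) (Fin N) ℂ) : Xi ξ X = (1 / (N : ℂ)) • kernelMap ξ X := by
  ext i k; simp [Xi, kernelMap]

theorem form_Xi (u v : Fin N → ℂ) (X : Matrix (Fin N) (Fin N) ℂ) :
    form u (Xi ξ X) v = ((1 / (N : ℝ) : ℝ) : ℂ) * form u (kernelMap ξ X) v := by
  rw [Xi_eq, form_smul]; simp

theorem im_form_Xi (u v : Fin N → ℂ) (X : Matrix (Fin N) (Fin N) ℂ) :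
    (form u (Xi ξ X) v).im = (1 / (N : ℝ)) * (form u (kernelMap ξ X) v).im := by
  rw [form_Xi, Complex.im_ofReal_mul]

theorem IsGram.im_form_Xi_nonneg (hξ : IsGram ξ) {X : Matrix (Fin N) (Fin N) ℂ}
    (hX : ∀ u, 0 ≤ (form u X u).im) (u : Fin N → ℂ) : 0 ≤ (form u (Xi ξ X) u).im := by
  rw [im_form_Xi]
  exact mul_nonneg (by positivity) (hξ.im_form_kernelMap_nonneg hX u)

theorem IsGram.form_Xi_le (hξ : IsGram ξ) {X M₁ M₂ : Matrix (Fin N) (Fin N) ℂ} {c : ℝ}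
    (hX : ∀ u v, 2 * ‖form u X v‖ ≤ c * ((form u M₁ u).im + (form v M₂ v).im))
    (u v : Fin N → ℂ) :
    2 * ‖form u (Xi ξ X) v‖ ≤ c * ((form u (Xi ξ M₁) u).im + (form v (Xi ξ M₂) v).im) := by
  rw [im_form_Xi, im_form_Xi, form_Xi, norm_mul, Complex.norm_real,
    Real.norm_of_nonneg (by positivity)]
  have h := mul_le_mul_of_nonneg_left (hξ.form_kernelMap_le hX u v)
    (show (0 : ℝ) ≤ 1 / N by positivity)
  linarith

theorem Xi_sub (X Y : Matrix (Fin N) (Fin N) ℂ) : Xi ξ (X - Y) = Xi ξ X - Xi ξ Y := by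
  ext i k; simp [Xi, mul_sub, Finset.sum_sub_distrib]

/-! ### Stability of the self-consistent equation -/

/-- With $w=M_1^*u$ and $w'=M_2v$, the equation expresses $\langle u,(M_1-M_2)v\rangle$ through
$\langle w,(D_1-D_2+\Xi(M_1-M_2))w'\rangle$. A bound of the difference by the imaginary parts of
$M_1,M_2$ passes through $\Xi$, and $\operatorname{Im}\langle w,\Xi(M_1)w\rangle$ is smaller than
$\operatorname{Im}\langle u,M_1u\rangle$ by at least $\frac\eta2\|w\|^2$. Repeating this contraction
removes all dependence on the initial bound. -/
theorem stability {η b δ ε : ℝ} (hη : 0 < η) (hηb : η ≤ b) (hδ : δ ≤ η / 2) (hε : 0 ≤ ε)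
    (hξ : IsGram ξ) {z : ℂ} (hz : η ≤ z.im) {M₁ M₂ A₁ A₂ D₁ D₂ : Matrix (Fin N) (Fin N) ℂ}
    (h₁ : M₁ * A₁ = 1) (h₂ : M₂ * A₂ = 1)
    (hA₁ : A₁ = -(z • (1 : Matrix (Fin N) (Fin N) ℂ)) - D₁ - Xi ξ M₁)
    (hA₂ : A₂ = -(z • (1 : Matrix (Fin N) (Fin N) ℂ)) - D₂ - Xi ξ M₂)
    (hM₁ : ∀ u, 0 ≤ (form u M₁ u).im) (hM₂ : ∀ u, 0 ≤ (form u M₂ u).im)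
    (hD₁ : FormLe D₁ δ) (hD₂ : FormLe D₂ δ) (hD : FormLe (D₁ - D₂) ε)
    (hb₁ : FormLe A₁ b) (hb₂ : FormLe A₂ b) :
    FormLe (M₁ - M₂) (16 * b ^ 2 / η ^ 4 * ε) := by
  have hb : 0 < b := hη.trans_le hηb
  -- The imaginary part of a solution controls, and is controlled by, its image vectors.
  have key : ∀ {M A D : Matrix (Fin N) (Fin N) ℂ} {u w : Fin N → ℂ}, FormLe D δ →
      A = -(z • (1 : Matrix (Fin N) (Fin N) ℂ)) - D - Xi ξ M →
      form u M u = star (form w A w) →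
      η / 2 * nsq w + (form w (Xi ξ M) w).im ≤ (form u M u).im := by
    intro M A D u w hD hA hf
    rw [hf, hA, form_sub, form_sub, form_neg, form_smul]
    have h1 : form w (1 : Matrix (Fin N) (Fin N) ℂ) w = (nsq w : ℂ) := by
      simp [form, dotProduct_star_self]
    have h2 := hD w w
    have h3 := (Complex.abs_im_le_norm (form w D w))
    have h4 := neg_abs_le (form w D w).im
    simp only [h1, RCLike.star_def, Complex.conj_im, Complex.sub_im, Complex.neg_im,
      Complex.mul_im, Complex.ofReal_re, Complex.ofReal_im]
    nlinarith [nsq_nonneg w]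
  -- Here `w` is $Mu$ or $M^*u$. The lower bound from `key`, combined with Cauchy–Schwarz and
  -- $\|u\|\le b\|w\|$, confines the imaginary part between $\frac\eta2\|w\|^2$ and $b\|w\|^2$.
  have ineq : ∀ {M A D : Matrix (Fin N) (Fin N) ℂ} {u w : Fin N → ℂ}, FormLe D δ → M * A = 1 →
      A = -(z • (1 : Matrix (Fin N) (Fin N) ℂ)) - D - Xi ξ M →
      (∀ u, 0 ≤ (form u M u).im) → nsq u ≤ b ^ 2 * nsq w →
      form u M u = star (form w A w) → (form u M u = star u ⬝ᵥ w ∨ form u M u = star w ⬝ᵥ u) →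
      nsq w ≤ 2 / η * (form u M u).im ∧ (form u M u).im ≤ b * nsq w ∧
        (form u M u).im ≤ 4 * b / η ^ 2 * nsq u := by
    intro M A D u w hD hMA hA hM hu hf hd
    have h1 := key hD hA hf
    have h2 := hξ.im_form_Xi_nonneg hM w
    have h3 : η / 2 * nsq w ≤ (form u M u).im := by linarith
    have h4 : (form u M u).im ^ 2 ≤ nsq u * nsq w := by
      have h5 : |(form u M u).im| ≤ ‖form u M u‖ := Complex.abs_im_le_norm _
      have h6 : ‖form u M u‖ ^ 2 ≤ nsq u * nsq w := by
        rcases hd with h | h <;> rw [h]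
        · exact norm_dotProduct_sq_le _ _
        · rw [mul_comm]; exact norm_dotProduct_sq_le _ _
      calc _ = |(form u M u).im| ^ 2 := (sq_abs _).symm
        _ ≤ _ := (pow_le_pow_left₀ (abs_nonneg _) h5 2).trans h6
    have hw := nsq_nonneg w
    have h7 : (form u M u).im ≤ b * nsq w := by
      refine abs_le_of_sq_le_sq' ?_ (by positivity) |>.2
      nlinarith
    refine ⟨?_, h7, ?_⟩
    · rw [div_mul_eq_mul_div, le_div_iff₀ hη]; linarith
    · have h8 : nsq w ≤ 4 / η ^ 2 * nsq u := by
        rcases hw.eq_or_lt with h0 | h0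
        · rw [← h0]; exact mul_nonneg (by positivity) (nsq_nonneg _)
        · have h9 : (η / 2 * nsq w) ^ 2 ≤ nsq u * nsq w :=
            (pow_le_pow_left₀ (by positivity) h3 2).trans h4
          have h10 : nsq w * (η ^ 2 * nsq w) ≤ nsq w * (4 * nsq u) := by nlinarith
          have h11 := le_of_mul_le_mul_left h10 h0
          rw [div_mul_eq_mul_div, le_div_iff₀ (by positivity)]
          linarith
      calc (form u M u).im ≤ b * nsq w := h7
        _ ≤ b * (4 / η ^ 2 * nsq u) := by gcongr
        _ = _ := by ring
  have h₁' : A₁ * M₁ = 1 := mul_eq_one_comm.1 h₁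
  have h₂' : A₂ * M₂ = 1 := mul_eq_one_comm.1 h₂
  have hw₁ : ∀ u, nsq u ≤ b ^ 2 * nsq (M₁.conjTranspose.mulVec u) := fun u => by
    have := hb₁.conjTranspose.nsq_mulVec_le hb (M₁.conjTranspose.mulVec u)
    rwa [Matrix.mulVec_mulVec, ← Matrix.conjTranspose_mul, h₁, Matrix.conjTranspose_one,
      Matrix.one_mulVec] at this
  have hw₂ : ∀ u, nsq u ≤ b ^ 2 * nsq (M₂.mulVec u) := fun u => by
    have := hb₂.nsq_mulVec_le hb (M₂.mulVec u)
    rwa [Matrix.mulVec_mulVec, h₂', Matrix.one_mulVec] at this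
  have f₁ := fun u => form_eq_star_of_mul_eq_one' h₁ u
  have f₂ := fun u => form_eq_star_of_mul_eq_one h₂ u
  have g₁ : ∀ u v, form u M₁ v = star (M₁.conjTranspose.mulVec u) ⬝ᵥ v := fun u v => by
    rw [form, Matrix.star_mulVec, Matrix.conjTranspose_conjTranspose, Matrix.dotProduct_mulVec]
  have i₁ := fun u => ineq hD₁ h₁ hA₁ hM₁ (hw₁ u) (f₁ u) (.inr (g₁ u u))
  have i₂ := fun u => ineq hD₂ h₂ hA₂ hM₂ (hw₂ u) (f₂ u) (.inl rfl)
  have hX : M₁ - M₂ = M₁ * (D₁ - D₂ + Xi ξ (M₁ - M₂)) * M₂ := by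
    have : D₁ - D₂ + Xi ξ (M₁ - M₂) = A₂ - A₁ := by rw [hA₁, hA₂, Xi_sub]; abel
    rw [this, mul_sub, sub_mul, h₁, mul_assoc, h₂', one_mul, mul_one]
  -- Since $\operatorname{Im}\langle u,Mu\rangle\le b\|w\|^2$, the gain $\frac\eta2\|w\|^2$ is at
  -- least the fraction $\theta$ of the imaginary part; $1-\theta$ is the contraction factor.
  set θ := η / (2 * b) with hθ
  have hθ0 : 0 < θ := by positivity
  have hθ1 : θ ≤ 1 := by rw [hθ, div_le_one (by positivity)]; linarith
  -- A crude starting constant, from Cauchy–Schwarz and $\|u\|\le b\|w\|$. Its value is irrelevant,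
  -- as it is multiplied by $(1-\theta)^k\to0$.
  set c₀ := (1 + b ^ 2) * (2 / η) with hc₀
  have step : ∀ c : ℝ, 0 ≤ c →
      (∀ u v, 2 * ‖form u (M₁ - M₂) v‖ ≤ c * ((form u M₁ u).im + (form v M₂ v).im)) →
      ∀ u v, 2 * ‖form u (M₁ - M₂) v‖ ≤
        ((1 - θ) * c + 2 * ε / η) * ((form u M₁ u).im + (form v M₂ v).im) := by
    intro c hc h u v
    set w := M₁.conjTranspose.mulVec u with hw
    set w' := M₂.mulVec v with hw'
    have e : form u (M₁ - M₂) v = form w (D₁ - D₂) w' + form w (Xi ξ (M₁ - M₂)) w' := by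
      conv_lhs => rw [hX]
      rw [form_mul_mul, form_add]
    have h3 := hξ.form_Xi_le h w w'
    have h4 := hD w w'
    have h5 := key hD₁ hA₁ (f₁ u)
    have h6 := key hD₂ hA₂ (f₂ v)
    obtain ⟨a1, a2, -⟩ := i₁ u
    obtain ⟨b1, b2, -⟩ := i₂ v
    rw [← hw] at h5 a1 a2
    rw [← hw'] at h6 b1 b2
    have h7 := norm_add_le (form w (D₁ - D₂) w') (form w (Xi ξ (M₁ - M₂)) w')
    rw [e]
    have t1 : θ * (form u M₁ u).im ≤ η / 2 * nsq w := by
      calc _ ≤ θ * (b * nsq w) := by gcongr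
        _ = _ := by rw [hθ]; field_simp
    have t2 : θ * (form v M₂ v).im ≤ η / 2 * nsq w' := by
      calc _ ≤ θ * (b * nsq w') := by gcongr
        _ = _ := by rw [hθ]; field_simp
    have t3 : (form w (Xi ξ M₁) w).im + (form w' (Xi ξ M₂) w').im ≤
        (1 - θ) * ((form u M₁ u).im + (form v M₂ v).im) := by linarith
    have t4 := mul_le_mul_of_nonneg_left t3 hc
    have t5 := mul_le_mul_of_nonneg_left (add_le_add a1 b1) hε
    have t6 : ε * (2 / η * (form u M₁ u).im + 2 / η * (form v M₂ v).im) =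
      2 * ε / η * ((form u M₁ u).im + (form v M₂ v).im) := by ring
    linarith
  -- The fixed point of $c\mapsto(1-\theta)c+2\varepsilon/\eta$.
  set c' := 2 * ε / η / θ with hc'
  have hc'0 : 0 ≤ c' := by positivity
  have iter : ∀ k : ℕ, ∀ u v, 2 * ‖form u (M₁ - M₂) v‖ ≤
      (c' + (1 - θ) ^ k * c₀) * ((form u M₁ u).im + (form v M₂ v).im) := by
    intro k
    induction k with
    | zero =>
      intro u v
      obtain ⟨a1, -, -⟩ := i₁ u
      obtain ⟨b1, -, -⟩ := i₂ v
      have h1 : 2 * ‖form u M₁ v‖ ≤ nsq (M₁.conjTranspose.mulVec u) + nsq v := by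
        rw [g₁]; exact two_norm_dotProduct_le _ _
      have h2 : 2 * ‖form u M₂ v‖ ≤ nsq u + nsq (M₂.mulVec v) := two_norm_dotProduct_le _ _
      have h3 := norm_sub_le (form u M₁ v) (form u M₂ v)
      rw [form_sub, pow_zero, one_mul]
      have h4 := hw₁ u
      have h5 := hw₂ v
      have h6 : (0 : ℝ) ≤ 1 + b ^ 2 := by positivity
      have h7 := mul_le_mul_of_nonneg_left (add_le_add a1 b1) h6
      have h8 := mul_nonneg hc'0 (add_nonneg (hM₁ u) (hM₂ v))
      rw [hc₀]
      linarith
    | succ k ih =>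
      intro u v
      refine (step _ (add_nonneg hc'0 (mul_nonneg (pow_nonneg (by linarith) _)
        (by positivity))) ih u v).trans_eq ?_
      rw [pow_succ, hc']
      field_simp
      ring
  intro u v
  have lim : Filter.Tendsto (fun k : ℕ => (c' + (1 - θ) ^ k * c₀) *
      ((form u M₁ u).im + (form v M₂ v).im)) Filter.atTop
      (nhds ((c' + 0 * c₀) * ((form u M₁ u).im + (form v M₂ v).im))) := by
    refine ((((tendsto_pow_atTop_nhds_zero_of_lt_one (by linarith) (by linarith)).mul_const
      _).const_add _).mul_const _)
  have h1 := ge_of_tendsto' lim fun k => iter k u v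
  rw [zero_mul, add_zero] at h1
  refine h1.trans ?_
  obtain ⟨-, -, a3⟩ := i₁ u
  obtain ⟨-, -, b3⟩ := i₂ v
  calc c' * ((form u M₁ u).im + (form v M₂ v).im)
      ≤ c' * (4 * b / η ^ 2 * nsq u + 4 * b / η ^ 2 * nsq v) := by gcongr
    _ = _ := by rw [hc', hθ]; field_simp; ring

end

end

section

/-! ### Banded matrices -/

section Banded

variable {N : ℕ}

/-- The indices at distance at most `w` from `a`. -/
def nbhd (w : ℕ) (a : Fin N) : Finset (Fin N) :=
  Finset.univ.filter fun b => |((a : ℕ) : ℤ) - ((b : ℕ) : ℤ)| ≤ w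

theorem mem_nbhd {w : ℕ} {a b : Fin N} :
    b ∈ nbhd w a ↔ |((a : ℕ) : ℤ) - ((b : ℕ) : ℤ)| ≤ w := by simp [nbhd]

theorem mem_nbhd_comm {w : ℕ} {a b : Fin N} : b ∈ nbhd w a ↔ a ∈ nbhd w b := by
  rw [mem_nbhd, mem_nbhd, abs_sub_comm]

theorem self_mem_nbhd (w : ℕ) (a : Fin N) : a ∈ nbhd w a := by simp [mem_nbhd]

theorem card_nbhd_le (w : ℕ) (a : Fin N) : (nbhd w a).card ≤ 2 * w + 1 := by
  have h : (nbhd w a).card ≤ (Finset.Icc (((a : ℕ) : ℤ) - w) (((a : ℕ) : ℤ) + w)).card := by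
    refine Finset.card_le_card_of_injOn (fun b => ((b : ℕ) : ℤ)) (fun b hb => ?_)
      (fun b _ c _ h => Fin.ext (by simpa using h))
    have := abs_le.1 (mem_nbhd.1 hb)
    simp only [Finset.coe_Icc, Set.mem_Icc]
    constructor <;> linarith
  refine h.trans ?_
  rw [Int.card_Icc]
  omega

theorem sum_nbhd_comm (w : ℕ) {α : Type*} [AddCommMonoid α] (f : Fin N → Fin N → α) :
    ∑ i, ∑ j ∈ nbhd w i, f i j = ∑ j, ∑ i ∈ nbhd w j, f i j := by
  refine Finset.sum_comm' fun i j => ?_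
  simp [mem_nbhd_comm (a := i)]

theorem sum_nbhd_const_le (w : ℕ) (i : Fin N) {b : ℝ} (hb : 0 ≤ b) :
    ∑ _j ∈ nbhd w i, b ≤ (2 * w + 1) * b := by
  rw [Finset.sum_const, nsmul_eq_mul]
  gcongr
  exact_mod_cast card_nbhd_le w i

/-- This is the Schur test: each row and each column meets the band in at most $2K+1$ places. -/
theorem formLe_of_banded {K : ℕ} {X : Matrix (Fin N) (Fin N) ℂ} {b : ℝ} (hb : 0 ≤ b)
    (hX : ∀ i j, ‖X i j‖ ≤ b) (hband : ∀ i j, j ∉ nbhd K i → X i j = 0) :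
    FormLe X ((2 * K + 1) * b) := by
  intro u v
  have h1 : ‖form u X v‖ ≤ ∑ i, ∑ j ∈ nbhd K i, b * (‖u i‖ * ‖v j‖) := by
    rw [form_eq_sum]
    refine (norm_sum_le _ _).trans (Finset.sum_le_sum fun i _ => ?_)
    rw [← Finset.sum_subset (Finset.subset_univ (nbhd K i))
      (fun j _ hj => by rw [hband i j hj]; simp)]
    refine (norm_sum_le _ _).trans (Finset.sum_le_sum fun j _ => ?_)
    rw [norm_mul, norm_mul, norm_star]
    nlinarith [hX i j, mul_nonneg (norm_nonneg (u i)) (norm_nonneg (v j))]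
  have h2 : 2 * (∑ i, ∑ j ∈ nbhd K i, b * (‖u i‖ * ‖v j‖)) ≤
      ∑ i, ∑ j ∈ nbhd K i, (b * ‖u i‖ ^ 2 + b * ‖v j‖ ^ 2) := by
    rw [Finset.mul_sum]
    refine Finset.sum_le_sum fun i _ => ?_
    rw [Finset.mul_sum]
    refine Finset.sum_le_sum fun j _ => ?_
    nlinarith [mul_nonneg hb (sq_nonneg (‖u i‖ - ‖v j‖))]
  have h3 : ∑ i, ∑ j ∈ nbhd K i, (b * ‖u i‖ ^ 2 + b * ‖v j‖ ^ 2) ≤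
      (2 * K + 1) * b * (nsq u + nsq v) := by
    simp only [Finset.sum_add_distrib]
    rw [sum_nbhd_comm K fun _ j => b * ‖v j‖ ^ 2, mul_add, nsq, nsq, Finset.mul_sum,
      Finset.mul_sum]
    refine add_le_add (Finset.sum_le_sum fun i _ => ?_) (Finset.sum_le_sum fun i _ => ?_)
    · exact (sum_nbhd_const_le K i (by positivity)).trans_eq (by ring)
    · exact (sum_nbhd_const_le K i (by positivity)).trans_eq (by ring)
  linarith

/-- The normalized `ℓ¹` size of the entries of `X` in a band around the diagonal. -/
def bandAvg (K : ℕ) (X : Matrix (Fin N) (Fin N) ℂ) : ℝ :=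
  1 / (N : ℝ) * ∑ j, ∑ l ∈ nbhd K j, ‖X j l‖

theorem bandAvg_nonneg (K : ℕ) (X : Matrix (Fin N) (Fin N) ℂ) : 0 ≤ bandAvg K X := by
  unfold bandAvg; positivity

theorem bandAvg_le {K : ℕ} {X : Matrix (Fin N) (Fin N) ℂ} {b : ℝ} (hb : 0 ≤ b)
    (hX : ∀ i j, ‖X i j‖ ≤ b) : bandAvg K X ≤ (2 * K + 1) * b := by
  have h : ∑ j, ∑ l ∈ nbhd K j, ‖X j l‖ ≤ ∑ _j : Fin N, (2 * K + 1) * b :=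
    Finset.sum_le_sum fun j _ =>
      (Finset.sum_le_sum fun l _ => hX j l).trans (sum_nbhd_const_le K j hb)
  rw [Finset.sum_const, Finset.card_univ, Fintype.card_fin, nsmul_eq_mul] at h
  unfold bandAvg
  rcases Nat.eq_zero_or_pos N with h0 | h0
  · subst h0
    simp only [Nat.cast_zero, div_zero, zero_mul]
    positivity
  · rw [one_div, inv_mul_le_iff₀ (by positivity)]
    exact h

/-- For fixed $a,b$ the products $|M_1(j,a)|\,|M_2(b,l)|$ summed over the band are controlled by the
$\ell^2$ norms of a column and a row, uniformly in $N$. Consequently a change of boundedly many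
bounded entries of $H$ moves the band average of the resolvent by only $O(1/N)$. -/
theorem bandAvg_mul_mul_le {K : ℕ} {η : ℝ} (hη : 0 < η) {M₁ M₂ : Matrix (Fin N) (Fin N) ℂ}
    (h₁ : IsDissipativeInverse η M₁) (h₂ : IsDissipativeInverse η M₂)
    (E : Matrix (Fin N) (Fin N) ℂ) :
    bandAvg K (M₁ * E * M₂) ≤ (2 * K + 1) / η ^ 2 * (1 / (N : ℝ) * ∑ a, ∑ b, ‖E a b‖) := by
  have h3 : ∀ a b, ∑ j, ∑ l ∈ nbhd K j, ‖M₁ j a‖ * ‖M₂ b l‖ ≤ (2 * K + 1) / η ^ 2 := by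
    intro a b
    have hs : ∑ j, ∑ l ∈ nbhd K j, 2 * (‖M₁ j a‖ * ‖M₂ b l‖) ≤
        ∑ j, ∑ l ∈ nbhd K j, (‖M₁ j a‖ ^ 2 + ‖M₂ b l‖ ^ 2) :=
      Finset.sum_le_sum fun j _ => Finset.sum_le_sum fun l _ => by
        nlinarith [sq_nonneg (‖M₁ j a‖ - ‖M₂ b l‖)]
    have h4 : ∑ j, ∑ l ∈ nbhd K j, (‖M₁ j a‖ ^ 2 + ‖M₂ b l‖ ^ 2) ≤
        (2 * K + 1) * (1 / η ^ 2) + (2 * K + 1) * (1 / η ^ 2) := by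
      simp only [Finset.sum_add_distrib]
      rw [sum_nbhd_comm K fun _ l => ‖M₂ b l‖ ^ 2]
      refine add_le_add ?_ ?_
      · refine (Finset.sum_le_sum fun j _ => sum_nbhd_const_le K j (by positivity)).trans ?_
        rw [← Finset.mul_sum]
        gcongr
        exact h₁.col_le hη a
      · refine (Finset.sum_le_sum fun j _ => sum_nbhd_const_le K j (by positivity)).trans ?_
        rw [← Finset.mul_sum]
        gcongr
        exact h₂.row_le hη b
    simp only [← Finset.mul_sum] at hs ⊢
    have h5 : (2 * (K : ℝ) + 1) / η ^ 2 = (2 * K + 1) * (1 / η ^ 2) := by ring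
    linarith
  have h4 : ∑ j, ∑ l ∈ nbhd K j, ‖(M₁ * E * M₂) j l‖ ≤
      ∑ a, ∑ b, ‖E a b‖ * ((2 * K + 1) / η ^ 2) := by
    calc _ ≤ ∑ j, ∑ l ∈ nbhd K j, ∑ a, ∑ b, ‖E a b‖ * (‖M₁ j a‖ * ‖M₂ b l‖) := by
          refine Finset.sum_le_sum fun j _ => Finset.sum_le_sum fun l _ => ?_
          simp only [Matrix.mul_apply, Finset.sum_mul]
          rw [Finset.sum_comm]
          refine (norm_sum_le _ _).trans (Finset.sum_le_sum fun a _ => ?_)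
          refine (norm_sum_le _ _).trans (Finset.sum_le_sum fun b _ => ?_)
          rw [norm_mul, norm_mul]
          exact le_of_eq (by ring)
      _ = ∑ a, ∑ b, ‖E a b‖ * ∑ j, ∑ l ∈ nbhd K j, ‖M₁ j a‖ * ‖M₂ b l‖ := by
          simp only [Finset.mul_sum]
          simp only [Finset.sum_comm (s := nbhd K _)]
          rw [Finset.sum_comm]
          refine Finset.sum_congr rfl fun a _ => ?_
          rw [Finset.sum_comm]
      _ ≤ _ := Finset.sum_le_sum fun a _ => Finset.sum_le_sum fun b _ => by
          gcongr; exact h3 a b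
  unfold bandAvg
  simp only [← Finset.sum_mul] at h4
  calc _ ≤ 1 / (N : ℝ) * ((∑ a, ∑ b, ‖E a b‖) * ((2 * K + 1) / η ^ 2)) := by gcongr
    _ = _ := by ring

/-- The kernel `ξ` is positive semidefinite, bounded and of finite range. -/
structure IsKernel (K : ℕ) (c : ℝ) (ξ : Fin N → Fin N → Fin N → Fin N → ℝ) : Prop where
  gram : IsGram ξ
  abs_le : ∀ i j k l, |ξ i j k l| ≤ c
  nonneg : 0 ≤ c
  near : ∀ i j k l, ξ i j k l ≠ 0 → k ∈ nbhd K i ∧ l ∈ nbhd K j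

variable {ξ : Fin N → Fin N → Fin N → Fin N → ℝ} {K : ℕ} {c : ℝ}

theorem IsKernel.Xi_apply_eq_zero (hξ : IsKernel K c ξ) (X : Matrix (Fin N) (Fin N) ℂ)
    {i k : Fin N} (h : k ∉ nbhd K i) : Xi ξ X i k = 0 := by
  unfold Xi
  rw [Finset.sum_eq_zero fun j _ => Finset.sum_eq_zero fun l _ => ?_, mul_zero]
  have : ξ i j k l = 0 := by
    by_contra h0
    exact h (hξ.near i j k l h0).1
  simp [this]

theorem IsKernel.norm_Xi_apply_le (hξ : IsKernel K c ξ) (X : Matrix (Fin N) (Fin N) ℂ)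
    (i k : Fin N) : ‖Xi ξ X i k‖ ≤ c * bandAvg K X := by
  unfold Xi bandAvg
  rw [norm_mul, mul_left_comm, norm_div, norm_one, Complex.norm_natCast]
  gcongr
  rw [Finset.mul_sum]
  refine (norm_sum_le _ _).trans (Finset.sum_le_sum fun j _ => ?_)
  rw [← Finset.sum_subset (Finset.subset_univ (nbhd K j)) (fun l _ hl => ?_), Finset.mul_sum]
  · refine (norm_sum_le _ _).trans (Finset.sum_le_sum fun l _ => ?_)
    rw [norm_mul, Complex.norm_real]
    gcongr
    exact hξ.abs_le i j k l
  · have : ξ i j k l = 0 := by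
      by_contra h0
      exact hl (hξ.near i j k l h0).2
    simp [this]

/-- Finite range makes $\Xi(X)$ banded and lets it depend only on entries of $X$ near the diagonal.
Closeness on average over the band is therefore enough for closeness of self-energies in operator
norm. -/
theorem IsKernel.formLe_Xi (hξ : IsKernel K c ξ) (X : Matrix (Fin N) (Fin N) ℂ) :
    FormLe (Xi ξ X) ((2 * K + 1) * (c * bandAvg K X)) :=
  formLe_of_banded (mul_nonneg hξ.nonneg (bandAvg_nonneg K X)) (hξ.norm_Xi_apply_le X)
    fun _ _ h => hξ.Xi_apply_eq_zero X h

/-! ### Decay of inverses of banded matrices -/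

theorem summable_inv_one_add_sq_int : Summable fun k : ℤ => 1 / (1 + (k : ℝ) ^ 2) := by
  refine Summable.of_nonneg_of_le (fun k => by positivity) (fun k => ?_)
    ((Real.summable_one_div_int_pow (p := 2)).2 one_lt_two |>.add
      (summable_of_ne_finset_zero (f := fun k : ℤ => if k = 0 then (1 : ℝ) else 0) (s := {0})
        (by simp)))
  by_cases h : k = 0
  · simp [h]
  · have : (0 : ℝ) < (k : ℝ) ^ 2 := by positivity
    simp only [h, if_false, add_zero]
    gcongr
    linarith

/-- A bound on `∑_k (1 + (k - j)²)⁻¹`. -/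
def invSqSum : ℝ := ∑' k : ℤ, 1 / (1 + (k : ℝ) ^ 2)

theorem sum_inv_one_add_sq_le (j : Fin N) :
    ∑ k : Fin N, 1 / (1 + (((k : ℕ) : ℝ) - ((j : ℕ) : ℝ)) ^ 2) ≤ invSqSum := by
  have hinj : Function.Injective fun k : Fin N => ((k : ℕ) : ℤ) - ((j : ℕ) : ℤ) := fun a b h => by
    simpa [Fin.ext_iff] using h
  have h := summable_inv_one_add_sq_int.sum_le_tsum
    (Finset.univ.map ⟨_, hinj⟩) (fun k _ => by positivity)
  rw [Finset.sum_map] at h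
  simpa [invSqSum] using h

/-- A polynomial version of the Combes–Thomas argument. The position operator $X=k-j$ annihilates
$e_j$, so $XMe_j=M[A,X]Me_j$, and $[A,X]$ is bounded because $A$ is banded. Hence the column is
square summable with weight $1+(k-j)^2$, and Cauchy–Schwarz gives an $\ell^1$ bound. Diagonal
entries of $A$ drop out of the commutator, so they need no bound. -/
theorem col_sum_le_of_banded {η a : ℝ} (hη : 0 < η) (ha : 0 ≤ a)
    {M A : Matrix (Fin N) (Fin N) ℂ} (hMA : M * A = 1)
    (hM : ∀ v, η ^ 2 * nsq (M.mulVec v) ≤ nsq v) (hA : ∀ i j, i ≠ j → ‖A i j‖ ≤ a) (hband : ∀ i j, j ∉ nbhd K i → A i j = 0) (j : Fin N) :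
    ∑ k, ‖M k j‖ ≤
      1 + invSqSum * (1 / η ^ 2 + 1 / η ^ 4 * (((2 * K + 1) * (K * a) + 1) ^ 2)) := by
  have hAM : A * M = 1 := mul_eq_one_comm.1 hMA
  set X : Matrix (Fin N) (Fin N) ℂ :=
    Matrix.diagonal fun k => (((k : ℕ) : ℂ) - ((j : ℕ) : ℂ)) with hX
  set v := M.col j with hv
  have hAv : A.mulVec v = Pi.single j 1 := by
    have : v = M.mulVec (Pi.single j 1) := by rw [Matrix.mulVec_single_one]
    rw [this, Matrix.mulVec_mulVec, hAM, Matrix.one_mulVec]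
  have hXj : X.mulVec (Pi.single j 1) = 0 := by
    funext k
    by_cases hk : k = j <;> simp [hX, Matrix.mulVec_diagonal, hk]
  have hcomm : X.mulVec v = M.mulVec ((A * X - X * A).mulVec v) := by
    rw [Matrix.sub_mulVec, ← Matrix.mulVec_mulVec, ← Matrix.mulVec_mulVec, hAv, hXj, sub_zero,
      Matrix.mulVec_mulVec, Matrix.mulVec_mulVec, hMA, Matrix.one_mul]
  have hCapp : ∀ i k, (A * X - X * A) i k = A i k * (((k : ℕ) : ℂ) - ((i : ℕ) : ℂ)) := by
    intro i k
    simp only [hX, Matrix.sub_apply, Matrix.mul_diagonal, Matrix.diagonal_mul]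
    ring
  have hC : FormLe (A * X - X * A) ((2 * K + 1) * (K * a)) := by
    refine formLe_of_banded (K := K) (by positivity) (fun i k => ?_) fun i k hk => ?_
    · rw [hCapp]
      by_cases hk : k ∈ nbhd K i
      · by_cases hik : i = k
        · simp only [hik, sub_self, mul_zero, norm_zero]; positivity
        · rw [norm_mul, mul_comm]
          refine mul_le_mul ?_ (hA i k hik) (norm_nonneg _) (by positivity)
          have h1 := mem_nbhd.1 hk
          rw [abs_sub_comm] at h1
          have h2 : (((k : ℕ) : ℂ) - ((i : ℕ) : ℂ)) =
              ((((((k : ℕ) : ℤ) - ((i : ℕ) : ℤ)) : ℤ) : ℝ) : ℂ) := by push_cast; ring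
          rw [h2, Complex.norm_real, Real.norm_eq_abs]
          exact_mod_cast h1
      · rw [hband i k hk]
        simp only [zero_mul, norm_zero]; positivity
    · rw [hCapp, hband i k hk, zero_mul]
  -- The summand $1$ only ensures positivity of the norm bound, which `FormLe.nsq_mulVec_le`
  -- requires.
  set b := (2 * (K : ℝ) + 1) * (K * a) + 1 with hb
  have hb0 : 0 < b := by positivity
  have h1 : nsq (X.mulVec v) ≤ 1 / η ^ 4 * b ^ 2 := by
    have e1 := hM ((A * X - X * A).mulVec v)
    rw [← hcomm] at e1
    have e2 := (hC.mono (le_add_of_nonneg_right zero_le_one)).nsq_mulVec_le hb0 v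
    have e3 : nsq v ≤ 1 / η ^ 2 := sum_col_sq_le hη hM j
    have e4 : η ^ 2 * nsq (X.mulVec v) ≤ b ^ 2 * (1 / η ^ 2) := e1.trans (e2.trans (by gcongr))
    rw [one_div_mul_eq_div, le_div_iff₀ (by positivity)]
    calc nsq (X.mulVec v) * η ^ 4 = η ^ 2 * (η ^ 2 * nsq (X.mulVec v)) := by ring
      _ ≤ η ^ 2 * (b ^ 2 * (1 / η ^ 2)) := by gcongr
      _ = b ^ 2 := by field_simp
  have h2 : ∑ k : Fin N, (1 + (((k : ℕ) : ℝ) - ((j : ℕ) : ℝ)) ^ 2) * ‖M k j‖ ^ 2 ≤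
      1 / η ^ 2 + 1 / η ^ 4 * b ^ 2 := by
    refine le_trans (le_of_eq ?_) (add_le_add (sum_col_sq_le hη hM j) h1)
    rw [nsq, ← Finset.sum_add_distrib]
    refine Finset.sum_congr rfl fun k _ => ?_
    have : (X.mulVec v) k = (((((k : ℕ) : ℝ) - ((j : ℕ) : ℝ) : ℝ)) : ℂ) * M k j := by
      simp [hX, hv, Matrix.mulVec_diagonal, Matrix.col]
    rw [this, norm_mul, Complex.norm_real, mul_pow, Real.norm_eq_abs, sq_abs]
    ring
  have h3 : (∑ k, ‖M k j‖) ^ 2 ≤ invSqSum * (1 / η ^ 2 + 1 / η ^ 4 * b ^ 2) := by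
    have cs := Finset.sum_mul_sq_le_sq_mul_sq Finset.univ
      (fun k : Fin N => 1 / Real.sqrt (1 + (((k : ℕ) : ℝ) - ((j : ℕ) : ℝ)) ^ 2))
      (fun k : Fin N => Real.sqrt (1 + (((k : ℕ) : ℝ) - ((j : ℕ) : ℝ)) ^ 2) * ‖M k j‖)
    have e1 : ∀ k : Fin N, 1 / Real.sqrt (1 + (((k : ℕ) : ℝ) - ((j : ℕ) : ℝ)) ^ 2) *
        (Real.sqrt (1 + (((k : ℕ) : ℝ) - ((j : ℕ) : ℝ)) ^ 2) * ‖M k j‖) = ‖M k j‖ := fun k => by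
      have : Real.sqrt (1 + (((k : ℕ) : ℝ) - ((j : ℕ) : ℝ)) ^ 2) ≠ 0 :=
        (Real.sqrt_pos.2 (by positivity)).ne'
      field_simp
    have e2 : ∀ k : Fin N, (1 / Real.sqrt (1 + (((k : ℕ) : ℝ) - ((j : ℕ) : ℝ)) ^ 2)) ^ 2 =
        1 / (1 + (((k : ℕ) : ℝ) - ((j : ℕ) : ℝ)) ^ 2) := fun k => by
      rw [div_pow, Real.sq_sqrt (by positivity), one_pow]
    have e3 : ∀ k : Fin N, (Real.sqrt (1 + (((k : ℕ) : ℝ) - ((j : ℕ) : ℝ)) ^ 2) * ‖M k j‖) ^ 2 =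
        (1 + (((k : ℕ) : ℝ) - ((j : ℕ) : ℝ)) ^ 2) * ‖M k j‖ ^ 2 := fun k => by
      rw [mul_pow, Real.sq_sqrt (by positivity)]
    simp only [e1, e2, e3] at cs
    refine cs.trans (mul_le_mul (sum_inv_one_add_sq_le j) h2
      (Finset.sum_nonneg fun k _ => by positivity) (tsum_nonneg fun k => by positivity))
  -- The inequality $t\le1+t^2$ replaces taking a square root.
  nlinarith [sq_nonneg (∑ k, ‖M k j‖ - 1)]

theorem row_sum_le_of_banded {η a : ℝ} (hη : 0 < η) (ha : 0 ≤ a)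
    {M A : Matrix (Fin N) (Fin N) ℂ} (hMA : M * A = 1) (hM : IsDissipativeInverse η M)
    (hA : ∀ i j, i ≠ j → ‖A i j‖ ≤ a) (hband : ∀ i j, j ∉ nbhd K i → A i j = 0) (i : Fin N) :
    ∑ k, ‖M i k‖ ≤
      1 + invSqSum * (1 / η ^ 2 + 1 / η ^ 4 * (((2 * K + 1) * (K * a) + 1) ^ 2)) := by
  have h : M.conjTranspose * A.conjTranspose = 1 := by
    rw [← Matrix.conjTranspose_mul, mul_eq_one_comm.1 hMA, Matrix.conjTranspose_one]
  have := col_sum_le_of_banded (K := K) hη ha h hM.nsq_conjTranspose_le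
    (fun i j hij => by simpa using hA j i hij.symm)
    (fun i j hij => by simpa using hband j i (mt mem_nbhd_comm.1 hij)) i
  simpa using this

end Banded

end

section

/-! ### Resolvent identities and bounds. -/

section Resolvent

variable {N : ℕ}

/-- The matrix `H` with complex entries. -/
def complexMatrix (x : UpperIndex N → ℝ) : Matrix (Fin N) (Fin N) ℂ :=
  (normMatrix x).map (fun r : ℝ => (r : ℂ))

theorem green_eq (x : UpperIndex N → ℝ) (z : ℂ) :
    green x z = (complexMatrix x - z • (1 : Matrix (Fin N) (Fin N) ℂ))⁻¹ := rfl

theorem normMatrix_comm (x : UpperIndex N → ℝ) (i j : Fin N) :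
    normMatrix x i j = normMatrix x j i := by
  simp [normMatrix, symMatrix, min_comm, max_comm]

theorem im_form_complexMatrix (x : UpperIndex N → ℝ) (w : Fin N → ℂ) :
    (form w (complexMatrix x) w).im = 0 := by
  have h : (complexMatrix x).conjTranspose = complexMatrix x := by
    ext i j
    simp [complexMatrix, normMatrix_comm x j i]
  have h1 := form_conjTranspose w (complexMatrix x) w
  rw [h] at h1
  have h2 := congrArg Complex.im h1
  simp only [RCLike.star_def, Complex.conj_im] at h2
  linarith

theorem dissipative_complexMatrix_sub (x : UpperIndex N → ℝ) (z : ℂ) :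
    Dissipative z.im (complexMatrix x - z • (1 : Matrix (Fin N) (Fin N) ℂ)) := by
  intro w
  rw [form_sub, Complex.sub_im, im_form_complexMatrix, form_smul]
  simp [form, dotProduct_star_self]

theorem green_mul {z : ℂ} (hz : 0 < z.im) (x : UpperIndex N → ℝ) :
    green x z * (complexMatrix x - z • (1 : Matrix (Fin N) (Fin N) ℂ)) = 1 :=
  (dissipative_complexMatrix_sub x z).inv_mul hz

theorem mul_green {z : ℂ} (hz : 0 < z.im) (x : UpperIndex N → ℝ) :
    (complexMatrix x - z • (1 : Matrix (Fin N) (Fin N) ℂ)) * green x z = 1 :=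
  mul_eq_one_comm.1 (green_mul hz x)

theorem IsDissipativeInverse.mono {n : Type*} [Fintype n] {η η' : ℝ} (hη : 0 ≤ η) (h : η ≤ η')
    {M : Matrix n n ℂ} (hM : IsDissipativeInverse η' M) : IsDissipativeInverse η M := by
  have h2 : η ^ 2 ≤ η' ^ 2 := by gcongr
  exact ⟨fun v => (mul_le_mul_of_nonneg_right h2 (nsq_nonneg _)).trans (hM.nsq_le v),
    fun v => (mul_le_mul_of_nonneg_right h2 (nsq_nonneg _)).trans (hM.nsq_conjTranspose_le v),
    hM.im_nonneg⟩

theorem isDissipativeInverse_green {η : ℝ} (hη : 0 < η) {z : ℂ} (hz : η ≤ z.im)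
    (x : UpperIndex N → ℝ) : IsDissipativeInverse η (green x z) :=
  ((dissipative_complexMatrix_sub x z).inv (hη.trans_le hz)).mono hη.le hz

theorem complexMatrix_mul_green {z : ℂ} (hz : 0 < z.im) (x : UpperIndex N → ℝ) :
    complexMatrix x * green x z = 1 + z • green x z := by
  have := mul_green hz x
  rw [sub_mul, Matrix.smul_mul, Matrix.one_mul] at this
  rw [← this, sub_add_cancel]

theorem green_sub_green {z : ℂ} (hz : 0 < z.im) (x y : UpperIndex N → ℝ) :
    green x z - green y z = green x z * (complexMatrix y - complexMatrix x) * green y z := by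
  have h1 := green_mul hz x
  have h2 := mul_green hz y
  have h3 : complexMatrix y - complexMatrix x =
      (complexMatrix y - z • (1 : Matrix (Fin N) (Fin N) ℂ)) -
        (complexMatrix x - z • (1 : Matrix (Fin N) (Fin N) ℂ)) := by abel
  rw [h3, mul_sub, sub_mul, h1, mul_assoc, h2, mul_one, one_mul]

theorem green_sub_green_param {z z' : ℂ} (hz : 0 < z.im) (hz' : 0 < z'.im)
    (x : UpperIndex N → ℝ) :
    green x z - green x z' = (z - z') • (green x z * green x z') := by
  have h1 := green_mul hz x
  have h2 := mul_green hz' x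
  have h3 : (z - z') • (1 : Matrix (Fin N) (Fin N) ℂ) =
      (complexMatrix x - z' • (1 : Matrix (Fin N) (Fin N) ℂ)) -
        (complexMatrix x - z • (1 : Matrix (Fin N) (Fin N) ℂ)) := by rw [sub_smul]; abel
  have h4 : green x z * ((z - z') • (1 : Matrix (Fin N) (Fin N) ℂ)) * green x z' =
      green x z - green x z' := by
    rw [h3, mul_sub, sub_mul, h1, mul_assoc, h2, mul_one, one_mul]
  rw [← h4]
  simp

end Resolvent

/-! ### Approximate solutions of the self-consistent equation -/

section Approximate

variable {N : ℕ}

/-- The error `1 + z G + Ξ(G) G` in the self-consistent equation. -/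
def residual (ξ : Fin N → Fin N → Fin N → Fin N → ℝ) (z : ℂ) (G : Matrix (Fin N) (Fin N) ℂ) :
    Matrix (Fin N) (Fin N) ℂ := 1 + z • G + Xi ξ G * G

/-- `M` solves the self-consistent equation up to a perturbation of norm `δ`. -/
structure IsApproxSolution (ξ : Fin N → Fin N → Fin N → Fin N → ℝ) (z : ℂ) (δ : ℝ)
    (M : Matrix (Fin N) (Fin N) ℂ) : Prop where
  im_nonneg : ∀ u, 0 ≤ (form u M u).im
  exists_eq : ∃ D, FormLe D δ ∧
    M * (-(z • (1 : Matrix (Fin N) (Fin N) ℂ)) - D - Xi ξ M) = 1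

theorem im_form_smul_one (z : ℂ) (w : Fin N → ℂ) :
    (form w (z • (1 : Matrix (Fin N) (Fin N) ℂ)) w).im = z.im * nsq w := by
  rw [form_smul]
  simp [form, dotProduct_star_self]

theorem dissipative_neg_sub {η : ℝ} {z : ℂ} (hz : η ≤ z.im) {S : Matrix (Fin N) (Fin N) ℂ}
    (hS : ∀ u, 0 ≤ (form u S u).im) :
    Dissipative η (-(z • (1 : Matrix (Fin N) (Fin N) ℂ)) - S) := by
  intro w
  rw [form_sub, form_neg, Complex.sub_im, Complex.neg_im, im_form_smul_one]
  nlinarith [hS w, nsq_nonneg w]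

theorem dissipative_neg_sub_sub {η δ : ℝ} {z : ℂ} (hz : η ≤ z.im) (hδ : δ ≤ η / 2)
    {D S : Matrix (Fin N) (Fin N) ℂ} (hD : FormLe D δ) (hS : ∀ u, 0 ≤ (form u S u).im) :
    Dissipative (η / 2) (-(z • (1 : Matrix (Fin N) (Fin N) ℂ)) - D - S) := by
  intro w
  rw [form_sub, form_sub, form_neg, Complex.sub_im, Complex.sub_im, Complex.neg_im,
    im_form_smul_one]
  have h2 := hD w w
  have h3 := (Complex.abs_im_le_norm (form w D w))
  have h4 := neg_abs_le (form w D w).im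
  nlinarith [hS w, nsq_nonneg w]

/-- The perturbation costs at most half of the imaginary part, so approximate solutions still have
entries at most $2/\eta$. This bounds the norm of $-z-D-\Xi(M)$ and makes `stability` applicable
with constants independent of $N$. -/
theorem IsApproxSolution.exists_stability {η : ℝ} (hη : 0 < η) (Z c : ℝ) (hZ : 0 ≤ Z)
    (hc : 0 ≤ c) (K : ℕ) :
    ∃ C : ℝ, 0 < C ∧ ∀ (N : ℕ) (ξ : Fin N → Fin N → Fin N → Fin N → ℝ), IsKernel K c ξ →
      ∀ z : ℂ, η ≤ z.im → ‖z‖ ≤ Z → ∀ δ₁ δ₂ : ℝ, δ₁ ≤ η / 2 → δ₂ ≤ η / 2 → 0 ≤ δ₁ → 0 ≤ δ₂ →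
      ∀ M₁ M₂ : Matrix (Fin N) (Fin N) ℂ, IsApproxSolution ξ z δ₁ M₁ →
        IsApproxSolution ξ z δ₂ M₂ → FormLe (M₁ - M₂) (C * (δ₁ + δ₂)) := by
  -- The summand $Z$ accounts for $z$, the last one for $\Xi(M)$ with $|M_{ij}|\le2/\eta$, and
  -- $\eta$ both dominates the perturbation and ensures $\eta\le b$.
  set b : ℝ := Z + η + (2 * K + 1) * (c * ((2 * K + 1) * (1 / (η / 2)))) with hb
  have hb0 : η ≤ b := by
    have : (0 : ℝ) ≤ (2 * K + 1) * (c * ((2 * K + 1) * (1 / (η / 2)))) := by positivity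
    rw [hb]; linarith
  have hbpos := hη.trans_le hb0
  refine ⟨16 * b ^ 2 / η ^ 4, by positivity, ?_⟩
  intro N ξ hξ z hz hzZ δ₁ δ₂ h₁ h₂ h₁0 h₂0 M₁ M₂ hM₁ hM₂
  obtain ⟨D₁, hD₁, e₁⟩ := hM₁.exists_eq
  obtain ⟨D₂, hD₂, e₂⟩ := hM₂.exists_eq
  have bound : ∀ {δ : ℝ} {M D : Matrix (Fin N) (Fin N) ℂ}, δ ≤ η / 2 → FormLe D δ →
      (∀ u, 0 ≤ (form u M u).im) →
      M * (-(z • (1 : Matrix (Fin N) (Fin N) ℂ)) - D - Xi ξ M) = 1 →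
      FormLe (-(z • (1 : Matrix (Fin N) (Fin N) ℂ)) - D - Xi ξ M) b := by
    intro δ M D hδ hD hM e
    have hdis := dissipative_neg_sub_sub hz hδ hD (hξ.gram.im_form_Xi_nonneg hM)
    have hinv := hdis.of_mul_eq_one (by positivity) e
    have h3 := bandAvg_le (K := K) (by positivity) (hinv.norm_apply_le (half_pos hη))
    have h4 := (((formLe_smul_one (n := Fin N) z).neg.sub hD).sub (hξ.formLe_Xi M))
    refine h4.mono ?_
    rw [hb]
    gcongr
    linarith
  exact stability hη hb0 (max_le h₁ h₂) (add_nonneg h₁0 h₂0) hξ.gram hz e₁ e₂ rfl rfl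
    hM₁.im_nonneg hM₂.im_nonneg (hD₁.mono (le_max_left _ _)) (hD₂.mono (le_max_right _ _))
    (hD₁.sub hD₂) (bound h₁ hD₁ hM₁.im_nonneg e₁) (bound h₂ hD₂ hM₂.im_nonneg e₂)

/-- A dissipative matrix with small residual is close to every approximate solution. -/
theorem exists_close_of_residual {η : ℝ} (hη : 0 < η) (Z c : ℝ) (hZ : 0 ≤ Z)
    (hc : 0 ≤ c) (K : ℕ) :
    ∃ C : ℝ, 0 < C ∧ ∀ (N : ℕ) (ξ : Fin N → Fin N → Fin N → Fin N → ℝ), IsKernel K c ξ →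
      ∀ z : ℂ, η ≤ z.im → ‖z‖ ≤ Z → ∀ r δ : ℝ, 0 ≤ r → 0 ≤ δ → C * r ≤ 1 → δ ≤ η / 2 →
      ∀ G M : Matrix (Fin N) (Fin N) ℂ, IsDissipativeInverse η G →
        (∀ i j, ‖residual ξ z G i j‖ ≤ r) → IsApproxSolution ξ z δ M →
        ∀ i j, ‖G i j - M i j‖ ≤ C * (r + δ) := by
  obtain ⟨C₀, hC₀, hstab⟩ := IsApproxSolution.exists_stability hη Z c hZ hc K
  set a : ℝ := c * ((2 * K + 1) * (1 / η)) with ha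
  set S : ℝ := 1 + invSqSum * (1 / η ^ 2 + 1 / η ^ 4 * (((2 * K + 1) * (K * a) + 1) ^ 2)) with hS
  have hS0 : 0 < S := by
    have : 0 ≤ invSqSum := tsum_nonneg fun k => by positivity
    positivity
  set T : ℝ := (2 * K + 1) * (c * ((2 * K + 1) * S)) with hT
  have hT0 : 0 ≤ T := by positivity
  -- `S` bounds the row sums of $A^{-1}$ and thus $G-A^{-1}$; `T` converts an entrywise bound into
  -- one for $\Xi$. The last term makes $Cr\le1$ imply $Tr\le\eta/2$, the smallness required for
  -- stability.
  refine ⟨S + C₀ * (T + 1) + T * 2 / η, by positivity, ?_⟩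
  intro N ξ hξ z hz hzZ r δ hr hδ hCr hδη G M hG hR hM i j
  set A := -(z • (1 : Matrix (Fin N) (Fin N) ℂ)) - Xi ξ G with hA
  have hAd : Dissipative η A := dissipative_neg_sub hz (hξ.gram.im_form_Xi_nonneg hG.im_nonneg)
  have hinv := hAd.inv hη
  have hAA := hAd.inv_mul hη
  have hAG : A * G = 1 - residual ξ z G := by
    rw [hA, residual, sub_mul, neg_mul, Matrix.smul_mul, Matrix.one_mul]; abel
  have hGM : G - A⁻¹ = -(A⁻¹ * residual ξ z G) := by
    have : A⁻¹ * (A * G) = G := by rw [← mul_assoc, hAA, one_mul]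
    calc G - A⁻¹ = A⁻¹ * (A * G) - A⁻¹ := by rw [this]
      _ = -(A⁻¹ * residual ξ z G) := by rw [hAG, mul_sub, mul_one]; abel
  have hsum : ∀ i, ∑ k, ‖A⁻¹ i k‖ ≤ S := by
    refine row_sum_le_of_banded hη (by positivity) hAA hinv (fun i j hij => ?_)
      fun i j hij => ?_
    · have e : A i j = -(Xi ξ G i j) := by simp [hA, Matrix.one_apply_ne hij]
      rw [e, norm_neg]
      exact (hξ.norm_Xi_apply_le G i j).trans (mul_le_mul_of_nonneg_left
        (bandAvg_le (by positivity) (hG.norm_apply_le hη)) hc)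
    · have hij' : i ≠ j := fun h => hij (h ▸ self_mem_nbhd K i)
      simp [hA, Matrix.one_apply_ne hij', hξ.Xi_apply_eq_zero G hij]
  have hclose : ∀ i j, ‖(G - A⁻¹) i j‖ ≤ S * r := by
    intro i j
    rw [hGM, Matrix.neg_apply, norm_neg, Matrix.mul_apply]
    refine (norm_sum_le _ _).trans ?_
    calc ∑ k, ‖A⁻¹ i k * residual ξ z G k j‖ ≤ ∑ k, ‖A⁻¹ i k‖ * r :=
          Finset.sum_le_sum fun k _ => by rw [norm_mul]; gcongr; exact hR k j
      _ ≤ S * r := by rw [← Finset.sum_mul]; gcongr; exact hsum i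
  have hD : FormLe (Xi ξ (G - A⁻¹)) (T * r) := by
    refine (hξ.formLe_Xi _).mono ?_
    have := bandAvg_le (K := K) (by positivity) hclose
    calc _ ≤ (2 * K + 1) * (c * ((2 * K + 1) * (S * r))) := by gcongr
      _ = _ := by rw [hT]; ring
  -- By definition $A^{-1}$ inverts $-z-\Xi(G)$, and $\Xi(G)=\Xi(G-A^{-1})+\Xi(A^{-1})$; the first
  -- part becomes the perturbation.
  have happ : IsApproxSolution ξ z (T * r) A⁻¹ := by
    refine ⟨hinv.im_nonneg, _, hD, ?_⟩
    have : -(z • (1 : Matrix (Fin N) (Fin N) ℂ)) - Xi ξ (G - A⁻¹) - Xi ξ A⁻¹ = A := by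
      rw [Xi_sub, hA]; abel
    rw [this, hAA]
  have hTr : T * r ≤ η / 2 := by
    have h1 : T * 2 / η * r ≤ 1 := by
      refine le_trans ?_ hCr
      gcongr
      have : 0 ≤ S + C₀ * (T + 1) := by positivity
      linarith
    have h2 : T * 2 / η * r = T * r / (η / 2) := by field_simp
    rw [h2, div_le_one (by positivity)] at h1
    exact h1
  have hfin := (hstab N ξ hξ z hz hzZ (T * r) δ hTr hδη (by positivity) hδ _ M happ
    hM).norm_apply_le i j
  have h1 := hclose i j
  rw [Matrix.sub_apply] at h1 hfin
  have h2 := norm_add_le (G i j - A⁻¹ i j) (A⁻¹ i j - M i j)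
  rw [sub_add_sub_cancel] at h2
  have h3 : 0 ≤ T * 2 / η * (r + δ) := by positivity
  have h4 : 0 ≤ S * δ := by positivity
  have h5 : 0 ≤ C₀ * r := by positivity
  have h6 : 0 ≤ C₀ * T * δ := by positivity
  calc ‖G i j - M i j‖ ≤ S * r + C₀ * (T * r + δ) := by linarith
    _ ≤ (S + C₀ * (T + 1) + T * 2 / η) * (r + δ) := by nlinarith

open scoped ComplexOrder in
theorem SolvesFinite.isApproxSolution {ξ : Fin N → Fin N → Fin N → Fin N → ℝ} {z : ℂ}
    {M : Matrix (Fin N) (Fin N) ℂ} (h : SolvesFinite ξ z M) : IsApproxSolution ξ z 0 M := by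
  refine ⟨fun u => ?_, 0, formLe_zero, by simpa using h.2⟩
  have h1 := h.1.posSemidef.dotProduct_mulVec_nonneg u
  have h2 : star u ⬝ᵥ ((1 / (2 * Complex.I)) • (M - M.conjTranspose)).mulVec u =
      ((form u M u).im : ℂ) := by
    change form u _ u = _
    rw [form_smul, form_sub, form_conjTranspose]
    have := Complex.sub_conj (form u M u)
    rw [RCLike.star_def, this]
    field_simp
    push_cast
    ring
  rw [h2] at h1
  exact_mod_cast h1

end Approximate

end

section

/-! ### Consequences of `K`-dependence -/

section KDependence

variable {N : ℕ} {Ω : Type*} [MeasurableSpace Ω] {P : Measure Ω} {K : ℕ}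
  {x : UpperIndex N → Ω → ℝ}

/-- The upper triangular index pair with entries `i` and `j`. -/
def upper (i j : Fin N) : UpperIndex N := ⟨(min i j, max i j), min_le_max⟩

theorem symMatrix_apply (y : UpperIndex N → ℝ) (i j : Fin N) :
    symMatrix y i j = y (upper i j) := rfl

theorem upper_comm (i j : Fin N) : upper i j = upper j i := by
  simp [upper, min_comm, max_comm]

theorem upper_of_le {i j : Fin N} (h : i ≤ j) : upper i j = ⟨(i, j), h⟩ := by
  simp [upper, h]

theorem indexDist_le_iff {w : ℕ} {i j k l : Fin N} (hij : i ≤ j) (hkl : k ≤ l) :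
    indexDist (upper i j) (upper k l) ≤ w ↔ k ∈ nbhd w i ∧ l ∈ nbhd w j := by
  rw [upper_of_le hij, upper_of_le hkl, indexDist, max_le_iff, mem_nbhd, mem_nbhd]

/-- Matching sorted entries minimizes the sup distance between two unordered pairs, so closeness can
be tested in either order. -/
theorem indexDist_upper_le_iff {w : ℕ} {i j k l : Fin N} :
    indexDist (upper i j) (upper k l) ≤ w ↔
      (k ∈ nbhd w i ∧ l ∈ nbhd w j) ∨ (l ∈ nbhd w i ∧ k ∈ nbhd w j) := by
  rcases le_total i j with h1 | h1 <;> rcases le_total k l with h2 | h2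
  · rw [indexDist_le_iff h1 h2]
    simp only [mem_nbhd, abs_le]
    have h3 : (i : ℕ) ≤ j := h1
    have h4 : (k : ℕ) ≤ l := h2
    omega
  · rw [upper_comm k l, indexDist_le_iff h1 h2]
    simp only [mem_nbhd, abs_le]
    have h3 : (i : ℕ) ≤ j := h1
    have h4 : (l : ℕ) ≤ k := h2
    omega
  · rw [upper_comm i j, indexDist_le_iff h1 h2]
    simp only [mem_nbhd, abs_le]
    have h3 : (j : ℕ) ≤ i := h1
    have h4 : (k : ℕ) ≤ l := h2
    omega
  · rw [upper_comm i j, upper_comm k l, indexDist_le_iff h1 h2]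
    simp only [mem_nbhd, abs_le]
    have h3 : (j : ℕ) ≤ i := h1
    have h4 : (l : ℕ) ≤ k := h2
    omega

theorem indexDist_triangle (a b c : UpperIndex N) :
    indexDist a c ≤ indexDist a b + indexDist b c := by
  simp only [indexDist]
  refine max_le ?_ ?_
  · exact (abs_sub_le _ _ _).trans (add_le_add (le_max_left _ _) (le_max_left _ _))
  · exact (abs_sub_le _ _ _).trans (add_le_add (le_max_right _ _) (le_max_right _ _))

/-- Subfamilies are encoded by setting the other entries to zero, so that $f$ and $g$ remain
functions of a full array and can be built from resolvents of cut matrices. -/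
theorem IsKDependent.integral_mul (h : IsKDependent K P x)
    (hx : ∀ a, Measurable (x a)) {𝕜 : Type*} [RCLike 𝕜] {S T : Set (UpperIndex N)}
    (hST : ∀ a ∈ S, ∀ b ∈ T, (K : ℤ) < indexDist a b)
    {f g : (UpperIndex N → ℝ) → 𝕜} (hf : Measurable f) (hg : Measurable g) :
    ∫ ω, f (S.indicator fun a => x a ω) * g (T.indicator fun a => x a ω) ∂P =
      (∫ ω, f (S.indicator fun a => x a ω) ∂P) * ∫ ω, g (T.indicator fun a => x a ω) ∂P := by
  classical
  let e : ∀ S : Set (UpperIndex N), (S → ℝ) → UpperIndex N → ℝ :=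
    fun S y a => if h : a ∈ S then y ⟨a, h⟩ else 0
  have he : ∀ S, Measurable (e S) := fun S => by
    refine measurable_pi_iff.2 fun a => ?_
    by_cases ha : a ∈ S
    · simpa [e, ha] using measurable_pi_apply _
    · simp [e, ha]
  have hS : ∀ (S : Set (UpperIndex N)) ω,
      S.indicator (fun a => x a ω) = e S (fun a : S => x a ω) := fun S ω => by
    funext a
    by_cases ha : a ∈ S <;> simp [e, ha]
  have hm : ∀ S : Set (UpperIndex N), Measurable fun ω (a : S) => x a ω := fun S =>
    measurable_pi_iff.2 fun a => hx _
  have hind := (h S T hST).comp (hf.comp (he S)) (hg.comp (he T))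
  simp only [hS]
  exact hind.integral_fun_mul_eq_mul_integral
    ((hf.comp (he S)).comp (hm S)).aestronglyMeasurable
    ((hg.comp (he T)).comp (hm T)).aestronglyMeasurable

theorem IsKDependent.comp (h : IsKDependent K P x) {φ : ℝ → ℝ}
    (hφ : Measurable φ) : IsKDependent K P fun a ω => φ (x a ω) := by
  intro S T hST
  exact (h S T hST).comp (φ := fun (y : S → ℝ) a => φ (y a)) (ψ := fun (y : T → ℝ) a => φ (y a))
    (measurable_pi_iff.2 fun a => hφ.comp (measurable_pi_apply a))
    (measurable_pi_iff.2 fun a => hφ.comp (measurable_pi_apply a))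

theorem IsKDependent.integral_pair (h : IsKDependent K P x) (hx : ∀ a, Measurable (x a))
    {a b : UpperIndex N} (hab : (K : ℤ) < indexDist a b) :
    ∫ ω, x a ω * x b ω ∂P = (∫ ω, x a ω ∂P) * ∫ ω, x b ω ∂P := by
  have := h.integral_mul hx (S := {a}) (T := {b}) (by simpa using hab)
    (measurable_pi_apply a) (measurable_pi_apply b)
  simpa using this

end KDependence

/-! ### The covariance tensor as a positive kernel of finite range. -/

section Covariance

variable {N : ℕ} {Ω : Type*} [MeasurableSpace Ω] {P : Measure Ω} {K : ℕ}
  {x : UpperIndex N → Ω → ℝ} {c : ℝ}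

theorem integrable_mul_of_sq {f g : Ω → ℝ} (hf : Measurable f) (hg : Measurable g)
    (hf2 : Integrable (fun ω => |f ω| ^ 2) P) (hg2 : Integrable (fun ω => |g ω| ^ 2) P) :
    Integrable (fun ω => f ω * g ω) P := by
  refine (hf2.add hg2).mono' (hf.mul hg).aestronglyMeasurable (.of_forall fun ω => ?_)
  simp only [Pi.add_apply, Real.norm_eq_abs, abs_mul]
  nlinarith [sq_nonneg (|f ω| - |g ω|), sq_nonneg (|f ω|), sq_nonneg |g ω|]

theorem abs_integral_mul_le {f g : Ω → ℝ}
    (hf2 : Integrable (fun ω => |f ω| ^ 2) P) (hg2 : Integrable (fun ω => |g ω| ^ 2) P)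
    (hfc : ∫ ω, |f ω| ^ 2 ∂P ≤ c) (hgc : ∫ ω, |g ω| ^ 2 ∂P ≤ c) :
    |∫ ω, f ω * g ω ∂P| ≤ c := by
  have h1 : ‖∫ ω, f ω * g ω ∂P‖ ≤ ∫ ω, (|f ω| ^ 2 + |g ω| ^ 2) * (1 / 2) ∂P := by
    refine norm_integral_le_of_norm_le ((hf2.add hg2).mul_const _) (.of_forall fun ω => ?_)
    simp only [Real.norm_eq_abs, abs_mul]
    nlinarith [sq_nonneg (|f ω| - |g ω|)]
  rw [integral_mul_const, integral_add hf2 hg2, Real.norm_eq_abs] at h1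
  linarith

/-- Because the tensor vanishes when one pair is sorted and the other is not, it is a sum of two
covariance matrices, one of the upper triangular array and one of the strictly lower triangular
array; this gives positivity. Centering and $K$-dependence give the finite range. -/
theorem isKernel_covTensor (hx : ∀ a, Measurable (x a)) (hK : IsKDependent K P x)
    (h0 : ∀ a, ∫ ω, x a ω ∂P = 0)
    (h2 : ∀ a, Integrable (fun ω => |x a ω| ^ 2) P) (hc : ∀ a, ∫ ω, |x a ω| ^ 2 ∂P ≤ c)
    (hc0 : 0 ≤ c) : IsKernel K c (covTensor P x) := by
  have hint : ∀ a b, Integrable (fun ω => x a ω * x b ω) P := fun a b =>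
    integrable_mul_of_sq (hx a) (hx b) (h2 a) (h2 b)
  refine ⟨?_, fun i j k l => ?_, hc0, fun i j k l h => ?_⟩
  · let U : Fin N → Fin N → Ω → ℝ := fun i j ω => if i ≤ j then x (upper i j) ω else 0
    let L : Fin N → Fin N → Ω → ℝ := fun i j ω => if j < i then x (upper i j) ω else 0
    have hU : ∀ i j k l, Integrable (fun ω => U i j ω * U k l ω) P := fun i j k l => by
      by_cases h1 : i ≤ j <;> by_cases h2 : k ≤ l <;> simp [U, h1, h2, hint]
    have hL : ∀ i j k l, Integrable (fun ω => L i j ω * L k l ω) P := fun i j k l => by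
      by_cases h1 : j < i <;> by_cases h2 : l < k <;> simp [L, h1, h2, hint]
    have hcov : ∀ i j k l, covTensor P x i j k l =
        ∫ ω, (U i j ω * U k l ω + L i j ω * L k l ω) ∂P := by
      intro i j k l
      by_cases h1 : i ≤ j <;> by_cases h2 : k ≤ l
      · simp [covTensor, U, L, h1, h2, h1.not_gt, h2.not_gt, symMatrix_apply]
      · simp [covTensor, U, L, h1, h2, h1.not_gt]
      · simp [covTensor, U, L, h1, h2, h2.not_gt]
      · simp [covTensor, U, L, h1, h2, not_le.1 h1, not_le.1 h2, symMatrix_apply]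
    refine isGram_of_nonneg (fun i j k l => ?_) fun d => ?_
    · rw [hcov, hcov]
      exact integral_congr_ae (.of_forall fun ω => by ring)
    · have : ∑ i, ∑ j, ∑ k, ∑ l, d i j * d k l * covTensor P x i j k l =
          ∫ ω, ((∑ i, ∑ j, d i j * U i j ω) ^ 2 + (∑ i, ∑ j, d i j * L i j ω) ^ 2) ∂P := by
        have e : ∀ ω, ((∑ i, ∑ j, d i j * U i j ω) ^ 2 + (∑ i, ∑ j, d i j * L i j ω) ^ 2) =
            ∑ i, ∑ j, ∑ k, ∑ l, d i j * d k l * (U i j ω * U k l ω + L i j ω * L k l ω) := by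
          intro ω
          rw [sq, sq]
          simp only [Finset.sum_mul, Finset.mul_sum, ← Finset.sum_add_distrib]
          refine Finset.sum_congr rfl fun i _ => Finset.sum_congr rfl fun j _ =>
            Finset.sum_congr rfl fun k _ => Finset.sum_congr rfl fun l _ => by ring
        simp only [e]
        have hi : ∀ i j k l, Integrable (fun ω =>
            d i j * d k l * (U i j ω * U k l ω + L i j ω * L k l ω)) P := fun i j k l =>
          ((hU i j k l).add (hL i j k l)).const_mul _
        rw [integral_finsetSum _ fun i _ => integrable_finsetSum _ fun j _ =>
          integrable_finsetSum _ fun k _ => integrable_finsetSum _ fun l _ => hi i j k l]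
        refine Finset.sum_congr rfl fun i _ => ?_
        rw [integral_finsetSum _ fun j _ =>
          integrable_finsetSum _ fun k _ => integrable_finsetSum _ fun l _ => hi i j k l]
        refine Finset.sum_congr rfl fun j _ => ?_
        rw [integral_finsetSum _ fun k _ => integrable_finsetSum _ fun l _ => hi i j k l]
        refine Finset.sum_congr rfl fun k _ => ?_
        rw [integral_finsetSum _ fun l _ => hi i j k l]
        refine Finset.sum_congr rfl fun l _ => ?_
        rw [hcov, integral_const_mul]
      rw [this]
      exact integral_nonneg fun ω => by positivity
  · unfold covTensor
    split_ifs
    · exact abs_integral_mul_le (h2 _) (h2 _) (hc _) (hc _)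
    · simpa using hc0
  · have key : indexDist (upper i j) (upper k l) ≤ K := by
      by_contra hlt
      apply h
      unfold covTensor
      split_ifs
      · simp only [symMatrix_apply]
        rw [hK.integral_pair hx (not_le.1 hlt), h0, zero_mul]
      · rfl
    unfold covTensor at h
    split_ifs at h with hif
    · rcases hif with ⟨h3, h4⟩ | ⟨h3, h4⟩
      · exact (indexDist_le_iff h3 h4).1 key
      · rw [upper_comm i j, upper_comm k l] at key
        exact ((indexDist_le_iff h3.le h4.le).1 key).symm
    · exact absurd rfl h

end Covariance

end

section

/-! ### Removing the entries near a given index pair -/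

section Cut

variable {N : ℕ}

/-- The array `x` with the entries at distance at most `w` from `{i, k}` set to zero. -/
def cut (w : ℕ) (i k : Fin N) (x : UpperIndex N → ℝ) : UpperIndex N → ℝ :=
  {b | (w : ℤ) < indexDist (upper i k) b}.indicator x

/-- The ordered pairs at distance at most `w` from `{i, k}`. -/
def pairs (w : ℕ) (i k : Fin N) : Finset (Fin N × Fin N) :=
  nbhd w i ×ˢ nbhd w k ∪ nbhd w k ×ˢ nbhd w i

theorem mem_pairs {w : ℕ} {i k u v : Fin N} :
    (u, v) ∈ pairs w i k ↔ indexDist (upper i k) (upper u v) ≤ w := by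
  rw [indexDist_upper_le_iff, pairs, Finset.mem_union, Finset.mem_product, Finset.mem_product,
    and_comm (a := u ∈ nbhd w k)]

theorem mem_pairs' {w : ℕ} {i k u v : Fin N} :
    (u, v) ∈ pairs w i k ↔ (u ∈ nbhd w i ∧ v ∈ nbhd w k) ∨ (u ∈ nbhd w k ∧ v ∈ nbhd w i) := by
  rw [pairs, Finset.mem_union, Finset.mem_product, Finset.mem_product]

theorem card_pairs_le (w : ℕ) (i k : Fin N) : (pairs w i k).card ≤ 2 * (2 * w + 1) ^ 2 := by
  refine (Finset.card_union_le _ _).trans ?_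
  rw [Finset.card_product, Finset.card_product]
  nlinarith [Nat.mul_le_mul (card_nbhd_le w i) (card_nbhd_le w k)]

theorem nbhd_mono {w w' : ℕ} (h : w ≤ w') (i : Fin N) : nbhd w i ⊆ nbhd w' i := fun j hj => by
  rw [mem_nbhd] at hj ⊢
  exact hj.trans (by exact_mod_cast h)

theorem sum_pairs_const_le (w : ℕ) (i k : Fin N) {b : ℝ} (hb : 0 ≤ b) :
    ∑ _p ∈ pairs w i k, b ≤ (2 * (2 * w + 1) ^ 2) * b := by
  rw [Finset.sum_const, nsmul_eq_mul]
  gcongr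
  exact_mod_cast card_pairs_le w i k

theorem normMatrix_cut (w : ℕ) (i k : Fin N) (x : UpperIndex N → ℝ) (u v : Fin N) :
    normMatrix (cut w i k x) u v = if (u, v) ∈ pairs w i k then 0 else normMatrix x u v := by
  by_cases h : (u, v) ∈ pairs w i k
  · have := mem_pairs.1 h
    simp [normMatrix, symMatrix_apply, cut, h, this]
  · have h' := h
    rw [mem_pairs, not_le] at h'
    simp [normMatrix, symMatrix_apply, cut, h, h']

theorem complexMatrix_cut_sub (w : ℕ) (i k : Fin N) (x : UpperIndex N → ℝ) (u v : Fin N) :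
    (complexMatrix (cut w i k x) - complexMatrix x) u v =
      if (u, v) ∈ pairs w i k then -(normMatrix x u v : ℂ) else 0 := by
  simp only [complexMatrix, Matrix.sub_apply, Matrix.map_apply, normMatrix_cut]
  split_ifs <;> simp

theorem mul_cut_mul_apply (w : ℕ) (i k : Fin N) (x : UpperIndex N → ℝ)
    (A B : Matrix (Fin N) (Fin N) ℂ) (l j : Fin N) :
    (A * (complexMatrix (cut w i k x) - complexMatrix x) * B) l j =
      -∑ p ∈ pairs w i k, (normMatrix x p.1 p.2 : ℂ) * (A l p.1 * B p.2 j) := by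
  simp only [Matrix.mul_apply, Finset.sum_mul, complexMatrix_cut_sub]
  rw [Finset.sum_comm, ← Finset.sum_product', ← Finset.sum_neg_distrib]
  rw [Finset.univ_product_univ, ← Finset.sum_subset (Finset.subset_univ (pairs w i k))]
  · refine Finset.sum_congr rfl fun p hp => ?_
    rw [if_pos hp]; ring
  · intro p _ hp
    rw [if_neg hp]; ring

/-- The size of the entries that are removed by `cut`. -/
def cutSize (w : ℕ) (i k : Fin N) (x : UpperIndex N → ℝ) : ℝ :=
  ∑ p ∈ pairs w i k, |normMatrix x p.1 p.2|

theorem cutSize_nonneg (w : ℕ) (i k : Fin N) (x : UpperIndex N → ℝ) : 0 ≤ cutSize w i k x :=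
  Finset.sum_nonneg fun _ _ => abs_nonneg _

/-- All entries of `H` are bounded by `ϕ`. -/
def Small (ϕ : ℝ) (x : UpperIndex N → ℝ) : Prop := ∀ u v, |normMatrix x u v| ≤ ϕ

theorem Small.cutSize_le {ϕ : ℝ} (hϕ : 0 ≤ ϕ) {x : UpperIndex N → ℝ} (hx : Small ϕ x) (w : ℕ)
    (i k : Fin N) : cutSize w i k x ≤ 2 * (2 * w + 1) ^ 2 * ϕ :=
  (Finset.sum_le_sum fun p _ => hx p.1 p.2).trans (sum_pairs_const_le w i k hϕ)

theorem norm_green_sub_cut_le {z : ℂ} (hz : 0 < z.im) (w : ℕ) (i k : Fin N)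
    (x : UpperIndex N → ℝ) (l j : Fin N) :
    ‖green x z l j - green (cut w i k x) z l j‖ ≤ ∑ p ∈ pairs w i k,
      |normMatrix x p.1 p.2| * (‖green x z l p.1‖ * ‖green (cut w i k x) z p.2 j‖) := by
  rw [← Matrix.sub_apply, green_sub_green hz, mul_cut_mul_apply, norm_neg]
  refine (norm_sum_le _ _).trans_eq (Finset.sum_congr rfl fun p _ => ?_)
  rw [norm_mul, norm_mul, Complex.norm_real, Real.norm_eq_abs]

theorem norm_green_sub_cut_le_cutSize {η : ℝ} (hη : 0 < η) {z : ℂ} (hz : η ≤ z.im) (w : ℕ)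
    (i k : Fin N) (x : UpperIndex N → ℝ) (l j : Fin N) :
    ‖green x z l j - green (cut w i k x) z l j‖ ≤ 1 / η ^ 2 * cutSize w i k x := by
  refine (norm_green_sub_cut_le (hη.trans_le hz) w i k x l j).trans ?_
  rw [cutSize, Finset.mul_sum]
  refine Finset.sum_le_sum fun p _ => ?_
  rw [mul_comm]
  gcongr
  calc _ ≤ (1 / η) * (1 / η) := by
        gcongr
        · exact (isDissipativeInverse_green hη hz x).norm_apply_le hη _ _
        · exact (isDissipativeInverse_green hη hz _).norm_apply_le hη _ _
    _ = 1 / η ^ 2 := by rw [div_mul_div_comm, sq, one_mul]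

theorem exists_norm_residual_le {η : ℝ} (hη : 0 < η) (Z c : ℝ) (hZ : 0 ≤ Z)
    (hc : 0 ≤ c) (K : ℕ) :
    ∃ C : ℝ, 0 < C ∧ ∀ (N : ℕ) (ξ : Fin N → Fin N → Fin N → Fin N → ℝ), IsKernel K c ξ →
      ∀ z : ℂ, η ≤ z.im → ‖z‖ ≤ Z → ∀ (x : UpperIndex N → ℝ) (i j : Fin N),
        ‖residual ξ z (green x z) i j‖ ≤ C := by
  refine ⟨1 + Z * (1 / η) + (2 * K + 1) * (c * ((2 * K + 1) * (1 / η)) * (1 / η)),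
    by positivity, ?_⟩
  intro N ξ hξ z hz hzZ x i j
  have hG := (isDissipativeInverse_green hη hz x)
  have h1 := hG.norm_apply_le hη
  simp only [residual, Matrix.add_apply, Matrix.smul_apply, smul_eq_mul]
  refine (norm_add_le _ _).trans (add_le_add ((norm_add_le _ _).trans (add_le_add ?_ ?_)) ?_)
  · rw [Matrix.one_apply]; split_ifs <;> simp
  · rw [norm_mul]
    gcongr
    exact h1 i j
  · rw [Matrix.mul_apply, ← Finset.sum_subset (Finset.subset_univ (nbhd K i))
      (fun l _ hl => by rw [hξ.Xi_apply_eq_zero _ hl, zero_mul])]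
    refine (norm_sum_le _ _).trans ?_
    refine (Finset.sum_le_sum fun l _ => ?_).trans (sum_nbhd_const_le K i (by positivity))
    rw [norm_mul]
    gcongr
    · exact (hξ.norm_Xi_apply_le _ i l).trans (mul_le_mul_of_nonneg_left
        (bandAvg_le (by positivity) h1) hc)
    · exact h1 l j

/-- In $R-R'$ the self-energy difference $\Xi(G-G')$ enters only through a band average and
contributes $1/N$. The other terms keep the product of two resolvent entries from the resolvent
identity, because it is typically small and must not yet be estimated by a constant. -/
theorem exists_norm_residual_sub_cut_le {η : ℝ} (hη : 0 < η) (Z c : ℝ) (hZ : 0 ≤ Z)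
    (hc : 0 ≤ c) (K : ℕ) :
    ∃ C : ℝ, 0 < C ∧ ∀ (N : ℕ) (ξ : Fin N → Fin N → Fin N → Fin N → ℝ), IsKernel K c ξ →
      ∀ z : ℂ, η ≤ z.im → ‖z‖ ≤ Z → ∀ (w : ℕ) (i' k : Fin N) (x : UpperIndex N → ℝ)
        (i j : Fin N),
        ‖residual ξ z (green x z) i j - residual ξ z (green (cut w i' k x) z) i j‖ ≤
          C * ∑ p ∈ pairs w i' k, |normMatrix x p.1 p.2| * (1 / (N : ℝ) +
            ∑ l ∈ nbhd K i, ‖green x z l p.1‖ * ‖green (cut w i' k x) z p.2 j‖) := by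
  set a : ℝ := c * ((2 * K + 1) * (1 / η)) with ha
  have ha0 : 0 ≤ a := by positivity
  set b : ℝ := (2 * K + 1) * (c * ((2 * K + 1) / η ^ 2) * (1 / η)) with hb
  have hb0 : 0 ≤ b := by positivity
  refine ⟨Z + a + b + 1, by positivity, ?_⟩
  intro N ξ hξ z hz hzZ w i' k x i j
  set y := cut w i' k x with hy
  have hzp := hη.trans_le hz
  set G := green x z with hG
  set G' := green y z with hG'
  have dG := isDissipativeInverse_green hη hz x
  have dG' := isDissipativeInverse_green hη hz y
  rw [← hG] at dG
  rw [← hG'] at dG'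
  have hsub : residual ξ z G i j - residual ξ z G' i j =
      z * (G i j - G' i j) + (∑ l ∈ nbhd K i, Xi ξ (G - G') i l * G l j) +
        ∑ l ∈ nbhd K i, Xi ξ G' i l * (G l j - G' l j) := by
    have e : ∀ A B : Matrix (Fin N) (Fin N) ℂ,
        (Xi ξ A * B) i j = ∑ l ∈ nbhd K i, Xi ξ A i l * B l j := fun A B => by
      rw [Matrix.mul_apply, ← Finset.sum_subset (Finset.subset_univ (nbhd K i))
        (fun l _ hl => by rw [hξ.Xi_apply_eq_zero _ hl, zero_mul])]
    simp only [residual, Matrix.add_apply, Matrix.smul_apply, smul_eq_mul, e, Xi_sub,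
      Matrix.sub_apply]
    simp only [sub_mul, mul_sub, Finset.sum_sub_distrib]
    ring
  set T : Fin N → ℝ := fun l => ∑ p ∈ pairs w i' k,
    |normMatrix x p.1 p.2| * (‖G l p.1‖ * ‖G' p.2 j‖) with hT
  have hT0 : ∀ l, 0 ≤ T l := fun l => Finset.sum_nonneg fun p _ => by positivity
  have hd : ∀ l, ‖G l j - G' l j‖ ≤ T l := fun l => norm_green_sub_cut_le hzp w i' k x l j
  have hTi : T i ≤ ∑ l ∈ nbhd K i, T l :=
    Finset.single_le_sum (fun l _ => hT0 l) (self_mem_nbhd K i)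
  have hs : bandAvg K (G - G') ≤ (2 * K + 1) / η ^ 2 * (1 / (N : ℝ) * cutSize w i' k x) := by
    rw [hG, hG', green_sub_green hzp]
    refine (bandAvg_mul_mul_le hη dG dG' _).trans ?_
    gcongr
    rw [← Finset.sum_product', cutSize, Finset.univ_product_univ,
      ← Finset.sum_subset (Finset.subset_univ (pairs w i' k))]
    · refine Finset.sum_le_sum fun p hp => ?_
      rw [complexMatrix_cut_sub, if_pos hp, norm_neg, Complex.norm_real, Real.norm_eq_abs]
    · intro p _ hp
      rw [complexMatrix_cut_sub, if_neg hp, norm_zero]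
  have h2 : ‖∑ l ∈ nbhd K i, Xi ξ (G - G') i l * G l j‖ ≤
      b * (1 / (N : ℝ) * cutSize w i' k x) := by
    refine (norm_sum_le _ _).trans ?_
    have : b * (1 / (N : ℝ) * cutSize w i' k x) = (2 * K + 1) *
        ((c * ((2 * K + 1) / η ^ 2 * (1 / (N : ℝ) * cutSize w i' k x))) * (1 / η)) := by
      rw [hb]; ring
    rw [this]
    have hcs := cutSize_nonneg w i' k x
    refine (Finset.sum_le_sum fun l _ => ?_).trans (sum_nbhd_const_le K i (by positivity))
    rw [norm_mul]
    refine mul_le_mul ((hξ.norm_Xi_apply_le _ _ _).trans (mul_le_mul_of_nonneg_left hs hc))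
      (dG.norm_apply_le hη l j) (norm_nonneg _) (by positivity)
  have h3 : ‖∑ l ∈ nbhd K i, Xi ξ G' i l * (G l j - G' l j)‖ ≤ a * ∑ l ∈ nbhd K i, T l := by
    refine (norm_sum_le _ _).trans ?_
    rw [Finset.mul_sum]
    refine Finset.sum_le_sum fun l _ => ?_
    rw [norm_mul]
    refine mul_le_mul ((hξ.norm_Xi_apply_le _ _ _).trans (mul_le_mul_of_nonneg_left
      (bandAvg_le (by positivity) (dG'.norm_apply_le hη)) hc)) (hd l) (norm_nonneg _) ha0
  have h1 : ‖z * (G i j - G' i j)‖ ≤ Z * ∑ l ∈ nbhd K i, T l := by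
    rw [norm_mul]
    exact mul_le_mul hzZ ((hd i).trans hTi) (norm_nonneg _) hZ
  have hfin : ∑ p ∈ pairs w i' k, |normMatrix x p.1 p.2| * (1 / (N : ℝ) +
      ∑ l ∈ nbhd K i, ‖G l p.1‖ * ‖G' p.2 j‖) =
      1 / (N : ℝ) * cutSize w i' k x + ∑ l ∈ nbhd K i, T l := by
    simp only [mul_add, Finset.sum_add_distrib, cutSize, hT]
    congr 1
    · rw [Finset.mul_sum]; exact Finset.sum_congr rfl fun p _ => mul_comm _ _
    · rw [Finset.sum_comm]
      refine Finset.sum_congr rfl fun p _ => ?_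
      rw [Finset.mul_sum]
  rw [hsub, hfin]
  have hS0 : 0 ≤ ∑ l ∈ nbhd K i, T l := Finset.sum_nonneg fun l _ => hT0 l
  have hc0 : 0 ≤ 1 / (N : ℝ) * cutSize w i' k x :=
    mul_nonneg (by positivity) (cutSize_nonneg w i' k x)
  have h4 := norm_add₃_le (a := z * (G i j - G' i j))
    (b := ∑ l ∈ nbhd K i, Xi ξ (G - G') i l * G l j)
    (c := ∑ l ∈ nbhd K i, Xi ξ G' i l * (G l j - G' l j))
  nlinarith [mul_nonneg hZ hc0, mul_nonneg ha0 hc0, mul_nonneg hb0 hS0]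

end Cut

end

section

/-! ### Control quantities and their comparability -/

/-- The standing assumptions on the covariance kernel, the spectral parameter and the bound `ϕ` on
the matrix entries. -/
structure Admissible (η Z c : ℝ) (K : ℕ) {N : ℕ} (ξ : Fin N → Fin N → Fin N → Fin N → ℝ)
    (z : ℂ) (ϕ : ℝ) : Prop where
  kernel : IsKernel K c ξ
  le_im : η ≤ z.im
  norm_le : ‖z‖ ≤ Z
  pos : 0 < ϕ
  le_one : ϕ ≤ 1
  one_le : 1 ≤ (N : ℝ) * ϕ ^ 2

variable {N : ℕ}

theorem Admissible.inv_le {η Z c : ℝ} {K : ℕ} {ξ : Fin N → Fin N → Fin N → Fin N → ℝ} {z : ℂ}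
    {ϕ : ℝ} (h : Admissible η Z c K ξ z ϕ) : 1 / (N : ℝ) ≤ ϕ := by
  have h1 := h.one_le
  have h2 := h.pos
  have hN : (0 : ℝ) < N := by
    by_contra h0
    nlinarith [sq_nonneg ϕ]
  rw [div_le_iff₀ hN]
  nlinarith [h.le_one, mul_pos hN h2]

/-- `|R_{ij}| + ϕ`, where `R` is the residual. -/
def residualSize (ξ : Fin N → Fin N → Fin N → Fin N → ℝ) (z : ℂ) (ϕ : ℝ) (i j : Fin N)
    (x : UpperIndex N → ℝ) : ℝ := ‖residual ξ z (green x z) i j‖ + ϕ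

/-- The size of the entries of `G` that connect a neighbourhood of `k` to `j` or to a
neighbourhood of `i`. -/
def weight (K : ℕ) (z : ℂ) (ϕ : ℝ) (i j k : Fin N) (x : UpperIndex N → ℝ) : ℝ :=
  ϕ + ∑ v ∈ nbhd (2 * K) k, (‖green x z v j‖ +
    ∑ l ∈ nbhd (2 * K) i, (‖green x z l v‖ + ‖green x z v l‖))

/-- `W` changes at most by a constant factor if the entries near a given index pair are removed. -/
def Comparable (K : ℕ) (ϕ C : ℝ) (W : (UpperIndex N → ℝ) → ℝ) : Prop :=
  ∀ x, Small ϕ x → ∀ w ≤ 2 * K, ∀ u v, W (cut w u v x) ≤ C * W x ∧ W x ≤ C * W (cut w u v x)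

theorem Comparable.mul {K : ℕ} {ϕ C C' : ℝ} {W W' : (UpperIndex N → ℝ) → ℝ}
    (h : Comparable K ϕ C W) (h' : Comparable K ϕ C' W') (hC : 0 ≤ C)
    (hW : ∀ x, 0 ≤ W x) (hW' : ∀ x, 0 ≤ W' x) :
    Comparable K ϕ (C * C') fun x => W x * W' x := fun x hx w hw u v => by
  obtain ⟨a, b⟩ := h x hx w hw u v
  obtain ⟨a', b'⟩ := h' x hx w hw u v
  constructor
  · calc _ ≤ (C * W x) * (C' * W' x) := mul_le_mul a a' (hW' _) (mul_nonneg hC (hW _))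
      _ = _ := by ring
  · calc _ ≤ (C * W (cut w u v x)) * (C' * W' (cut w u v x)) :=
        mul_le_mul b b' (hW' _) (mul_nonneg hC (hW _))
      _ = _ := by ring

theorem Comparable.pow {K : ℕ} {ϕ C : ℝ} {W : (UpperIndex N → ℝ) → ℝ}
    (h : Comparable K ϕ C W) (hW : ∀ x, 0 ≤ W x) (n : ℕ) :
    Comparable K ϕ (C ^ n) fun x => W x ^ n := fun x hx w hw u v => by
  obtain ⟨a, b⟩ := h x hx w hw u v
  rw [← mul_pow, ← mul_pow]
  exact ⟨pow_le_pow_left₀ (hW _) a n, pow_le_pow_left₀ (hW _) b n⟩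

/-- An additive change of order $\phi$ is a bounded multiplicative change for a quantity bounded
below by $\phi$. This is the purpose of the summand $\phi$ in `residualSize` and `weight`. -/
theorem comparable_of_abs_sub_le {K : ℕ} {ϕ C : ℝ} (hC : 0 ≤ C) {W : (UpperIndex N → ℝ) → ℝ}
    (hW : ∀ x, ϕ ≤ W x)
    (h : ∀ x, Small ϕ x → ∀ w ≤ 2 * K, ∀ u v, |W x - W (cut w u v x)| ≤ C * ϕ) :
    Comparable K ϕ (1 + C) W := fun x hx w hw u v => by
  have h1 := abs_le.1 (h x hx w hw u v)
  have h2 := mul_le_mul_of_nonneg_left (hW x) hC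
  have h3 := mul_le_mul_of_nonneg_left (hW (cut w u v x)) hC
  constructor <;> linarith [h1.1, h1.2]

theorem Small.cutSize_le_of_le {K : ℕ} {ϕ : ℝ} (hϕ : 0 ≤ ϕ) {x : UpperIndex N → ℝ}
    (hx : Small ϕ x) {w : ℕ} (hw : w ≤ 2 * K) (i k : Fin N) :
    cutSize w i k x ≤ 2 * (4 * K + 1) ^ 2 * ϕ := by
  refine (hx.cutSize_le hϕ w i k).trans ?_
  have h1 : 2 * (w : ℝ) ≤ 4 * K := by
    have : (w : ℝ) ≤ 2 * K := by exact_mod_cast hw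
    linarith
  gcongr

theorem exists_comparable_residualSize {η : ℝ} (hη : 0 < η) (Z c : ℝ) (hZ : 0 ≤ Z)
    (hc : 0 ≤ c) (K : ℕ) :
    ∃ C : ℝ, 1 ≤ C ∧ ∀ (N : ℕ) (ξ : Fin N → Fin N → Fin N → Fin N → ℝ) (z : ℂ) (ϕ : ℝ),
      Admissible η Z c K ξ z ϕ → ∀ i j, Comparable K ϕ C (residualSize ξ z ϕ i j) := by
  obtain ⟨C, hC, h⟩ := exists_norm_residual_sub_cut_le hη Z c hZ hc K
  refine ⟨1 + C * (2 * (4 * K + 1) ^ 2 * (1 + (2 * K + 1) * (1 / η * (1 / η)))),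
    le_add_of_nonneg_right (by positivity), ?_⟩
  intro N ξ z ϕ ha i j
  refine comparable_of_abs_sub_le (by positivity)
    (fun x => le_add_of_nonneg_left (norm_nonneg _)) fun x hx w hw u v => ?_
  have h1 := h N ξ ha.kernel z ha.le_im ha.norm_le w u v x i j
  have h2 : |residualSize ξ z ϕ i j x - residualSize ξ z ϕ i j (cut w u v x)| ≤
      ‖residual ξ z (green x z) i j - residual ξ z (green (cut w u v x) z) i j‖ := by
    unfold residualSize
    rw [add_sub_add_right_eq_sub]
    exact abs_norm_sub_norm_le _ _
  refine h2.trans (h1.trans ?_)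
  rw [mul_assoc]
  gcongr
  have hs := hx.cutSize_le_of_le ha.pos.le hw u v
  calc _ ≤ ∑ p ∈ pairs w u v, |normMatrix x p.1 p.2| * (1 + (2 * K + 1) * (1 / η * (1 / η))) := by
        refine Finset.sum_le_sum fun p _ => ?_
        gcongr
        · exact ha.inv_le.trans ha.le_one
        · refine (Finset.sum_le_sum fun l _ => ?_).trans (sum_nbhd_const_le K i (by positivity))
          gcongr
          · exact (isDissipativeInverse_green hη ha.le_im x).norm_apply_le hη _ _
          · exact (isDissipativeInverse_green hη ha.le_im _).norm_apply_le hη _ _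
    _ = cutSize w u v x * (1 + (2 * K + 1) * (1 / η * (1 / η))) := by
        rw [cutSize, Finset.sum_mul]
    _ ≤ (2 * (4 * K + 1) ^ 2 * ϕ) * (1 + (2 * K + 1) * (1 / η * (1 / η))) := by gcongr
    _ = _ := by ring

theorem exists_comparable_weight {η : ℝ} (hη : 0 < η) (Z c : ℝ) (K : ℕ) :
    ∃ C : ℝ, 1 ≤ C ∧ ∀ (N : ℕ) (ξ : Fin N → Fin N → Fin N → Fin N → ℝ) (z : ℂ) (ϕ : ℝ),
      Admissible η Z c K ξ z ϕ → ∀ i j k : Fin N, Comparable K ϕ C (weight K z ϕ i j k) := by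
  set d : ℝ := 1 / η ^ 2 * (2 * (4 * K + 1) ^ 2) with hd
  have hd0 : 0 ≤ d := by positivity
  refine ⟨1 + (2 * (2 * K : ℕ) + 1) * (d + (2 * (2 * K : ℕ) + 1) * (d + d)),
    le_add_of_nonneg_right (by positivity), ?_⟩
  intro N ξ z ϕ ha i j k
  refine comparable_of_abs_sub_le (by positivity)
    (fun x => le_add_of_nonneg_right (Finset.sum_nonneg fun v _ => by positivity))
    fun x hx w hw u v => ?_
  have h1 : ∀ a b, |‖green x z a b‖ - ‖green (cut w u v x) z a b‖| ≤ d * ϕ := fun a b => by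
    refine (abs_norm_sub_norm_le _ _).trans
      ((norm_green_sub_cut_le_cutSize hη ha.le_im w u v x a b).trans ?_)
    have hs := hx.cutSize_le_of_le ha.pos.le hw u v
    calc _ ≤ 1 / η ^ 2 * (2 * (4 * K + 1) ^ 2 * ϕ) := by gcongr
      _ = _ := by rw [hd]; ring
  have hϕ := ha.pos.le
  unfold weight
  rw [add_sub_add_left_eq_sub, ← Finset.sum_sub_distrib,
    show (2 * ((2 * K : ℕ) : ℝ) + 1) * (d + (2 * (2 * K : ℕ) + 1) * (d + d)) * ϕ =
      (2 * ((2 * K : ℕ) : ℝ) + 1) * (d * ϕ + (2 * (2 * K : ℕ) + 1) * (d * ϕ + d * ϕ)) by ring]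
  refine (Finset.abs_sum_le_sum_abs _ _).trans ((Finset.sum_le_sum fun a _ => ?_).trans
    (sum_nbhd_const_le (2 * K) k (by positivity)))
  rw [add_sub_add_comm, ← Finset.sum_sub_distrib]
  refine (abs_add_le _ _).trans (add_le_add (h1 _ _) ?_)
  refine (Finset.abs_sum_le_sum_abs _ _).trans ((Finset.sum_le_sum fun a _ => ?_).trans
    (sum_nbhd_const_le (2 * K) i (by positivity)))
  rw [add_sub_add_comm]
  exact (abs_add_le _ _).trans (add_le_add (h1 _ _) (h1 _ _))

theorem le_weight {K : ℕ} {z : ℂ} {ϕ : ℝ} {i j k : Fin N} {x : UpperIndex N → ℝ} :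
    ϕ ≤ weight K z ϕ i j k x :=
  le_add_of_nonneg_right (Finset.sum_nonneg fun v _ => by positivity)

theorem norm_green_col_le_weight {K : ℕ} {z : ℂ} {ϕ : ℝ} (hϕ : 0 ≤ ϕ) {i j k v : Fin N}
    {x : UpperIndex N → ℝ} (hv : v ∈ nbhd (2 * K) k) :
    ‖green x z v j‖ ≤ weight K z ϕ i j k x := by
  have h1 := Finset.single_le_sum (f := fun v => ‖green x z v j‖ +
    ∑ l ∈ nbhd (2 * K) i, (‖green x z l v‖ + ‖green x z v l‖)) (fun v _ => by positivity) hv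
  have h2 : 0 ≤ ∑ l ∈ nbhd (2 * K) i, (‖green x z l v‖ + ‖green x z v l‖) :=
    Finset.sum_nonneg fun v _ => by positivity
  unfold weight
  linarith

theorem norm_green_add_le_weight {K : ℕ} {z : ℂ} {ϕ : ℝ} (hϕ : 0 ≤ ϕ) {i j k v l : Fin N}
    {x : UpperIndex N → ℝ} (hv : v ∈ nbhd (2 * K) k) (hl : l ∈ nbhd (2 * K) i) :
    ‖green x z l v‖ + ‖green x z v l‖ ≤ weight K z ϕ i j k x := by
  have h1 := Finset.single_le_sum (f := fun v => ‖green x z v j‖ +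
    ∑ l ∈ nbhd (2 * K) i, (‖green x z l v‖ + ‖green x z v l‖)) (fun v _ => by positivity) hv
  have h2 := Finset.single_le_sum (f := fun l => ‖green x z l v‖ + ‖green x z v l‖)
    (fun v _ => by positivity) hl
  have h3 := norm_nonneg (green x z v j)
  unfold weight
  linarith

theorem exists_weight_le {η : ℝ} (hη : 0 < η) (Z c : ℝ) (K : ℕ) :
    ∃ C : ℝ, 1 ≤ C ∧ ∀ (N : ℕ) (ξ : Fin N → Fin N → Fin N → Fin N → ℝ) (z : ℂ) (ϕ : ℝ),
      Admissible η Z c K ξ z ϕ → ∀ (i j k : Fin N) x, weight K z ϕ i j k x ≤ C := by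
  refine ⟨1 + (2 * (2 * K : ℕ) + 1) * (1 / η + (2 * (2 * K : ℕ) + 1) * (1 / η + 1 / η)),
    le_add_of_nonneg_right (by positivity), ?_⟩
  intro N ξ z ϕ ha i j k x
  have h1 := (isDissipativeInverse_green hη ha.le_im x).norm_apply_le hη
  refine add_le_add ha.le_one ((Finset.sum_le_sum fun v _ => ?_).trans
    (sum_nbhd_const_le _ k (by positivity)))
  refine add_le_add (h1 _ _) ((Finset.sum_le_sum fun l _ => ?_).trans
    (sum_nbhd_const_le _ i (by positivity)))
  exact add_le_add (h1 _ _) (h1 _ _)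

/-- The sum over $k$ of the squared resolvent entries in the weight is bounded by row and column
$\ell^2$ norms, so their average is $O(1/N)$, and $N\phi^2\ge1$ absorbs it into $\phi^2$. This
averaging is the source of smallness in the moment recursion. -/
theorem exists_sum_weight_sq_le {η : ℝ} (hη : 0 < η) (Z c : ℝ) (K : ℕ) :
    ∃ C : ℝ, 0 < C ∧ ∀ (N : ℕ) (ξ : Fin N → Fin N → Fin N → Fin N → ℝ) (z : ℂ) (ϕ : ℝ),
      Admissible η Z c K ξ z ϕ → ∀ (i j : Fin N) x,
        1 / (N : ℝ) * ∑ k, weight K z ϕ i j k x ^ 2 ≤ C * ϕ ^ 2 := by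
  set m : ℝ := 2 * (2 * K : ℕ) + 1 with hm
  have hm0 : 0 < m := by positivity
  refine ⟨2 + 2 * (m * (m * (2 * (1 / η ^ 2) + 2 * (m * (m * (2 * (1 / η ^ 2 + 1 / η ^ 2))))))),
    by positivity, ?_⟩
  intro N ξ z ϕ ha i j x
  set G := green x z with hG
  have dG := isDissipativeInverse_green hη ha.le_im x
  rw [← hG] at dG
  have hcs : ∀ (a : Fin N) (f : Fin N → ℝ),
      (∑ v ∈ nbhd (2 * K) a, f v) ^ 2 ≤ m * ∑ v ∈ nbhd (2 * K) a, f v ^ 2 := fun a f => by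
    refine (sq_sum_le_card_mul_sum_sq (s := nbhd (2 * K) a) (f := f)).trans ?_
    have : 0 ≤ ∑ v ∈ nbhd (2 * K) a, f v ^ 2 := Finset.sum_nonneg fun v _ => sq_nonneg _
    gcongr
    rw [hm]
    exact_mod_cast card_nbhd_le (2 * K) a
  set A : Fin N → ℝ := fun v => ‖G v j‖ + ∑ l ∈ nbhd (2 * K) i, (‖G l v‖ + ‖G v l‖) with hA
  have hAsum : ∑ v, A v ^ 2 ≤ 2 * (1 / η ^ 2) +
      2 * (m * (m * (2 * (1 / η ^ 2 + 1 / η ^ 2)))) := by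
    calc ∑ v, A v ^ 2 ≤ ∑ v, (2 * ‖G v j‖ ^ 2 +
          2 * (m * ∑ l ∈ nbhd (2 * K) i, 2 * (‖G l v‖ ^ 2 + ‖G v l‖ ^ 2))) := by
          refine Finset.sum_le_sum fun v _ => ?_
          have h1 := hcs i fun l => ‖G l v‖ + ‖G v l‖
          have h2 : ∑ l ∈ nbhd (2 * K) i, (‖G l v‖ + ‖G v l‖) ^ 2 ≤
              ∑ l ∈ nbhd (2 * K) i, 2 * (‖G l v‖ ^ 2 + ‖G v l‖ ^ 2) :=
            Finset.sum_le_sum fun l _ => add_sq_le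
          have h3 := mul_le_mul_of_nonneg_left h2 hm0.le
          have h4 := add_sq_le (a := ‖G v j‖) (b := ∑ l ∈ nbhd (2 * K) i, (‖G l v‖ + ‖G v l‖))
          simp only [hA]
          linarith
      _ = 2 * ∑ v, ‖G v j‖ ^ 2 + 2 * (m * ∑ l ∈ nbhd (2 * K) i,
            2 * (∑ v, ‖G l v‖ ^ 2 + ∑ v, ‖G v l‖ ^ 2)) := by
          rw [Finset.sum_add_distrib, ← Finset.mul_sum, ← Finset.mul_sum, ← Finset.mul_sum,
            Finset.sum_comm]
          simp only [← Finset.mul_sum, Finset.sum_add_distrib]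
      _ ≤ _ := by
          gcongr
          · exact dG.col_le hη j
          · refine (Finset.sum_le_sum fun l _ => ?_).trans
              (sum_nbhd_const_le (2 * K) i (by positivity))
            gcongr
            · exact dG.row_le hη l
            · exact dG.col_le hη l
  have hA0 : 0 ≤ ∑ v, A v ^ 2 := Finset.sum_nonneg fun v _ => sq_nonneg _
  have h5 : ∑ k, weight K z ϕ i j k x ^ 2 ≤ 2 * ((N : ℝ) * ϕ ^ 2) +
      2 * (m * (m * ∑ v, A v ^ 2)) := by
    calc _ ≤ ∑ k, (2 * ϕ ^ 2 + 2 * (m * ∑ v ∈ nbhd (2 * K) k, A v ^ 2)) := by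
          refine Finset.sum_le_sum fun k _ => ?_
          have h1 := hcs k A
          have h4 := add_sq_le (a := ϕ) (b := ∑ v ∈ nbhd (2 * K) k, A v)
          have h6 : weight K z ϕ i j k x = ϕ + ∑ v ∈ nbhd (2 * K) k, A v := rfl
          rw [h6]
          linarith
      _ = 2 * ((N : ℝ) * ϕ ^ 2) + 2 * (m * ∑ v, ∑ _k ∈ nbhd (2 * K) v, A v ^ 2) := by
          rw [Finset.sum_add_distrib, ← Finset.mul_sum, ← Finset.mul_sum, ← Finset.mul_sum,
            sum_nbhd_comm (2 * K) fun _ v => A v ^ 2]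
          simp
      _ ≤ _ := by
          gcongr
          rw [Finset.mul_sum]
          exact Finset.sum_le_sum fun v _ => sum_nbhd_const_le (2 * K) v (sq_nonneg _)
  have hN : (0 : ℝ) < N := by
    by_contra h0
    nlinarith [sq_nonneg ϕ, ha.one_le]
  rw [one_div, inv_mul_le_iff₀ hN]
  refine h5.trans ?_
  set B := 2 * (1 / η ^ 2) + 2 * (m * (m * (2 * (1 / η ^ 2 + 1 / η ^ 2)))) with hB
  have hB0 : 0 ≤ B := by positivity
  have h6 : 2 * (m * (m * ∑ v, A v ^ 2)) ≤ 2 * (m * (m * B)) * ((N : ℝ) * ϕ ^ 2) :=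
    calc 2 * (m * (m * ∑ v, A v ^ 2)) ≤ 2 * (m * (m * B)) := by gcongr
      _ ≤ 2 * (m * (m * B)) * ((N : ℝ) * ϕ ^ 2) := le_mul_of_one_le_right (by positivity) ha.one_le
  linarith

/-- Each removed position has one index near $k$ and the other near $i$. In either case one of the
two resolvent factors connects $k$ to $j$ or to $i$ and is dominated by the weight, while the other
is at most $1/\eta$. -/
theorem exists_norm_residual_sub_cut_le_weight {η : ℝ} (hη : 0 < η) (Z c : ℝ) (hZ : 0 ≤ Z)
    (hc : 0 ≤ c) (K : ℕ) :
    ∃ C : ℝ, 0 < C ∧ ∀ (N : ℕ) (ξ : Fin N → Fin N → Fin N → Fin N → ℝ) (z : ℂ) (ϕ : ℝ),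
      Admissible η Z c K ξ z ϕ → ∀ i j k x, Small ϕ x →
        ‖residual ξ z (green x z) i j - residual ξ z (green (cut (2 * K) i k x) z) i j‖ ≤
          C * (cutSize (2 * K) i k x * weight K z ϕ i j k x) := by
  obtain ⟨C, hC, h⟩ := exists_norm_residual_sub_cut_le hη Z c hZ hc K
  obtain ⟨C', hC', h'⟩ := exists_comparable_weight hη Z c K
  refine ⟨C * (1 + (2 * K + 1) * (C' * (1 / η))), by positivity, ?_⟩
  intro N ξ z ϕ ha i j k x hx
  refine (h N ξ ha.kernel z ha.le_im ha.norm_le (2 * K) i k x i j).trans ?_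
  rw [mul_assoc]
  gcongr
  rw [cutSize, Finset.sum_mul, Finset.mul_sum]
  refine Finset.sum_le_sum fun p hp => ?_
  set y := cut (2 * K) i k x with hy
  have hw : weight K z ϕ i j k y ≤ C' * weight K z ϕ i j k x :=
    (h' N ξ z ϕ ha i j k x hx _ le_rfl i k).1
  have hw0 : 0 ≤ weight K z ϕ i j k x := ha.pos.le.trans le_weight
  have b1 := (isDissipativeInverse_green hη ha.le_im x).norm_apply_le hη
  have b2 := (isDissipativeInverse_green hη ha.le_im y).norm_apply_le hη
  have hterm : ∀ l ∈ nbhd K i, ‖green x z l p.1‖ * ‖green y z p.2 j‖ ≤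
      C' * (1 / η) * weight K z ϕ i j k x := by
    intro l hl
    rcases mem_pairs'.1 (show (p.1, p.2) ∈ pairs (2 * K) i k from hp) with ⟨-, h2⟩ | ⟨h1, -⟩
    · calc _ ≤ (1 / η) * (C' * weight K z ϕ i j k x) := by
            gcongr
            · exact b1 _ _
            · exact (norm_green_col_le_weight ha.pos.le h2).trans hw
        _ = _ := by ring
    · calc _ ≤ (C' * weight K z ϕ i j k x) * (1 / η) := by
            gcongr
            · have h3 := norm_green_add_le_weight (z := z) (j := j) (x := x) ha.pos.le h1
                (nbhd_mono (by omega) i hl)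
              have h4 := norm_nonneg (green x z p.1 l)
              have h5 := le_mul_of_one_le_left hw0 hC'
              linarith
            · exact b2 _ _
        _ = _ := by ring
  have hsum : ∑ l ∈ nbhd K i, ‖green x z l p.1‖ * ‖green y z p.2 j‖ ≤
      (2 * K + 1) * (C' * (1 / η) * weight K z ϕ i j k x) :=
    (Finset.sum_le_sum hterm).trans (sum_nbhd_const_le K i (by positivity))
  have h7 : 1 / (N : ℝ) ≤ weight K z ϕ i j k x := ha.inv_le.trans le_weight
  calc _ ≤ |normMatrix x p.1 p.2| * (weight K z ϕ i j k x +
        (2 * K + 1) * (C' * (1 / η) * weight K z ϕ i j k x)) := by gcongr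
    _ = _ := by ring

end

section

/-! ### Pointwise estimates for the moment recursion -/

/-- The function `w ↦ w̄^{q+1} w^q`, so that `w * momentFactor q w = |w|^{2q+2}`. -/
def momentFactor (q : ℕ) (w : ℂ) : ℂ := star w ^ (q + 1) * w ^ q

theorem norm_momentFactor (q : ℕ) (w : ℂ) : ‖momentFactor q w‖ = ‖w‖ ^ (2 * q + 1) := by
  rw [momentFactor, norm_mul, norm_pow, norm_pow, norm_star, ← pow_add]
  congr 1; ring

theorem mul_momentFactor (q : ℕ) (w : ℂ) :
    w * momentFactor q w = ((‖w‖ ^ (2 * q + 2) : ℝ) : ℂ) := by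
  have h : star w * w = ((‖w‖ ^ 2 : ℝ) : ℂ) := by
    rw [RCLike.star_def, Complex.conj_mul']; push_cast; rfl
  calc w * momentFactor q w = (star w * w) ^ (q + 1) := by rw [momentFactor]; ring
    _ = _ := by rw [h, ← Complex.ofReal_pow, ← pow_mul]; congr 2

/-- Multiplying through by $M$ avoids the exponent $n-1$, which would need a separate treatment at
$n=0$. -/
theorem norm_pow_sub_pow_le_mul {a b : ℂ} {M : ℝ} (ha : ‖a‖ ≤ M) (hb : ‖b‖ ≤ M) (n : ℕ) :
    ‖a ^ n - b ^ n‖ * M ≤ n * M ^ n * ‖a - b‖ := by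
  have hM : 0 ≤ M := (norm_nonneg a).trans ha
  induction n with
  | zero => simp
  | succ n ih =>
    have e : a ^ (n + 1) - b ^ (n + 1) = (a ^ n - b ^ n) * a + b ^ n * (a - b) := by ring
    have h1 := norm_add_le ((a ^ n - b ^ n) * a) (b ^ n * (a - b))
    rw [← e, norm_mul, norm_mul, norm_pow] at h1
    have h2 : ‖b‖ ^ n ≤ M ^ n := pow_le_pow_left₀ (norm_nonneg _) hb n
    calc ‖a ^ (n + 1) - b ^ (n + 1)‖ * M
        ≤ (‖a ^ n - b ^ n‖ * ‖a‖ + ‖b‖ ^ n * ‖a - b‖) * M := by gcongr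
      _ ≤ (‖a ^ n - b ^ n‖ * M + M ^ n * ‖a - b‖) * M := by gcongr
      _ ≤ (n * M ^ n * ‖a - b‖ + M ^ n * ‖a - b‖) * M := by gcongr
      _ = _ := by push_cast; ring

theorem norm_momentFactor_sub_le {a b : ℂ} {M : ℝ} (hM : 0 < M) (ha : ‖a‖ ≤ M) (hb : ‖b‖ ≤ M)
    (q : ℕ) : ‖momentFactor q a - momentFactor q b‖ ≤ (2 * q + 1) * M ^ (2 * q) * ‖a - b‖ := by
  have e : momentFactor q a - momentFactor q b =
      (star a ^ (q + 1) - star b ^ (q + 1)) * a ^ q + star b ^ (q + 1) * (a ^ q - b ^ q) := by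
    unfold momentFactor; ring
  have h1 := norm_pow_sub_pow_le_mul (a := star a) (b := star b) (M := M) (by simpa) (by simpa)
    (q + 1)
  have h2 := norm_pow_sub_pow_le_mul ha hb q
  rw [← star_sub, norm_star] at h1
  have h3 := norm_add_le ((star a ^ (q + 1) - star b ^ (q + 1)) * a ^ q)
    (star b ^ (q + 1) * (a ^ q - b ^ q))
  rw [← e, norm_mul, norm_mul, norm_pow, norm_pow, norm_star] at h3
  have h4 : ‖a‖ ^ q ≤ M ^ q := pow_le_pow_left₀ (norm_nonneg _) ha q
  have h5 : ‖b‖ ^ (q + 1) ≤ M ^ (q + 1) := pow_le_pow_left₀ (norm_nonneg _) hb _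
  refine le_of_mul_le_mul_right ?_ hM
  calc ‖momentFactor q a - momentFactor q b‖ * M
      ≤ (‖star a ^ (q + 1) - star b ^ (q + 1)‖ * M ^ q +
          M ^ (q + 1) * ‖a ^ q - b ^ q‖) * M := by
        gcongr
        exact h3.trans (by gcongr)
    _ = (‖star a ^ (q + 1) - star b ^ (q + 1)‖ * M) * M ^ q +
          M ^ (q + 1) * (‖a ^ q - b ^ q‖ * M) := by ring
    _ ≤ ((q + 1 : ℕ) * M ^ (q + 1) * ‖a - b‖) * M ^ q +
          M ^ (q + 1) * (q * M ^ q * ‖a - b‖) := by gcongr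
    _ = _ := by push_cast; ring

variable {N : ℕ}

/-- The factor `momentFactor q R_{ij}`. -/
def resFactor (q : ℕ) (ξ : Fin N → Fin N → Fin N → Fin N → ℝ) (z : ℂ) (i j : Fin N)
    (x : UpperIndex N → ℝ) : ℂ := momentFactor q (residual ξ z (green x z) i j)

/-- The product `G_{ku} G_{vj}` times `resFactor`. -/
def quadTerm (q : ℕ) (ξ : Fin N → Fin N → Fin N → Fin N → ℝ) (z : ℂ) (i j k u v : Fin N)
    (x : UpperIndex N → ℝ) : ℂ :=
  green x z k u * green x z v j * resFactor q ξ z i j x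

/-- The error term `ϕ Y^{2q+1} + g² Y^{2q}`. -/
def errorTerm (q K : ℕ) (ξ : Fin N → Fin N → Fin N → Fin N → ℝ) (z : ℂ) (ϕ : ℝ) (i j k : Fin N)
    (x : UpperIndex N → ℝ) : ℝ :=
  ϕ * residualSize ξ z ϕ i j x ^ (2 * q + 1) +
    weight K z ϕ i j k x ^ 2 * residualSize ξ z ϕ i j x ^ (2 * q)

theorem residualSize_nonneg {ξ : Fin N → Fin N → Fin N → Fin N → ℝ} {z : ℂ} {ϕ : ℝ} (hϕ : 0 ≤ ϕ)
    {i j : Fin N} {x : UpperIndex N → ℝ} : 0 ≤ residualSize ξ z ϕ i j x :=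
  add_nonneg (norm_nonneg _) hϕ

theorem errorTerm_nonneg {q K : ℕ} {ξ : Fin N → Fin N → Fin N → Fin N → ℝ} {z : ℂ} {ϕ : ℝ}
    (hϕ : 0 ≤ ϕ) {i j k : Fin N} {x : UpperIndex N → ℝ} :
    0 ≤ errorTerm q K ξ z ϕ i j k x := by
  have := residualSize_nonneg (ξ := ξ) (z := z) (i := i) (j := j) (x := x) hϕ
  unfold errorTerm
  positivity

theorem Comparable.add {K : ℕ} {ϕ C C' : ℝ} {W W' : (UpperIndex N → ℝ) → ℝ}
    (h : Comparable K ϕ C W) (h' : Comparable K ϕ C' W')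
    (hW : ∀ x, 0 ≤ W x) (hW' : ∀ x, 0 ≤ W' x) :
    Comparable K ϕ (max C C') fun x => W x + W' x := fun x hx w hw u v => by
  obtain ⟨a, b⟩ := h x hx w hw u v
  obtain ⟨a', b'⟩ := h' x hx w hw u v
  have h1 := mul_le_mul_of_nonneg_right (le_max_left C C') (hW x)
  have h2 := mul_le_mul_of_nonneg_right (le_max_right C C') (hW' x)
  have h3 := mul_le_mul_of_nonneg_right (le_max_left C C') (hW (cut w u v x))
  have h4 := mul_le_mul_of_nonneg_right (le_max_right C C') (hW' (cut w u v x))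
  constructor <;> linarith

theorem Comparable.const_mul {K : ℕ} {ϕ C a : ℝ} {W : (UpperIndex N → ℝ) → ℝ}
    (h : Comparable K ϕ C W) (ha : 0 ≤ a) :
    Comparable K ϕ C fun x => a * W x := fun x hx w hw u v => by
  obtain ⟨h1, h2⟩ := h x hx w hw u v
  have h3 := mul_le_mul_of_nonneg_left h1 ha
  have h4 := mul_le_mul_of_nonneg_left h2 ha
  constructor <;> linarith

theorem exists_comparable_errorTerm {η : ℝ} (hη : 0 < η) (Z c : ℝ) (hZ : 0 ≤ Z)
    (hc : 0 ≤ c) (K q : ℕ) :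
    ∃ C : ℝ, 1 ≤ C ∧ ∀ (N : ℕ) (ξ : Fin N → Fin N → Fin N → Fin N → ℝ) (z : ℂ) (ϕ : ℝ),
      Admissible η Z c K ξ z ϕ → ∀ i j k : Fin N,
        Comparable K ϕ C (errorTerm q K ξ z ϕ i j k) := by
  obtain ⟨C₁, hC₁, h₁⟩ := exists_comparable_residualSize hη Z c hZ hc K
  obtain ⟨C₂, hC₂, h₂⟩ := exists_comparable_weight hη Z c K
  refine ⟨max (C₁ ^ (2 * q + 1)) (C₂ ^ 2 * C₁ ^ (2 * q)),
    (one_le_pow₀ hC₁).trans (le_max_left _ _), ?_⟩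
  intro N ξ z ϕ ha i j k
  have hY : ∀ x, 0 ≤ residualSize ξ z ϕ i j x := fun x => residualSize_nonneg ha.pos.le
  have hg : ∀ x, 0 ≤ weight K z ϕ i j k x := fun x => ha.pos.le.trans le_weight
  exact (((h₁ N ξ z ϕ ha i j).pow hY _).const_mul ha.pos.le).add
    (((h₂ N ξ z ϕ ha i j k).pow hg 2).mul ((h₁ N ξ z ϕ ha i j).pow hY _) (by positivity)
      (fun x => by positivity) fun x => pow_nonneg (hY x) _)
    (fun x => mul_nonneg ha.pos.le (pow_nonneg (hY x) _))
    (fun x => mul_nonneg (by positivity) (pow_nonneg (hY x) _))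

theorem exists_residualSize_le {η : ℝ} (hη : 0 < η) (Z c : ℝ) (hZ : 0 ≤ Z)
    (hc : 0 ≤ c) (K : ℕ) :
    ∃ C : ℝ, 1 ≤ C ∧ ∀ (N : ℕ) (ξ : Fin N → Fin N → Fin N → Fin N → ℝ) (z : ℂ) (ϕ : ℝ),
      Admissible η Z c K ξ z ϕ → ∀ (i j : Fin N) x, residualSize ξ z ϕ i j x ≤ C := by
  obtain ⟨C, hC, h⟩ := exists_norm_residual_le hη Z c hZ hc K
  exact ⟨C + 1, by linarith, fun N ξ z ϕ ha i j x =>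
    add_le_add (h N ξ ha.kernel z ha.le_im ha.norm_le x i j) ha.le_one⟩

/-- These are the deterministic inputs for one step of the recursion: a first-order expansion of
$G_{kj}$ times the moment factor in the removed entries, a priori bounds for the terms evaluated on
the cut array, the cost of restoring the removed entries in the quadratic term, and the smallness of
those quadratic terms in which $(u,v)$ matches $(i,k)$ in the same order. The change of the moment
factor is of size `s * g * Y ^ (2 * q)`, and the factor $G_{kj}$ in front supplies the second `g` of
the error term. -/
theorem exists_pointwise_bounds {η : ℝ} (hη : 0 < η) (Z c : ℝ) (hZ : 0 ≤ Z)
    (hc : 0 ≤ c) (K q : ℕ) :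
    ∃ C : ℝ, 1 ≤ C ∧ ∀ (N : ℕ) (ξ : Fin N → Fin N → Fin N → Fin N → ℝ) (z : ℂ) (ϕ : ℝ),
      Admissible η Z c K ξ z ϕ → ∀ (i j k : Fin N) (x : UpperIndex N → ℝ), Small ϕ x →
      (‖green x z k j * resFactor q ξ z i j x -
          green (cut (2 * K) i k x) z k j * resFactor q ξ z i j (cut (2 * K) i k x) +
          ∑ p ∈ pairs (2 * K) i k, (normMatrix x p.1 p.2 : ℂ) *
            quadTerm q ξ z i j k p.1 p.2 (cut (2 * K) i k x)‖ ≤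
        C * (cutSize (2 * K) i k x * errorTerm q K ξ z ϕ i j k x)) ∧
      (∀ k, ‖green (cut (2 * K) i k x) z k j * resFactor q ξ z i j (cut (2 * K) i k x)‖ ≤
        C * residualSize ξ z ϕ i j x ^ (2 * q + 1)) ∧
      (∀ u v, ‖quadTerm q ξ z i j k u v (cut (2 * K) i k x)‖ ≤
        C * residualSize ξ z ϕ i j x ^ (2 * q + 1)) ∧
      (∀ u v, ‖quadTerm q ξ z i j k u v (cut (2 * K) i k x) - quadTerm q ξ z i j k u v x‖ ≤
        C * errorTerm q K ξ z ϕ i j k x) ∧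
      (∀ u v, u ∈ nbhd K i → v ∈ nbhd K k →
        ‖quadTerm q ξ z i j k u v x‖ ≤ C * errorTerm q K ξ z ϕ i j k x) := by
  obtain ⟨C₁, hC₁, h₁⟩ := exists_comparable_residualSize hη Z c hZ hc K
  obtain ⟨C₂, hC₂, h₂⟩ := exists_comparable_weight hη Z c K
  obtain ⟨C₃, hC₃, h₃⟩ := exists_norm_residual_sub_cut_le_weight hη Z c hZ hc K
  obtain ⟨C₄, hC₄, h₄⟩ := exists_residualSize_le hη Z c hZ hc K
  set m : ℝ := 2 * (4 * K + 1) ^ 2 with hm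
  have hm0 : 0 ≤ m := by positivity
  set e : ℝ := 1 / η with he
  have he0 : 0 < e := by positivity
  -- the Lipschitz constant of `resFactor`
  set L : ℝ := (2 * q + 1) * C₁ ^ (2 * q) * C₃ with hL
  have hL0 : 0 ≤ L := by positivity
  set P : ℝ := C₁ ^ (2 * q + 1) with hP
  have hP1 : 1 ≤ P := one_le_pow₀ hC₁
  -- A single constant collecting those of the five estimates.
  refine ⟨e ^ 3 * m + e ^ 2 * m * L + C₂ * L + e * P + e ^ 2 * P + 2 * e ^ 3 * m * P +
    e ^ 2 * L * m + C₄ + 1, ?_, ?_⟩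
  · have : 0 ≤ e ^ 3 * m + e ^ 2 * m * L + C₂ * L + e * P + e ^ 2 * P + 2 * e ^ 3 * m * P +
      e ^ 2 * L * m := by positivity
    linarith
  intro N ξ z ϕ ha i j k x hx
  have hϕ := ha.pos
  have hY : ∀ x, 0 < residualSize ξ z ϕ i j x := fun x => add_pos_of_nonneg_of_pos (norm_nonneg _) hϕ
  have hRY : ∀ x, ‖residual ξ z (green x z) i j‖ ≤ residualSize ξ z ϕ i j x := fun x =>
    le_add_of_nonneg_right hϕ.le
  have hb : ∀ (x : UpperIndex N → ℝ) a b, ‖green x z a b‖ ≤ e := fun x =>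
    (isDissipativeInverse_green hη ha.le_im x).norm_apply_le hη
  have hYle : ∀ i k, ‖residual ξ z (green (cut (2 * K) i k x) z) i j‖ ≤
      C₁ * residualSize ξ z ϕ i j x := fun i k =>
    (le_add_of_nonneg_right hϕ.le).trans (h₁ N ξ z ϕ ha i j x hx _ le_rfl i k).1
  have hF : ∀ x, ‖resFactor q ξ z i j x‖ ≤ residualSize ξ z ϕ i j x ^ (2 * q + 1) := fun x => by
    rw [resFactor, norm_momentFactor]
    exact pow_le_pow_left₀ (norm_nonneg _) (hRY x) _
  have hF0 : ∀ k, ‖resFactor q ξ z i j (cut (2 * K) i k x)‖ ≤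
      P * residualSize ξ z ϕ i j x ^ (2 * q + 1) := fun k => by
    rw [resFactor, norm_momentFactor, hP, ← mul_pow]
    exact pow_le_pow_left₀ (norm_nonneg _) (hYle i k) _
  set y := cut (2 * K) i k x with hy
  set s := cutSize (2 * K) i k x with hs
  set g := weight K z ϕ i j k x with hg
  set Y := residualSize ξ z ϕ i j x with hYdef
  have hYx := hY x
  rw [← hYdef] at hYx
  have hs0 : 0 ≤ s := cutSize_nonneg _ _ _ _
  have hsϕ : s ≤ m * ϕ := hx.cutSize_le_of_le hϕ.le le_rfl i k
  have hϕg : ϕ ≤ g := le_weight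
  have hg0 : 0 < g := hϕ.trans_le hϕg
  have hFd : ‖resFactor q ξ z i j x - resFactor q ξ z i j y‖ ≤ L * (s * g * Y ^ (2 * q)) := by
    have hM : 0 < C₁ * Y := by positivity
    refine (norm_momentFactor_sub_le hM ((hRY x).trans (le_mul_of_one_le_left hYx.le hC₁))
      (hYle i k) q).trans ?_
    calc _ ≤ (2 * q + 1) * (C₁ * Y) ^ (2 * q) * (C₃ * (s * g)) := by
          gcongr
          exact h₃ N ξ z ϕ ha i j k x hx
      _ = _ := by rw [hL, mul_pow]; ring
  have hGd : ∀ a b, ‖green x z a b - green y z a b‖ ≤ e ^ 2 * s := fun a b => by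
    refine (norm_green_sub_cut_le_cutSize hη ha.le_im (2 * K) i k x a b).trans_eq ?_
    rw [he, div_pow, one_pow]
  have hEr : errorTerm q K ξ z ϕ i j k x = ϕ * Y ^ (2 * q + 1) + g ^ 2 * Y ^ (2 * q) := rfl
  have hYp : 0 < Y ^ (2 * q) := by positivity
  have hYp1 : 0 < Y ^ (2 * q + 1) := by positivity
  have hEr1 : ϕ * Y ^ (2 * q + 1) ≤ errorTerm q K ξ z ϕ i j k x := by
    rw [hEr]; have : 0 ≤ g ^ 2 * Y ^ (2 * q) := by positivity
    linarith
  have hEr2 : g ^ 2 * Y ^ (2 * q) ≤ errorTerm q K ξ z ϕ i j k x := by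
    rw [hEr]; have : 0 ≤ ϕ * Y ^ (2 * q + 1) := by positivity
    linarith
  set V := errorTerm q K ξ z ϕ i j k x with hV
  have hV0 : 0 ≤ V := errorTerm_nonneg hϕ.le
  have hQ0 : ∀ u v, ‖green y z k u * green y z v j‖ ≤ e ^ 2 := fun u v => by
    rw [norm_mul, sq]
    exact mul_le_mul (hb _ _ _) (hb _ _ _) (norm_nonneg _) he0.le
  refine ⟨?_, fun k' => ?_, fun u v => ?_, fun u v => ?_, fun u v hu hv => ?_⟩
  · set S := ∑ p ∈ pairs (2 * K) i k, (normMatrix x p.1 p.2 : ℂ) *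
      (green y z k p.1 * green y z p.2 j) with hS
    have hSle : ‖S‖ ≤ e ^ 2 * s := by
      rw [hS, hs, cutSize, Finset.mul_sum]
      refine (norm_sum_le _ _).trans (Finset.sum_le_sum fun p _ => ?_)
      rw [norm_mul, Complex.norm_real, Real.norm_eq_abs, mul_comm]
      gcongr
      exact hQ0 _ _
    -- Replacing the remaining uncut resolvent in the resolvent identity by the cut one costs a
    -- second factor of the cut size, so this is a genuine second-order remainder.
    have hGS : ‖green x z k j - green y z k j + S‖ ≤ e ^ 3 * (s * s) := by
      have e1 : green x z k j - green y z k j = -∑ p ∈ pairs (2 * K) i k,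
          (normMatrix x p.1 p.2 : ℂ) * (green x z k p.1 * green y z p.2 j) := by
        rw [← Matrix.sub_apply, green_sub_green (hη.trans_le ha.le_im), hy, mul_cut_mul_apply]
      have e2 : green x z k j - green y z k j + S = ∑ p ∈ pairs (2 * K) i k,
          (normMatrix x p.1 p.2 : ℂ) *
            ((green y z k p.1 - green x z k p.1) * green y z p.2 j) := by
        rw [e1, hS, neg_add_eq_sub, ← Finset.sum_sub_distrib]
        exact Finset.sum_congr rfl fun p _ => by ring
      rw [e2]
      refine (norm_sum_le _ _).trans ?_
      have e3 : e ^ 3 * (s * s) = ∑ p ∈ pairs (2 * K) i k,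
          |normMatrix x p.1 p.2| * (e ^ 2 * s * e) := by
        rw [← Finset.sum_mul, ← cutSize, ← hs]; ring
      rw [e3]
      refine Finset.sum_le_sum fun p _ => ?_
      rw [norm_mul, norm_mul, Complex.norm_real, Real.norm_eq_abs]
      gcongr
      · rw [norm_sub_rev]; exact hGd _ _
      · exact hb _ _ _
    have hsum : ∑ p ∈ pairs (2 * K) i k, (normMatrix x p.1 p.2 : ℂ) *
        quadTerm q ξ z i j k p.1 p.2 y = S * resFactor q ξ z i j y := by
      rw [hS, Finset.sum_mul]
      exact Finset.sum_congr rfl fun p _ => by unfold quadTerm; ring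
    -- The variation of the moment factor is put entirely into the second summand; there it is
    -- multiplied by a quantity bounded by `g`, which avoids expanding it to higher order.
    have edec : green x z k j * resFactor q ξ z i j x - green y z k j * resFactor q ξ z i j y +
        S * resFactor q ξ z i j y =
        (green x z k j - green y z k j + S) * resFactor q ξ z i j x +
        (green y z k j - S) * (resFactor q ξ z i j x - resFactor q ξ z i j y) := by ring
    rw [hsum, edec]
    have hgy : ‖green y z k j‖ ≤ C₂ * g :=
      (norm_green_col_le_weight hϕ.le (self_mem_nbhd _ k)).trans
        (h₂ N ξ z ϕ ha i j k x hx _ le_rfl i k).1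
    have t1 : ‖(green x z k j - green y z k j + S) * resFactor q ξ z i j x‖ ≤
        e ^ 3 * m * (s * V) := by
      rw [norm_mul]
      calc _ ≤ e ^ 3 * (s * s) * Y ^ (2 * q + 1) := by gcongr; exact hF x
        _ ≤ e ^ 3 * (s * (m * ϕ)) * Y ^ (2 * q + 1) := by gcongr
        _ = e ^ 3 * m * (s * (ϕ * Y ^ (2 * q + 1))) := by ring
        _ ≤ _ := by gcongr
    have t2 : ‖(green y z k j - S) * (resFactor q ξ z i j x - resFactor q ξ z i j y)‖ ≤
        (C₂ * L + e ^ 2 * m * L) * (s * V) := by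
      rw [norm_mul]
      have hgS : ‖green y z k j - S‖ ≤ (C₂ + e ^ 2 * m) * g := by
        refine (norm_sub_le _ _).trans ?_
        have : e ^ 2 * s ≤ e ^ 2 * (m * g) := by
          gcongr; exact hsϕ.trans (by gcongr)
        linarith
      calc _ ≤ (C₂ + e ^ 2 * m) * g * (L * (s * g * Y ^ (2 * q))) := by gcongr
        _ = (C₂ * L + e ^ 2 * m * L) * (s * (g ^ 2 * Y ^ (2 * q))) := by ring
        _ ≤ _ := by gcongr
    refine (norm_add_le _ _).trans ((add_le_add t1 t2).trans ?_)
    rw [← add_mul]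
    refine mul_le_mul_of_nonneg_right ?_ (by positivity)
    have : 0 ≤ e * P + e ^ 2 * P + 2 * e ^ 3 * m * P + e ^ 2 * L * m := by positivity
    linarith
  · rw [norm_mul]
    calc _ ≤ e * (P * Y ^ (2 * q + 1)) := by gcongr; exacts [hb _ _ _, hF0 k']
      _ = e * P * Y ^ (2 * q + 1) := by ring
      _ ≤ _ := by
        refine mul_le_mul_of_nonneg_right ?_ hYp1.le
        have : 0 ≤ e ^ 3 * m + e ^ 2 * m * L + C₂ * L + e ^ 2 * P + 2 * e ^ 3 * m * P +
          e ^ 2 * L * m := by positivity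
        linarith
  · rw [quadTerm, norm_mul]
    calc _ ≤ e ^ 2 * (P * Y ^ (2 * q + 1)) := by gcongr; exacts [hQ0 _ _, hF0 k]
      _ = e ^ 2 * P * Y ^ (2 * q + 1) := by ring
      _ ≤ _ := by
        refine mul_le_mul_of_nonneg_right ?_ hYp1.le
        have : 0 ≤ e ^ 3 * m + e ^ 2 * m * L + C₂ * L + e * P + 2 * e ^ 3 * m * P +
          e ^ 2 * L * m := by positivity
        linarith
  · have edec : quadTerm q ξ z i j k u v y - quadTerm q ξ z i j k u v x =
        ((green y z k u - green x z k u) * green y z v j +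
          green x z k u * (green y z v j - green x z v j)) * resFactor q ξ z i j y -
        green x z k u * green x z v j * (resFactor q ξ z i j x - resFactor q ξ z i j y) := by
      unfold quadTerm; ring
    rw [edec]
    refine (norm_sub_le _ _).trans ?_
    rw [norm_mul, norm_mul]
    have hA : ‖(green y z k u - green x z k u) * green y z v j +
        green x z k u * (green y z v j - green x z v j)‖ ≤ 2 * e ^ 3 * s := by
      refine (norm_add_le _ _).trans ?_
      rw [norm_mul, norm_mul, norm_sub_rev, norm_sub_rev (green y z v j)]
      calc _ ≤ e ^ 2 * s * e + e * (e ^ 2 * s) := by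
            gcongr
            exacts [hGd _ _, hb _ _ _, hb _ _ _, hGd _ _]
        _ = _ := by ring
    have hB : ‖green x z k u * green x z v j‖ ≤ e ^ 2 := by
      rw [norm_mul, sq]
      exact mul_le_mul (hb _ _ _) (hb _ _ _) (norm_nonneg _) he0.le
    calc _ ≤ 2 * e ^ 3 * (m * ϕ) * (P * Y ^ (2 * q + 1)) +
          e ^ 2 * (L * ((m * g) * g * Y ^ (2 * q))) := by
          gcongr
          · exact hA.trans (by gcongr)
          · exact hF0 k
          · refine hFd.trans ?_
            gcongr
            exact hsϕ.trans (by gcongr)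
      _ = 2 * e ^ 3 * m * P * (ϕ * Y ^ (2 * q + 1)) +
          e ^ 2 * L * m * (g ^ 2 * Y ^ (2 * q)) := by ring
      _ ≤ 2 * e ^ 3 * m * P * V + e ^ 2 * L * m * V := by gcongr
      _ ≤ _ := by
        rw [← add_mul]
        refine mul_le_mul_of_nonneg_right ?_ hV0
        have : 0 ≤ e ^ 3 * m + e ^ 2 * m * L + C₂ * L + e * P + e ^ 2 * P := by positivity
        linarith
  · rw [quadTerm, norm_mul, norm_mul]
    have a1 : ‖green x z k u‖ ≤ g := by
      have := norm_green_add_le_weight (z := z) (j := j) (x := x) hϕ.le (self_mem_nbhd (2 * K) k)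
        (nbhd_mono (by omega : K ≤ 2 * K) i hu)
      have h0 := norm_nonneg (green x z u k)
      linarith
    have a2 : ‖green x z v j‖ ≤ g :=
      norm_green_col_le_weight hϕ.le (nbhd_mono (by omega : K ≤ 2 * K) k hv)
    -- One factor `Y` is sacrificed to its trivial bound, since `g ^ 2` already supplies the
    -- smallness.
    calc _ ≤ g * g * Y ^ (2 * q + 1) := by gcongr; exact hF x
      _ = Y * (g ^ 2 * Y ^ (2 * q)) := by ring
      _ ≤ C₄ * V := by gcongr; exact h₄ N ξ z ϕ ha i j x
      _ ≤ _ := by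
        refine mul_le_mul_of_nonneg_right ?_ hV0
        have : 0 ≤ e ^ 3 * m + e ^ 2 * m * L + C₂ * L + e * P + e ^ 2 * P + 2 * e ^ 3 * m * P +
          e ^ 2 * L * m := by positivity
        linarith

end

section

/-! ### Measurability -/

theorem measurable_det {α n : Type*} [MeasurableSpace α] [Fintype n] [DecidableEq n]
    {A : α → Matrix n n ℂ} (hA : ∀ i j, Measurable fun a => A a i j) :
    Measurable fun a => (A a).det := by
  simp only [Matrix.det_apply]
  refine Finset.measurable_sum _ fun σ _ => ?_
  exact (Finset.measurable_prod _ fun i _ => hA _ _).const_smul _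

theorem measurable_inv_apply {α n : Type*} [MeasurableSpace α] [Fintype n] [DecidableEq n]
    {A : α → Matrix n n ℂ} (hA : ∀ i j, Measurable fun a => A a i j) (i j : n) :
    Measurable fun a => (A a)⁻¹ i j := by
  simp only [Matrix.inv_def, Ring.inverse_eq_inv', Matrix.smul_apply, smul_eq_mul,
    Matrix.adjugate_apply]
  refine (measurable_det hA).inv.mul (measurable_det fun k l => ?_)
  by_cases h : k = j
  · subst h; simp
  · simp only [Matrix.updateRow_ne h]; exact hA k l

variable {N : ℕ}

theorem measurable_normMatrix (u v : Fin N) :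
    Measurable fun x : UpperIndex N → ℝ => normMatrix x u v := by
  simp only [normMatrix, Matrix.smul_apply, symMatrix_apply, smul_eq_mul]
  exact (measurable_pi_apply _).const_mul _

theorem measurable_green (z : ℂ) (i j : Fin N) :
    Measurable fun x : UpperIndex N → ℝ => green x z i j := by
  simp only [green_eq]
  refine measurable_inv_apply (fun k l => ?_) i j
  simp only [Matrix.sub_apply, complexMatrix, Matrix.map_apply]
  exact (Complex.measurable_ofReal.comp (measurable_normMatrix k l)).sub_const _

theorem measurable_residual (ξ : Fin N → Fin N → Fin N → Fin N → ℝ) (z : ℂ) (i j : Fin N) :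
    Measurable fun x : UpperIndex N → ℝ => residual ξ z (green x z) i j := by
  simp only [residual, Matrix.add_apply, Matrix.smul_apply, smul_eq_mul, Matrix.mul_apply, Xi]
  refine ((measurable_green z i j).const_mul z |>.const_add _).add
    (Finset.measurable_sum _ fun l _ => ?_)
  refine ((Finset.measurable_sum _ fun a _ => Finset.measurable_sum _ fun b _ =>
    (measurable_green z a b).const_mul _).const_mul _).mul (measurable_green z l j)

theorem measurable_resFactor (q : ℕ) (ξ : Fin N → Fin N → Fin N → Fin N → ℝ) (z : ℂ)
    (i j : Fin N) : Measurable (resFactor q ξ z i j) := by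
  have h := measurable_residual ξ z i j
  exact ((Complex.continuous_conj.measurable.comp h).pow_const _).mul (h.pow_const _)

theorem measurable_quadTerm (q : ℕ) (ξ : Fin N → Fin N → Fin N → Fin N → ℝ) (z : ℂ)
    (i j k u v : Fin N) : Measurable (quadTerm q ξ z i j k u v) :=
  ((measurable_green z k u).mul (measurable_green z v j)).mul (measurable_resFactor q ξ z i j)

theorem measurable_residualSize (ξ : Fin N → Fin N → Fin N → Fin N → ℝ) (z : ℂ) (ϕ : ℝ)
    (i j : Fin N) : Measurable (residualSize ξ z ϕ i j) :=
  (measurable_residual ξ z i j).norm.add_const _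

theorem measurable_weight (K : ℕ) (z : ℂ) (ϕ : ℝ) (i j k : Fin N) :
    Measurable (weight K z ϕ i j k) := by
  unfold weight
  refine (Finset.measurable_sum _ fun v _ => (measurable_green z v j).norm.add
    (Finset.measurable_sum _ fun l _ =>
      (measurable_green z l v).norm.add (measurable_green z v l).norm)).const_add _

theorem measurable_errorTerm (q K : ℕ) (ξ : Fin N → Fin N → Fin N → Fin N → ℝ) (z : ℂ) (ϕ : ℝ)
    (i j k : Fin N) : Measurable (errorTerm q K ξ z ϕ i j k) :=
  (((measurable_residualSize ξ z ϕ i j).pow_const _).const_mul _).add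
    (((measurable_weight K z ϕ i j k).pow_const _).mul
      ((measurable_residualSize ξ z ϕ i j).pow_const _))

theorem measurable_cut (w : ℕ) (i k : Fin N) : Measurable (cut w i k) := by
  classical
  refine measurable_pi_iff.2 fun a => ?_
  unfold cut
  by_cases h : a ∈ {b | (w : ℤ) < indexDist (upper i k) b}
  · simpa [Set.indicator_of_mem h] using measurable_pi_apply a
  · simp [Set.indicator_of_notMem h]

theorem measurable_cutSize (w : ℕ) (i k : Fin N) : Measurable (cutSize w i k) :=
  Finset.measurable_sum _ fun p _ =>
    continuous_abs.measurable.comp (measurable_normMatrix p.1 p.2)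

/-! ### The moment recursion -/

/-- A bounded array which is almost centered, with covariance kernel close to `ξ`; here
`σ_{ik,uv}` approximates the covariances of the original array. -/
structure IsTruncated (K : ℕ) (c ϕ : ℝ) {Ω : Type*} [MeasurableSpace Ω] (P : Measure Ω)
    (ξ σ : Fin N → Fin N → Fin N → Fin N → ℝ) (x : UpperIndex N → Ω → ℝ) : Prop where
  measurable : ∀ a, Measurable (x a)
  dependent : IsKDependent K P x
  small : ∀ ω, Small ϕ fun a => x a ω
  mean : ∀ u v, |∫ ω, normMatrix (fun a => x a ω) u v ∂P| ≤ ϕ / N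
  second : ∀ u v, ∫ ω, normMatrix (fun a => x a ω) u v ^ 2 ∂P ≤ c / N
  cov : ∀ i k u v, |∫ ω, normMatrix (fun a => x a ω) i k * normMatrix (fun a => x a ω) u v ∂P
    - σ i k u v / N| ≤ ϕ / N
  abs_le : ∀ i k u v, |σ i k u v| ≤ c
  eq_zero : ∀ i k u v, (u, v) ∉ pairs K i k → σ i k u v = 0
  eq_ordered : ∀ i k u v, (i ≤ k ∧ v ≤ u) ∨ (k < i ∧ u < v) → ξ i k v u = σ i k u v
  eq_unordered : ∀ i k u v, ¬ ((i ≤ k ∧ v ≤ u) ∨ (k < i ∧ u < v)) → ξ i k v u = 0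

namespace IsTruncated

variable {K : ℕ} {c ϕ : ℝ} {Ω : Type*} [MeasurableSpace Ω] {P : Measure Ω}
  {ξ σ : Fin N → Fin N → Fin N → Fin N → ℝ} {x : UpperIndex N → Ω → ℝ}

theorem measurable_comp (h : IsTruncated K c ϕ P ξ σ x) {α : Type*} [MeasurableSpace α]
    {f : (UpperIndex N → ℝ) → α} (hf : Measurable f) :
    Measurable fun ω => f fun a => x a ω :=
  hf.comp (measurable_pi_iff.2 fun a => h.measurable a)

theorem integrable_comp [IsProbabilityMeasure P] (h : IsTruncated K c ϕ P ξ σ x) {E : Type*} [NormedAddCommGroup E]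
    [MeasurableSpace E] [BorelSpace E] [SecondCountableTopology E]
    {f : (UpperIndex N → ℝ) → E} (hf : Measurable f) {B : ℝ}
    (hB : ∀ y, Small ϕ y → ‖f y‖ ≤ B) : Integrable (fun ω => f fun a => x a ω) P :=
  Integrable.of_bound (h.measurable_comp hf).aestronglyMeasurable B
    (.of_forall fun ω => hB _ (h.small ω))

theorem integral_mul (h : IsTruncated K c ϕ P ξ σ x) {𝕜 : Type*} [RCLike 𝕜]
    {S T : Set (UpperIndex N)} (hST : ∀ a ∈ S, ∀ b ∈ T, (K : ℤ) < indexDist a b)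
    {f g : (UpperIndex N → ℝ) → 𝕜} (hf : Measurable f) (hg : Measurable g)
    (hfS : ∀ y, f (S.indicator y) = f y) (hgT : ∀ y, g (T.indicator y) = g y) :
    ∫ ω, f (fun a => x a ω) * g (fun a => x a ω) ∂P =
      (∫ ω, f (fun a => x a ω) ∂P) * ∫ ω, g (fun a => x a ω) ∂P := by
  have := h.dependent.integral_mul h.measurable hST hf hg
  simpa only [hfS, hgT] using this

theorem normMatrix_indicator {S : Set (UpperIndex N)} {u v : Fin N} (h : upper u v ∈ S)
    (y : UpperIndex N → ℝ) : normMatrix (S.indicator y) u v = normMatrix y u v := by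
  simp [normMatrix, symMatrix_apply, h]

theorem cut_indicator {S : Set (UpperIndex N)} {w : ℕ} {i k : Fin N}
    (h : {b | (w : ℤ) < indexDist (upper i k) b} ⊆ S) (y : UpperIndex N → ℝ) :
    cut w i k (S.indicator y) = cut w i k y := by
  rw [cut, Set.indicator_indicator, Set.inter_eq_left.2 h, cut]

variable [IsProbabilityMeasure P]

/-- A decoupling: `W` is replaced by its value on the array cut around $(u,v)$, which is independent
of the squared entry, and after factorization it is restored. Each replacement costs one factor `C`
by comparability. -/
theorem integral_sq_mul_le (h : IsTruncated K c ϕ P ξ σ x) (hc : 0 ≤ c) {C B : ℝ} (hC : 0 ≤ C)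
    {W : (UpperIndex N → ℝ) → ℝ} (hW : Measurable W) (hW0 : ∀ y, 0 ≤ W y) (hWB : ∀ y, W y ≤ B)
    (hcomp : Comparable K ϕ C W) (u v : Fin N) :
    ∫ ω, normMatrix (fun a => x a ω) u v ^ 2 * W (fun a => x a ω) ∂P ≤
      C ^ 2 * (c / N) * ∫ ω, W (fun a => x a ω) ∂P := by
  have hB0 : 0 ≤ B := (hW0 0).trans (hWB 0)
  have hWn : ∀ y, ‖W y‖ ≤ B := fun y => by
    rw [Real.norm_of_nonneg (hW0 y)]; exact hWB y
  have hsqb : ∀ y, Small ϕ y → ‖normMatrix y u v ^ 2‖ ≤ ϕ ^ 2 := fun y hy => by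
    rw [norm_pow]
    exact pow_le_pow_left₀ (norm_nonneg _) (hy u v) 2
  have hcutm := hW.comp (measurable_cut K u v)
  have hm2 := (measurable_normMatrix u v).pow_const 2
  have h1 : ∫ ω, normMatrix (fun a => x a ω) u v ^ 2 * W (fun a => x a ω) ∂P ≤
      ∫ ω, C * (normMatrix (fun a => x a ω) u v ^ 2 * W (cut K u v fun a => x a ω)) ∂P := by
    refine integral_mono
      (h.integrable_comp (f := fun y => normMatrix y u v ^ 2 * W y) (hm2.mul hW)
        (B := ϕ ^ 2 * B) fun y hy => ?_)
      ((h.integrable_comp (f := fun y => normMatrix y u v ^ 2 * W (cut K u v y))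
        (hm2.mul hcutm) (B := ϕ ^ 2 * B) fun y hy => ?_).const_mul C) fun ω => ?_
    · rw [norm_mul]
      exact mul_le_mul (hsqb y hy) (hWn _) (norm_nonneg _) (by positivity)
    · rw [norm_mul]
      exact mul_le_mul (hsqb y hy) (hWn _) (norm_nonneg _) (by positivity)
    · have := (hcomp _ (h.small ω) K (by omega) u v).2
      have h2 := mul_le_mul_of_nonneg_left this (sq_nonneg (normMatrix (fun a => x a ω) u v))
      simp only
      linarith
  have h2 := h.integral_mul (S := {upper u v}) (T := {b | (K : ℤ) < indexDist (upper u v) b})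
    (by simp) (f := fun y => normMatrix y u v ^ 2) (g := fun y => W (cut K u v y)) hm2 hcutm
    (fun y => by simp only [normMatrix_indicator (Set.mem_singleton (upper u v))]) (fun y => by rw [cut_indicator subset_rfl])
  rw [integral_const_mul, h2] at h1
  have h3 : ∫ ω, W (cut K u v fun a => x a ω) ∂P ≤ C * ∫ ω, W (fun a => x a ω) ∂P := by
    rw [← integral_const_mul]
    refine integral_mono (h.integrable_comp (f := fun y => W (cut K u v y)) hcutm (B := B)
      fun y _ => hWn _) ((h.integrable_comp hW (B := B) fun y _ => hWn _).const_mul C)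
      fun ω => (hcomp _ (h.small ω) K (by omega) u v).1
  have h4 : 0 ≤ ∫ ω, W (cut K u v fun a => x a ω) ∂P := integral_nonneg fun ω => hW0 _
  refine h1.trans ?_
  calc C * ((∫ ω, normMatrix (fun a => x a ω) u v ^ 2 ∂P) *
        ∫ ω, W (cut K u v fun a => x a ω) ∂P)
      ≤ C * (c / N * (C * ∫ ω, W (fun a => x a ω) ∂P)) := by
        gcongr
        exact h.second u v
    _ = _ := by ring

/-- The products of two entries are split into squares, so that each can be decoupled from `W`
separately; the second moment of an entry of $H$ gives the factor $1/N$ for the remainder of the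
expansion. -/
theorem integral_abs_mul_cutSize_mul_le (h : IsTruncated K c ϕ P ξ σ x) (hc : 0 ≤ c) {C B : ℝ}
    (hC : 0 ≤ C) {W : (UpperIndex N → ℝ) → ℝ} (hW : Measurable W) (hW0 : ∀ y, 0 ≤ W y)
    (hWB : ∀ y, W y ≤ B) (hcomp : Comparable K ϕ C W) (i k : Fin N) :
    ∫ ω, |normMatrix (fun a => x a ω) i k| *
        (cutSize (2 * K) i k (fun a => x a ω) * W (fun a => x a ω)) ∂P ≤
      2 * (2 * (2 * K : ℕ) + 1) ^ 2 * (2 * (C ^ 2 * (c / N) * ∫ ω, W (fun a => x a ω) ∂P)) := by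
  have hsq : ∀ u v, Integrable
      (fun ω => normMatrix (fun a => x a ω) u v ^ 2 * W (fun a => x a ω)) P := fun u v =>
    h.integrable_comp (f := fun y => normMatrix y u v ^ 2 * W y)
      (((measurable_normMatrix u v).pow_const 2).mul hW) (B := ϕ ^ 2 * B) fun y hy => by
        rw [norm_mul, norm_pow, Real.norm_of_nonneg (hW0 y)]
        exact mul_le_mul (pow_le_pow_left₀ (norm_nonneg _) (hy u v) 2) (hWB _) (hW0 _)
          (by positivity)
  have h1 : ∫ ω, |normMatrix (fun a => x a ω) i k| *
        (cutSize (2 * K) i k (fun a => x a ω) * W (fun a => x a ω)) ∂P ≤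
      ∫ ω, ∑ p ∈ pairs (2 * K) i k,
        (normMatrix (fun a => x a ω) i k ^ 2 * W (fun a => x a ω) +
          normMatrix (fun a => x a ω) p.1 p.2 ^ 2 * W (fun a => x a ω)) ∂P := by
    refine integral_mono_of_nonneg (.of_forall fun ω => ?_) (integrable_finsetSum _ fun p _ =>
      (hsq i k).add (hsq p.1 p.2)) (.of_forall fun ω => ?_)
    · exact mul_nonneg (abs_nonneg _) (mul_nonneg (cutSize_nonneg _ _ _ _) (hW0 _))
    · simp only [cutSize, Finset.sum_mul, Finset.mul_sum]
      refine Finset.sum_le_sum fun p _ => ?_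
      have h0 := hW0 fun a => x a ω
      set A := normMatrix (fun a => x a ω) i k
      set B := normMatrix (fun a => x a ω) p.1 p.2
      have h2 : |A| * |B| ≤ A ^ 2 + B ^ 2 := by
        nlinarith [sq_nonneg (|A| - |B|), sq_abs A, sq_abs B, sq_nonneg A, sq_nonneg B]
      calc _ = |A| * |B| * W (fun a => x a ω) := by ring
        _ ≤ (A ^ 2 + B ^ 2) * W (fun a => x a ω) := by gcongr
        _ = _ := by ring
  refine h1.trans ?_
  have hadd : ∀ p ∈ pairs (2 * K) i k, Integrable (fun ω =>
      normMatrix (fun a => x a ω) i k ^ 2 * W (fun a => x a ω) +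
        normMatrix (fun a => x a ω) p.1 p.2 ^ 2 * W (fun a => x a ω)) P := fun p _ =>
    (hsq i k).add (hsq p.1 p.2)
  rw [integral_finsetSum _ hadd]
  have hI : 0 ≤ ∫ ω, W (fun a => x a ω) ∂P := integral_nonneg fun ω => hW0 _
  refine (Finset.sum_le_sum fun p _ => ?_).trans (sum_pairs_const_le (2 * K) i k (by positivity))
  rw [integral_add (hsq i k) (hsq p.1 p.2)]
  have a1 := h.integral_sq_mul_le hc hC hW hW0 hWB hcomp i k
  have a2 := h.integral_sq_mul_le hc hC hW hW0 hWB hcomp p.1 p.2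
  linarith

end IsTruncated

end

/-! ### The second-order expansion and the moment bound for the residual. -/

section

variable {N : ℕ}

theorem norm_integral_sub_integral_le {Ω : Type*} [MeasurableSpace Ω] {P : Measure Ω}
    {f g : Ω → ℂ} {b : Ω → ℝ} (hf : Integrable f P) (hg : Integrable g P) (hb : Integrable b P)
    (h : ∀ ω, ‖f ω - g ω‖ ≤ b ω) : ‖∫ ω, f ω ∂P - ∫ ω, g ω ∂P‖ ≤ ∫ ω, b ω ∂P := by
  rw [← integral_sub hf hg]
  exact norm_integral_le_of_norm_le hb (.of_forall h)

/-- The function `Q` is evaluated on the array cut at distance $2K$ precisely so that it is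
independent of every pair $(H_{ik},H_{uv})$ at mutual distance at most $K$. The covariance then
factors out, and the cut is undone afterwards at the cost of `V`. -/
theorem IsTruncated.norm_integral_pair_sub_le {K : ℕ} {c ϕ : ℝ} {Ω : Type*} [MeasurableSpace Ω]
    {P : Measure Ω} [IsProbabilityMeasure P] {ξ σ : Fin N → Fin N → Fin N → Fin N → ℝ}
    {x : UpperIndex N → Ω → ℝ} (h : IsTruncated K c ϕ P ξ σ x) (hc : 0 ≤ c) (hϕ : 0 ≤ ϕ)
    (hϕ1 : ϕ ≤ 1) {C B : ℝ} {V : (UpperIndex N → ℝ) → ℝ} {Q : (UpperIndex N → ℝ) → ℂ}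
    (hV : Measurable V) (hQ : Measurable Q)
    (hVB : ∀ y, ‖V y‖ ≤ B) (hQB : ∀ y, ‖Q y‖ ≤ B) {i k : Fin N}
    (h1 : ∀ y, Small ϕ y → ϕ * ‖Q (cut (2 * K) i k y)‖ ≤ C * V y)
    (h2 : ∀ y, Small ϕ y → ‖Q (cut (2 * K) i k y) - Q y‖ ≤ C * V y) (u v : Fin N) :
    ‖∫ ω, (normMatrix (fun a => x a ω) i k : ℂ) * ((normMatrix (fun a => x a ω) u v : ℂ) *
        Q (cut (2 * K) i k fun a => x a ω)) ∂P -
        (σ i k u v / N : ℝ) * ∫ ω, Q (fun a => x a ω) ∂P‖ ≤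
      (1 + c) * (C / N) * ∫ ω, V (fun a => x a ω) ∂P := by
  have hQcm := hQ.comp (measurable_cut (2 * K) i k)
  have hN1 := Complex.measurable_ofReal.comp (measurable_normMatrix (N := N) i k)
  have hN2 := Complex.measurable_ofReal.comp (measurable_normMatrix (N := N) u v)
  have iQ : Integrable (fun ω => Q fun a => x a ω) P := h.integrable_comp hQ (B := B) fun y _ => hQB y
  have iQc : Integrable (fun ω => Q (cut (2 * K) i k fun a => x a ω)) P :=
    h.integrable_comp hQcm (B := B) fun y _ => hQB _
  have iV : Integrable (fun ω => V fun a => x a ω) P := h.integrable_comp hV (B := B) fun y _ => hVB y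
  have hIV : 0 ≤ C * ∫ ω, V (fun a => x a ω) ∂P := by
    rw [← integral_const_mul]
    exact integral_nonneg fun ω => (norm_nonneg _).trans (h2 _ (h.small ω))
  -- the expectation of `Q` on the truncated array
  have hQ0 : ϕ * ‖∫ ω, Q (cut (2 * K) i k fun a => x a ω) ∂P‖ ≤ C * ∫ ω, V (fun a => x a ω) ∂P := by
    rw [← integral_const_mul]
    calc ϕ * ‖∫ ω, Q (cut (2 * K) i k fun a => x a ω) ∂P‖
        ≤ ϕ * ∫ ω, ‖Q (cut (2 * K) i k fun a => x a ω)‖ ∂P := by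
          gcongr; exact norm_integral_le_integral_norm _
      _ = ∫ ω, ϕ * ‖Q (cut (2 * K) i k fun a => x a ω)‖ ∂P := (integral_const_mul _ _).symm
      _ ≤ _ := integral_mono (iQc.norm.const_mul ϕ) (iV.const_mul C) fun ω => h1 _ (h.small ω)
  have hQd : ‖∫ ω, Q (cut (2 * K) i k fun a => x a ω) ∂P - ∫ ω, Q (fun a => x a ω) ∂P‖ ≤
      C * ∫ ω, V (fun a => x a ω) ∂P := by
    rw [← integral_const_mul]
    exact norm_integral_sub_integral_le iQc iQ (iV.const_mul C) fun ω => h2 _ (h.small ω)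
  have hN0 : (0 : ℝ) ≤ 1 / N := by positivity
  -- Near pairs factor off jointly by the triangle inequality. Far pairs have zero covariance:
  -- $H_{ik}$ factors off alone, and its small mean suffices.
  by_cases hp : (u, v) ∈ pairs K i k
  · have hST : ∀ a ∈ ({upper i k, upper u v} : Set (UpperIndex N)),
        ∀ b ∈ {b | ((2 * K : ℕ) : ℤ) < indexDist (upper i k) b}, (K : ℤ) < indexDist a b := by
      intro a ha b hb
      have hb' : (2 : ℤ) * K < indexDist (upper i k) b := by simpa using hb
      rcases ha with rfl | ha
      · have : (0 : ℤ) ≤ K := by positivity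
        omega
      · rw [Set.mem_singleton_iff] at ha
        subst ha
        have := indexDist_triangle (upper i k) (upper u v) b
        have := mem_pairs.1 hp
        omega
    have e1 := h.integral_mul hST (𝕜 := ℂ)
      (f := fun y => (normMatrix y i k : ℂ) * (normMatrix y u v : ℂ))
      (g := fun y => Q (cut (2 * K) i k y)) (hN1.mul hN2) hQcm
      (fun y => by
        simp only [IsTruncated.normMatrix_indicator (show upper i k ∈ ({upper i k, upper u v} : Set _) by simp),
          IsTruncated.normMatrix_indicator (show upper u v ∈ ({upper i k, upper u v} : Set _) by simp)])
      (fun y => by rw [IsTruncated.cut_indicator subset_rfl])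
    simp only [← mul_assoc]
    rw [e1]
    have e2 : ∫ ω, (normMatrix (fun a => x a ω) i k : ℂ) * (normMatrix (fun a => x a ω) u v : ℂ) ∂P
        = ((∫ ω, normMatrix (fun a => x a ω) i k * normMatrix (fun a => x a ω) u v ∂P : ℝ) : ℂ) := by
      rw [← integral_complex_ofReal]; simp
    rw [e2]
    set A := ∫ ω, normMatrix (fun a => x a ω) i k * normMatrix (fun a => x a ω) u v ∂P with hA
    set q0 := ∫ ω, Q (cut (2 * K) i k fun a => x a ω) ∂P
    set q1 := ∫ ω, Q (fun a => x a ω) ∂P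
    set I := ∫ ω, V (fun a => x a ω) ∂P
    have e3 : (A : ℂ) * q0 - (σ i k u v / N : ℝ) * q1 =
        ((A - σ i k u v / N : ℝ) : ℂ) * q0 + (σ i k u v / N : ℝ) * (q0 - q1) := by
      push_cast; ring
    rw [e3]
    refine (norm_add_le _ _).trans ?_
    rw [norm_mul, norm_mul, Complex.norm_real, Complex.norm_real, Real.norm_eq_abs,
      Real.norm_eq_abs]
    have b1 : |A - σ i k u v / N| * ‖q0‖ ≤ 1 / N * (C * I) :=
      calc _ ≤ ϕ / N * ‖q0‖ := by gcongr; exact h.cov i k u v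
        _ = 1 / N * (ϕ * ‖q0‖) := by ring
        _ ≤ _ := by gcongr
    have b2 : |σ i k u v / N| * ‖q0 - q1‖ ≤ c / N * (C * I) := by
      rw [abs_div, Nat.abs_cast]
      gcongr
      exact h.abs_le i k u v
    refine (add_le_add b1 b2).trans_eq ?_
    ring
  · rw [h.eq_zero i k u v hp]
    have hT : ∀ y : UpperIndex N → ℝ, normMatrix
        ({b | (K : ℤ) < indexDist (upper i k) b}.indicator y) u v = normMatrix y u v := fun y =>
      IsTruncated.normMatrix_indicator (by rw [mem_pairs, not_le] at hp; exact hp) y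
    have e1 := h.integral_mul (S := {upper i k})
      (T := {b | (K : ℤ) < indexDist (upper i k) b}) (by simp) (𝕜 := ℂ)
      (f := fun y => (normMatrix y i k : ℂ))
      (g := fun y => (normMatrix y u v : ℂ) * Q (cut (2 * K) i k y)) hN1 (hN2.mul hQcm)
      (fun y => by simp only [IsTruncated.normMatrix_indicator (Set.mem_singleton (upper i k))])
      (fun y => by
        rw [hT, IsTruncated.cut_indicator]
        intro b hb
        simp only [Set.mem_ofPred_eq] at hb ⊢
        push_cast at hb
        have : (0 : ℤ) ≤ K := by positivity
        omega)
    rw [e1]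
    have e2 : ∫ ω, (normMatrix (fun a => x a ω) i k : ℂ) ∂P
        = ((∫ ω, normMatrix (fun a => x a ω) i k ∂P : ℝ) : ℂ) := integral_complex_ofReal
    rw [e2]
    simp only [zero_div, Complex.ofReal_zero, zero_mul, sub_zero, norm_mul, Complex.norm_real,
      Real.norm_eq_abs]
    have b1 : ϕ * ‖∫ ω, (normMatrix (fun a => x a ω) u v : ℂ) *
        Q (cut (2 * K) i k fun a => x a ω) ∂P‖ ≤ C * ∫ ω, V (fun a => x a ω) ∂P := by
      rw [← integral_const_mul]
      calc _ ≤ ϕ * ∫ ω, ‖Q (cut (2 * K) i k fun a => x a ω)‖ ∂P := by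
            gcongr
            refine norm_integral_le_of_norm_le iQc.norm (.of_forall fun ω => ?_)
            rw [norm_mul, Complex.norm_real, Real.norm_eq_abs]
            exact mul_le_of_le_one_left (norm_nonneg _) ((h.small ω u v).trans hϕ1)
        _ = ∫ ω, ϕ * ‖Q (cut (2 * K) i k fun a => x a ω)‖ ∂P := (integral_const_mul _ _).symm
        _ ≤ _ := integral_mono (iQc.norm.const_mul ϕ) (iV.const_mul C) fun ω => h1 _ (h.small ω)
    calc _ ≤ ϕ / N * ‖∫ ω, (normMatrix (fun a => x a ω) u v : ℂ) *
        Q (cut (2 * K) i k fun a => x a ω) ∂P‖ := by gcongr; exact h.mean i k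
      _ = 1 / N * (ϕ * ‖∫ ω, (normMatrix (fun a => x a ω) u v : ℂ) *
        Q (cut (2 * K) i k fun a => x a ω) ∂P‖) := by ring
      _ ≤ 1 / N * (C * ∫ ω, V (fun a => x a ω) ∂P) := by gcongr
      _ ≤ (1 + c) * (1 / N * (C * ∫ ω, V (fun a => x a ω) ∂P)) :=
          le_mul_of_one_le_left (by positivity) (by linarith)
      _ = _ := by ring

end

/-- Expansion around the array cut near $(i,k)$: the zeroth-order term factors and is small since
the mean is, the first-order terms produce the covariances, and these are cancelled by the
corresponding part of $\Xi(G)G$. The factor $1/N$ on the right makes the sum over $k$ an average. -/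
theorem exists_norm_expansion_le {η : ℝ} (hη : 0 < η) (Z c : ℝ) (hZ : 0 ≤ Z)
    (hc : 0 ≤ c) (K q : ℕ) :
    ∃ C : ℝ, 0 < C ∧ ∀ (N : ℕ) (ξ σ : Fin N → Fin N → Fin N → Fin N → ℝ) (z : ℂ) (ϕ : ℝ),
      Admissible η Z c K ξ z ϕ → ∀ (Ω : Type*) [MeasurableSpace Ω] (P : Measure Ω)
      [IsProbabilityMeasure P] (x : UpperIndex N → Ω → ℝ), IsTruncated K c ϕ P ξ σ x →
      ∀ i j k : Fin N,
      ‖∫ ω, (normMatrix (fun a => x a ω) i k : ℂ) * (green (fun a => x a ω) z k j *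
          resFactor q ξ z i j fun a => x a ω) ∂P +
        1 / (N : ℂ) * ∑ u, ∑ v, (ξ i k v u : ℂ) * ∫ ω, quadTerm q ξ z i j k u v
          (fun a => x a ω) ∂P‖ ≤
        C / N * ∫ ω, errorTerm q K ξ z ϕ i j k (fun a => x a ω) ∂P := by
  obtain ⟨C₁, hC₁, h₁⟩ := exists_pointwise_bounds hη Z c hZ hc K q
  obtain ⟨C₂, hC₂, h₂⟩ := exists_comparable_errorTerm hη Z c hZ hc K q
  obtain ⟨C₃, hC₃, h₃⟩ := exists_residualSize_le hη Z c hZ hc K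
  obtain ⟨C₄, hC₄, h₄⟩ := exists_weight_le hη Z c K
  set m : ℝ := 2 * (2 * (2 * K : ℕ) + 1) ^ 2 with hm
  have hm0 : 0 < m := by positivity
  refine ⟨C₁ * (m * (2 * (C₂ ^ 2 * c))) + C₁ + m * ((1 + c) * C₁) + m * (c * C₁), by positivity, ?_⟩
  intro N ξ σ z ϕ ha Ω _ P _ x h i j k
  have hϕ := ha.pos
  have hN : (0 : ℝ) < N := by
    by_contra h0
    nlinarith [sq_nonneg ϕ, ha.one_le]
  set e : ℝ := 1 / η with he
  have he0 : 0 < e := by positivity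
  have hG : ∀ (y : UpperIndex N → ℝ) a b, ‖green y z a b‖ ≤ e := fun y =>
    (isDissipativeInverse_green hη ha.le_im y).norm_apply_le hη
  have hF : ∀ y, ‖resFactor q ξ z i j y‖ ≤ C₃ ^ (2 * q + 1) := fun y => by
    rw [resFactor, norm_momentFactor]
    exact pow_le_pow_left₀ (norm_nonneg _)
      ((le_add_of_nonneg_right hϕ.le).trans (h₃ N ξ z ϕ ha i j y)) _
  have hGF : ∀ y, ‖green y z k j * resFactor q ξ z i j y‖ ≤ e * C₃ ^ (2 * q + 1) := fun y => by
    rw [norm_mul]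
    exact mul_le_mul (hG _ _ _) (hF y) (norm_nonneg _) he0.le
  have hQ : ∀ u v y, ‖quadTerm q ξ z i j k u v y‖ ≤ e * e * C₃ ^ (2 * q + 1) := fun u v y => by
    rw [quadTerm, norm_mul, norm_mul]
    have := hG y k u
    have := hG y v j
    have := hF y
    gcongr
  have hY0 : ∀ y, 0 ≤ residualSize ξ z ϕ i j y := fun y => residualSize_nonneg hϕ.le
  have hV0 : ∀ y, 0 ≤ errorTerm q K ξ z ϕ i j k y := fun y => errorTerm_nonneg hϕ.le
  set BV : ℝ := 1 * C₃ ^ (2 * q + 1) + C₄ ^ 2 * C₃ ^ (2 * q) with hBV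
  have hVB : ∀ y, errorTerm q K ξ z ϕ i j k y ≤ BV := fun y => by
    have := h₃ N ξ z ϕ ha i j y
    have := h₄ N ξ z ϕ ha i j k y
    have := hY0 y
    have := ha.le_one
    have : 0 ≤ weight K z ϕ i j k y := hϕ.le.trans le_weight
    rw [errorTerm, hBV]
    gcongr
  have hBV0 : 0 ≤ BV := by positivity
  have hYV : ∀ y, ϕ * residualSize ξ z ϕ i j y ^ (2 * q + 1) ≤ errorTerm q K ξ z ϕ i j k y := by
    intro y
    have := hY0 y
    unfold errorTerm
    have : 0 ≤ weight K z ϕ i j k y ^ 2 * residualSize ξ z ϕ i j y ^ (2 * q) := by positivity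
    linarith
  have mV := measurable_errorTerm q K ξ z ϕ i j k
  have mGF := (measurable_green z k j).mul (measurable_resFactor q ξ z i j)
  have mc := measurable_cut (N := N) (2 * K) i k
  have mh : ∀ u v, Measurable fun y : UpperIndex N → ℝ => (normMatrix y u v : ℂ) := fun u v =>
    Complex.measurable_ofReal.comp (measurable_normMatrix u v)
  have hh : ∀ (u v : Fin N) (y : UpperIndex N → ℝ), Small ϕ y → ‖(normMatrix y u v : ℂ)‖ ≤ ϕ := fun u v y hy => by
    rw [Complex.norm_real]; exact hy u v
  set I := ∫ ω, errorTerm q K ξ z ϕ i j k (fun a => x a ω) ∂P with hI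
  have hI0 : 0 ≤ I := integral_nonneg fun ω => hV0 _
  have iV : Integrable (fun ω => errorTerm q K ξ z ϕ i j k fun a => x a ω) P :=
    h.integrable_comp mV (B := BV) fun y _ => by
      rw [Real.norm_of_nonneg (hV0 y)]; exact hVB y
  -- the first term of the expansion
  have t1 : ‖∫ ω, (normMatrix (fun a => x a ω) i k : ℂ) *
      (green (cut (2 * K) i k fun a => x a ω) z k j *
        resFactor q ξ z i j (cut (2 * K) i k fun a => x a ω)) ∂P‖ ≤ C₁ / N * I := by
    have e1 := h.integral_mul (S := {upper i k})
      (T := {b | ((2 * K : ℕ) : ℤ) < indexDist (upper i k) b})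
      (by
        intro a ha b hb
        rw [Set.mem_singleton_iff] at ha
        subst ha
        simp only [Set.mem_ofPred_eq] at hb
        push_cast at hb
        have : (0 : ℤ) ≤ K := by positivity
        omega) (𝕜 := ℂ)
      (f := fun y => (normMatrix y i k : ℂ))
      (g := fun y => green (cut (2 * K) i k y) z k j * resFactor q ξ z i j (cut (2 * K) i k y))
      (mh i k) (mGF.comp mc)
      (fun y => by simp only [IsTruncated.normMatrix_indicator (Set.mem_singleton (upper i k))])
      (fun y => by rw [IsTruncated.cut_indicator subset_rfl])
    rw [e1]
    have e2 : ∫ ω, (normMatrix (fun a => x a ω) i k : ℂ) ∂P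
        = ((∫ ω, normMatrix (fun a => x a ω) i k ∂P : ℝ) : ℂ) := integral_complex_ofReal
    rw [e2, norm_mul, Complex.norm_real, Real.norm_eq_abs]
    have b1 : ϕ * ‖∫ ω, green (cut (2 * K) i k fun a => x a ω) z k j *
        resFactor q ξ z i j (cut (2 * K) i k fun a => x a ω) ∂P‖ ≤ C₁ * I := by
      have b2 : ‖∫ ω, (ϕ : ℂ) * (green (cut (2 * K) i k fun a => x a ω) z k j *
        resFactor q ξ z i j (cut (2 * K) i k fun a => x a ω)) ∂P‖ ≤
          ∫ ω, C₁ * errorTerm q K ξ z ϕ i j k (fun a => x a ω) ∂P := by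
        refine norm_integral_le_of_norm_le (iV.const_mul C₁) (.of_forall fun ω => ?_)
        have b3 := (h₁ N ξ z ϕ ha i j k _ (h.small ω)).2.1 k
        rw [norm_mul, Complex.norm_real, Real.norm_of_nonneg hϕ.le]
        calc _ ≤ ϕ * (C₁ * residualSize ξ z ϕ i j (fun a => x a ω) ^ (2 * q + 1)) := by gcongr
          _ = C₁ * (ϕ * residualSize ξ z ϕ i j (fun a => x a ω) ^ (2 * q + 1)) := by ring
          _ ≤ _ := by gcongr; exact hYV _
      rwa [integral_const_mul, integral_const_mul, norm_mul, Complex.norm_real,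
        Real.norm_of_nonneg hϕ.le] at b2
    calc _ ≤ ϕ / N * ‖∫ ω, green (cut (2 * K) i k fun a => x a ω) z k j *
        resFactor q ξ z i j (cut (2 * K) i k fun a => x a ω) ∂P‖ := by
          gcongr; exact h.mean i k
      _ = 1 / N * (ϕ * ‖∫ ω, green (cut (2 * K) i k fun a => x a ω) z k j *
        resFactor q ξ z i j (cut (2 * K) i k fun a => x a ω) ∂P‖) := by ring
      _ ≤ 1 / N * (C₁ * I) := by gcongr
      _ = _ := by ring
  -- the second order terms
  have t2 : ∀ u v, ‖∫ ω, (normMatrix (fun a => x a ω) i k : ℂ) *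
      ((normMatrix (fun a => x a ω) u v : ℂ) *
        quadTerm q ξ z i j k u v (cut (2 * K) i k fun a => x a ω)) ∂P -
        (σ i k u v / N : ℝ) * ∫ ω, quadTerm q ξ z i j k u v (fun a => x a ω) ∂P‖ ≤
      (1 + c) * (C₁ / N) * I := fun u v => by
    refine h.norm_integral_pair_sub_le hc hϕ.le ha.le_one mV (measurable_quadTerm q ξ z i j k u v)
      (B := max BV (e * e * C₃ ^ (2 * q + 1)))
      (fun y => by rw [Real.norm_of_nonneg (hV0 y)]; exact (hVB y).trans (le_max_left _ _))
      (fun y => (hQ u v y).trans (le_max_right _ _)) (fun y hy => ?_) (fun y hy => ?_) u v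
    · calc _ ≤ ϕ * (C₁ * residualSize ξ z ϕ i j y ^ (2 * q + 1)) := by
            gcongr; exact (h₁ N ξ z ϕ ha i j k y hy).2.2.1 u v
        _ = C₁ * (ϕ * residualSize ξ z ϕ i j y ^ (2 * q + 1)) := by ring
        _ ≤ _ := by gcongr; exact hYV _
    · exact (h₁ N ξ z ϕ ha i j k y hy).2.2.2.1 u v
  -- the remainder
  have i1 : Integrable (fun ω => (normMatrix (fun a => x a ω) i k : ℂ) *
      (green (fun a => x a ω) z k j * resFactor q ξ z i j fun a => x a ω)) P :=
    h.integrable_comp (f := fun y => (normMatrix y i k : ℂ) *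
      (green y z k j * resFactor q ξ z i j y)) ((mh i k).mul mGF)
      (B := ϕ * (e * C₃ ^ (2 * q + 1))) fun y hy => by
        rw [norm_mul]
        exact mul_le_mul (hh i k y hy) (hGF y) (norm_nonneg _) hϕ.le
  have i2 : Integrable (fun ω => (normMatrix (fun a => x a ω) i k : ℂ) *
      (green (cut (2 * K) i k fun a => x a ω) z k j *
        resFactor q ξ z i j (cut (2 * K) i k fun a => x a ω))) P :=
    h.integrable_comp (f := fun y => (normMatrix y i k : ℂ) *
      (green (cut (2 * K) i k y) z k j * resFactor q ξ z i j (cut (2 * K) i k y)))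
      ((mh i k).mul (mGF.comp mc))
      (B := ϕ * (e * C₃ ^ (2 * q + 1))) fun y hy => by
        rw [norm_mul]
        exact mul_le_mul (hh i k y hy) (hGF _) (norm_nonneg _) hϕ.le
  have i3 : ∀ p ∈ pairs (2 * K) i k, Integrable (fun ω => (normMatrix (fun a => x a ω) i k : ℂ) *
      ((normMatrix (fun a => x a ω) p.1 p.2 : ℂ) *
        quadTerm q ξ z i j k p.1 p.2 (cut (2 * K) i k fun a => x a ω))) P := fun p _ =>
    h.integrable_comp (f := fun y => (normMatrix y i k : ℂ) *
      ((normMatrix y p.1 p.2 : ℂ) * quadTerm q ξ z i j k p.1 p.2 (cut (2 * K) i k y)))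
      ((mh i k).mul ((mh p.1 p.2).mul ((measurable_quadTerm q ξ z i j k p.1 p.2).comp mc)))
      (B := ϕ * (ϕ * (e * e * C₃ ^ (2 * q + 1)))) fun y hy => by
        rw [norm_mul, norm_mul]
        have := hh i k y hy
        have := hh p.1 p.2 y hy
        have := hQ p.1 p.2 (cut (2 * K) i k y)
        gcongr
  set A0 := ∫ ω, (normMatrix (fun a => x a ω) i k : ℂ) * (green (fun a => x a ω) z k j *
          resFactor q ξ z i j fun a => x a ω) ∂P with hA0
  set A1 := ∫ ω, (normMatrix (fun a => x a ω) i k : ℂ) *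
      (green (cut (2 * K) i k fun a => x a ω) z k j *
        resFactor q ξ z i j (cut (2 * K) i k fun a => x a ω)) ∂P with hA1
  set A2 : Fin N × Fin N → ℂ := fun p => ∫ ω, (normMatrix (fun a => x a ω) i k : ℂ) *
      ((normMatrix (fun a => x a ω) p.1 p.2 : ℂ) *
        quadTerm q ξ z i j k p.1 p.2 (cut (2 * K) i k fun a => x a ω)) ∂P with hA2
  have t3 : ‖A0 - A1 + ∑ p ∈ pairs (2 * K) i k, A2 p‖ ≤
      C₁ * (m * (2 * (C₂ ^ 2 * (c / N) * I))) := by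
    have hsum : ∑ p ∈ pairs (2 * K) i k, A2 p = ∫ ω, ∑ p ∈ pairs (2 * K) i k,
        (normMatrix (fun a => x a ω) i k : ℂ) * ((normMatrix (fun a => x a ω) p.1 p.2 : ℂ) *
        quadTerm q ξ z i j k p.1 p.2 (cut (2 * K) i k fun a => x a ω)) ∂P :=
      (integral_finsetSum _ i3).symm
    have i4 := i1.sub i2
    rw [hsum, hA0, hA1, ← integral_sub i1 i2]
    refine (congrArg norm (integral_add i4 (integrable_finsetSum _ i3)).symm).trans_le ?_
    have b1 := h.integral_abs_mul_cutSize_mul_le hc (zero_le_one.trans hC₂) mV hV0 hVB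
      (h₂ N ξ z ϕ ha i j k) i k
    rw [← hm, ← hI] at b1
    refine le_trans ?_ (mul_le_mul_of_nonneg_left b1 (zero_le_one.trans hC₁))
    rw [← integral_const_mul]
    refine norm_integral_le_of_norm_le ((h.integrable_comp
      (f := fun y => |normMatrix y i k| * (cutSize (2 * K) i k y * errorTerm q K ξ z ϕ i j k y))
      (((continuous_abs.measurable.comp (measurable_normMatrix i k))).mul
        ((measurable_cutSize (2 * K) i k).mul mV)) (B := ϕ * (m * ϕ * BV))
      fun y hy => ?_).const_mul C₁) (.of_forall fun ω => ?_)
    · have c1 := cutSize_nonneg (2 * K) i k y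
      have c2 := hy.cutSize_le hϕ.le (2 * K) i k
      rw [Real.norm_of_nonneg (mul_nonneg (abs_nonneg _) (mul_nonneg c1 (hV0 y)))]
      have := hy i k
      have := hVB y
      have := hV0 y
      rw [← hm] at c2
      gcongr
    · have b3 := (h₁ N ξ z ϕ ha i j k _ (h.small ω)).1
      simp only [Pi.sub_apply]
      rw [← Finset.mul_sum, ← mul_sub, ← mul_add, norm_mul, Complex.norm_real, Real.norm_eq_abs]
      calc _ ≤ |normMatrix (fun a => x a ω) i k| * (C₁ * (cutSize (2 * K) i k (fun a => x a ω) *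
            errorTerm q K ξ z ϕ i j k (fun a => x a ω))) := by gcongr
        _ = _ := by ring
  -- reordering the covariances
  set Q : Fin N × Fin N → ℂ := fun p => ∫ ω, quadTerm q ξ z i j k p.1 p.2 (fun a => x a ω) ∂P
    with hQdef
  have hzero : ∀ u v, (u, v) ∉ pairs (2 * K) i k → ξ i k v u = 0 := fun u v hp => by
    have hp' : (u, v) ∉ pairs K i k := fun h' => hp <| by
      rw [mem_pairs] at h' ⊢
      have : (0 : ℤ) ≤ K := by positivity
      push_cast; omega
    by_cases ho : (i ≤ k ∧ v ≤ u) ∨ (k < i ∧ u < v)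
    · rw [h.eq_ordered i k u v ho, h.eq_zero i k u v hp']
    · exact h.eq_unordered i k u v ho
  have hxi : ∑ u, ∑ v, (ξ i k v u : ℂ) * Q (u, v) =
      ∑ p ∈ pairs (2 * K) i k, (ξ i k p.2 p.1 : ℂ) * Q p := by
    rw [← Finset.sum_product' (f := fun u v => (ξ i k v u : ℂ) * Q (u, v)),
      Finset.univ_product_univ, ← Finset.sum_subset (Finset.subset_univ (pairs (2 * K) i k))]
    rintro ⟨u, v⟩ - hp
    rw [hzero u v hp]; simp
  have t4 : ∀ p ∈ pairs (2 * K) i k,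
      ‖1 / (N : ℂ) * ((ξ i k p.2 p.1 : ℂ) * Q p) - (σ i k p.1 p.2 / N : ℝ) * Q p‖ ≤
        c * C₁ / N * I := by
    rintro ⟨u, v⟩ -
    by_cases ho : (i ≤ k ∧ v ≤ u) ∨ (k < i ∧ u < v)
    · rw [h.eq_ordered i k u v ho]
      refine le_of_eq_of_le ?_ (show 0 ≤ c * C₁ / N * I by positivity)
      rw [norm_eq_zero]; push_cast; ring
    · rw [h.eq_unordered i k u v ho]
      simp only [Complex.ofReal_zero, zero_mul, mul_zero, zero_sub, norm_neg, norm_mul,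
        Complex.norm_real, Real.norm_eq_abs]
      by_cases hp : (u, v) ∈ pairs K i k
      -- If the order is not the one retained in `ξ`, then $u$ is near $i$ and $v$ is near $k$, so
      -- $G_{ku}$ and $G_{vj}$ are both dominated by the weight and the covariance may be dropped.
      · have hloc : u ∈ nbhd K i ∧ v ∈ nbhd K k := by
          rw [mem_pairs] at hp
          rcases le_or_gt i k with hik | hik
          · have : u ≤ v := by
              by_contra hvu
              exact ho (Or.inl ⟨hik, (not_le.1 hvu).le⟩)
            exact (indexDist_le_iff hik this).1 hp
          · have : v ≤ u := by
              by_contra hvu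
              exact ho (Or.inr ⟨hik, not_le.1 hvu⟩)
            rw [upper_comm i k, upper_comm u v] at hp
            exact ((indexDist_le_iff hik.le this).1 hp).symm
        have b1 : ‖Q (u, v)‖ ≤ C₁ * I := by
          rw [hI, ← integral_const_mul]
          exact norm_integral_le_of_norm_le (iV.const_mul C₁) (.of_forall fun ω =>
            (h₁ N ξ z ϕ ha i j k _ (h.small ω)).2.2.2.2 u v hloc.1 hloc.2)
        calc _ ≤ c / N * (C₁ * I) := by
              rw [abs_div, Nat.abs_cast]
              gcongr
              exact h.abs_le i k u v
          _ = _ := by ring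
      · rw [h.eq_zero i k u v hp]
        simp only [zero_div, abs_zero, zero_mul]
        positivity
  have efin : A0 + 1 / (N : ℂ) * ∑ u, ∑ v, (ξ i k v u : ℂ) * Q (u, v) =
      (A0 - A1 + ∑ p ∈ pairs (2 * K) i k, A2 p) + A1 -
      ∑ p ∈ pairs (2 * K) i k, (A2 p - (σ i k p.1 p.2 / N : ℝ) * Q p) +
      ∑ p ∈ pairs (2 * K) i k,
        (1 / (N : ℂ) * ((ξ i k p.2 p.1 : ℂ) * Q p) - (σ i k p.1 p.2 / N : ℝ) * Q p) := by
    rw [hxi, Finset.sum_sub_distrib, Finset.sum_sub_distrib, Finset.mul_sum]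
    ring
  have s1 : ‖∑ p ∈ pairs (2 * K) i k, (A2 p - (σ i k p.1 p.2 / N : ℝ) * Q p)‖ ≤
      m * ((1 + c) * (C₁ / N) * I) :=
    (norm_sum_le _ _).trans ((Finset.sum_le_sum fun p _ => t2 p.1 p.2).trans
      (sum_pairs_const_le (2 * K) i k (by positivity)))
  have s2 : ‖∑ p ∈ pairs (2 * K) i k,
      (1 / (N : ℂ) * ((ξ i k p.2 p.1 : ℂ) * Q p) - (σ i k p.1 p.2 / N : ℝ) * Q p)‖ ≤
      m * (c * C₁ / N * I) :=
    (norm_sum_le _ _).trans ((Finset.sum_le_sum t4).trans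
      (sum_pairs_const_le (2 * K) i k (by positivity)))
  change ‖A0 + 1 / (N : ℂ) * ∑ u, ∑ v, (ξ i k v u : ℂ) * Q (u, v)‖ ≤ _
  rw [efin]
  refine (norm_add_le _ _).trans ((add_le_add ((norm_sub_le _ _).trans
    (add_le_add ((norm_add_le _ _).trans (add_le_add t3 t1)) s1)) s2).trans_eq ?_)
  ring

/-- Substituting $HG$ for $1+zG$ makes the entries of $H$ explicit and pairs each $k$ with its own
part of the self-energy, the form in which `exists_norm_expansion_le` applies. -/
theorem residual_mul_resFactor {N : ℕ} {z : ℂ} (hz : 0 < z.im) (q : ℕ)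
    (ξ : Fin N → Fin N → Fin N → Fin N → ℝ) (i j : Fin N) (y : UpperIndex N → ℝ) :
    residual ξ z (green y z) i j * resFactor q ξ z i j y =
      ∑ k, ((normMatrix y i k : ℂ) * (green y z k j * resFactor q ξ z i j y) +
        1 / (N : ℂ) * ∑ u, ∑ v, (ξ i k v u : ℂ) * quadTerm q ξ z i j k u v y) := by
  rw [residual, ← complexMatrix_mul_green hz, Matrix.add_apply, Matrix.mul_apply, Matrix.mul_apply,
    Finset.sum_add_distrib, add_mul, Finset.sum_mul]
  congr 1
  · exact Finset.sum_congr rfl fun k _ => by simp [complexMatrix, mul_assoc]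
  · simp only [Xi, quadTerm, Finset.sum_mul, Finset.mul_sum]
    rw [Finset.sum_comm]
    refine Finset.sum_congr rfl fun k _ => ?_
    rw [Finset.sum_comm]
    exact Finset.sum_congr rfl fun u _ => Finset.sum_congr rfl fun v _ => by ring

/-- After summation over $k$ the averaged squared weight is at most a constant times $\phi^2\le\phi
Y$ with $Y=|R_{ij}|+\phi$. Both parts of the error term are thus of order $\phi\,\mathbb
E\,Y^{2q+1}$, one power below the moment being estimated, and Young's inequality absorbs it. -/
theorem exists_moment_residual_le {η : ℝ} (hη : 0 < η) (Z c : ℝ) (hZ : 0 ≤ Z)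
    (hc : 0 ≤ c) (K q : ℕ) :
    ∃ C : ℝ, 0 < C ∧ ∀ (N : ℕ) (ξ σ : Fin N → Fin N → Fin N → Fin N → ℝ) (z : ℂ) (ϕ : ℝ),
      Admissible η Z c K ξ z ϕ → ∀ (Ω : Type*) [MeasurableSpace Ω] (P : Measure Ω)
      [IsProbabilityMeasure P] (x : UpperIndex N → Ω → ℝ), IsTruncated K c ϕ P ξ σ x →
      ∀ i j : Fin N,
      ∫ ω, ‖residual ξ z (green (fun a => x a ω) z) i j‖ ^ (2 * q + 2) ∂P ≤
        C * ϕ ^ (2 * q + 2) := by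
  obtain ⟨C₁, hC₁, h₁⟩ := exists_norm_expansion_le hη Z c hZ hc K q
  obtain ⟨C₂, hC₂, h₂⟩ := exists_sum_weight_sq_le hη Z c K
  obtain ⟨C₃, hC₃, h₃⟩ := exists_residualSize_le hη Z c hZ hc K
  obtain ⟨C₄, hC₄, h₄⟩ := exists_weight_le hη Z c K
  set A : ℝ := 2 ^ (2 * q + 1) * (C₁ * (1 + C₂) + 1) with hA
  have hA0 : 0 < A := by positivity
  refine ⟨2 * (2 * A) ^ (2 * q + 2), by positivity, ?_⟩
  intro N ξ σ z ϕ ha Ω _ P _ x h i j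
  have hϕ := ha.pos
  have hN : (0 : ℝ) < N := by
    by_contra h0
    nlinarith [sq_nonneg ϕ, ha.one_le]
  set e : ℝ := 1 / η with he
  have he0 : 0 < e := by positivity
  have hG : ∀ (y : UpperIndex N → ℝ) a b, ‖green y z a b‖ ≤ e := fun y =>
    (isDissipativeInverse_green hη ha.le_im y).norm_apply_le hη
  have hF : ∀ y, ‖resFactor q ξ z i j y‖ ≤ C₃ ^ (2 * q + 1) := fun y => by
    rw [resFactor, norm_momentFactor]
    exact pow_le_pow_left₀ (norm_nonneg _)
      ((le_add_of_nonneg_right hϕ.le).trans (h₃ N ξ z ϕ ha i j y)) _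
  have hY0 : ∀ y, 0 ≤ residualSize ξ z ϕ i j y := fun y => residualSize_nonneg hϕ.le
  have hYϕ : ∀ y, ϕ ≤ residualSize ξ z ϕ i j y := fun y => le_add_of_nonneg_left (norm_nonneg _)
  have iY : ∀ n : ℕ, Integrable (fun ω => residualSize ξ z ϕ i j (fun a => x a ω) ^ n) P := fun n =>
    h.integrable_comp (f := fun y => residualSize ξ z ϕ i j y ^ n)
      ((measurable_residualSize ξ z ϕ i j).pow_const n) (B := C₃ ^ n) fun y _ => by
        rw [norm_pow, Real.norm_of_nonneg (hY0 y)]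
        exact pow_le_pow_left₀ (hY0 y) (h₃ N ξ z ϕ ha i j y) n
  have iV : ∀ k, Integrable (fun ω => errorTerm q K ξ z ϕ i j k fun a => x a ω) P := fun k =>
    h.integrable_comp (measurable_errorTerm q K ξ z ϕ i j k)
      (B := 1 * C₃ ^ (2 * q + 1) + C₄ ^ 2 * C₃ ^ (2 * q)) fun y _ => by
        rw [Real.norm_of_nonneg (errorTerm_nonneg hϕ.le)]
        have := h₃ N ξ z ϕ ha i j y
        have := h₄ N ξ z ϕ ha i j k y
        have := hY0 y
        have := ha.le_one
        have : 0 ≤ weight K z ϕ i j k y := hϕ.le.trans le_weight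
        rw [errorTerm]
        gcongr
  have i1 : ∀ k, Integrable (fun ω => (normMatrix (fun a => x a ω) i k : ℂ) *
      (green (fun a => x a ω) z k j * resFactor q ξ z i j fun a => x a ω)) P := fun k =>
    h.integrable_comp (f := fun y => (normMatrix y i k : ℂ) *
      (green y z k j * resFactor q ξ z i j y))
      ((Complex.measurable_ofReal.comp (measurable_normMatrix i k)).mul
        ((measurable_green z k j).mul (measurable_resFactor q ξ z i j)))
      (B := ϕ * (e * C₃ ^ (2 * q + 1))) fun y hy => by
        rw [norm_mul, norm_mul, Complex.norm_real]
        have : ‖normMatrix y i k‖ ≤ ϕ := hy i k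
        have := hG y k j
        have := hF y
        gcongr
  have i2 : ∀ k u v, Integrable (fun ω => quadTerm q ξ z i j k u v fun a => x a ω) P :=
    fun k u v => h.integrable_comp (measurable_quadTerm q ξ z i j k u v)
      (B := e * e * C₃ ^ (2 * q + 1)) fun y _ => by
        rw [quadTerm, norm_mul, norm_mul]
        have := hG y k u
        have := hG y v j
        have := hF y
        gcongr
  have i3 : ∀ k u v, Integrable (fun ω => (ξ i k v u : ℂ) *
      quadTerm q ξ z i j k u v fun a => x a ω) P := fun k u v => (i2 k u v).const_mul _
  have i4 : ∀ k u, Integrable (fun ω => ∑ v, (ξ i k v u : ℂ) *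
      quadTerm q ξ z i j k u v fun a => x a ω) P := fun k u =>
    integrable_finsetSum _ fun v _ => i3 k u v
  have i5 : ∀ k, Integrable (fun ω => 1 / (N : ℂ) * ∑ u, ∑ v, (ξ i k v u : ℂ) *
      quadTerm q ξ z i j k u v fun a => x a ω) P := fun k =>
    (integrable_finsetSum _ fun u _ => i4 k u).const_mul _
  have i6 : ∀ k, Integrable (fun ω => (normMatrix (fun a => x a ω) i k : ℂ) *
      (green (fun a => x a ω) z k j * resFactor q ξ z i j fun a => x a ω) +
      1 / (N : ℂ) * ∑ u, ∑ v, (ξ i k v u : ℂ) * quadTerm q ξ z i j k u v fun a => x a ω) P :=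
    fun k => (i1 k).add (i5 k)
  have hmain : ((∫ ω, ‖residual ξ z (green (fun a => x a ω) z) i j‖ ^ (2 * q + 2) ∂P : ℝ) : ℂ) =
      ∑ k, (∫ ω, (normMatrix (fun a => x a ω) i k : ℂ) * (green (fun a => x a ω) z k j *
          resFactor q ξ z i j fun a => x a ω) ∂P +
        1 / (N : ℂ) * ∑ u, ∑ v, (ξ i k v u : ℂ) * ∫ ω, quadTerm q ξ z i j k u v
          (fun a => x a ω) ∂P) := by
    rw [← integral_complex_ofReal]
    simp only [← mul_momentFactor]
    change ∫ ω, residual ξ z (green (fun a => x a ω) z) i j *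
      resFactor q ξ z i j (fun a => x a ω) ∂P = _
    simp only [residual_mul_resFactor (hη.trans_le ha.le_im)]
    rw [integral_finsetSum _ fun k _ => i6 k]
    refine Finset.sum_congr rfl fun k _ => ?_
    rw [integral_add (i1 k) (i5 k), integral_const_mul,
      integral_finsetSum _ fun u _ => i4 k u]
    congr 2
    refine Finset.sum_congr rfl fun u _ => ?_
    rw [integral_finsetSum _ fun v _ => i3 k u v]
    exact Finset.sum_congr rfl fun v _ => integral_const_mul _ _
  have hR0 : 0 ≤ ∫ ω, ‖residual ξ z (green (fun a => x a ω) z) i j‖ ^ (2 * q + 2) ∂P :=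
    integral_nonneg fun ω => by positivity
  have hR : ∫ ω, ‖residual ξ z (green (fun a => x a ω) z) i j‖ ^ (2 * q + 2) ∂P ≤
      C₁ * (1 + C₂) * (ϕ * ∫ ω, residualSize ξ z ϕ i j (fun a => x a ω) ^ (2 * q + 1) ∂P) := by
    have b1 := congrArg norm hmain
    rw [Complex.norm_real, Real.norm_of_nonneg hR0] at b1
    rw [b1]
    refine (norm_sum_le _ _).trans ((Finset.sum_le_sum fun k _ =>
      h₁ N ξ σ z ϕ ha Ω P x h i j k).trans ?_)
    rw [← Finset.mul_sum, ← integral_finsetSum _ fun k _ => iV k, mul_assoc C₁, div_mul_eq_mul_div,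
      mul_div_assoc]
    refine mul_le_mul_of_nonneg_left ?_ hC₁.le
    rw [← integral_const_mul, ← integral_const_mul, ← integral_div]
    refine integral_mono ((integrable_finsetSum _ fun k _ => iV k).div_const _)
      (((iY _).const_mul ϕ).const_mul _) fun ω => ?_
    set y := fun a => x a ω
    have w := h₂ N ξ z ϕ ha i j y
    simp only
    have e1 : (∑ k, errorTerm q K ξ z ϕ i j k y) / N = ϕ * residualSize ξ z ϕ i j y ^ (2 * q + 1) +
        (1 / (N : ℝ) * ∑ k, weight K z ϕ i j k y ^ 2) * residualSize ξ z ϕ i j y ^ (2 * q) := by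
      simp only [errorTerm, Finset.sum_add_distrib, Finset.sum_const, ← Finset.sum_mul,
        Finset.card_univ, Fintype.card_fin, nsmul_eq_mul]
      field_simp
    rw [e1]
    have hY := hY0 y
    calc _ ≤ ϕ * residualSize ξ z ϕ i j y ^ (2 * q + 1) +
          (C₂ * (ϕ * residualSize ξ z ϕ i j y)) * residualSize ξ z ϕ i j y ^ (2 * q) := by
          have w' : C₂ * ϕ ^ 2 ≤ C₂ * (ϕ * residualSize ξ z ϕ i j y) := by
            rw [sq]
            gcongr
            exact hYϕ y
          exact add_le_add_right (mul_le_mul_of_nonneg_right (w.trans w') (by positivity)) _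
      _ = _ := by ring
  set n := 2 * q + 2 with hn
  have iR : Integrable (fun ω => ‖residual ξ z (green (fun a => x a ω) z) i j‖ ^ n) P :=
    h.integrable_comp (f := fun y => ‖residual ξ z (green y z) i j‖ ^ n)
      ((measurable_residual ξ z i j).norm.pow_const n) (B := C₃ ^ n) fun y _ => by
        rw [norm_pow, norm_norm]
        exact pow_le_pow_left₀ (norm_nonneg _)
          ((le_add_of_nonneg_right hϕ.le).trans (h₃ N ξ z ϕ ha i j y)) _
  set I := ∫ ω, residualSize ξ z ϕ i j (fun a => x a ω) ^ (2 * q + 1) ∂P with hI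
  set J := ∫ ω, residualSize ξ z ϕ i j (fun a => x a ω) ^ n ∂P with hJ
  have hϕI : ϕ ^ n ≤ ϕ * I := by
    have : ∫ _, ϕ ^ (2 * q + 1) ∂P ≤ I :=
      integral_mono (integrable_const _) (iY _) fun ω => pow_le_pow_left₀ hϕ.le (hYϕ _) _
    simp only [integral_const, probReal_univ, one_smul] at this
    calc ϕ ^ n = ϕ * ϕ ^ (2 * q + 1) := by rw [hn]; ring
      _ ≤ _ := by gcongr
  -- Passing from $|R|$ to $Y=|R|+\phi$ adds only $\phi^n$, which is itself at most $\phi I$ because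
  -- $Y\ge\phi$.
  have hJle : J ≤ A * (ϕ * I) := by
    have b1 : J ≤ ∫ ω, 2 ^ (2 * q + 1) * (‖residual ξ z (green (fun a => x a ω) z) i j‖ ^ n +
        ϕ ^ n) ∂P := by
      refine integral_mono (iY n) ((iR.add (integrable_const _)).const_mul _) fun ω => ?_
      exact add_pow_le (norm_nonneg _) hϕ.le n
    rw [integral_const_mul, integral_add iR (integrable_const _)] at b1
    simp only [integral_const, probReal_univ, one_smul] at b1
    refine b1.trans ?_
    rw [hA, mul_assoc, add_mul, one_mul]
    gcongr
  have hYoung : A * (ϕ * I) ≤ 1 / 2 * J + (2 * A) ^ n * ϕ ^ n := by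
    have b1 : ∫ ω, A * ϕ * residualSize ξ z ϕ i j (fun a => x a ω) ^ (2 * q + 1) ∂P ≤
        ∫ ω, (1 / 2 * residualSize ξ z ϕ i j (fun a => x a ω) ^ n + (2 * A * ϕ) ^ n) ∂P := by
      refine integral_mono ((iY _).const_mul _) (((iY n).const_mul _).add (integrable_const _))
        fun ω => ?_
      set Y := residualSize ξ z ϕ i j (fun a => x a ω) with hYd
      have hY : 0 ≤ Y := hY0 _
      have hYn : Y ^ n = Y * Y ^ (2 * q + 1) := by rw [hn]; ring
      simp only
      -- Young's inequality by hand: below the threshold $2A\phi$ the constant term dominates, above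
      -- it half of $Y^n$ does.
      rcases le_total Y (2 * A * ϕ) with hle | hle
      · have c1 : Y ^ (2 * q + 1) ≤ (2 * A * ϕ) ^ (2 * q + 1) := pow_le_pow_left₀ hY hle _
        have c2 : (2 * A * ϕ) ^ n = 2 * (A * ϕ * (2 * A * ϕ) ^ (2 * q + 1)) := by rw [hn]; ring
        have c3 : A * ϕ * Y ^ (2 * q + 1) ≤ A * ϕ * (2 * A * ϕ) ^ (2 * q + 1) := by gcongr
        have c4 : 0 ≤ A * ϕ * (2 * A * ϕ) ^ (2 * q + 1) := by positivity
        have c5 : 0 ≤ Y ^ n := by positivity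
        linarith
      · have c1 : 2 * A * ϕ * Y ^ (2 * q + 1) ≤ Y * Y ^ (2 * q + 1) := by gcongr
        have c2 : 0 ≤ (2 * A * ϕ) ^ n := by positivity
        linarith
    rw [integral_const_mul, integral_add ((iY n).const_mul _) (integrable_const _),
      integral_const_mul] at b1
    simp only [integral_const, probReal_univ, one_smul] at b1
    rw [mul_pow (2 * A)] at b1
    rw [← mul_assoc]
    exact b1
  have hRJ : ∫ ω, ‖residual ξ z (green (fun a => x a ω) z) i j‖ ^ n ∂P ≤ J :=
    integral_mono iR (iY n) fun ω =>
      pow_le_pow_left₀ (norm_nonneg _) (le_add_of_nonneg_right hϕ.le) n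
  linarith

section

/-! ### Truncation -/

/-- The truncation of a real number at level `T`. -/
def trunc (T y : ℝ) : ℝ := if |y| ≤ T then y else 0

theorem measurable_trunc (T : ℝ) : Measurable (trunc T) :=
  Measurable.ite (measurableSet_le continuous_abs.measurable measurable_const) measurable_id
    measurable_const

theorem abs_trunc_le {T : ℝ} (hT : 0 ≤ T) (y : ℝ) : |trunc T y| ≤ T := by
  unfold trunc
  split_ifs with h
  · exact h
  · simpa using hT

theorem abs_trunc_le_abs (T y : ℝ) : |trunc T y| ≤ |y| := by
  unfold trunc
  split_ifs with h
  · exact le_rfl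
  · simp

/-- Chebyshev's trade: above the level `T`, lower powers are exchanged for the $p$-th moment with a
gain of powers of `T`. -/
theorem pow_le_of_lt_abs {T y : ℝ} (hT : 0 < T) (hy : T < |y|) {m p : ℕ} (hmp : m ≤ p) :
    |y| ^ m ≤ T ^ m * (|y| ^ p / T ^ p) := by
  have hy0 : 0 < |y| := hT.trans hy
  obtain ⟨r, rfl⟩ := Nat.exists_eq_add_of_le hmp
  rw [pow_add, pow_add, mul_div_mul_comm, ← mul_assoc, mul_div_cancel₀ _ (pow_pos hT m).ne']
  refine le_mul_of_one_le_right (by positivity) ?_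
  rw [one_le_div (by positivity)]
  exact pow_le_pow_left₀ hT.le hy.le r

theorem abs_sub_trunc_le {T : ℝ} (hT : 0 < T) (y : ℝ) {p : ℕ} (hp : 2 ≤ p) :
    |y - trunc T y| ≤ T * (|y| ^ p / T ^ p) := by
  unfold trunc
  split_ifs with h
  · simp only [sub_self, abs_zero]; positivity
  · have := pow_le_of_lt_abs hT (not_le.1 h) (m := 1) (p := p) (by omega)
    simpa using this

theorem abs_mul_sub_trunc_mul_le {T : ℝ} (hT : 0 < T) (y y' : ℝ) {p : ℕ} (hp : 2 ≤ p) :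
    |trunc T y * trunc T y' - y * y'| ≤
      T ^ 2 * (|y| ^ p / T ^ p) + T ^ 2 * (|y'| ^ p / T ^ p) := by
  have h0 : ∀ u : ℝ, 0 ≤ T ^ 2 * (|u| ^ p / T ^ p) := fun u => by positivity
  by_cases h : |y| ≤ T ∧ |y'| ≤ T
  · simp only [trunc, h.1, h.2, if_true, sub_self, abs_zero]
    exact add_nonneg (h0 _) (h0 _)
  · have e : trunc T y * trunc T y' = 0 := by
      rw [not_and_or] at h
      rcases h with h | h <;> simp [trunc, h]
    rw [e, zero_sub, abs_neg, abs_mul]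
    have hmax : T < max |y| |y'| := by
      by_contra h'
      rw [not_lt, max_le_iff] at h'
      exact h h'
    rcases le_total |y| |y'| with hle | hle
    · rw [max_eq_right hle] at hmax
      have := pow_le_of_lt_abs hT hmax (m := 2) (p := p) hp
      nlinarith [h0 y, abs_nonneg y, abs_nonneg y']
    · rw [max_eq_left hle] at hmax
      have := pow_le_of_lt_abs hT hmax (m := 2) (p := p) hp
      nlinarith [h0 y', abs_nonneg y, abs_nonneg y']

variable {N : ℕ} {Ω : Type*} [MeasurableSpace Ω]

/-- A centered `K`-dependent array with second moments at most `c`. -/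
structure IsArray (K : ℕ) (c : ℝ) (P : Measure Ω) (x : UpperIndex N → Ω → ℝ) : Prop where
  measurable : ∀ a, Measurable (x a)
  dependent : IsKDependent K P x
  centered : ∀ a, ∫ ω, x a ω ∂P = 0
  integrable_sq : ∀ a, Integrable (fun ω => |x a ω| ^ 2) P
  second : ∀ a, ∫ ω, |x a ω| ^ 2 ∂P ≤ c

variable {K : ℕ} {c : ℝ} {P : Measure Ω} [IsProbabilityMeasure P] {x : UpperIndex N → Ω → ℝ}

/-- At level $T=\sqrt N\phi$ the entries of $H$ are bounded by $\phi$. A small tail parameter $t$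
makes the changes in mean and covariance at most $\phi/N$, so there is no need to recenter, and the
self-energy can keep the original covariances. -/
theorem IsArray.isTruncated (h : IsArray K c P x) {ϕ T t : ℝ} (hϕ : 0 < ϕ) (hϕ1 : ϕ ≤ 1)
    (hN : 0 < N) (hT : T = √N * ϕ) {p : ℕ} (hp : 2 ≤ p)
    (hi : ∀ a, Integrable (fun ω => |x a ω| ^ p) P) (hm : ∀ a, ∫ ω, |x a ω| ^ p ∂P ≤ t * T ^ p)
    (ht0 : 0 ≤ t) (ht : 2 * t ≤ 1 / N) :
    IsTruncated K c ϕ P (covTensor P x) (fun i k u v => ∫ ω, x (upper i k) ω * x (upper u v) ω ∂P)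
      fun a ω => trunc T (x a ω) := by
  have hN0 : (0 : ℝ) < N := by exact_mod_cast hN
  have hs : 0 < √(N : ℝ) := Real.sqrt_pos.2 hN0
  have hss : √(N : ℝ) * √N = N := Real.mul_self_sqrt hN0.le
  have hT0 : 0 < T := by rw [hT]; positivity
  have hmeas : ∀ a, Measurable fun ω => trunc T (x a ω) := fun a =>
    (measurable_trunc T).comp (h.measurable a)
  have hnorm : ∀ u v ω, normMatrix (fun a => trunc T (x a ω)) u v =
      1 / √N * trunc T (x (upper u v) ω) := fun u v ω => rfl
  have hdiv : ∀ a, ∫ ω, |x a ω| ^ p / T ^ p ∂P ≤ t := fun a => by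
    rw [integral_div, div_le_iff₀ (by positivity)]
    exact hm a
  have hx1 : ∀ a, Integrable (x a) P := fun a => by
    have h2 : Integrable (fun ω => 1 + |x a ω| ^ 2) P := (integrable_const _).add (h.integrable_sq a)
    refine h2.mono' (h.measurable a).aestronglyMeasurable (.of_forall fun ω => ?_)
    rw [Real.norm_eq_abs]
    nlinarith [sq_nonneg (|x a ω| - 1)]
  have hxx : ∀ a b, Integrable (fun ω => x a ω * x b ω) P := fun a b =>
    integrable_mul_of_sq (h.measurable a) (h.measurable b) (h.integrable_sq a) (h.integrable_sq b)
  have htr : ∀ a, Integrable (fun ω => trunc T (x a ω)) P := fun a =>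
    Integrable.of_bound (hmeas a).aestronglyMeasurable T
      (.of_forall fun ω => abs_trunc_le hT0.le _)
  have htt : ∀ a b, Integrable (fun ω => trunc T (x a ω) * trunc T (x b ω)) P := fun a b =>
    Integrable.of_bound ((hmeas a).mul (hmeas b)).aestronglyMeasurable (T * T)
      (.of_forall fun ω => by
        rw [norm_mul]
        exact mul_le_mul (abs_trunc_le hT0.le _) (abs_trunc_le hT0.le _) (norm_nonneg _) hT0.le)
  refine ⟨hmeas, h.dependent.comp (measurable_trunc T), fun ω u v => ?_, fun u v => ?_,
    fun u v => ?_, fun i k u v => ?_, fun i k u v => ?_, fun i k u v hp => ?_,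
    fun i k u v ho => ?_, fun i k u v ho => ?_⟩
  · rw [hnorm, abs_mul, abs_of_pos (by positivity), one_div, inv_mul_le_iff₀ hs, ← hT]
    exact abs_trunc_le hT0.le _
  · simp only [hnorm]
    rw [integral_const_mul, abs_mul, abs_of_pos (by positivity : 0 < 1 / √(N : ℝ))]
    have b1 : |∫ ω, trunc T (x (upper u v) ω) ∂P| ≤ T * t := by
      have e1 : ∫ ω, trunc T (x (upper u v) ω) ∂P =
          -∫ ω, (x (upper u v) ω - trunc T (x (upper u v) ω)) ∂P := by
        rw [integral_sub (hx1 _) (htr _), h.centered]; ring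
      rw [e1, abs_neg]
      have b2 : ‖∫ ω, (x (upper u v) ω - trunc T (x (upper u v) ω)) ∂P‖ ≤
          ∫ ω, T * (|x (upper u v) ω| ^ p / T ^ p) ∂P :=
        norm_integral_le_of_norm_le (((hi _).div_const _).const_mul T)
          (.of_forall fun ω => abs_sub_trunc_le hT0 _ hp)
      rw [integral_const_mul] at b2
      exact b2.trans (mul_le_mul_of_nonneg_left (hdiv _) hT0.le)
    calc _ ≤ 1 / √N * (T * t) := by gcongr
      _ = ϕ * t := by rw [hT]; field_simp
      _ ≤ ϕ * (1 / N) := by gcongr; linarith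
      _ = _ := by ring
  · simp only [hnorm, mul_pow]
    rw [integral_const_mul, div_pow, Real.sq_sqrt hN0.le, one_pow, one_div, ← div_eq_inv_mul]
    gcongr
    refine le_trans ?_ (h.second (upper u v))
    refine integral_mono_of_nonneg (.of_forall fun ω => sq_nonneg _) (h.integrable_sq _)
      (.of_forall fun ω => ?_)
    simp only
    rw [← sq_abs (trunc T _)]
    exact pow_le_pow_left₀ (abs_nonneg _) (abs_trunc_le_abs _ _) 2
  · have e1 : ∀ ω, normMatrix (fun a => trunc T (x a ω)) i k *
        normMatrix (fun a => trunc T (x a ω)) u v =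
        1 / N * (trunc T (x (upper i k) ω) * trunc T (x (upper u v) ω)) := fun ω => by
      have : 1 / (N : ℝ) = 1 / √N * (1 / √N) := by rw [div_mul_div_comm, hss, one_mul]
      rw [hnorm, hnorm, this]
      ring
    simp only [e1]
    rw [integral_const_mul, one_div, ← div_eq_inv_mul, ← sub_div, abs_div, Nat.abs_cast,
      ← integral_sub (htt _ _) (hxx _ _)]
    have b2 : ‖∫ ω, (trunc T (x (upper i k) ω) * trunc T (x (upper u v) ω) -
        x (upper i k) ω * x (upper u v) ω) ∂P‖ ≤
          ∫ ω, (T ^ 2 * (|x (upper i k) ω| ^ p / T ^ p) +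
            T ^ 2 * (|x (upper u v) ω| ^ p / T ^ p)) ∂P :=
      norm_integral_le_of_norm_le ((((hi _).div_const _).const_mul _).add
          (((hi _).div_const _).const_mul _))
          (.of_forall fun ω => abs_mul_sub_trunc_mul_le hT0 _ _ hp)
    rw [integral_add (((hi _).div_const _).const_mul _) (((hi _).div_const _).const_mul _),
      integral_const_mul, integral_const_mul] at b2
    have b3 := hdiv (upper i k)
    have b4 := hdiv (upper u v)
    have b5 : T ^ 2 * t + T ^ 2 * t ≤ ϕ := by
      have : T ^ 2 = N * ϕ ^ 2 := by rw [hT, mul_pow, Real.sq_sqrt hN0.le]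
      calc T ^ 2 * t + T ^ 2 * t = N * ϕ ^ 2 * (2 * t) := by rw [this]; ring
        _ ≤ N * ϕ ^ 2 * (1 / N) := by gcongr
        _ = ϕ * ϕ := by field_simp
        _ ≤ ϕ * 1 := by gcongr
        _ = ϕ := mul_one _
    gcongr
    refine b2.trans (le_trans ?_ b5)
    gcongr
  · exact abs_integral_mul_le (h.integrable_sq _) (h.integrable_sq _) (h.second _) (h.second _)
  · rw [mem_pairs, not_le] at hp
    rw [h.dependent.integral_pair h.measurable hp, h.centered, zero_mul]
  · rw [covTensor, if_pos ho]
    simp only [symMatrix_apply, upper_comm v u]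
  · rw [covTensor, if_neg ho]

theorem measureReal_trunc_ne_le {T t : ℝ} (hT : 0 < T) {p : ℕ}
    (hi : ∀ a, Integrable (fun ω => |x a ω| ^ p) P) (hm : ∀ a, ∫ ω, |x a ω| ^ p ∂P ≤ t * T ^ p)
    (ht : 0 ≤ t) :
    P.real {ω | ∃ a, trunc T (x a ω) ≠ x a ω} ≤ (N : ℝ) ^ 2 * t := by
  have h1 : ∀ a, P.real {ω | trunc T (x a ω) ≠ x a ω} ≤ t := fun a => by
    have h2 := mul_meas_ge_le_integral_of_nonneg (.of_forall fun ω => by positivity) (hi a) (T ^ p)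
    have h3 : P.real {ω | trunc T (x a ω) ≠ x a ω} ≤ P.real {ω | T ^ p ≤ |x a ω| ^ p} := by
      refine measureReal_mono fun ω hω => ?_
      have : ¬ |x a ω| ≤ T := fun h' => hω (by simp [trunc, h'])
      exact pow_le_pow_left₀ hT.le (not_le.1 this).le p
    have h4 := h2.trans (hm a)
    rw [mul_comm t] at h4
    exact h3.trans (le_of_mul_le_mul_left h4 (by positivity))
  have h2 : {ω | ∃ a, trunc T (x a ω) ≠ x a ω} = ⋃ a, {ω | trunc T (x a ω) ≠ x a ω} := by
    ext ω; simp
  rw [h2]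
  refine (measureReal_iUnion_fintype_le _).trans ((Finset.sum_le_sum fun a _ => h1 a).trans ?_)
  rw [Finset.sum_const, nsmul_eq_mul]
  gcongr
  have h3 : Fintype.card (UpperIndex N) ≤ Fintype.card (Fin N × Fin N) := Fintype.card_subtype_le _
  rw [Fintype.card_prod, Fintype.card_fin, ← sq] at h3
  rw [Finset.card_univ]
  exact_mod_cast h3

end

/-! ### Uniformity in the spectral parameter -/

/-- The net has to lie in `D`, where the bounds hold, so a representative of `D` is chosen in each
cell of a square grid that meets `D`. -/
theorem exists_finset_net (Z : ℝ) (hZ : 0 ≤ Z) (s : ℕ) (hs : 0 < s) (D : Set ℂ)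
    (hD : ∀ z ∈ D, ‖z‖ ≤ Z) :
    ∃ F : Finset ℂ, (↑F : Set ℂ) ⊆ D ∧ (F.card : ℝ) ≤ (2 * (Z + 1) * s + 1) ^ 2 ∧
      ∀ z ∈ D, ∃ w ∈ F, ‖z - w‖ ≤ 2 / s := by
  classical
  have hs0 : (0 : ℝ) < s := by exact_mod_cast hs
  set g : ℂ → ℤ × ℤ := fun z => (⌊z.re * s⌋, ⌊z.im * s⌋) with hg
  set m : ℤ := ⌊(Z + 1) * s⌋ with hm
  have hm0 : 0 ≤ m := Int.floor_nonneg.2 (by positivity)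
  set B : Finset (ℤ × ℤ) := Finset.Icc (-m) m ×ˢ Finset.Icc (-m) m with hB
  have hfl : ∀ t : ℝ, |t| ≤ Z → ⌊t * s⌋ ∈ Finset.Icc (-m) m := fun t ht => by
    have ht' := abs_le.1 ht
    have hs1 : (1 : ℝ) ≤ s := by exact_mod_cast hs
    rw [Finset.mem_Icc]
    constructor
    · rw [neg_le, hm, Int.le_floor]
      push_cast
      have := Int.sub_one_lt_floor (t * s)
      nlinarith
    · exact Int.floor_le_floor (by nlinarith)
  have hgB : ∀ z ∈ D, g z ∈ B := fun z hz => by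
    rw [hB, Finset.mem_product]
    exact ⟨hfl _ ((Complex.abs_re_le_norm z).trans (hD z hz)),
      hfl _ ((Complex.abs_im_le_norm z).trans (hD z hz))⟩
  set A : Finset (ℤ × ℤ) := B.filter fun b => ∃ z ∈ D, g z = b with hA
  have hch : ∀ b : A, ∃ z ∈ D, g z = b := fun b => (Finset.mem_filter.1 b.2).2
  choose r hrD hr using hch
  refine ⟨A.attach.image r, ?_, ?_, fun z hz => ?_⟩
  · intro z hz
    obtain ⟨b, -, rfl⟩ := Finset.mem_image.1 (Finset.mem_coe.1 hz)
    exact hrD b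
  · have h1 : (A.attach.image r).card ≤ B.card :=
      Finset.card_image_le.trans (by rw [Finset.card_attach]; exact Finset.card_filter_le _ _)
    have h2 : (B.card : ℝ) = (2 * m + 1) ^ 2 := by
      rw [hB, Finset.card_product, Int.card_Icc]
      have h3 : (((m + 1 - -m).toNat : ℤ) : ℝ) = 2 * m + 1 := by
        rw [Int.toNat_of_nonneg (by omega)]; push_cast; ring
      rw [Int.cast_natCast] at h3
      push_cast
      rw [h3]; ring
    have h4 : (m : ℝ) ≤ (Z + 1) * s := Int.floor_le _
    have h5 : (0 : ℝ) ≤ m := by exact_mod_cast hm0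
    calc ((A.attach.image r).card : ℝ) ≤ B.card := by exact_mod_cast h1
      _ = (2 * m + 1) ^ 2 := h2
      _ ≤ (2 * ((Z + 1) * s) + 1) ^ 2 := by gcongr
      _ = _ := by ring
  · have hzA : g z ∈ A := Finset.mem_filter.2 ⟨hgB z hz, z, hz, rfl⟩
    refine ⟨r ⟨g z, hzA⟩, Finset.mem_image.2 ⟨_, Finset.mem_attach _ _, rfl⟩, ?_⟩
    have h1 := hr ⟨g z, hzA⟩
    set w := r ⟨g z, hzA⟩
    simp only [hg, Prod.mk.injEq] at h1
    have h2 : ∀ a b : ℝ, ⌊b * s⌋ = ⌊a * s⌋ → |a - b| ≤ 1 / s := fun a b hab => by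
      have := Int.abs_sub_lt_one_of_floor_eq_floor hab.symm
      rw [← sub_mul, abs_mul, abs_of_pos hs0] at this
      rw [le_div_iff₀ hs0]
      exact this.le
    refine (Complex.norm_le_abs_re_add_abs_im _).trans ?_
    rw [Complex.sub_re, Complex.sub_im]
    have h3 := h2 _ _ h1.1
    have h4 := h2 _ _ h1.2
    have h5 : (2 : ℝ) / s = 1 / s + 1 / s := by ring
    linarith

theorem norm_green_sub_param_le {N : ℕ} {η : ℝ} (hη : 0 < η) {z z' : ℂ} (hz : η ≤ z.im)
    (hz' : η ≤ z'.im) (x : UpperIndex N → ℝ) (i j : Fin N) :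
    ‖green x z i j - green x z' i j‖ ≤ 1 / η ^ 2 * N * ‖z - z'‖ := by
  rw [← Matrix.sub_apply, green_sub_green_param (hη.trans_le hz) (hη.trans_le hz'),
    Matrix.smul_apply, smul_eq_mul, norm_mul, mul_comm]
  gcongr
  rw [Matrix.mul_apply]
  refine (norm_sum_le _ _).trans ((Finset.sum_le_sum fun k _ => ?_).trans_eq
    (b := ∑ _k : Fin N, 1 / η * (1 / η)) ?_)
  · rw [norm_mul]
    have h1 := (isDissipativeInverse_green hη hz x).norm_apply_le hη i k
    have h2 := (isDissipativeInverse_green hη hz' x).norm_apply_le hη k j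
    gcongr
  · rw [Finset.sum_const, Finset.card_univ, Fintype.card_fin, nsmul_eq_mul]
    field_simp

theorem norm_Xi_apply_le_mul {N : ℕ} {c b : ℝ} {ξ : Fin N → Fin N → Fin N → Fin N → ℝ}
    (hξ : ∀ i j k l, |ξ i j k l| ≤ c) (hc : 0 ≤ c) {M : Matrix (Fin N) (Fin N) ℂ}
    (hM : ∀ i j, ‖M i j‖ ≤ b) (i k : Fin N) : ‖Xi ξ M i k‖ ≤ N * (c * b) := by
  have hN : (0 : ℝ) < N := by exact_mod_cast i.pos
  rw [Xi, norm_mul, norm_div, norm_one, Complex.norm_natCast, one_div, inv_mul_le_iff₀ hN]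
  refine (norm_sum_le _ _).trans ((Finset.sum_le_sum fun j _ => (norm_sum_le _ _).trans
    (Finset.sum_le_sum fun l _ => ?_)).trans_eq (b := ∑ _j : Fin N, ∑ _l : Fin N, c * b) ?_)
  · rw [norm_mul, Complex.norm_real]
    exact mul_le_mul (hξ _ _ _ _) (hM _ _) (norm_nonneg _) hc
  · simp only [Finset.sum_const, Finset.card_univ, Fintype.card_fin, nsmul_eq_mul]

/-- A crude Lipschitz constant of order $N^3$ suffices, since a net of mesh of order $N^{-4}$ still
has polynomially many points. -/
theorem exists_norm_residual_sub_param_le {η : ℝ} (hη : 0 < η) (Z c : ℝ) (hZ : 0 ≤ Z)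
    (hc : 0 ≤ c) :
    ∃ L : ℝ, 0 < L ∧ ∀ (N : ℕ) (ξ : Fin N → Fin N → Fin N → Fin N → ℝ),
      (∀ i j k l, |ξ i j k l| ≤ c) → ∀ z z' : ℂ, η ≤ z.im → η ≤ z'.im → ‖z'‖ ≤ Z →
      ∀ (x : UpperIndex N → ℝ) (i j : Fin N),
        ‖residual ξ z (green x z) i j - residual ξ z' (green x z') i j‖ ≤
          L * N ^ 3 * ‖z - z'‖ := by
  refine ⟨1 / η + Z * (1 / η ^ 2) + 2 * (c * (1 / η ^ 2) * (1 / η)), by positivity, ?_⟩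
  intro N ξ hξ z z' hz hz' hZ' x i j
  have hN : (1 : ℝ) ≤ N := by exact_mod_cast i.pos
  set G := green x z with hG
  set G' := green x z' with hG'
  have b1 : ∀ a b, ‖G a b‖ ≤ 1 / η := (isDissipativeInverse_green hη hz x).norm_apply_le hη
  have b2 : ∀ a b, ‖G' a b‖ ≤ 1 / η := (isDissipativeInverse_green hη hz' x).norm_apply_le hη
  have b3 : ∀ a b, ‖(G - G') a b‖ ≤ 1 / η ^ 2 * N * ‖z - z'‖ := fun a b =>
    norm_green_sub_param_le hη hz hz' x a b
  have e1 : residual ξ z G - residual ξ z' G' = (z - z') • G + z' • (G - G') +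
      (Xi ξ (G - G') * G + Xi ξ G' * (G - G')) := by
    rw [Xi_sub]
    unfold residual
    simp only [sub_smul, smul_sub, Matrix.sub_mul, Matrix.mul_sub]
    abel
  rw [← Matrix.sub_apply, e1]
  set d := ‖z - z'‖
  have hd : 0 ≤ d := norm_nonneg _
  have t1 : ‖((z - z') • G) i j‖ ≤ 1 / η * d := by
    rw [Matrix.smul_apply, norm_smul, mul_comm]
    gcongr
    exact b1 i j
  have t2 : ‖(z' • (G - G')) i j‖ ≤ Z * (1 / η ^ 2 * N * d) := by
    rw [Matrix.smul_apply, norm_smul]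
    exact mul_le_mul hZ' (b3 i j) (norm_nonneg _) hZ
  have t3 : ‖(Xi ξ (G - G') * G) i j‖ ≤ N * (N * (c * (1 / η ^ 2 * N * d)) * (1 / η)) := by
    rw [Matrix.mul_apply]
    refine (norm_sum_le _ _).trans ((Finset.sum_le_sum fun k _ => ?_).trans_eq
      (b := ∑ _k : Fin N, N * (c * (1 / η ^ 2 * N * d)) * (1 / η)) (by simp))
    rw [norm_mul]
    exact mul_le_mul (norm_Xi_apply_le_mul hξ hc b3 i k) (b1 k j) (norm_nonneg _) (by positivity)
  have t4 : ‖(Xi ξ G' * (G - G')) i j‖ ≤ N * (N * (c * (1 / η)) * (1 / η ^ 2 * N * d)) := by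
    rw [Matrix.mul_apply]
    refine (norm_sum_le _ _).trans ((Finset.sum_le_sum fun k _ => ?_).trans_eq
      (b := ∑ _k : Fin N, N * (c * (1 / η)) * (1 / η ^ 2 * N * d)) (by simp))
    rw [norm_mul]
    exact mul_le_mul (norm_Xi_apply_le_mul hξ hc b2 i k) (b3 k j) (norm_nonneg _) (by positivity)
  have hN1 : (1 : ℝ) ≤ N ^ 3 := one_le_pow₀ hN
  have hN2 : (N : ℝ) ≤ N ^ 3 := le_self_pow₀ hN (by norm_num)
  have u1 : 1 / η * d ≤ N ^ 3 * (1 / η * d) := le_mul_of_one_le_left (by positivity) hN1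
  have u2 : Z * (1 / η ^ 2 * N * d) ≤ Z * (1 / η ^ 2 * N ^ 3 * d) := by gcongr
  rw [Matrix.add_apply, Matrix.add_apply, Matrix.add_apply]
  refine (norm_add_le _ _).trans ((add_le_add (norm_add_le _ _) (norm_add_le _ _)).trans ?_)
  refine (add_le_add (add_le_add (t1.trans u1) (t2.trans u2)) (add_le_add t3 t4)).trans_eq ?_
  ring

/-- The moment condition of the model for a single array. -/
def HasMoments {N : ℕ} {Ω : Type*} [MeasurableSpace Ω] (τ : ℝ) (μ : ℕ → ℝ) (P : Measure Ω)
    (x : UpperIndex N → Ω → ℝ) : Prop :=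
  ∀ p : ℕ, 2 ≤ p → ∀ a, Integrable (fun ω => |x a ω| ^ p) P ∧
    ∫ ω, |x a ω| ^ p ∂P ≤ ((N : ℝ) / (N : ℝ) ^ τ) ^ ((p : ℝ) / 2 - 1) * μ p ^ p

theorem IsArray.isKernel {N K : ℕ} {c : ℝ} {Ω : Type*} [MeasurableSpace Ω] {P : Measure Ω}
    [IsProbabilityMeasure P] {x : UpperIndex N → Ω → ℝ} (h : IsArray K c P x) (hc : 0 ≤ c) :
    IsKernel K c (covTensor P x) :=
  isKernel_covTensor h.measurable h.dependent h.centered h.integrable_sq h.second hc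

/-- With very high probability the residual is small uniformly in the spectral parameter. -/
theorem exists_residual_prob_le {η : ℝ} (hη : 0 < η) (Z c τ ε A : ℝ) (hZ : 0 ≤ Z)
    (hc : 0 ≤ c) (hτ : τ ∈ Set.Ioc (0 : ℝ) 1) (hε : 0 < ε) (hετ : ε ≤ τ) (hA : 0 ≤ A)
    (K : ℕ) (μ : ℕ → ℝ) :
    ∃ N₀ : ℕ, ∀ N ≥ N₀, ∀ (D : Set ℂ), (∀ z ∈ D, η ≤ z.im ∧ ‖z‖ ≤ Z) →
      ∀ (Ω : Type*) [MeasurableSpace Ω] (P : Measure Ω) [IsProbabilityMeasure P]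
      (x : UpperIndex N → Ω → ℝ), IsArray K c P x → HasMoments τ μ P x →
      P.real {ω | ∃ z ∈ D, ∃ i j, (N : ℝ) ^ (ε - τ / 2) ≤
        ‖residual (covTensor P x) z (green (fun a => x a ω) z) i j‖} ≤ (N : ℝ) ^ (-A) := by
  -- In $A+11$, eight powers of $N$ pay for the net, two for the pairs $(i,j)$, and one for
  -- constants. In $A+3$, two pay for the union over all entries in the truncation and one for
  -- constants.
  obtain ⟨q, hq⟩ := exists_nat_ge ((A + 11) / ε)
  obtain ⟨r, hr⟩ := exists_nat_ge ((A + 3) / ε)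
  set p := 2 * r + 2 with hp
  obtain ⟨C, hC, hmom⟩ := exists_moment_residual_le hη Z c hZ hc K q
  obtain ⟨L, hL, hlip⟩ := exists_norm_residual_sub_param_le hη Z c hZ hc
  set n := 2 * q + 2 with hn
  set b := |μ p ^ p| with hb
  have hb0 : 0 ≤ b := abs_nonneg _
  obtain ⟨N₁, hN₁⟩ := exists_nat_ge ((4 * L) ^ 2 + 2 * b + ((2 * Z + 3) ^ 2 * (C * 2 ^ n) + b))
  refine ⟨N₁ + 1, ?_⟩
  intro N hN D hD Ω _ P _ x hx hm
  have hC0 : 0 ≤ (2 * Z + 3) ^ 2 * (C * 2 ^ n) := by positivity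
  have hNN : (N₁ : ℝ) + 1 ≤ N := by exact_mod_cast hN
  have hN1 : (1 : ℝ) ≤ N := by
    have : (0 : ℝ) ≤ N₁ := by positivity
    linarith
  have hN0 : (0 : ℝ) < N := by linarith
  have c1 : (4 * L) ^ 2 ≤ N := by linarith
  have c2 : 2 * b ≤ N := by nlinarith [sq_nonneg (4 * L)]
  have c3 : (2 * Z + 3) ^ 2 * (C * 2 ^ n) + b ≤ N := by nlinarith [sq_nonneg (4 * L)]
  have hqε : A + 11 ≤ n * (ε / 2) := by
    rw [div_le_iff₀ hε] at hq
    rw [hn]; push_cast; linarith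
  have hpε : A + 3 ≤ p * (ε / 2) := by
    rw [div_le_iff₀ hε] at hr
    rw [hp]; push_cast; linarith
  -- This lies a factor $N^{\varepsilon/2}$ above $N^{-\tau/2}$, which makes truncation unlikely to
  -- act, and the same factor below the target $N^{\varepsilon-\tau/2}$, which is the gain in
  -- Markov's inequality.
  set ϕ : ℝ := (N : ℝ) ^ (ε / 2 - τ / 2) with hϕ
  have hϕ0 : 0 < ϕ := by positivity
  have hϕ1 : ϕ ≤ 1 := Real.rpow_le_one_of_one_le_of_nonpos hN1 (by linarith)
  have hone : 1 ≤ (N : ℝ) * ϕ ^ 2 := by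
    have : (N : ℝ) * ϕ ^ 2 = (N : ℝ) ^ (1 + (ε / 2 - τ / 2) * 2) := by
      rw [Real.rpow_add hN0, Real.rpow_one, hϕ, ← Real.rpow_natCast, ← Real.rpow_mul hN0.le]
      norm_num
    rw [this]
    exact Real.one_le_rpow hN1 (by linarith [hτ.2])
  set T : ℝ := √N * ϕ with hT
  have hT0 : 0 < T := by positivity
  set t : ℝ := b * (N : ℝ) ^ (-(p * (ε / 2))) with ht
  have ht0 : 0 ≤ t := by positivity
  have hmT : ∀ a, ∫ ω, |x a ω| ^ p ∂P ≤ t * T ^ p := fun a => by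
    refine (hm p (by omega) a).2.trans ?_
    have e1 : t * T ^ p = (N : ℝ) ^ ((1 - τ) * (p / 2)) * b := by
      have e2 : T = (N : ℝ) ^ (1 / 2 + (ε / 2 - τ / 2)) := by
        rw [hT, hϕ, Real.sqrt_eq_rpow, ← Real.rpow_add hN0]
      rw [e2, ← Real.rpow_natCast, ← Real.rpow_mul hN0.le, ht, mul_assoc, ← Real.rpow_add hN0,
        mul_comm]
      congr 2
      ring
    have e3 : (N : ℝ) / (N : ℝ) ^ τ = (N : ℝ) ^ (1 - τ) := by
      rw [Real.rpow_sub hN0, Real.rpow_one]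
    rw [e1, e3, ← Real.rpow_mul hN0.le]
    refine mul_le_mul (Real.rpow_le_rpow_of_exponent_le hN1 ?_) (le_abs_self _) ?_ (by positivity)
    · have := hτ.2
      nlinarith
    · have : Even p := ⟨r + 1, by omega⟩
      exact this.pow_nonneg _
  have htA : t ≤ b * (N : ℝ) ^ (-(A + 3)) := by
    rw [ht]
    gcongr
  have ht2 : 2 * t ≤ 1 / N := by
    have e1 : (N : ℝ) ^ (-(A + 3)) ≤ (N : ℝ) ^ (-2 : ℝ) :=
      Real.rpow_le_rpow_of_exponent_le hN1 (by linarith)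
    have e2 : (N : ℝ) ^ (-2 : ℝ) = 1 / N * (1 / N) := by
      rw [Real.rpow_neg hN0.le, Real.rpow_two]; field_simp
    calc 2 * t ≤ 2 * (b * (1 / N * (1 / N))) := by
          rw [← e2]
          have := htA.trans (mul_le_mul_of_nonneg_left e1 hb0)
          linarith
      _ = 2 * b * (1 / N) * (1 / N) := by ring
      _ ≤ N * (1 / N) * (1 / N) := by gcongr
      _ = 1 / N := by field_simp
  have htr := hx.isTruncated hϕ0 hϕ1 (by exact_mod_cast hN0) hT (by omega)
    (fun a => (hm p (by omega) a).1) hmT ht0 ht2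
  have hker := hx.isKernel hc
  set ξ := covTensor P x with hξ
  set y : UpperIndex N → Ω → ℝ := fun a ω => trunc T (x a ω) with hy
  set ρ : ℝ := (N : ℝ) ^ (ε - τ / 2) with hρ
  have hρ0 : 0 < ρ := by positivity
  -- Markov's inequality for one entry
  have hmark : ∀ z ∈ D, ∀ i j, P.real {ω | ρ / 2 ≤
      ‖residual ξ z (green (fun a => y a ω) z) i j‖} ≤ C * 2 ^ n * (N : ℝ) ^ (-(A + 11)) := by
    intro z hz i j
    have hadm : Admissible η Z c K ξ z ϕ := ⟨hker, (hD z hz).1, (hD z hz).2, hϕ0, hϕ1, hone⟩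
    have m1 := hmom N ξ _ z ϕ hadm Ω P y htr i j
    obtain ⟨C', -, hC'⟩ := exists_residualSize_le hη Z c hZ hc K
    have hint : Integrable (fun ω => ‖residual ξ z (green (fun a => y a ω) z) i j‖ ^ n) P :=
      htr.integrable_comp (f := fun y => ‖residual ξ z (green y z) i j‖ ^ n)
        ((measurable_residual ξ z i j).norm.pow_const n) (B := C' ^ n) fun y _ => by
          rw [norm_pow, norm_norm]
          exact pow_le_pow_left₀ (norm_nonneg _)
            ((le_add_of_nonneg_right hϕ0.le).trans (hC' N ξ z ϕ hadm i j y)) _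
    have m2 := mul_meas_ge_le_integral_of_nonneg (.of_forall fun ω => by positivity) hint
      ((ρ / 2) ^ n)
    have m3 : P.real {ω | ρ / 2 ≤ ‖residual ξ z (green (fun a => y a ω) z) i j‖} ≤
        P.real {ω | (ρ / 2) ^ n ≤ ‖residual ξ z (green (fun a => y a ω) z) i j‖ ^ n} :=
      measureReal_mono fun ω hω => pow_le_pow_left₀ (by positivity : (0 : ℝ) ≤ ρ / 2) hω n
    have e1 : ϕ = ρ * (N : ℝ) ^ (-(ε / 2)) := by
      rw [hϕ, hρ, ← Real.rpow_add hN0]; congr 1; ring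
    have m4 : (ρ / 2) ^ n * P.real {ω | ρ / 2 ≤ ‖residual ξ z (green (fun a => y a ω) z) i j‖} ≤
        (ρ / 2) ^ n * (C * 2 ^ n * (N : ℝ) ^ (-(A + 11))) := by
      calc _ ≤ (ρ / 2) ^ n *
            P.real {ω | (ρ / 2) ^ n ≤ ‖residual ξ z (green (fun a => y a ω) z) i j‖ ^ n} := by
            gcongr
        _ ≤ C * ϕ ^ n := m2.trans m1
        _ = (ρ / 2) ^ n * (C * 2 ^ n * (N : ℝ) ^ (-(n * (ε / 2)))) := by
            have e2 : ((N : ℝ) ^ (-(ε / 2))) ^ n = (N : ℝ) ^ (-(n * (ε / 2))) := by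
              rw [← Real.rpow_mul_natCast hN0.le]; congr 1; ring
            rw [e1, mul_pow, e2, div_pow]
            field_simp
        _ ≤ _ := by
            gcongr
    exact le_of_mul_le_mul_left m4 (by positivity)
  -- the net
  obtain ⟨F, hFD, hFcard, hFnet⟩ := exists_finset_net Z hZ (N ^ 4)
    (by have : 0 < N := by exact_mod_cast hN0
        positivity) D fun z hz => (hD z hz).2
  have hFc : (F.card : ℝ) ≤ (2 * Z + 3) ^ 2 * N ^ 8 := by
    refine hFcard.trans ?_
    have : (1 : ℝ) ≤ N ^ 4 := one_le_pow₀ hN1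
    push_cast
    calc (2 * (Z + 1) * (N : ℝ) ^ 4 + 1) ^ 2 ≤ (2 * (Z + 1) * (N : ℝ) ^ 4 + N ^ 4) ^ 2 := by
          gcongr
      _ = _ := by ring
  have hsub : {ω | ∃ z ∈ D, ∃ i j, ρ ≤ ‖residual ξ z (green (fun a => x a ω) z) i j‖} ⊆
      {ω | ∃ a, trunc T (x a ω) ≠ x a ω} ∪ ⋃ w ∈ F, ⋃ i : Fin N, ⋃ j : Fin N,
        {ω | ρ / 2 ≤ ‖residual ξ w (green (fun a => y a ω) w) i j‖} := by
    rintro ω ⟨z, hz, i, j, hω⟩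
    by_cases hxy : ∃ a, trunc T (x a ω) ≠ x a ω
    · exact Or.inl hxy
    · push Not at hxy
      obtain ⟨w, hwF, hzw⟩ := hFnet z hz
      refine Or.inr ?_
      simp only [Set.mem_iUnion]
      refine ⟨w, hwF, i, j, ?_⟩
      have e1 : (fun a => y a ω) = fun a => x a ω := funext fun a => hxy a
      have l1 := hlip N ξ hker.abs_le z w (hD z hz).1 (hD w (hFD hwF)).1 (hD w (hFD hwF)).2
        (fun a => x a ω) i j
      have l2 : L * (N : ℝ) ^ 3 * ‖z - w‖ ≤ ρ / 2 := by
        have s1 : √(N : ℝ) * √N = N := Real.mul_self_sqrt hN0.le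
        have s2 : 4 * L ≤ √N := Real.le_sqrt_of_sq_le c1
        have s0 : 0 < √(N : ℝ) := Real.sqrt_pos.2 hN0
        have s3 : 1 / √N ≤ ρ := by
          rw [hρ, Real.sqrt_eq_rpow, one_div, ← Real.rpow_neg hN0.le]
          exact Real.rpow_le_rpow_of_exponent_le hN1 (by linarith [hτ.2])
        calc L * (N : ℝ) ^ 3 * ‖z - w‖ ≤ L * (N : ℝ) ^ 3 * (2 / (N ^ 4 : ℕ)) := by gcongr
          _ = 4 * L / N / 2 := by push_cast; field_simp; ring
          _ ≤ √N / N / 2 := by gcongr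
          _ = 1 / √N / 2 := by
              congr 1
              rw [div_eq_div_iff hN0.ne' s0.ne', s1, one_mul]
          _ ≤ _ := by gcongr
      have l3 := norm_sub_norm_le (residual ξ z (green (fun a => x a ω) z) i j)
        (residual ξ w (green (fun a => x a ω) w) i j)
      rw [Set.mem_ofPred_eq, e1]
      linarith
  refine (measureReal_mono hsub).trans ((measureReal_union_le _ _).trans ?_)
  have u1 := measureReal_trunc_ne_le (P := P) hT0 (fun a => (hm p (by omega) a).1) hmT ht0
  have u2 : P.real (⋃ w ∈ F, ⋃ i : Fin N, ⋃ j : Fin N,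
      {ω | ρ / 2 ≤ ‖residual ξ w (green (fun a => y a ω) w) i j‖}) ≤
      F.card * (N * (N * (C * 2 ^ n * (N : ℝ) ^ (-(A + 11))))) := by
    refine (measureReal_biUnion_finset_le _ _).trans ((Finset.sum_le_sum fun w hw =>
      (measureReal_iUnion_fintype_le _).trans (Finset.sum_le_sum fun i _ =>
        (measureReal_iUnion_fintype_le _).trans (Finset.sum_le_sum fun j _ =>
          hmark w (hFD hw) i j))).trans_eq ?_)
    simp
  have e11 : (N : ℝ) ^ (-(A + 11)) = (N : ℝ) ^ (-A) * (1 / N ^ 11) := by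
    rw [neg_add, Real.rpow_add hN0, Real.rpow_neg hN0.le 11, one_div]
    congr 2
    exact_mod_cast Real.rpow_natCast (N : ℝ) 11
  have e3 : (N : ℝ) ^ (-(A + 3)) = (N : ℝ) ^ (-A) * (1 / N ^ 3) := by
    rw [neg_add, Real.rpow_add hN0, Real.rpow_neg hN0.le 3, one_div]
    congr 2
    exact_mod_cast Real.rpow_natCast (N : ℝ) 3
  calc _ ≤ (N : ℝ) ^ 2 * (b * (N : ℝ) ^ (-(A + 3))) +
        ((2 * Z + 3) ^ 2 * N ^ 8) * (N * (N * (C * 2 ^ n * (N : ℝ) ^ (-(A + 11))))) := by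
        refine add_le_add (u1.trans (by gcongr)) (u2.trans ?_)
        gcongr
    _ = ((2 * Z + 3) ^ 2 * (C * 2 ^ n) + b) * (1 / N) * (N : ℝ) ^ (-A) := by
        rw [e11, e3]; field_simp; ring
    _ ≤ N * (1 / N) * (N : ℝ) ^ (-A) := by gcongr
    _ = _ := by field_simp

/-! ### From the residual to the law for the finite equation. -/

theorem eventually_le_rpow {a : ℝ} (ha : 0 < a) (b : ℝ) :
    ∀ᶠ N : ℕ in Filter.atTop, b ≤ (N : ℝ) ^ a :=
  ((tendsto_rpow_atTop ha).comp tendsto_natCast_atTop_atTop).eventually_ge_atTop b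

/-- With very high probability the Green's function is close to approximate solutions of the
self-consistent equation, uniformly in the spectral parameter. -/
theorem exists_green_prob_le {η : ℝ} (hη : 0 < η) (Z c τ ν A b : ℝ) (hZ : 0 ≤ Z)
    (hc : 0 ≤ c) (hτ : τ ∈ Set.Ioc (0 : ℝ) 1) (hν : 0 < ν) (hA : 0 ≤ A) (hb : 0 ≤ b)
    (K : ℕ) (μ : ℕ → ℝ) :
    ∃ N₀ : ℕ, ∀ N ≥ N₀, ∀ (D : Set ℂ), (∀ z ∈ D, η ≤ z.im ∧ ‖z‖ ≤ Z) →
      ∀ (Ω : Type*) [MeasurableSpace Ω] (P : Measure Ω) [IsProbabilityMeasure P]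
      (x : UpperIndex N → Ω → ℝ), IsArray K c P x → HasMoments τ μ P x →
      ∀ M : ℂ → Matrix (Fin N) (Fin N) ℂ,
      (∀ z ∈ D, IsApproxSolution (covTensor P x) z (b / √N) (M z)) →
      P.real {ω | ∃ z ∈ D, ∃ i j, (N : ℝ) ^ (ν - τ / 2) ≤
        ‖green (fun a => x a ω) z i j - M z i j‖} ≤ (N : ℝ) ^ (-A) := by
  obtain ⟨C, hC, hclose⟩ := exists_close_of_residual hη Z c hZ hc K
  have hτ0 := hτ.1
  -- The bound $\tau/4$ forces the residual to tend to zero so that stability applies; the bound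
  -- $\nu/2$ leaves a factor $N^{\nu/2}$ to absorb constants.
  set ε : ℝ := min (ν / 2) (τ / 4) with hε
  have hε0 : 0 < ε := lt_min (by linarith) (by linarith)
  have hεν : ε ≤ ν / 2 := min_le_left _ _
  have hετ : ε ≤ τ / 4 := min_le_right _ _
  obtain ⟨N₁, h₁⟩ := exists_residual_prob_le hη Z c τ ε A hZ hc hτ hε0 (by linarith) hA K μ
  obtain ⟨N₂, h₂⟩ := Filter.eventually_atTop.1
    ((eventually_le_rpow (show 0 < τ / 4 by linarith) C).and
    ((eventually_le_rpow (show 0 < ν / 2 by linarith) (C * (1 + b) + 1)).and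
    ((eventually_le_rpow (show (0 : ℝ) < 1 / 2 by norm_num) (2 * b / η)).and
      (Filter.eventually_ge_atTop 1))))
  refine ⟨max N₁ N₂, fun N hN D hD Ω _ P _ x hx hm M hM => ?_⟩
  obtain ⟨e1, e2, e3, hN1⟩ := h₂ N ((le_max_right _ _).trans hN)
  have hN1' : (1 : ℝ) ≤ N := by exact_mod_cast hN1
  have hN0 : (0 : ℝ) < N := by linarith
  refine (measureReal_mono ?_).trans (h₁ N ((le_max_left _ _).trans hN) D hD Ω P x hx hm)
  rintro ω ⟨z, hz, i, j, hω⟩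
  refine ⟨z, hz, ?_⟩
  by_contra hcon
  push Not at hcon
  rw [← Real.sqrt_eq_rpow, div_le_iff₀ hη] at e3
  have hs : 0 < √(N : ℝ) := Real.sqrt_pos.2 hN0
  have hr : C * (N : ℝ) ^ (ε - τ / 2) ≤ 1 := by
    calc C * (N : ℝ) ^ (ε - τ / 2) ≤ (N : ℝ) ^ (τ / 4) * (N : ℝ) ^ (ε - τ / 2) := by gcongr
      _ = (N : ℝ) ^ (τ / 4 + (ε - τ / 2)) := (Real.rpow_add hN0 _ _).symm
      _ ≤ 1 := Real.rpow_le_one_of_one_le_of_nonpos hN1' (by linarith)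
  have hδ : b / √N ≤ η / 2 := by
    rw [div_le_iff₀ hs]; linarith
  have hfin := hclose N _ (hx.isKernel hc) z (hD z hz).1 (hD z hz).2 _ _ (by positivity)
    (by positivity) hr hδ _ _ (isDissipativeInverse_green hη (hD z hz).1 fun a => x a ω)
    (fun i j => (hcon i j).le) (hM z hz) i j
  have hs2 : b / √N ≤ b * (N : ℝ) ^ (ε - τ / 2) := by
    rw [div_eq_mul_inv, Real.sqrt_eq_rpow, ← Real.rpow_neg hN0.le]
    gcongr
    linarith [hτ.2]
  have hlt : C * ((N : ℝ) ^ (ε - τ / 2) + b / √N) < (N : ℝ) ^ (ν - τ / 2) := by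
    calc C * ((N : ℝ) ^ (ε - τ / 2) + b / √N)
        ≤ C * ((N : ℝ) ^ (ε - τ / 2) + b * (N : ℝ) ^ (ε - τ / 2)) := by gcongr
      _ = C * (1 + b) * (N : ℝ) ^ (ε - τ / 2) := by ring
      _ < (N : ℝ) ^ (ν / 2) * (N : ℝ) ^ (ε - τ / 2) := by
          gcongr
          linarith
      _ = (N : ℝ) ^ (ν / 2 + (ε - τ / 2)) := (Real.rpow_add hN0 _ _).symm
      _ ≤ _ := Real.rpow_le_rpow_of_exponent_le hN1' (by linarith)
  linarith

theorem CorrelatedModel.isArray {K : ℕ} {τ : ℝ} {μ : ℕ → ℝ} {ψ : ℝ → ℝ → ℤ → ℤ → ℝ} {C : ℝ}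
    (X : CorrelatedModel K τ μ ψ C) (N : ℕ) : IsArray K (μ 2 ^ 2) (X.P N) (X.x N) :=
  ⟨X.measurable_x N, X.kDependent N, X.centered N, fun a => (X.moments 2 le_rfl N a).1,
    fun a => by simpa using (X.moments 2 le_rfl N a).2⟩

theorem CorrelatedModel.hasMoments {K : ℕ} {τ : ℝ} {μ : ℕ → ℝ} {ψ : ℝ → ℝ → ℤ → ℤ → ℝ} {C : ℝ}
    (X : CorrelatedModel K τ μ ψ C) (N : ℕ) : HasMoments τ μ (X.P N) (X.x N) :=
  fun p hp a => X.moments p hp N a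

theorem exists_bounds_of_isCompact_closure {D : Set ℂ} (hDc : IsCompact (closure D))
    (hD : closure D ⊆ {z : ℂ | 0 < z.im}) :
    ∃ η Z : ℝ, 0 < η ∧ 0 ≤ Z ∧ ∀ z ∈ D, η ≤ z.im ∧ ‖z‖ ≤ Z := by
  obtain ⟨η, hη, h1⟩ := hDc.exists_forall_le' Complex.continuous_im.continuousOn
    (a := 0) fun z hz => hD hz
  obtain ⟨Z, hZ⟩ := hDc.isBounded.exists_norm_le
  exact ⟨η, max Z 0, hη, le_max_right _ _, fun z hz =>
    ⟨h1 z (subset_closure hz), (hZ z (subset_closure hz)).trans (le_max_left _ _)⟩⟩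

/-- At fixed distance from the real axis the sparsity term alone is a sufficient yardstick, since
$\tau\le1$; the term in $\operatorname{Im}z$ can be discarded. -/
theorem rpow_le_controlPhi {τ : ℝ} {N : ℕ} (hN : 0 < N) (z : ℂ) :
    (N : ℝ) ^ (-(τ / 2)) ≤ controlPhi τ N z := by
  have hN0 : (0 : ℝ) < N := by exact_mod_cast hN
  have h1 : 1 / √((N : ℝ) ^ τ) = (N : ℝ) ^ (-(τ / 2)) := by
    rw [Real.sqrt_eq_rpow, ← Real.rpow_mul hN0.le, one_div, ← Real.rpow_neg hN0.le]
    congr 1; ring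
  rw [controlPhi, h1]
  exact le_add_of_nonneg_left (by positivity)

theorem rpow_le_of_lt_div_controlPhi {τ ν a : ℝ} {N : ℕ} (hN : 0 < N) {z : ℂ}
    (h : ENNReal.ofReal ((N : ℝ) ^ ν) < ENNReal.ofReal (a / controlPhi τ N z)) :
    (N : ℝ) ^ (ν - τ / 2) ≤ a := by
  have hN0 : (0 : ℝ) < N := by exact_mod_cast hN
  have h1 := rpow_le_controlPhi (τ := τ) hN z
  have h0 : 0 < (N : ℝ) ^ (-(τ / 2)) := by positivity
  have h2 := (ENNReal.ofReal_lt_ofReal_iff_of_nonneg (by positivity)).1 h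
  rw [lt_div_iff₀ (h0.trans_le h1)] at h2
  calc (N : ℝ) ^ (ν - τ / 2) = (N : ℝ) ^ ν * (N : ℝ) ^ (-(τ / 2)) := by
        rw [← Real.rpow_add hN0, sub_eq_add_neg]
    _ ≤ (N : ℝ) ^ ν * controlPhi τ N z := by gcongr
    _ ≤ a := h2.le

/-- A supremum that is at least $N^\nu$ need not be attained. Lowering the exponent makes the
inequality strict, so that some point witnesses it. -/
theorem ofReal_rpow_half_lt {N : ℕ} (hN : 2 ≤ N) {ν : ℝ} (hν : 0 < ν) :
    ENNReal.ofReal ((N : ℝ) ^ (ν / 2)) < ENNReal.ofReal ((N : ℝ) ^ ν) := by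
  have hN1 : (1 : ℝ) < N := by exact_mod_cast hN
  have hN0 : (0 : ℝ) < N := by linarith
  exact (ENNReal.ofReal_lt_ofReal_iff (by positivity)).2
    (Real.rpow_lt_rpow_of_exponent_lt hN1 (by linarith))

theorem measure_le_ofReal_of_subset {Ω : Type*} [MeasurableSpace Ω] {P : Measure Ω}
    [IsProbabilityMeasure P] {S T : Set Ω} {a : ℝ} (hST : S ⊆ T) (h : P.real T ≤ a) :
    P S ≤ ENNReal.ofReal a := by
  refine (measure_mono hST).trans ?_
  rw [← ofReal_measureReal]
  exact ENNReal.ofReal_le_ofReal h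

theorem finite_law {K : ℕ} {τ : ℝ} (hτ : τ ∈ Set.Ioc (0 : ℝ) 1) (μ : ℕ → ℝ)
    {D : Set ℂ} (hDc : IsCompact (closure D)) (hD : closure D ⊆ {z : ℂ | 0 < z.im})
    {ν : ℝ} (hν : 0 < ν) (p : ℕ) : ∃ N₀ : ℕ,
      ∀ (ψ : ℝ → ℝ → ℤ → ℤ → ℝ) (C : ℝ) (X : CorrelatedModel K τ μ ψ C),
      ∀ N ≥ N₀, ∀ M : ℂ → Matrix (Fin N) (Fin N) ℂ,
        (∀ z ∈ D, SolvesFinite (covTensor (X.P N) (X.x N)) z (M z)) →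
        X.P N {ω | ENNReal.ofReal ((N : ℝ) ^ ν) ≤ ⨆ z ∈ D, ⨆ i : Fin N, ⨆ j : Fin N,
            ENNReal.ofReal
              (‖green (fun a => X.x N a ω) z i j - M z i j‖ / controlPhi τ N z)}
          ≤ ENNReal.ofReal ((N : ℝ) ^ (-(ν * (p : ℝ)))) := by
  obtain ⟨η, Z, hη, hZ, hDb⟩ := exists_bounds_of_isCompact_closure hDc hD
  obtain ⟨N₁, h₁⟩ := exists_green_prob_le hη Z (μ 2 ^ 2) τ (ν / 2) (ν * p) 0 hZ (sq_nonneg _) hτ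
    (by linarith) (by positivity) le_rfl K μ
  refine ⟨max N₁ 2, fun ψ C X N hN M hM => ?_⟩
  have hN2 : 2 ≤ N := (le_max_right _ _).trans hN
  have := X.isProb N
  refine measure_le_ofReal_of_subset ?_ (h₁ N ((le_max_left _ _).trans hN) D hDb (X.Ω N) (X.P N)
    (X.x N) (X.isArray N) (X.hasMoments N) M fun z hz => by
      simpa using (hM z hz).isApproxSolution)
  intro ω hω
  have h2 := (ofReal_rpow_half_lt hN2 hν).trans_le hω
  simp only [lt_iSup_iff] at h2
  obtain ⟨z, hz, i, j, h3⟩ := h2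
  exact ⟨z, hz, i, j, rpow_le_of_lt_div_controlPhi (by omega) h3⟩

/-! ### Properties of the profile -/

/-- The interval between `θ` and `θ'` contains no point of `E`. -/
def Avoids (E : Finset ℝ) (θ θ' : ℝ) : Prop := ∀ e ∈ E, e ∉ Set.uIcc θ θ'

/-- The distance from `θ` to `E` is larger than `r`. -/
def Far (E : Finset ℝ) (r θ : ℝ) : Prop := ∀ e ∈ E, r < |θ - e|

theorem Far.avoids {E : Finset ℝ} {r θ θ' : ℝ} (h : Far E r θ) (h' : |θ' - θ| ≤ r) :
    Avoids E θ θ' := fun e he hm => by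
  have h1 := Set.abs_sub_left_of_mem_uIcc hm
  rw [abs_sub_comm] at h1
  linarith [h e he]

theorem Far.of_abs_sub_le {E : Finset ℝ} {r d θ θ' : ℝ} (h : Far E r θ) (h' : |θ' - θ| ≤ d) :
    Far E (r - d) θ' := fun e he => by
  have h1 := abs_sub_abs_le_abs_sub (θ - e) (θ' - e)
  rw [sub_sub_sub_cancel_right, abs_sub_comm θ θ'] at h1
  linarith [h e he]

theorem Far.mono {E : Finset ℝ} {r r' θ : ℝ} (h : Far E r θ) (h' : r' ≤ r) : Far E r' θ :=
  fun e he => h'.trans_lt (h e he)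

theorem exists_far {E : Finset ℝ} {θ : ℝ} (h : θ ∉ E) : ∃ r, 0 < r ∧ Far E r θ := by
  have ho : IsOpen ((↑E : Set ℝ)ᶜ) := E.finite_toSet.isClosed.isOpen_compl
  obtain ⟨r, hr, hs⟩ := Metric.isOpen_iff.1 ho θ (by simpa using h)
  refine ⟨r / 2, half_pos hr, fun e he => ?_⟩
  by_contra h'
  have hm : e ∈ Metric.ball θ r := by
    rw [Metric.mem_ball, Real.dist_eq, abs_sub_comm]
    linarith
  exact hs hm he

theorem Far.notMem {E : Finset ℝ} {r θ : ℝ} (hr : 0 ≤ r) (h : Far E r θ) : θ ∉ E := fun he => by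
  have := h θ he
  simp at this
  linarith

/-- The profile is Lipschitz away from a finite set of break points. -/
structure IsLipschitzProfile (E : Finset ℝ) (L : ℤ → ℤ → ℝ) (ψ : ℝ → ℝ → ℤ → ℤ → ℝ) : Prop where
  zero_mem : 0 ∈ E
  one_mem : 1 ∈ E
  nonneg : ∀ k l, 0 ≤ L k l
  abs_sub_le : ∀ θ ∈ Set.Ico (0 : ℝ) 1, ∀ θ' ∈ Set.Ico (0 : ℝ) 1, ∀ φ ∈ Set.Ico (0 : ℝ) 1,
    ∀ φ' ∈ Set.Ico (0 : ℝ) 1, Avoids E θ θ' → Avoids E φ φ' → ∀ k l,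
      |ψ θ φ k l - ψ θ' φ' k l| ≤ L k l * (|θ - θ'| + |φ - φ'|)

/-- If $\theta<\theta'$ lie in different pieces, the supremum of the piece containing $\theta$ lies
between them. Avoiding all these suprema therefore forces both points into one piece. -/
theorem IsProfile.exists_isLipschitzProfile {ψ : ℝ → ℝ → ℤ → ℤ → ℝ} (h : IsProfile ψ) :
    ∃ E L, IsLipschitzProfile E L ψ := by
  classical
  obtain ⟨n, I, hI, -, hU, hL⟩ := h.piecewise_lipschitz
  choose Lc hLc using hL
  set E : Finset ℝ := insert 0 (insert 1 (Finset.univ.image fun α => sSup (I α))) with hE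
  have hsub : ∀ α, I α ⊆ Set.Ico 0 1 := fun α => hU ▸ Set.subset_iUnion I α
  have aux : ∀ θ ∈ Set.Ico (0 : ℝ) 1, ∀ θ' ∈ Set.Ico (0 : ℝ) 1, θ ≤ θ' → Avoids E θ θ' →
      ∃ α, θ ∈ I α ∧ θ' ∈ I α := by
    intro θ hθ θ' hθ' hle ha
    rw [← hU] at hθ
    obtain ⟨α, hα⟩ := Set.mem_iUnion.1 hθ
    refine ⟨α, hα, ?_⟩
    by_contra hn
    have hb : ∀ y ∈ I α, y ≤ θ' := fun y hy => by
      by_contra hy'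
      exact hn ((hI α).out hα hy ⟨hle, (not_le.1 hy').le⟩)
    refine ha (sSup (I α)) (by simp [hE]) ?_
    rw [Set.uIcc_of_le hle]
    exact ⟨le_csSup ⟨θ', hb⟩ hα, csSup_le ⟨θ, hα⟩ hb⟩
  have same : ∀ θ ∈ Set.Ico (0 : ℝ) 1, ∀ θ' ∈ Set.Ico (0 : ℝ) 1, Avoids E θ θ' →
      ∃ α, θ ∈ I α ∧ θ' ∈ I α := by
    intro θ hθ θ' hθ' ha
    rcases le_total θ θ' with hle | hle
    · exact aux θ hθ θ' hθ' hle ha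
    · obtain ⟨α, h1, h2⟩ := aux θ' hθ' θ hθ hle fun e he => by
        rw [Set.uIcc_comm]; exact ha e he
      exact ⟨α, h2, h1⟩
  refine ⟨E, fun k l => ∑ α, ∑ β, (Lc α β k l : ℝ), by simp [hE], by simp [hE],
    fun k l => by positivity, ?_⟩
  intro θ hθ θ' hθ' φ hφ φ' hφ' ha hb k l
  obtain ⟨α, h1, h2⟩ := same θ hθ θ' hθ' ha
  obtain ⟨β, h3, h4⟩ := same φ hφ φ' hφ' hb
  have h5 := (hLc α β k l).dist_le_mul (θ, φ) ⟨h1, h3⟩ (θ', φ') ⟨h2, h4⟩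
  rw [Real.dist_eq, Prod.dist_eq, Real.dist_eq, Real.dist_eq] at h5
  refine h5.trans ?_
  have h6 : (Lc α β k l : ℝ) ≤ ∑ α, ∑ β, (Lc α β k l : ℝ) :=
    (Finset.single_le_sum (f := fun β => (Lc α β k l : ℝ)) (fun _ _ => by positivity)
      (Finset.mem_univ β)).trans
    (Finset.single_le_sum (f := fun α => ∑ β, (Lc α β k l : ℝ)) (fun _ _ => by positivity)
      (Finset.mem_univ α))
  gcongr
  exact max_le_add_of_nonneg (abs_nonneg _) (abs_nonneg _)

theorem IsLipschitzProfile.not_nearDiscontinuity {E : Finset ℝ} {L : ℤ → ℤ → ℝ}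
    {ψ : ℝ → ℝ → ℤ → ℤ → ℝ} (h : IsLipschitzProfile E L ψ) {r a b : ℝ} (ha : Far E r a)
    (hb : Far E r b) (k l : ℤ) : ¬ NearDiscontinuity (fun p => ψ p.1 p.2 k l) r a b := by
  rintro ⟨θ, hθ, φ, hφ, hc, h1, h2⟩
  rw [abs_sub_comm] at h1 h2
  have hθE : θ ∉ E := (ha.of_abs_sub_le h1).notMem (by simp)
  have hφE : φ ∉ E := (hb.of_abs_sub_le h2).notMem (by simp)
  obtain ⟨r₁, hr₁, f₁⟩ := exists_far hθE
  obtain ⟨r₂, hr₂, f₂⟩ := exists_far hφE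
  refine hc (Metric.continuousWithinAt_iff.2 fun ε hε => ?_)
  have hL := h.nonneg k l
  have hL' : 0 < 2 * L k l + 1 := by linarith
  refine ⟨min (min r₁ r₂) (ε / (2 * L k l + 1)), lt_min (lt_min hr₁ hr₂) (by positivity), ?_⟩
  rintro ⟨θ', φ'⟩ ⟨hθ', hφ'⟩ hd
  rw [Prod.dist_eq, max_lt_iff, Real.dist_eq, Real.dist_eq, lt_min_iff, lt_min_iff, lt_min_iff,
    lt_min_iff] at hd
  obtain ⟨⟨⟨d1, -⟩, d2⟩, ⟨-, d3⟩, d4⟩ := hd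
  simp only at d1 d2 d3 d4
  have h3 := h.abs_sub_le θ hθ θ' hθ' φ hφ φ' hφ' (f₁.avoids d1.le) (f₂.avoids d3.le) k l
  rw [Real.dist_eq, abs_sub_comm]
  refine h3.trans_lt ?_
  rw [abs_sub_comm θ, abs_sub_comm φ]
  rw [lt_div_iff₀ hL'] at d2 d4
  nlinarith [abs_nonneg (θ' - θ), abs_nonneg (φ' - φ)]

theorem IsLipschitzProfile.abs_sub_le_of_isDiscretization {E : Finset ℝ} {L : ℤ → ℤ → ℝ}
    {ψ : ℝ → ℝ → ℤ → ℤ → ℝ} (h : IsLipschitzProfile E L ψ) {N K : ℕ} {C : ℝ}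
    {ξ : Fin N → Fin N → Fin N → Fin N → ℝ} (hξ : IsDiscretization K C ψ ξ) {i j k l : Fin N}
    (hij : i ≤ j) (hkl : k ≤ l) {d θ φ : ℝ} (hθ : θ ∈ Set.Ico (0 : ℝ) 1)
    (hφ : φ ∈ Set.Ico (0 : ℝ) 1) (fθ : Far E (d + K / N) θ) (fφ : Far E (d + K / N) φ)
    (dθ : |gridPoint i - θ| ≤ d) (dφ : |gridPoint j - φ| ≤ d) :
    |ξ i j k l - ψ θ φ (((k : ℕ) : ℤ) - ((i : ℕ) : ℤ)) (((l : ℕ) : ℤ) - ((j : ℕ) : ℤ))| ≤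
      C / N + L (((k : ℕ) : ℤ) - ((i : ℕ) : ℤ)) (((l : ℕ) : ℤ) - ((j : ℕ) : ℤ)) * (d + d) := by
  have hKN : (0 : ℝ) ≤ K / N := by positivity
  have hgp : ∀ (i : Fin N) (θ : ℝ), θ ∈ Set.Ico (0 : ℝ) 1 → Far E (d + K / N) θ →
      |gridPoint i - θ| ≤ d → gridPoint i ∈ Set.Ico (0 : ℝ) 1 := fun i θ hθ fθ dθ => by
    have h1 := fθ 1 h.one_mem
    rw [abs_sub_comm, abs_of_pos (by linarith [hθ.2])] at h1
    refine ⟨by unfold gridPoint; positivity, ?_⟩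
    linarith [(abs_le.1 dθ).2]
  have h1 := hgp i θ hθ fθ dθ
  have h2 := hgp j φ hφ fφ dφ
  have h3 := hξ i j k l hij hkl h1.2 h2.2 (h.not_nearDiscontinuity
    ((fθ.of_abs_sub_le dθ).mono (by linarith)) ((fφ.of_abs_sub_le dφ).mono (by linarith)) _ _)
  have h4 := h.abs_sub_le θ hθ _ h1 φ hφ _ h2 (fθ.avoids (dθ.trans (by linarith)))
    (fφ.avoids (dφ.trans (by linarith))) (((k : ℕ) : ℤ) - ((i : ℕ) : ℤ))
    (((l : ℕ) : ℤ) - ((j : ℕ) : ℤ))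
  rw [abs_sub_comm θ, abs_sub_comm φ, abs_sub_comm (ψ θ _ _ _)] at h4
  have h5 := mul_le_mul_of_nonneg_left (add_le_add dθ dφ) (h.nonneg
    (((k : ℕ) : ℤ) - ((i : ℕ) : ℤ)) (((l : ℕ) : ℤ) - ((j : ℕ) : ℤ)))
  have h6 := _root_.abs_sub_le (ξ i j k l) (ψ (gridPoint i) (gridPoint j)
    (((k : ℕ) : ℤ) - ((i : ℕ) : ℤ)) (((l : ℕ) : ℤ) - ((j : ℕ) : ℤ)))
    (ψ θ φ (((k : ℕ) : ℤ) - ((i : ℕ) : ℤ)) (((l : ℕ) : ℤ) - ((j : ℕ) : ℤ)))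
  linarith

/-- The profile at two distinct points is the limit of covariance kernels. -/
theorem IsLipschitzProfile.exists_approx {E : Finset ℝ} {L : ℤ → ℤ → ℝ}
    {ψ : ℝ → ℝ → ℤ → ℤ → ℝ} (h : IsLipschitzProfile E L ψ) {K : ℕ} {c C : ℝ}
    {ξ : ∀ N, Fin N → Fin N → Fin N → Fin N → ℝ} (hker : ∀ N, IsKernel K c (ξ N))
    (hdis : ∀ N, IsDiscretization K C ψ (ξ N)) {θ φ : ℝ} (hθ : θ ∈ Set.Ico (0 : ℝ) 1)
    (hφ : φ ∈ Set.Ico (0 : ℝ) 1) (hθE : θ ∉ E) (hφE : φ ∉ E) (hθφ : θ < φ) (R : ℕ) {ε : ℝ}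
    (hε : 0 < ε) :
    ∃ ζ : ℕ → ℕ → ℕ → ℕ → ℝ, IsGram ζ ∧ (∀ a b a' b', |ζ a b a' b'| ≤ c) ∧
      ∀ a ≤ R, ∀ b ≤ R, ∀ a' ≤ R, ∀ b' ≤ R,
        |ζ a b a' b' - ψ θ φ ((a' : ℤ) - a) ((b' : ℤ) - b)| ≤ ε ∧
        ((K : ℤ) < |(a' : ℤ) - a| ∨ (K : ℤ) < |(b' : ℤ) - b| → ζ a b a' b' = 0) := by
  obtain ⟨r₁, hr₁, f₁⟩ := exists_far hθE
  obtain ⟨r₂, hr₂, f₂⟩ := exists_far hφE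
  set r := min (min r₁ r₂) (φ - θ) with hr
  have hr0 : 0 < r := lt_min (lt_min hr₁ hr₂) (by linarith)
  have g₁ : Far E r θ := f₁.mono ((min_le_left _ _).trans (min_le_left _ _))
  have g₂ : Far E r φ := f₂.mono ((min_le_left _ _).trans (min_le_right _ _))
  have hrd : r ≤ φ - θ := min_le_right _ _
  set Lm : ℝ := ∑ k ∈ Finset.Icc (-(R : ℤ)) R, ∑ l ∈ Finset.Icc (-(R : ℤ)) R, L k l with hLm
  have hLm0 : 0 ≤ Lm := Finset.sum_nonneg fun k _ => Finset.sum_nonneg fun l _ => h.nonneg k l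
  have hLle : ∀ k l : ℤ, |k| ≤ R → |l| ≤ R → L k l ≤ Lm := fun k l hk hl =>
    (Finset.single_le_sum (f := fun l => L k l) (fun l _ => h.nonneg k l)
      (Finset.mem_Icc.2 (abs_le.1 hl))).trans
    (Finset.single_le_sum (f := fun k => ∑ l ∈ Finset.Icc (-(R : ℤ)) R, L k l)
      (fun k _ => Finset.sum_nonneg fun l _ => h.nonneg k l) (Finset.mem_Icc.2 (abs_le.1 hk)))
  -- The three summands ensure in turn that the window of indices stays within distance `r` of the
  -- points, that $C/N\le\varepsilon/2$, and that the Lipschitz error is at most $\varepsilon/2$.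
  obtain ⟨N, hN⟩ := exists_nat_gt ((R + 2 + K) / r + 2 * |C| / ε + 4 * (Lm * (R + 2)) / ε)
  have t1 : (0 : ℝ) ≤ (R + 2 + K) / r := by positivity
  have t2 : 0 ≤ 2 * |C| / ε := by positivity
  have t3 : 0 ≤ 4 * (Lm * (R + 2)) / ε := by positivity
  have hN0 : (0 : ℝ) < N := by linarith
  have n1 : (R + 2 + K : ℝ) / N ≤ r := by
    rw [div_le_iff₀ hN0, mul_comm, ← div_le_iff₀ hr0]; linarith
  have n2 : C / N ≤ ε / 2 := by
    have : 2 * |C| ≤ N * ε := by rw [← div_le_iff₀ hε]; linarith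
    rw [div_le_iff₀ hN0]
    nlinarith [le_abs_self C]
  set d : ℝ := (R + 2) / N with hd
  have hd0 : 0 ≤ d := by positivity
  have n3 : Lm * (d + d) ≤ ε / 2 := by
    have : 4 * (Lm * (R + 2)) ≤ N * ε := by rw [← div_le_iff₀ hε]; linarith
    rw [hd, show Lm * ((R + 2 : ℝ) / N + (R + 2) / N) = 2 * (Lm * (R + 2)) / N by ring,
      div_le_iff₀ hN0]
    linarith
  have n4 : d + K / N ≤ r := by rw [hd, ← add_div]; exact n1
  have hdr : d ≤ r := le_trans (le_add_of_nonneg_right (by positivity)) n4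
  -- the index near a point of the unit interval
  set I : ℝ → ℕ → Fin N := fun t a => ⟨min (⌊t * N⌋₊ + a) (N - 1), by
    have : 0 < N := by exact_mod_cast hN0
    omega⟩ with hI
  -- The minimum in `I` is a default that keeps the index in range; it is inactive for the points
  -- and shifts considered, since they stay away from the break point $1$.
  have hIv : ∀ t ∈ Set.Ico (0 : ℝ) 1, Far E r t → ∀ a ≤ R, ((I t a : Fin N) : ℕ) = ⌊t * N⌋₊ + a := by
    intro t ht ft a ha
    have h1 := ft 1 h.one_mem
    rw [abs_sub_comm, abs_of_pos (by linarith [ht.2])] at h1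
    have h2 : (⌊t * N⌋₊ : ℝ) ≤ t * N := Nat.floor_le (by have := ht.1; positivity)
    have h3 : (a : ℝ) ≤ R := by exact_mod_cast ha
    have h4 : d * N = R + 2 := by rw [hd]; field_simp
    have h5 : (⌊t * N⌋₊ : ℝ) + a + 1 < N := by nlinarith
    have h6 : ⌊t * N⌋₊ + a + 1 < N := by exact_mod_cast h5
    simp only [hI]
    omega
  have hgp : ∀ t ∈ Set.Ico (0 : ℝ) 1, Far E r t → ∀ a ≤ R, |gridPoint (I t a) - t| ≤ d := by
    intro t ht ft a ha
    have h2 : (⌊t * N⌋₊ : ℝ) ≤ t * N := Nat.floor_le (by have := ht.1; positivity)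
    have h2' : t * N < ⌊t * N⌋₊ + 1 := Nat.lt_floor_add_one _
    have h3 : (a : ℝ) ≤ R := by exact_mod_cast ha
    have h3' : (0 : ℝ) ≤ a := by positivity
    rw [gridPoint, hIv t ht ft a ha]
    have h4 : ((⌊t * N⌋₊ + a : ℕ) + 1 : ℝ) / N - t = (⌊t * N⌋₊ + a + 1 - t * N) / N := by
      push_cast; field_simp
    rw [h4, hd, abs_div, Nat.abs_cast]
    gcongr
    rw [abs_le]
    constructor <;> linarith
  obtain ⟨m, B, hB⟩ := (hker N).gram
  refine ⟨fun a b a' b' => ξ N (I θ a) (I φ b) (I θ a') (I φ b'),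
    ⟨m, fun s a b => B s (I θ a) (I φ b), fun a b a' b' => hB _ _ _ _⟩,
    fun a b a' b' => (hker N).abs_le _ _ _ _, fun a ha b hb a' ha' b' hb' => ?_⟩
  have hle : ∀ a ≤ R, ∀ b ≤ R, I θ a ≤ I φ b := by
    intro a ha b hb
    rw [Fin.le_def, hIv θ hθ g₁ a ha, hIv φ hφ g₂ b hb]
    have h2 : (⌊θ * N⌋₊ : ℝ) ≤ θ * N := Nat.floor_le (by have := hθ.1; positivity)
    have h2' : φ * N < ⌊φ * N⌋₊ + 1 := Nat.lt_floor_add_one _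
    have h3 : (a : ℝ) ≤ R := by exact_mod_cast ha
    have h4 : d * N = R + 2 := by rw [hd]; field_simp
    have h5 : (⌊θ * N⌋₊ : ℝ) + a ≤ ⌊φ * N⌋₊ := by nlinarith
    have h6 : ⌊θ * N⌋₊ + a ≤ ⌊φ * N⌋₊ := by exact_mod_cast h5
    omega
  have ea : ((I θ a' : ℕ) : ℤ) - ((I θ a : ℕ) : ℤ) = (a' : ℤ) - a := by
    rw [hIv θ hθ g₁ a ha, hIv θ hθ g₁ a' ha']; push_cast; ring
  have eb : ((I φ b' : ℕ) : ℤ) - ((I φ b : ℕ) : ℤ) = (b' : ℤ) - b := by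
    rw [hIv φ hφ g₂ b hb, hIv φ hφ g₂ b' hb']; push_cast; ring
  constructor
  · have h1 := h.abs_sub_le_of_isDiscretization (hdis N) (hle a ha b hb) (hle a' ha' b' hb') hθ hφ
      (g₁.mono n4) (g₂.mono n4) (hgp θ hθ g₁ a ha) (hgp φ hφ g₂ b hb)
    rw [ea, eb] at h1
    refine h1.trans ?_
    have h2 : L ((a' : ℤ) - a) ((b' : ℤ) - b) ≤ Lm :=
      hLle _ _ (by rw [abs_le]; omega) (by rw [abs_le]; omega)
    have h3 : L ((a' : ℤ) - a) ((b' : ℤ) - b) * (d + d) ≤ Lm * (d + d) := by gcongr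
    linarith
  · intro hK
    by_contra h0
    obtain ⟨h1, h2⟩ := (hker N).near _ _ _ _ h0
    rw [mem_nbhd, abs_sub_comm] at h1 h2
    rw [ea] at h1
    rw [eb] at h2
    rcases hK with hK | hK
    · omega
    · omega

/-! ### Bounds, finite range and positivity inherited by the profile. -/

/-- The integers of absolute value at most `K`. -/
abbrev band (K : ℕ) : Finset ℤ := Finset.Icc (-(K : ℤ)) K

theorem card_band (K : ℕ) : ((band K).card : ℝ) = 2 * K + 1 := by
  have h : (band K).card = 2 * K + 1 := by
    rw [Int.card_Icc]; omega
  rw [h]; push_cast; ring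

theorem sum_band_const_le (K : ℕ) (b : ℝ) : ∑ _k ∈ band K, b = (2 * K + 1) * b := by
  rw [Finset.sum_const, nsmul_eq_mul, card_band]

/-- A difference $k$ with $|k|\le K$ occurs $n$ times in the square up to an error of at most $K$,
and the other differences contribute nothing. -/
theorem abs_sum_sum_sub_le {K : ℕ} {g : ℤ → ℝ} {c : ℝ} (hg : ∀ k, |g k| ≤ c)
    (h0 : ∀ k : ℤ, (K : ℤ) < |k| → g k = 0) (n : ℕ) :
    |∑ a ∈ Finset.range n, ∑ a' ∈ Finset.range n, g ((a' : ℤ) - a) - n * ∑ k ∈ band K, g k| ≤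
      (2 * K + 1) * (K * c) := by
  classical
  set A : ℤ → Finset (ℕ × ℕ) := fun k =>
    (Finset.range n ×ˢ Finset.range n).filter fun p => (p.2 : ℤ) - p.1 = k with hA
  have e1 : ∑ a ∈ Finset.range n, ∑ a' ∈ Finset.range n, g ((a' : ℤ) - a) =
      ∑ k ∈ band K, ((A k).card : ℝ) * g k := by
    rw [← Finset.sum_product' (f := fun a a' : ℕ => g ((a' : ℤ) - a))]
    have e2 : ∀ p ∈ Finset.range n ×ˢ Finset.range n, g ((p.2 : ℤ) - p.1) =
        ∑ k ∈ band K, if (p.2 : ℤ) - p.1 = k then g k else 0 := by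
      intro p _
      rw [Finset.sum_ite_eq]
      split_ifs with h
      · rfl
      · refine h0 _ ?_
        rw [Finset.mem_Icc, ← abs_le, not_le] at h
        exact h
    rw [Finset.sum_congr rfl e2, Finset.sum_comm]
    refine Finset.sum_congr rfl fun k _ => ?_
    rw [← Finset.sum_filter, Finset.sum_const, nsmul_eq_mul]
  have hcard : ∀ k ∈ band K, |((A k).card : ℝ) - n| ≤ K := by
    intro k hk
    rw [Finset.mem_Icc] at hk
    have h1 : (A k).card ≤ n := by
      rw [← Finset.card_range n]
      refine Finset.card_le_card_of_injOn Prod.fst (fun p hp => ?_) fun p hp p' hp' h => ?_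
      · exact (Finset.mem_product.1 (Finset.mem_filter.1 hp).1).1
      · have h1 := (Finset.mem_filter.1 hp).2
        have h2 := (Finset.mem_filter.1 hp').2
        refine Prod.ext h ?_
        omega
    have h2 : n - K ≤ (A k).card := by
      rw [← Finset.card_range (n - K)]
      refine Finset.card_le_card_of_injOn (fun t => (t + (-k).toNat, t + k.toNat))
        (fun t ht => ?_) fun t _ t' _ h => ?_
      · have ht' := Finset.mem_range.1 (Finset.mem_coe.1 ht)
        simp only [hA, Finset.coe_filter, Finset.mem_product, Finset.mem_range, Set.mem_ofPred_eq]
        push_cast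
        omega
      · have := congrArg Prod.fst h
        simp only at this
        omega
    have h3 : ((A k).card : ℝ) ≤ n := by exact_mod_cast h1
    have h4 : (n : ℝ) ≤ (A k).card + K := by
      have : n ≤ (A k).card + K := by omega
      exact_mod_cast this
    rw [abs_le]
    constructor <;> linarith
  rw [e1, Finset.mul_sum, ← Finset.sum_sub_distrib, ← sum_band_const_le]
  refine (Finset.abs_sum_le_sum_abs _ _).trans (Finset.sum_le_sum fun k hk => ?_)
  rw [← sub_mul, abs_mul]
  exact mul_le_mul (hcard k hk) (hg k) (abs_nonneg _) (by positivity)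

/-- A Fejér argument: the box sum equals $n^2$ times the sum over the band, up to $O(n)$. Dividing
by $n^2$ and letting $n\to\infty$ leaves a nonnegative limit. -/
theorem nonneg_of_forall_box {K : ℕ} {f : ℤ → ℤ → ℝ} {c : ℝ} (hc : 0 ≤ c)
    (hf : ∀ k l, |f k l| ≤ c)
    (h0 : ∀ k l : ℤ, (K : ℤ) < |k| ∨ (K : ℤ) < |l| → f k l = 0)
    (hbox : ∀ n : ℕ, 0 ≤ ∑ a ∈ Finset.range n, ∑ a' ∈ Finset.range n, ∑ b ∈ Finset.range n,
      ∑ b' ∈ Finset.range n, f ((a' : ℤ) - a) ((b' : ℤ) - b)) :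
    0 ≤ ∑ k ∈ band K, ∑ l ∈ band K, f k l := by
  set p := ∑ k ∈ band K, ∑ l ∈ band K, f k l with hp
  set M : ℝ := (2 * K + 1) * (K * c) with hM
  have hM0 : 0 ≤ M := by positivity
  have hsumf : ∀ k, |∑ l ∈ band K, f k l| ≤ (2 * K + 1) * c := fun k => by
    rw [← sum_band_const_le]
    exact (Finset.abs_sum_le_sum_abs _ _).trans (Finset.sum_le_sum fun l _ => hf k l)
  have key : ∀ n : ℕ, 0 ≤ (n : ℝ) ^ 2 * p + n * ((2 * K + 1) * M + (2 * K + 1) * (K * ((2 * K + 1) * c))) +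
      (2 * K + 1) * (K * M) := by
    intro n
    set g : ℤ → ℝ := fun k => ∑ b ∈ Finset.range n, ∑ b' ∈ Finset.range n, f k ((b' : ℤ) - b)
      with hg
    have g1 : ∀ k, |g k - n * ∑ l ∈ band K, f k l| ≤ M := fun k =>
      abs_sum_sum_sub_le (hf k) (fun l hl => h0 k l (Or.inr hl)) n
    have g2 : ∀ k, |g k| ≤ M + n * ((2 * K + 1) * c) := fun k => by
      have h1 := abs_sub_abs_le_abs_sub (g k) (n * ∑ l ∈ band K, f k l)
      have h2 : |(n : ℝ) * ∑ l ∈ band K, f k l| ≤ n * ((2 * K + 1) * c) := by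
        rw [abs_mul, Nat.abs_cast]
        exact mul_le_mul_of_nonneg_left (hsumf k) (by positivity)
      linarith [g1 k]
    have h1 := abs_sum_sum_sub_le g2 (fun k hk => Finset.sum_eq_zero fun b _ =>
      Finset.sum_eq_zero fun b' _ => h0 k _ (Or.inl hk)) n
    have h2 : |∑ k ∈ band K, g k - n * p| ≤ (2 * K + 1) * M := by
      rw [hp, Finset.mul_sum, ← Finset.sum_sub_distrib, ← sum_band_const_le]
      exact (Finset.abs_sum_le_sum_abs _ _).trans (Finset.sum_le_sum fun k _ => g1 k)
    have h3 := mul_le_mul_of_nonneg_left (abs_le.1 h2).2 (Nat.cast_nonneg (α := ℝ) n)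
    have h4 := (abs_le.1 h1).2
    have h5 := hbox n
    simp only [hg] at h4
    have h6 : (n : ℝ) * (∑ k ∈ band K, g k - n * p) = n * ∑ k ∈ band K, g k - n ^ 2 * p := by ring
    rw [h6] at h3
    simp only [hg] at h3
    nlinarith
  by_contra hneg
  push Not at hneg
  set a1 : ℝ := (2 * K + 1) * M + (2 * K + 1) * (K * ((2 * K + 1) * c)) with ha1
  set a2 : ℝ := (2 * K + 1) * (K * M) with ha2
  have ha1' : 0 ≤ a1 := by positivity
  have ha2' : 0 ≤ a2 := by positivity
  obtain ⟨n, hn⟩ := exists_nat_gt ((a1 + a2) / -p + 1)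
  have hp0 : 0 < -p := by linarith
  have h1 : (a1 + a2) / -p < n - 1 := by linarith
  rw [div_lt_iff₀ hp0] at h1
  have h2 := key n
  have h3 : (1 : ℝ) ≤ n := by
    have : 0 ≤ (a1 + a2) / -p := by positivity
    linarith
  nlinarith

/-- The profile has the properties of a limit of covariance kernels. -/
structure IsLimitProfile (K : ℕ) (c : ℝ) (E : Finset ℝ) (L : ℤ → ℤ → ℝ)
    (ψ : ℝ → ℝ → ℤ → ℤ → ℝ) : Prop extends IsLipschitzProfile E L ψ where
  abs_le : ∀ θ ∈ Set.Ico (0 : ℝ) 1, ∀ φ ∈ Set.Ico (0 : ℝ) 1, θ ∉ E → φ ∉ E → θ ≠ φ →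
    ∀ k l, |ψ θ φ k l| ≤ c
  eq_zero : ∀ θ ∈ Set.Ico (0 : ℝ) 1, ∀ φ ∈ Set.Ico (0 : ℝ) 1, θ ∉ E → φ ∉ E → θ ≠ φ →
    ∀ k l : ℤ, (K : ℤ) < |k| ∨ (K : ℤ) < |l| → ψ θ φ k l = 0
  symm_neg : ∀ θ ∈ Set.Ico (0 : ℝ) 1, ∀ φ ∈ Set.Ico (0 : ℝ) 1, ∀ k l : ℤ,
    ψ θ φ k l = ψ θ φ (-k) (-l)
  symbol_nonneg : ∀ θ ∈ Set.Ico (0 : ℝ) 1, ∀ φ ∈ Set.Ico (0 : ℝ) 1, θ ∉ E → φ ∉ E → θ ≠ φ →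
    ∀ s t : ℝ, 0 ≤ ∑ k ∈ band K, ∑ l ∈ band K, ψ θ φ k l * Real.cos (k * s + l * t)

/-- By the addition theorem for the cosine the sum is a sum of squares of cosine and sine sums of
the Gram vectors. -/
theorem IsGram.sum_cos_nonneg {ζ : ℕ → ℕ → ℕ → ℕ → ℝ} (h : IsGram ζ) (n : ℕ) (s t : ℝ) :
    0 ≤ ∑ a ∈ Finset.range n, ∑ a' ∈ Finset.range n, ∑ b ∈ Finset.range n,
      ∑ b' ∈ Finset.range n, ζ a b a' b' *
        Real.cos ((((a' : ℤ) - a : ℤ) : ℝ) * s + (((b' : ℤ) - b : ℤ) : ℝ) * t) := by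
  obtain ⟨m, B, hB⟩ := h
  have e1 : ∀ a a' b b' : ℕ, ζ a b a' b' *
      Real.cos ((((a' : ℤ) - a : ℤ) : ℝ) * s + (((b' : ℤ) - b : ℤ) : ℝ) * t) =
      ∑ r, ((B r a b * Real.cos (a * s + b * t)) * (B r a' b' * Real.cos (a' * s + b' * t)) +
        (B r a b * Real.sin (a * s + b * t)) * (B r a' b' * Real.sin (a' * s + b' * t))) := by
    intro a a' b b'
    have : (((a' : ℤ) - a : ℤ) : ℝ) * s + (((b' : ℤ) - b : ℤ) : ℝ) * t =
        (a' * s + b' * t) - (a * s + b * t) := by push_cast; ring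
    rw [this, Real.cos_sub, hB, Finset.sum_mul]
    exact Finset.sum_congr rfl fun r _ => by ring
  have e2 : ∀ u : ℕ → ℕ → ℝ, ∑ a ∈ Finset.range n, ∑ a' ∈ Finset.range n, ∑ b ∈ Finset.range n,
      ∑ b' ∈ Finset.range n, u a b * u a' b' =
      (∑ a ∈ Finset.range n, ∑ b ∈ Finset.range n, u a b) ^ 2 := by
    intro u
    rw [sq, Finset.sum_mul]
    refine Finset.sum_congr rfl fun a _ => ?_
    rw [Finset.mul_sum]
    refine Finset.sum_congr rfl fun a' _ => ?_
    rw [Finset.sum_mul]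
    refine Finset.sum_congr rfl fun b _ => ?_
    rw [Finset.mul_sum]
  have e3 : ∑ a ∈ Finset.range n, ∑ a' ∈ Finset.range n, ∑ b ∈ Finset.range n,
      ∑ b' ∈ Finset.range n, ζ a b a' b' *
        Real.cos ((((a' : ℤ) - a : ℤ) : ℝ) * s + (((b' : ℤ) - b : ℤ) : ℝ) * t) =
      ∑ r, ((∑ a ∈ Finset.range n, ∑ b ∈ Finset.range n,
          B r a b * Real.cos (a * s + b * t)) ^ 2 +
        (∑ a ∈ Finset.range n, ∑ b ∈ Finset.range n,
          B r a b * Real.sin (a * s + b * t)) ^ 2) := by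
    simp only [e1, ← e2]
    simp only [← Finset.sum_add_distrib]
    symm
    rw [Finset.sum_comm]
    refine Finset.sum_congr rfl fun a _ => ?_
    rw [Finset.sum_comm]
    refine Finset.sum_congr rfl fun a' _ => ?_
    rw [Finset.sum_comm]
    refine Finset.sum_congr rfl fun b _ => ?_
    rw [Finset.sum_comm]
  rw [e3]
  exact Finset.sum_nonneg fun r _ => by positivity

/-- Around two distinct generic points $\theta<\varphi$ the covariances look translation invariant
and converge to $\psi$, so closed properties of kernels pass to $\psi$; positive semidefiniteness
becomes nonnegativity of the symbol. The case $\theta>\varphi$ follows from the exchange symmetry.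
-/
theorem IsProfile.exists_isLimitProfile {ψ : ℝ → ℝ → ℤ → ℤ → ℝ} (h : IsProfile ψ) {K : ℕ} {c C : ℝ}
    {ξ : ∀ N, Fin N → Fin N → Fin N → Fin N → ℝ} (hker : ∀ N, IsKernel K c (ξ N))
    (hdis : ∀ N, IsDiscretization K C ψ (ξ N)) : ∃ E L, IsLimitProfile K c E L ψ := by
  obtain ⟨E, L, hL⟩ := h.exists_isLipschitzProfile
  have hc : 0 ≤ c := (hker 0).nonneg
  have main : ∀ θ ∈ Set.Ico (0 : ℝ) 1, ∀ φ ∈ Set.Ico (0 : ℝ) 1, θ ∉ E → φ ∉ E → θ < φ →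
      (∀ k l, |ψ θ φ k l| ≤ c) ∧
      (∀ k l : ℤ, (K : ℤ) < |k| ∨ (K : ℤ) < |l| → ψ θ φ k l = 0) ∧
      (∀ s t : ℝ, 0 ≤ ∑ k ∈ band K, ∑ l ∈ band K, ψ θ φ k l * Real.cos (k * s + l * t)) := by
    intro θ hθ φ hφ hθE hφE hlt
    have happ := fun R ε hε => hL.exists_approx hker hdis hθ hφ hθE hφE hlt R (ε := ε) hε
    have hoff : ∀ k l : ℤ, ∀ ε > 0, ∃ y : ℝ, |y| ≤ c ∧ |y - ψ θ φ k l| ≤ ε ∧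
        ((K : ℤ) < |k| ∨ (K : ℤ) < |l| → y = 0) := by
      intro k l ε hε
      obtain ⟨ζ, -, h1, h2⟩ := happ (k.natAbs + l.natAbs) ε hε
      -- Positive and negative parts write each integer as a difference of two natural numbers.
      obtain ⟨h3, h4⟩ := h2 (-k).toNat (by omega) (-l).toNat (by omega) k.toNat (by omega) l.toNat
        (by omega)
      have ek : (k.toNat : ℤ) - ((-k).toNat : ℤ) = k := by omega
      have el : (l.toNat : ℤ) - ((-l).toNat : ℤ) = l := by omega
      rw [ek, el] at h3 h4
      exact ⟨_, h1 _ _ _ _, h3, h4⟩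
    have hb : ∀ k l, |ψ θ φ k l| ≤ c := fun k l => by
      refine le_of_forall_pos_le_add fun ε hε => ?_
      obtain ⟨y, h1, h2, -⟩ := hoff k l ε hε
      have := abs_sub_abs_le_abs_sub (ψ θ φ k l) y
      rw [abs_sub_comm] at this
      linarith
    have hz : ∀ k l : ℤ, (K : ℤ) < |k| ∨ (K : ℤ) < |l| → ψ θ φ k l = 0 := fun k l hkl => by
      rw [← abs_nonpos_iff]
      refine le_of_forall_pos_le_add fun ε hε => ?_
      obtain ⟨y, -, h2, h3⟩ := hoff k l ε hε
      rw [h3 hkl, zero_sub, abs_neg] at h2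
      linarith
    refine ⟨hb, hz, fun s t => ?_⟩
    refine nonneg_of_forall_box (f := fun k l => ψ θ φ k l * Real.cos (k * s + l * t)) hc
      (fun k l => ?_) (fun k l hkl => by rw [hz k l hkl, zero_mul]) fun n => ?_
    · rw [abs_mul]
      exact (mul_le_of_le_one_right (abs_nonneg _) (Real.abs_cos_le_one _)).trans (hb k l)
    · refine le_of_forall_pos_le_add fun ε hε => ?_
      -- The box sum has $n^4$ terms, each off by at most `δ`.
      set δ : ℝ := ε / (n ^ 4 + 1) with hδ
      have hδ0 : 0 < δ := by positivity
      obtain ⟨ζ, hζ, -, h2⟩ := happ n δ hδ0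
      have h3 := hζ.sum_cos_nonneg n s t
      have h4 : ∑ a ∈ Finset.range n, ∑ a' ∈ Finset.range n, ∑ b ∈ Finset.range n,
          ∑ b' ∈ Finset.range n, ζ a b a' b' *
            Real.cos ((((a' : ℤ) - a : ℤ) : ℝ) * s + (((b' : ℤ) - b : ℤ) : ℝ) * t) ≤
          ∑ a ∈ Finset.range n, ∑ a' ∈ Finset.range n, ∑ b ∈ Finset.range n,
          ∑ b' ∈ Finset.range n, (ψ θ φ ((a' : ℤ) - a) ((b' : ℤ) - b) *
            Real.cos ((((a' : ℤ) - a : ℤ) : ℝ) * s + (((b' : ℤ) - b : ℤ) : ℝ) * t) + δ) := by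
        refine Finset.sum_le_sum fun a ha => Finset.sum_le_sum fun a' ha' =>
          Finset.sum_le_sum fun b hb => Finset.sum_le_sum fun b' hb' => ?_
        rw [Finset.mem_range] at ha ha' hb hb'
        have h5 := (h2 a ha.le b hb.le a' ha'.le b' hb'.le).1
        set y := Real.cos ((((a' : ℤ) - a : ℤ) : ℝ) * s + (((b' : ℤ) - b : ℤ) : ℝ) * t) with hy
        have h6 : (ζ a b a' b' - ψ θ φ ((a' : ℤ) - a) ((b' : ℤ) - b)) * y ≤ δ := by
          refine (le_abs_self _).trans ?_
          rw [abs_mul]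
          exact (mul_le_of_le_one_right (abs_nonneg _) (Real.abs_cos_le_one _)).trans h5
        linarith
      simp only [Finset.sum_add_distrib, Finset.sum_const, Finset.card_range, nsmul_eq_mul] at h4
      have h7 : (n : ℝ) * (n * (n * (n * δ))) ≤ ε := by
        have : (n : ℝ) * (n * (n * (n * δ))) = n ^ 4 / (n ^ 4 + 1) * ε := by rw [hδ]; ring
        rw [this]
        refine mul_le_of_le_one_left hε.le ?_
        rw [div_le_one (by positivity)]
        linarith
      linarith
  have hswap : ∀ θ ∈ Set.Ico (0 : ℝ) 1, ∀ φ ∈ Set.Ico (0 : ℝ) 1, θ ∉ E → φ ∉ E → θ ≠ φ →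
      (∀ k l, |ψ θ φ k l| ≤ c) ∧
      (∀ k l : ℤ, (K : ℤ) < |k| ∨ (K : ℤ) < |l| → ψ θ φ k l = 0) ∧
      (∀ s t : ℝ, 0 ≤ ∑ k ∈ band K, ∑ l ∈ band K, ψ θ φ k l * Real.cos (k * s + l * t)) := by
    intro θ hθ φ hφ hθE hφE hne
    rcases lt_or_gt_of_ne hne with hlt | hlt
    · exact main θ hθ φ hφ hθE hφE hlt
    · obtain ⟨h1, h2, h3⟩ := main φ hφ θ hθ hφE hθE hlt
      simp only [h.symm_swap θ hθ φ hφ]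
      refine ⟨fun k l => h1 l k, fun k l hkl => h2 l k hkl.symm, fun s t => ?_⟩
      rw [Finset.sum_comm]
      simpa only [add_comm] using h3 t s
  exact ⟨E, L, hL, fun θ hθ φ hφ a b d => (hswap θ hθ φ hφ a b d).1,
    fun θ hθ φ hφ a b d => (hswap θ hθ φ hφ a b d).2.1, h.symm_neg,
    fun θ hθ φ hφ a b d => (hswap θ hθ φ hφ a b d).2.2⟩

section

/-! ### Convolution inverses of trigonometric polynomials -/

/-- The trigonometric polynomial with coefficients `s k`, `|k| ≤ K`. -/
def symbol (K : ℕ) (s : ℤ → ℂ) (u : AddCircle (1 : ℝ)) : ℂ := ∑ k ∈ band K, s k * fourier k u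

theorem continuous_symbol (K : ℕ) (s : ℤ → ℂ) : Continuous (symbol K s) :=
  continuous_finsetSum _ fun k _ => continuous_const.mul (fourier k).continuous

theorem norm_fourier_apply (k : ℤ) (u : AddCircle (1 : ℝ)) : ‖(fourier k u : ℂ)‖ = 1 := by
  rw [fourier_apply]; exact Circle.norm_coe _

theorem integrable_of_continuous_circle {f : AddCircle (1 : ℝ) → ℂ} (hf : Continuous f) :
    Integrable f (@AddCircle.haarAddCircle (1 : ℝ) _) :=
  hf.integrable_of_hasCompactSupport (HasCompactSupport.of_compactSpace f)

/-- The sequence `-z δ_{k0} - s k`. -/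
def operand (z : ℂ) (s : ℤ → ℂ) (k : ℤ) : ℂ := -(if k = 0 then z else 0) - s k

theorem symbol_operand (K : ℕ) (z : ℂ) (s : ℤ → ℂ) (u : AddCircle (1 : ℝ)) :
    symbol K (operand z s) u = -z - symbol K s u := by
  simp only [symbol, operand, sub_mul, Finset.sum_sub_distrib, neg_mul, Finset.sum_neg_distrib,
    ite_mul, zero_mul]
  rw [Finset.sum_ite_eq' , if_pos (by simp)]
  simp

/-- `a` is the inverse of `-z - s` in the convolution algebra, where `s` is supported on
`[-K, K]` and its symbol has nonnegative imaginary part. -/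
structure IsSolutionAt (K : ℕ) (η : ℝ) (z : ℂ) (s a : ℤ → ℂ) : Prop where
  eq_zero : ∀ k : ℤ, (K : ℤ) < |k| → s k = 0
  im_nonneg : ∀ u, 0 ≤ (symbol K s u).im
  conv : ∀ n, ∑ k ∈ band K, a (n - k) * operand z s k = if n = 0 then 1 else 0
  eq_coeff : ∀ k, a k = fourierCoeff (fun u => (symbol K (operand z s) u)⁻¹) k
  sum_sq_le : ∀ T : Finset ℤ, ∑ k ∈ T, ‖a k‖ ^ 2 ≤ 1 / η ^ 2

theorem le_norm_symbol_operand {K : ℕ} {η : ℝ} {z : ℂ} (hz : η ≤ z.im) {s : ℤ → ℂ}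
    (hs : ∀ u, 0 ≤ (symbol K s u).im) (u : AddCircle (1 : ℝ)) :
    η ≤ ‖symbol K (operand z s) u‖ := by
  have h1 := Complex.abs_im_le_norm (symbol K (operand z s) u)
  rw [symbol_operand, Complex.sub_im, Complex.neg_im] at h1
  have h2 := neg_abs_le (-z.im - (symbol K s u).im)
  rw [symbol_operand]
  linarith [hs u]

theorem fourierCoeff_symbol_mul {K : ℕ} (s : ℤ → ℂ) {F : AddCircle (1 : ℝ) → ℂ}
    (hF : Integrable F (@AddCircle.haarAddCircle (1 : ℝ) _)) (n : ℤ) :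
    fourierCoeff (fun u => symbol K s u * F u) n =
      ∑ k ∈ band K, fourierCoeff F (n - k) * s k := by
  have hi : ∀ k ∈ band K, Integrable (fun u => s k * (fourier (-(n - k)) u * F u))
      (@AddCircle.haarAddCircle (1 : ℝ) _) := fun k _ =>
    (hF.fourier_smul (n := -(n - k))).const_mul (s k)
  have e : (fun u => (fourier (-n) u : ℂ) • (symbol K s u * F u)) =
      fun u => ∑ k ∈ band K, s k * (fourier (-(n - k)) u * F u) := by
    funext u
    rw [symbol, smul_eq_mul, Finset.sum_mul, Finset.mul_sum]
    refine Finset.sum_congr rfl fun k _ => ?_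
    rw [neg_sub, sub_eq_add_neg k n, fourier_add]
    ring
  simp only [fourierCoeff, e]
  rw [integral_finsetSum _ hi]
  refine Finset.sum_congr rfl fun k _ => ?_
  rw [integral_const_mul, mul_comm]
  rfl

/-- On the Fourier side the convolution equation says that the symbol $w$ times the function with
coefficients $a$ is $1$. Since $\operatorname{Im}w\le-\eta$, this function is $w^{-1}$ almost
everywhere and bounded by $1/\eta$, and Parseval's identity bounds $a$ in $\ell^2$. -/
theorem isSolutionAt_of_conv {K : ℕ} {η : ℝ} (hη : 0 < η) {z : ℂ} (hz : η ≤ z.im) {s a : ℤ → ℂ}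
    (ha : Memℓp a 2) (h0 : ∀ k : ℤ, (K : ℤ) < |k| → s k = 0)
    (him : ∀ u, 0 ≤ (symbol K s u).im)
    (hconv : ∀ n, ∑ k ∈ band K, a (n - k) * operand z s k = if n = 0 then 1 else 0) :
    IsSolutionAt K η z s a := by
  set F := (fourierBasis (T := (1 : ℝ))).repr.symm ⟨a, ha⟩ with hF
  have hFa : ∀ n, fourierCoeff F n = a n := fun n => by
    rw [← fourierBasis_repr, hF, LinearIsometryEquiv.apply_symm_apply]
  set w := symbol K (operand z s) with hw
  have hwc : Continuous w := continuous_symbol _ _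
  have hwη : ∀ u, η ≤ ‖w u‖ := le_norm_symbol_operand hz him
  have hw0 : ∀ u, w u ≠ 0 := fun u h => by
    have := hwη u
    rw [h, norm_zero] at this
    linarith
  have hFi : Integrable F (@AddCircle.haarAddCircle (1 : ℝ) _) :=
    (Lp.memLp F).integrable (by norm_num)
  obtain ⟨b, hb⟩ := (isCompact_range hwc).isBounded.exists_norm_le
  have hgm : MemLp (fun u => w u * F u) 2 (@AddCircle.haarAddCircle (1 : ℝ) _) :=
    MemLp.mul (Lp.memLp F) (memLp_top_of_bound hwc.aestronglyMeasurable b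
      (.of_forall fun u => hb _ ⟨u, rfl⟩))
  have hone : hgm.toLp _ = fourierLp (T := (1 : ℝ)) 2 0 := by
    refine (fourierBasis (T := (1 : ℝ))).repr.injective ?_
    ext n
    rw [fourierBasis_repr, fourierBasis_repr, fourierCoeff_congr_ae (MemLp.coeFn_toLp hgm),
      fourierCoeff_congr_ae (coeFn_fourierLp 2 0), fourierCoeff_symbol_mul _ hFi,
      fourierCoeff_fourier]
    simp only [hFa, hconv]
    rw [Pi.single_apply]
  have hF1 : (F : AddCircle (1 : ℝ) → ℂ) =ᵐ[@AddCircle.haarAddCircle (1 : ℝ) _]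
      fun u => (w u)⁻¹ := by
    have h1 := MemLp.coeFn_toLp hgm
    rw [hone] at h1
    filter_upwards [h1, coeFn_fourierLp (T := (1 : ℝ)) 2 0] with u h2 h3
    rw [h3, fourier_zero] at h2
    exact eq_inv_of_mul_eq_one_right h2.symm
  refine ⟨h0, him, hconv, fun k => ?_, fun T => ?_⟩
  · rw [← hFa]
    exact fourierCoeff_congr_ae hF1 ▸ rfl
  · have h1 := hasSum_sq_fourierCoeff F
    simp only [hFa] at h1
    refine (sum_le_hasSum T (fun _ _ => by positivity) h1).trans ?_
    have h2 : ∫ t, ‖F t‖ ^ 2 ∂(@AddCircle.haarAddCircle (1 : ℝ) _) ≤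
        ∫ _, 1 / η ^ 2 ∂(@AddCircle.haarAddCircle (1 : ℝ) _) := by
      refine integral_mono_of_nonneg (.of_forall fun _ => by positivity) (integrable_const _) ?_
      filter_upwards [hF1] with u hu
      rw [hu, norm_inv, inv_pow, one_div]
      exact inv_anti₀ (by positivity) (pow_le_pow_left₀ hη.le (hwη u) 2)
    simpa using h2

namespace IsSolutionAt

variable {K : ℕ} {η : ℝ} {z : ℂ} {s a : ℤ → ℂ}

theorem norm_le (h : IsSolutionAt K η z s a) (hη : 0 < η) (k : ℤ) : ‖a k‖ ≤ 1 / η := by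
  have h1 := h.sum_sq_le {k}
  rw [Finset.sum_singleton, ← one_div_pow] at h1
  exact le_of_sq_le_sq h1 (by positivity)

/-- The coefficients are compared through $w^{-1}-w'^{-1}=(w'-w)/(ww')$, where both denominators are
at least $\eta$ in modulus. -/
theorem norm_sub_le {s' a' : ℤ → ℂ} (h : IsSolutionAt K η z s a) (h' : IsSolutionAt K η z s' a')
    (hη : 0 < η) (hz : η ≤ z.im) {b : ℝ} (hb : ∀ k ∈ band K, ‖s k - s' k‖ ≤ b) (k : ℤ) :
    ‖a k - a' k‖ ≤ 1 / η ^ 2 * ((2 * K + 1) * b) := by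
  set w := symbol K (operand z s) with hw
  set w' := symbol K (operand z s') with hw'
  have hwη : ∀ u, η ≤ ‖w u‖ := le_norm_symbol_operand hz h.im_nonneg
  have hwη' : ∀ u, η ≤ ‖w' u‖ := le_norm_symbol_operand hz h'.im_nonneg
  have hw0 : ∀ u, w u ≠ 0 := fun u => norm_pos_iff.1 (hη.trans_le (hwη u))
  have hw0' : ∀ u, w' u ≠ 0 := fun u => norm_pos_iff.1 (hη.trans_le (hwη' u))
  have hc : Continuous fun u => (w u)⁻¹ := (continuous_symbol _ _).inv₀ hw0
  have hc' : Continuous fun u => (w' u)⁻¹ := (continuous_symbol _ _).inv₀ hw0'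
  have i1 : Integrable (fun u => (fourier (-k) u : ℂ) • (w u)⁻¹)
      (@AddCircle.haarAddCircle (1 : ℝ) _) :=
    integrable_of_continuous_circle ((fourier (-k)).continuous.smul hc)
  have i2 : Integrable (fun u => (fourier (-k) u : ℂ) • (w' u)⁻¹)
      (@AddCircle.haarAddCircle (1 : ℝ) _) :=
    integrable_of_continuous_circle ((fourier (-k)).continuous.smul hc')
  rw [h.eq_coeff, h'.eq_coeff, fourierCoeff, fourierCoeff, ← integral_sub i1 i2]
  have h1 : ∀ u, ‖(fourier (-k) u : ℂ) • (w u)⁻¹ - (fourier (-k) u : ℂ) • (w' u)⁻¹‖ ≤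
      1 / η ^ 2 * ((2 * K + 1) * b) := fun u => by
    rw [← smul_sub, norm_smul, norm_fourier_apply, one_mul, inv_sub_inv (hw0 u) (hw0' u), norm_div,
      norm_mul, div_eq_inv_mul, one_div, sq]
    have h2 : ‖w' u - w u‖ ≤ (2 * K + 1) * b := by
      rw [hw, hw', symbol_operand, symbol_operand, sub_sub_sub_cancel_left, symbol, symbol,
        ← Finset.sum_sub_distrib, ← sum_band_const_le]
      refine (norm_sum_le _ _).trans (Finset.sum_le_sum fun k hk => ?_)
      rw [← sub_mul, norm_mul, norm_fourier_apply, mul_one]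
      exact hb k hk
    have := hwη u
    have := hwη' u
    gcongr
  have h2 := norm_integral_le_of_norm_le_const (μ := @AddCircle.haarAddCircle (1 : ℝ) _)
    (.of_forall h1)
  simpa using h2

/-- The Toeplitz form is $\int w^{-1}|g|^2$ for a trigonometric polynomial $g$ with coefficients
$u$, and $\operatorname{Im}w^{-1}\ge0$. -/
theorem im_toeplitz_nonneg (h : IsSolutionAt K η z s a) (hη : 0 < η) (hz : η ≤ z.im) {ι : Type*}
    (T : Finset ι) (p : ι → ℤ) (u : ι → ℂ) :
    0 ≤ (∑ i ∈ T, ∑ j ∈ T, star (u i) * a (p j - p i) * u j).im := by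
  set w := symbol K (operand z s) with hw
  have hw0 : ∀ u, w u ≠ 0 := fun u =>
    norm_pos_iff.1 (hη.trans_le (le_norm_symbol_operand hz h.im_nonneg u))
  have hc : Continuous fun u => (w u)⁻¹ := (continuous_symbol _ _).inv₀ hw0
  set g : AddCircle (1 : ℝ) → ℂ := fun t => ∑ j ∈ T, fourier (-p j) t * u j with hg
  have hgc : Continuous g :=
    continuous_finsetSum _ fun j _ => (fourier (-p j)).continuous.mul continuous_const
  have hterm : ∀ i j, Integrable (fun t => star (u i) * (fourier (-(p j - p i)) t • (w t)⁻¹) *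
      u j) (@AddCircle.haarAddCircle (1 : ℝ) _) := fun i j =>
    ((integrable_of_continuous_circle ((fourier _).continuous.smul hc)).const_mul _).mul_const _
  have e1 : ∑ i ∈ T, ∑ j ∈ T, star (u i) * a (p j - p i) * u j =
      ∫ t, (w t)⁻¹ * (star (g t) * g t) ∂(@AddCircle.haarAddCircle (1 : ℝ) _) := by
    have e2 : ∀ t, (w t)⁻¹ * (star (g t) * g t) = ∑ i ∈ T, ∑ j ∈ T,
        star (u i) * (fourier (-(p j - p i)) t • (w t)⁻¹) * u j := fun t => by
      simp only [hg, star_sum, Finset.sum_mul, Finset.mul_sum, star_mul]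
      refine Finset.sum_comm.trans (Finset.sum_congr rfl fun i _ => Finset.sum_congr rfl fun j _ => ?_)
      have e3 : star (fourier (-p i) t : ℂ) = fourier (p i) t := by
        rw [RCLike.star_def, ← fourier_neg, neg_neg]
      rw [e3, neg_sub, sub_eq_add_neg, fourier_add, smul_eq_mul]
      ring
    simp only [e2]
    rw [integral_finsetSum _ fun i _ => integrable_finsetSum _ fun j _ => hterm i j]
    refine Finset.sum_congr rfl fun i _ => ?_
    rw [integral_finsetSum _ fun j _ => hterm i j]
    refine Finset.sum_congr rfl fun j _ => ?_
    rw [integral_mul_const, integral_const_mul, h.eq_coeff]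
    rfl
  have hint : Integrable (fun t => (w t)⁻¹ * (star (g t) * g t))
      (@AddCircle.haarAddCircle (1 : ℝ) _) :=
    integrable_of_continuous_circle (hc.mul (hgc.star.mul hgc))
  rw [e1]
  refine le_of_le_of_eq ?_ (integral_im (𝕜 := ℂ) hint)
  refine integral_nonneg fun t => ?_
  have e4 : star (g t) * g t = ((‖g t‖ ^ 2 : ℝ) : ℂ) := by
    rw [RCLike.star_def, Complex.conj_mul']; push_cast; rfl
  change 0 ≤ ((w t)⁻¹ * (star (g t) * g t)).im
  rw [e4, Complex.im_mul_ofReal, Complex.inv_im]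
  refine mul_nonneg (div_nonneg ?_ (Complex.normSq_nonneg _)) (by positivity)
  rw [hw, symbol_operand, Complex.sub_im, Complex.neg_im]
  linarith [h.im_nonneg t]

end IsSolutionAt

end

section

/-! ### Solutions of the limiting equation -/

/-- Convolution with the unit sequence at $0$ returns $a$ itself. -/
theorem memK_memℓp {a : ℤ → ℂ} {c : ℝ} (h : MemK a) (hc : NormKLe a c) :
    Memℓp a 2 ∧ ∀ k, ‖a k‖ ≤ c := by
  set v : lp (fun _ : ℤ => ℂ) 2 := lp.single 2 0 1 with hv
  obtain ⟨w, hw⟩ := h v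
  have hwa : ∀ n, w n = a n := fun n => by
    have h1 : HasSum (fun k => a (n - k) * v k) (a (n - 0) * v 0) :=
      hasSum_single 0 fun k hk => by
        rw [hv, lp.single_apply, Pi.single_eq_of_ne hk, mul_zero]
    rw [(hw n).unique h1, hv, lp.single_apply_self]
    simp
  have hwa' : (w : ℤ → ℂ) = a := funext hwa
  refine ⟨hwa' ▸ lp.memℓp w, fun k => ?_⟩
  have h1 := hc v w hw
  rw [hv, lp.norm_single (by norm_num), norm_one, mul_one] at h1
  rw [← hwa]
  exact (lp.norm_apply_le_norm (by norm_num) w k).trans h1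

theorem fourier_mul_fourier_coe (k l : ℤ) (x y : ℝ) :
    (fourier k (x : AddCircle (1 : ℝ)) : ℂ) * fourier (-l) (y : AddCircle (1 : ℝ)) =
      Complex.exp ((k * (2 * Real.pi * x) + l * (-(2 * Real.pi * y)) : ℝ) * Complex.I) := by
  rw [fourier_coe_apply, fourier_coe_apply, ← Complex.exp_add]
  congr 1
  push_cast
  ring

namespace IsLimitProfile

variable {K : ℕ} {c : ℝ} {E : Finset ℝ} {L : ℤ → ℤ → ℝ} {ψ : ℝ → ℝ → ℤ → ℤ → ℝ}

/-- The sine part cancels under $(k,l)\mapsto(-k,-l)$ by the symmetry of $\psi$, which leaves the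
nonnegative cosine sum. -/
theorem exists_symbol_eq (h : IsLimitProfile K c E L ψ) {θ φ : ℝ} (hθ : θ ∈ Set.Ico (0 : ℝ) 1)
    (hφ : φ ∈ Set.Ico (0 : ℝ) 1) (hθE : θ ∉ E) (hφE : φ ∉ E) (hne : θ ≠ φ)
    (u t : AddCircle (1 : ℝ)) :
    ∃ p : ℝ, 0 ≤ p ∧
      ∑ k ∈ band K, ∑ l ∈ band K, (ψ θ φ k l : ℂ) * (fourier k u * fourier (-l) t) = p := by
  obtain ⟨x, rfl⟩ := QuotientAddGroup.mk_surjective u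
  obtain ⟨y, rfl⟩ := QuotientAddGroup.mk_surjective t
  set s := 2 * Real.pi * x with hs
  set r := -(2 * Real.pi * y) with hr
  refine ⟨_, h.symbol_nonneg θ hθ φ hφ hθE hφE hne s r, ?_⟩
  have hsin : ∑ k ∈ band K, ∑ l ∈ band K, ψ θ φ k l * Real.sin (k * s + l * r) = 0 := by
    have e : ∀ f : ℤ → ℝ, ∑ k ∈ band K, f (-k) = ∑ k ∈ band K, f k := fun f =>
      Finset.sum_nbij' (fun k => -k) (fun k => -k) (by simp; omega) (by simp; omega) (by simp)
        (by simp) (by simp)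
    have e1 : ∑ k ∈ band K, ∑ l ∈ band K, ψ θ φ k l * Real.sin (k * s + l * r) =
        ∑ k ∈ band K, ∑ l ∈ band K, -(ψ θ φ k l * Real.sin (k * s + l * r)) := by
      rw [← e]
      refine Finset.sum_congr rfl fun k _ => ?_
      rw [← e]
      refine Finset.sum_congr rfl fun l _ => ?_
      rw [← h.symm_neg θ hθ φ hφ, ← mul_neg, ← Real.sin_neg]
      congr 2
      push_cast; ring
    simp only [Finset.sum_neg_distrib] at e1
    linarith
  have e2 : ∀ k l : ℤ, (ψ θ φ k l : ℂ) * (fourier k (x : AddCircle (1 : ℝ)) *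
      fourier (-l) (y : AddCircle (1 : ℝ))) =
      ((ψ θ φ k l * Real.cos (k * s + l * r) : ℝ) : ℂ) +
        ((ψ θ φ k l * Real.sin (k * s + l * r) : ℝ) : ℂ) * Complex.I := fun k l => by
    rw [fourier_mul_fourier_coe, ← hs, ← hr, Complex.exp_mul_I, ← Complex.ofReal_cos,
      ← Complex.ofReal_sin]
    push_cast; ring
  have e3 : ∑ k ∈ band K, ∑ l ∈ band K, ((ψ θ φ k l * Real.cos (k * s + l * r) : ℝ) : ℂ) +
      (∑ k ∈ band K, ∑ l ∈ band K, ((ψ θ φ k l * Real.sin (k * s + l * r) : ℝ) : ℂ)) *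
        Complex.I = ((∑ k ∈ band K, ∑ l ∈ band K, ψ θ φ k l * Real.cos (k * s + l * r) : ℝ) : ℂ) := by
    have := congrArg (fun r : ℝ => (r : ℂ)) hsin
    push_cast at this ⊢
    rw [this]; simp
  rw [← e3, Finset.sum_mul, ← Finset.sum_add_distrib]
  refine Finset.sum_congr rfl fun k _ => ?_
  rw [Finset.sum_mul, ← Finset.sum_add_distrib]
  exact Finset.sum_congr rfl fun l _ => e2 k l

/-- Writing $b_l$ as Fourier coefficients turns the sum over $l$ into an integral of $\check b$
against the nonnegative symbol of $\psi$. This is the limiting counterpart of the positivity of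
$\Xi$. -/
theorem im_sum_nonneg (h : IsLimitProfile K c E L ψ) {θ φ : ℝ} (hθ : θ ∈ Set.Ico (0 : ℝ) 1)
    (hφ : φ ∈ Set.Ico (0 : ℝ) 1) (hθE : θ ∉ E) (hφE : φ ∉ E) (hne : θ ≠ φ) {b : ℤ → ℂ}
    (hb : Memℓp b 2)
    (him : ∀ᵐ t ∂(@AddCircle.haarAddCircle (1 : ℝ) _), 0 ≤ (invFourier b t).im)
    (u : AddCircle (1 : ℝ)) :
    0 ≤ (∑ k ∈ band K, ∑ l ∈ band K, (ψ θ φ k l : ℂ) * b l * fourier k u).im := by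
  set F := invFourier b with hF
  have hFb : ∀ n, fourierCoeff F n = b n := fun n => by
    rw [← fourierBasis_repr, hF, invFourier, dif_pos hb, LinearIsometryEquiv.apply_symm_apply]
  have hFi : Integrable F (@AddCircle.haarAddCircle (1 : ℝ) _) :=
    (Lp.memLp F).integrable (by norm_num)
  choose p hp0 hp using fun t => h.exists_symbol_eq hθ hφ hθE hφE hne u t
  have hterm : ∀ k l, Integrable (fun t => (ψ θ φ k l : ℂ) * (fourier k u * (fourier (-l) t * F t)))
      (@AddCircle.haarAddCircle (1 : ℝ) _) := fun k l =>
    ((hFi.fourier_smul (n := -l)).const_mul _).const_mul _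
  have e1 : ∀ t, (p t : ℂ) * F t = ∑ k ∈ band K, ∑ l ∈ band K,
      (ψ θ φ k l : ℂ) * (fourier k u * (fourier (-l) t * F t)) := fun t => by
    rw [← hp, Finset.sum_mul]
    refine Finset.sum_congr rfl fun k _ => ?_
    rw [Finset.sum_mul]
    exact Finset.sum_congr rfl fun l _ => by ring
  have hint : Integrable (fun t => (p t : ℂ) * F t) (@AddCircle.haarAddCircle (1 : ℝ) _) := by
    simp only [e1]
    exact integrable_finsetSum _ fun k _ => integrable_finsetSum _ fun l _ => hterm k l
  have e2 : ∑ k ∈ band K, ∑ l ∈ band K, (ψ θ φ k l : ℂ) * b l * fourier k u =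
      ∫ t, (p t : ℂ) * F t ∂(@AddCircle.haarAddCircle (1 : ℝ) _) := by
    simp only [e1]
    rw [integral_finsetSum _ fun k _ => integrable_finsetSum _ fun l _ => hterm k l]
    refine Finset.sum_congr rfl fun k _ => ?_
    rw [integral_finsetSum _ fun l _ => hterm k l]
    refine Finset.sum_congr rfl fun l _ => ?_
    rw [integral_const_mul, integral_const_mul, ← hFb, fourierCoeff]
    simp only [smul_eq_mul]
    ring
  rw [e2]
  refine le_of_le_of_eq ?_ (integral_im (𝕜 := ℂ) hint)
  refine integral_nonneg_of_ae ?_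
  filter_upwards [him] with t ht
  change 0 ≤ ((p t : ℂ) * F t).im
  rw [Complex.im_ofReal_mul]
  exact mul_nonneg (hp0 t) ht

theorem ae_generic (θ : ℝ) (E : Finset ℝ) :
    ∀ᵐ φ ∂unitMeasure, φ ∈ Set.Ico (0 : ℝ) 1 ∧ φ ∉ E ∧ θ ≠ φ := by
  have h1 : ∀ᵐ φ ∂unitMeasure, φ ∈ Set.Ico (0 : ℝ) 1 := ae_restrict_mem measurableSet_Ico
  have h2 : ∀ᵐ φ ∂unitMeasure, φ ∉ (↑E : Set ℝ) := E.finite_toSet.countable.ae_notMem _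
  have h3 : ∀ᵐ φ ∂unitMeasure, φ ∉ ({θ} : Set ℝ) := (Set.countable_singleton θ).ae_notMem _
  filter_upwards [h1, h2, h3] with φ a1 a2 a3
  exact ⟨a1, by simpa using a2, fun h => a3 h.symm⟩

theorem aestronglyMeasurable (h : IsLimitProfile K c E L ψ) {θ : ℝ} (hθ : θ ∈ Set.Ico (0 : ℝ) 1)
    (hθE : θ ∉ E) (k l : ℤ) : AEStronglyMeasurable (fun φ => ψ θ φ k l) unitMeasure := by
  have hm : MeasurableSet (Set.Ico (0 : ℝ) 1 \ ↑E) :=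
    measurableSet_Ico.diff E.finite_toSet.measurableSet
  have hcont : ContinuousOn (fun φ => ψ θ φ k l) (Set.Ico (0 : ℝ) 1 \ ↑E) := by
    intro φ hφ
    obtain ⟨r, hr, hf⟩ := exists_far (by simpa using hφ.2 : φ ∉ E)
    have hL : 0 < L k l + 1 := by linarith [h.nonneg k l]
    refine Metric.continuousWithinAt_iff.2 fun ε hε => ⟨min r (ε / (L k l + 1)),
      lt_min hr (by positivity), fun φ' hφ' hd => ?_⟩
    rw [Real.dist_eq, lt_min_iff, lt_div_iff₀ hL] at hd
    have h1 := h.abs_sub_le θ hθ θ hθ φ hφ.1 φ' hφ'.1 (fun e he hm => by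
      rw [Set.uIcc_self, Set.mem_singleton_iff] at hm
      exact hθE (hm ▸ he)) (hf.avoids hd.1.le) k l
    rw [Real.dist_eq, abs_sub_comm]
    rw [sub_self, abs_zero, zero_add, abs_sub_comm φ] at h1
    nlinarith [abs_nonneg (φ' - φ)]
  have hrest : unitMeasure = volume.restrict (Set.Ico (0 : ℝ) 1 \ ↑E) := by
    refine Measure.restrict_congr_set ?_
    have h0 : ∀ᵐ φ ∂(volume : Measure ℝ), φ ∉ (↑E : Set ℝ) := E.finite_toSet.countable.ae_notMem _
    filter_upwards [h0] with φ hφ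
    exact propext ⟨fun hm => ⟨hm, hφ⟩, fun hm => hm.1⟩
  rw [hrest]
  exact hcont.aestronglyMeasurable hm

theorem integrable_mul (h : IsLimitProfile K c E L ψ) {θ : ℝ} (hθ : θ ∈ Set.Ico (0 : ℝ) 1)
    (hθE : θ ∉ E) {f : ℝ → ℂ} (hf : AEStronglyMeasurable f unitMeasure) {b : ℝ}
    (hb : ∀ᵐ φ ∂unitMeasure, ‖f φ‖ ≤ b) (k l : ℤ) :
    Integrable (fun φ => (ψ θ φ k l : ℂ) * f φ) unitMeasure := by
  refine Integrable.of_bound ((Complex.continuous_ofReal.comp_aestronglyMeasurable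
    (h.aestronglyMeasurable hθ hθE k l)).mul hf) (c * b) ?_
  filter_upwards [hb, ae_generic θ E] with φ h1 h2
  rw [norm_mul, Complex.norm_real]
  exact mul_le_mul (h.abs_le θ hθ φ h2.1 hθE h2.2.1 h2.2.2 k l) h1 (norm_nonneg _)
    ((abs_nonneg _).trans (h.abs_le θ hθ φ h2.1 hθE h2.2.1 h2.2.2 k l))

theorem Psi_eq (h : IsLimitProfile K c E L ψ) {θ : ℝ} (hθ : θ ∈ Set.Ico (0 : ℝ) 1)
    (hθE : θ ∉ E) (m : ℝ → ℤ → ℂ) (k : ℤ) :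
    Psi ψ m θ k = ∑ l ∈ band K, ∫ φ in Set.Ico (0 : ℝ) 1, (ψ θ φ k l : ℂ) * m φ l := by
  refine tsum_eq_sum fun l hl => ?_
  rw [Finset.mem_Icc, ← _root_.abs_le, not_le] at hl
  refine integral_eq_zero_of_ae ?_
  filter_upwards [ae_generic θ E] with φ h2
  rw [h.eq_zero θ hθ φ h2.1 hθE h2.2.1 h2.2.2 k l (Or.inr hl)]
  simp

theorem Psi_eq_zero (h : IsLimitProfile K c E L ψ) {θ : ℝ} (hθ : θ ∈ Set.Ico (0 : ℝ) 1)
    (hθE : θ ∉ E) (m : ℝ → ℤ → ℂ) (k : ℤ) (hk : (K : ℤ) < |k|) : Psi ψ m θ k = 0 := by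
  rw [h.Psi_eq hθ hθE]
  refine Finset.sum_eq_zero fun l _ => integral_eq_zero_of_ae ?_
  filter_upwards [ae_generic θ E] with φ h2
  rw [h.eq_zero θ hθ φ h2.1 hθE h2.2.1 h2.2.2 k l (Or.inl hk)]
  simp

/-- A solution of the limiting equation is, almost everywhere, the convolution inverse of
`-z - Ψ(m)`, and `Ψ(m)` has nonnegative imaginary part. -/
theorem ae_isSolutionAt (h : IsLimitProfile K c E L ψ) {η : ℝ} (hη : 0 < η) {z : ℂ}
    (hz : η ≤ z.im) {m : ℝ → ℤ → ℂ} (hm : SolvesLimit ψ z m) :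
    ∀ᵐ θ ∂unitMeasure, θ ∈ Set.Ico (0 : ℝ) 1 ∧ θ ∉ E ∧
      IsSolutionAt K η z (Psi ψ m θ) (m θ) := by
  obtain ⟨⟨⟨hmeas, b, hb⟩, c₀, hc₀, him⟩, heq⟩ := hm
  have hbd : ∀ᵐ φ ∂unitMeasure, Memℓp (m φ) 2 ∧ ∀ k, ‖m φ k‖ ≤ b := by
    filter_upwards [hb] with φ hφ
    exact memK_memℓp hφ.1 hφ.2
  filter_upwards [ae_generic 2 E, hbd, heq] with θ ⟨hθ, hθE, _⟩ hmθ heqθ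
  refine ⟨hθ, hθE, isSolutionAt_of_conv hη hz hmθ.1 (h.Psi_eq_zero hθ hθE m) (fun u => ?_) fun n => ?_⟩
  · have hint : ∀ k l, Integrable (fun φ => (ψ θ φ k l : ℂ) * m φ l * fourier k u) unitMeasure :=
      fun k l => (h.integrable_mul hθ hθE (hmeas l)
        (by filter_upwards [hbd] with φ hφ using hφ.2 l) k l).mul_const _
    have e1 : symbol K (Psi ψ m θ) u = ∫ φ in Set.Ico (0 : ℝ) 1,
        ∑ k ∈ band K, ∑ l ∈ band K, (ψ θ φ k l : ℂ) * m φ l * fourier k u := by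
      rw [integral_finsetSum _ fun k _ => integrable_finsetSum _ fun l _ => hint k l]
      refine Finset.sum_congr rfl fun k _ => ?_
      rw [integral_finsetSum _ fun l _ => hint k l, h.Psi_eq hθ hθE, Finset.sum_mul]
      exact Finset.sum_congr rfl fun l _ => (integral_mul_const _ _).symm
    have hI : Integrable (fun φ => ∑ k ∈ band K, ∑ l ∈ band K,
        (ψ θ φ k l : ℂ) * m φ l * fourier k u) unitMeasure :=
      integrable_finsetSum _ fun k _ => integrable_finsetSum _ fun l _ => hint k l
    rw [e1]
    refine le_of_le_of_eq ?_ (integral_im (𝕜 := ℂ) hI)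
    refine integral_nonneg_of_ae ?_
    filter_upwards [ae_generic θ E, hbd, him] with φ h2 h3 h4
    exact h.im_sum_nonneg hθ h2.1 hθE h2.2.1 h2.2.2 h3.1
      (by filter_upwards [h4] with t ht using hc₀.le.trans ht) u
  · have h1 := heqθ.2 n
    have h2 : ∀ k ∉ band K, m θ (n - k) * limitOperand ψ z m θ k = 0 := fun k hk => by
      rw [Finset.mem_Icc, ← _root_.abs_le, not_le] at hk
      have hk0 : k ≠ 0 := by
        rintro rfl
        simp at hk
        omega
      rw [limitOperand, h.Psi_eq_zero hθ hθE m k hk, if_neg hk0]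
      simp
    exact (hasSum_sum_of_ne_finset_zero h2).unique h1

end IsLimitProfile

end

section

/-! ### Approximate solutions from approximate inverses -/

variable {N : ℕ}

theorem sum_sum_nbhd_mul_le {K : ℕ} {η r : ℝ} (hη : 0 < η) (hr : 0 ≤ r) {v w : Fin N → ℝ}
    (hv : ∑ j, v j ^ 2 ≤ 1 / η ^ 2) (hw : ∑ j, w j ^ 2 ≤ r ^ 2) :
    ∑ j, ∑ l ∈ nbhd K j, v j * w l ≤ (2 * K + 1) / η * r := by
  have h1 : ∑ j, ∑ l ∈ nbhd K j, v j ^ 2 ≤ (2 * K + 1) * (1 / η ^ 2) := by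
    refine (Finset.sum_le_sum fun j _ => sum_nbhd_const_le K j (by positivity)).trans ?_
    rw [← Finset.mul_sum]
    gcongr
  have h2 : ∑ j, ∑ l ∈ nbhd K j, w l ^ 2 ≤ (2 * K + 1) * r ^ 2 := by
    rw [sum_nbhd_comm K fun _ l => w l ^ 2]
    refine (Finset.sum_le_sum fun j _ => sum_nbhd_const_le K j (by positivity)).trans ?_
    rw [← Finset.mul_sum]
    gcongr
  rw [Finset.sum_sigma'] at h1 h2 ⊢
  have h3 := Finset.sum_mul_sq_le_sq_mul_sq (Finset.univ.sigma fun j => nbhd K j)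
    (fun p : (_ : Fin N) × Fin N => v p.1) (fun p => w p.2)
  refine le_of_sq_le_sq (h3.trans ?_) (by positivity)
  calc _ ≤ ((2 * K + 1) * (1 / η ^ 2)) * ((2 * K + 1) * r ^ 2) :=
        mul_le_mul h1 h2 (Finset.sum_nonneg fun _ _ => by positivity) (by positivity)
    _ = _ := by ring

/-- Only the average of the row norms of the error enters, so $O(\sqrt N)$ rows with an error of
order one do little harm. -/
theorem bandAvg_mul_le {K : ℕ} {η : ℝ} (hη : 0 < η) {M E : Matrix (Fin N) (Fin N) ℂ}
    (hM : IsDissipativeInverse η M) {r : Fin N → ℝ} (hr : ∀ a, 0 ≤ r a)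
    (hE : ∀ a, ∑ b, ‖E a b‖ ^ 2 ≤ r a ^ 2) :
    bandAvg K (M * E) ≤ (2 * K + 1) / η * (1 / (N : ℝ) * ∑ a, r a) := by
  have h1 : ∑ j, ∑ l ∈ nbhd K j, ‖(M * E) j l‖ ≤ ∑ a, (2 * K + 1) / η * r a := by
    calc _ ≤ ∑ j, ∑ l ∈ nbhd K j, ∑ a, ‖M j a‖ * ‖E a l‖ :=
          Finset.sum_le_sum fun j _ => Finset.sum_le_sum fun l _ => by
            rw [Matrix.mul_apply]
            refine (norm_sum_le _ _).trans_eq (Finset.sum_congr rfl fun a _ => norm_mul _ _)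
      _ = ∑ a, ∑ j, ∑ l ∈ nbhd K j, ‖M j a‖ * ‖E a l‖ := by
          simp only [Finset.sum_comm (s := nbhd K _)]
          rw [Finset.sum_comm]
      _ ≤ _ := Finset.sum_le_sum fun a _ =>
          sum_sum_nbhd_mul_le hη (hr a) (hM.col_le hη a) (hE a)
  rw [← Finset.mul_sum] at h1
  unfold bandAvg
  calc _ ≤ 1 / (N : ℝ) * ((2 * K + 1) / η * ∑ a, r a) := by gcongr
    _ = _ := by ring

theorem sum_norm_sum_sq_le {K : ℕ} {η δ : ℝ} (hη : 0 < η) (hδ : 0 ≤ δ)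
    {W : Matrix (Fin N) (Fin N) ℂ} (hW : ∀ a, ∑ b, ‖W a b‖ ^ 2 ≤ 1 / η ^ 2) (a : Fin N)
    {t : Fin N → ℂ} (ht : ∀ k ∈ nbhd K a, ‖t k‖ ≤ δ) :
    ∑ b, ‖∑ k ∈ nbhd K a, t k * W k b‖ ^ 2 ≤ ((2 * K + 1) * δ / η) ^ 2 := by
  have hc : ((nbhd K a).card : ℝ) ≤ 2 * K + 1 := by exact_mod_cast card_nbhd_le K a
  calc _ ≤ ∑ b, ((2 * K + 1 : ℝ) * ∑ k ∈ nbhd K a, δ ^ 2 * ‖W k b‖ ^ 2) := by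
        refine Finset.sum_le_sum fun b _ => ?_
        have h1 : ‖∑ k ∈ nbhd K a, t k * W k b‖ ≤ ∑ k ∈ nbhd K a, δ * ‖W k b‖ :=
          (norm_sum_le _ _).trans (Finset.sum_le_sum fun k hk => by
            rw [norm_mul]; gcongr; exact ht k hk)
        have h2 := sq_sum_le_card_mul_sum_sq (s := nbhd K a) (f := fun k => δ * ‖W k b‖)
        simp only [mul_pow] at h2
        have h3 : (0 : ℝ) ≤ ∑ k ∈ nbhd K a, δ ^ 2 * ‖W k b‖ ^ 2 := by positivity
        calc _ ≤ (∑ k ∈ nbhd K a, δ * ‖W k b‖) ^ 2 := by gcongr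
          _ ≤ _ := h2
          _ ≤ _ := by gcongr
    _ = (2 * K + 1) * ∑ k ∈ nbhd K a, δ ^ 2 * ∑ b, ‖W k b‖ ^ 2 := by
        rw [← Finset.mul_sum, Finset.sum_comm]
        simp only [Finset.mul_sum]
    _ ≤ (2 * K + 1) * ∑ k ∈ nbhd K a, δ ^ 2 * (1 / η ^ 2) := by
        gcongr with k _
        exact hW k
    _ ≤ (2 * K + 1) * ((2 * K + 1) * (δ ^ 2 * (1 / η ^ 2))) := by
        gcongr
        exact sum_nbhd_const_le K a (by positivity)
    _ = _ := by ring

/-- If `W` is an approximate solution, except for few rows, then there is an approximate solution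
in the sense of small perturbations near it. -/
theorem exists_isApproxSolution {K : ℕ} {c η Z δ : ℝ} (hη : 0 < η) (hδ : 0 ≤ δ)
    {ξ : Fin N → Fin N → Fin N → Fin N → ℝ} (hξ : IsKernel K c ξ) {z : ℂ} (hz : η ≤ z.im)
    (hZ : ‖z‖ ≤ Z) {W : Matrix (Fin N) (Fin N) ℂ} (hW : ∀ u, 0 ≤ (form u W u).im)
    (hrow : ∀ a, ∑ b, ‖W a b‖ ^ 2 ≤ 1 / η ^ 2) (S : Finset (Fin N)) (t : Fin N → Fin N → ℂ)
    (ht : ∀ a ∉ S, ∀ k ∈ nbhd K a, ‖t a k‖ ≤ δ)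
    (heq : ∀ a ∉ S, ∀ b, ((-(z • (1 : Matrix (Fin N) (Fin N) ℂ)) - Xi ξ W) * W - 1) a b =
      ∑ k ∈ nbhd K a, t a k * W k b)
    {ε : ℝ} (hε : (2 * K + 1) / η * ((2 * K + 1) * δ / η + S.card / N *
      (2 * ((2 * K + 1) * (Z + c * ((2 * K + 1) * (1 / η))) / η + 1))) ≤ ε) :
    ∃ M, IsApproxSolution ξ z ((2 * K + 1) * (c * ε)) M ∧ bandAvg K (W - M) ≤ ε := by
  classical
  set A := -(z • (1 : Matrix (Fin N) (Fin N) ℂ)) - Xi ξ W with hA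
  have hdis : Dissipative η A := dissipative_neg_sub hz (hξ.gram.im_form_Xi_nonneg hW)
  have hM := hdis.inv hη
  have hMA := hdis.inv_mul hη
  have hWle : ∀ i j, ‖W i j‖ ≤ 1 / η := fun i j => by
    have h1 : ‖W i j‖ ^ 2 ≤ (1 / η) ^ 2 := by
      refine le_trans ?_ ((hrow i).trans_eq (by rw [div_pow, one_pow]))
      exact Finset.single_le_sum (f := fun k => ‖W i k‖ ^ 2) (fun k _ => by positivity)
        (Finset.mem_univ j)
    exact (pow_le_pow_iff_left₀ (norm_nonneg _) (by positivity) two_ne_zero).1 h1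
  have hc := hξ.nonneg
  set T : ℝ := Z + c * ((2 * K + 1) * (1 / η)) with hT
  have hZ0 : 0 ≤ Z := (norm_nonneg z).trans hZ
  have hT0 : 0 ≤ T := by positivity
  have hAle : ∀ a k, ‖A a k‖ ≤ T := fun a k => by
    rw [hA, Matrix.sub_apply, Matrix.neg_apply, Matrix.smul_apply]
    refine (norm_sub_le _ _).trans (add_le_add ?_ ((hξ.norm_Xi_apply_le W a k).trans
      (mul_le_mul_of_nonneg_left (bandAvg_le (by positivity) hWle) hc)))
    rw [norm_neg, Matrix.one_apply]
    split_ifs <;> simp [hZ, hZ0]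
  have hAW : ∀ a b, (A * W) a b = ∑ k ∈ nbhd K a, A a k * W k b := fun a b => by
    rw [Matrix.mul_apply, Finset.sum_subset (Finset.subset_univ (nbhd K a))]
    intro k _ hk
    have hne : a ≠ k := by rintro rfl; exact hk (self_mem_nbhd K a)
    rw [hA, Matrix.sub_apply, hξ.Xi_apply_eq_zero W hk, Matrix.neg_apply, Matrix.smul_apply,
      Matrix.one_apply_ne hne]
    simp
  -- Row norms of $AW-1$: of order $\delta$ for ordinary rows, and of order one for exceptional
  -- rows, where nothing but the size of $A$ and $W$ is used.
  set r : Fin N → ℝ := fun a => (2 * K + 1) * δ / η +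
    if a ∈ S then 2 * ((2 * K + 1) * T / η + 1) else 0 with hr
  have hr0 : ∀ a, 0 ≤ r a := fun a => by
    simp only [hr]
    split_ifs <;> positivity
  have hE : ∀ a, ∑ b, ‖(A * W - 1) a b‖ ^ 2 ≤ r a ^ 2 := fun a => by
    by_cases ha : a ∈ S
    · have h1 := sum_norm_sum_sq_le hη hT0 hrow a fun k (_ : k ∈ nbhd K a) => hAle a k
      have h2 : ∑ b, ‖(1 : Matrix (Fin N) (Fin N) ℂ) a b‖ ^ 2 = 1 := by
        rw [Finset.sum_eq_single a (fun b _ hb => by simp [Matrix.one_apply_ne hb.symm])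
          (by simp)]
        simp
      calc _ ≤ ∑ b, (2 * ‖∑ k ∈ nbhd K a, A a k * W k b‖ ^ 2 +
            2 * ‖(1 : Matrix (Fin N) (Fin N) ℂ) a b‖ ^ 2) := by
            refine Finset.sum_le_sum fun b _ => ?_
            rw [Matrix.sub_apply, hAW]
            set x := ∑ k ∈ nbhd K a, A a k * W k b
            set y := (1 : Matrix (Fin N) (Fin N) ℂ) a b
            have := norm_sub_le x y
            have h3 : ‖x - y‖ ^ 2 ≤ (‖x‖ + ‖y‖) ^ 2 := by gcongr
            nlinarith [sq_nonneg (‖x‖ - ‖y‖)]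
        _ ≤ 2 * ((2 * K + 1) * T / η) ^ 2 + 2 * 1 := by
            rw [Finset.sum_add_distrib, ← Finset.mul_sum, ← Finset.mul_sum, h2]
            gcongr
        _ ≤ (2 * ((2 * K + 1) * T / η + 1)) ^ 2 := by
            have : (0 : ℝ) ≤ (2 * K + 1) * T / η := by positivity
            nlinarith
        _ ≤ _ := by
            simp only [hr, if_pos ha]
            have : (0 : ℝ) ≤ (2 * K + 1) * δ / η := by positivity
            gcongr
            linarith
    · simp only [hr, if_neg ha, add_zero]
      simp only [heq a ha]
      exact sum_norm_sum_sq_le hη hδ hrow a (ht a ha)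
  have hb : bandAvg K (W - A⁻¹) ≤ ε := by
    have e : W - A⁻¹ = A⁻¹ * (A * W - 1) := by
      rw [mul_sub, ← mul_assoc, hMA, one_mul, mul_one]
    rw [e]
    refine (bandAvg_mul_le hη hM hr0 hE).trans (le_trans ?_ hε)
    refine mul_le_mul_of_nonneg_left ?_ (by positivity)
    simp only [hr, Finset.sum_add_distrib, Finset.sum_const, Finset.card_univ, Fintype.card_fin,
      nsmul_eq_mul, ← Finset.sum_filter, Finset.filter_univ_mem]
    rcases Nat.eq_zero_or_pos N with h0 | h0
    · subst h0
      simp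
      positivity
    · have hN : (0 : ℝ) < N := by exact_mod_cast h0
      refine le_of_eq ?_
      field_simp
  -- The inverse of $-z-\Xi(W)$ solves the equation with perturbation $\Xi(W-A^{-1})$, and this is
  -- small in operator norm because the band average of $W-A^{-1}$ is.
  refine ⟨A⁻¹, ⟨hM.im_nonneg, Xi ξ (W - A⁻¹), ?_, ?_⟩, hb⟩
  · refine (hξ.formLe_Xi _).mono ?_
    gcongr
  · rw [Xi_sub, sub_sub, sub_add_cancel]
    exact hMA

end

section

/-! ### Block Toeplitz matrices -/

variable {N : ℕ}

/-- The block diagonal matrix with blocks of size `B`, where the block `β` is the Toeplitz matrix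
with entries `a β (k - i)`. -/
def blockToeplitz (N B : ℕ) (a : ℕ → ℤ → ℂ) : Matrix (Fin N) (Fin N) ℂ := fun i k =>
  if (i : ℕ) / B = (k : ℕ) / B then a ((i : ℕ) / B) (((k : ℕ) : ℤ) - ((i : ℕ) : ℤ)) else 0

/-- The indices in `[i - K, i + K]` belong to the same block of size `B` as `i`. -/
def IsInterior (K B : ℕ) (i : Fin N) : Prop :=
  K ≤ (i : ℕ) % B ∧ (i : ℕ) % B + K < B ∧ (i : ℕ) + K < N

theorem IsInterior.div_eq {K B : ℕ} {i k : Fin N} (h : IsInterior K B i) (hk : k ∈ nbhd K i) :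
    (k : ℕ) / B = (i : ℕ) / B := by
  rw [mem_nbhd, abs_le] at hk
  obtain ⟨h1, h2, -⟩ := h
  have e := Nat.div_add_mod (i : ℕ) B
  have hB : 0 < B := by omega
  rw [Nat.div_eq_iff hB]
  have e' : B * ((i : ℕ) / B) = (i : ℕ) / B * B := mul_comm _ _
  constructor
  · omega
  · omega

theorem IsInterior.sum_nbhd {K B : ℕ} {i : Fin N} (h : IsInterior K B i) {α : Type*}
    [AddCommMonoid α] (f : ℤ → α) :
    ∑ k ∈ nbhd K i, f (((k : ℕ) : ℤ) - ((i : ℕ) : ℤ)) = ∑ d ∈ band K, f d := by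
  obtain ⟨h1, -, h3⟩ := h
  have h4 := Nat.mod_le (i : ℕ) B
  refine Finset.sum_bij (fun k _ => ((k : ℕ) : ℤ) - ((i : ℕ) : ℤ)) (fun k hk => ?_)
    (fun k _ k' _ hkk => ?_) (fun d hd => ?_) fun _ _ => rfl
  · rw [mem_nbhd, abs_le] at hk
    rw [Finset.mem_Icc]
    omega
  · ext; omega
  · rw [Finset.mem_Icc] at hd
    refine ⟨⟨(((i : ℕ) : ℤ) + d).toNat, by omega⟩, ?_, ?_⟩
    · rw [mem_nbhd, abs_le]
      simp only
      omega
    · simp only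
      omega

theorem im_form_blockToeplitz_nonneg {K B : ℕ} {η : ℝ} (hη : 0 < η) {z : ℂ} (hz : η ≤ z.im)
    {s a : ℕ → ℤ → ℂ}
    (h : ∀ β, β * B < N → IsSolutionAt K η z (s β) (a β)) (u : Fin N → ℂ) :
    0 ≤ (form u (blockToeplitz N B a) u).im := by
  classical
  have e : form u (blockToeplitz N B a) u = ∑ β ∈ Finset.univ.image fun i : Fin N => (i : ℕ) / B,
      ∑ i ∈ Finset.univ.filter fun i : Fin N => (i : ℕ) / B = β,
        ∑ j ∈ Finset.univ.filter fun j : Fin N => (j : ℕ) / B = β,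
        star (u i) * a β (((j : ℕ) : ℤ) - ((i : ℕ) : ℤ)) * u j := by
    rw [form_eq_sum, ← Finset.sum_fiberwise_of_maps_to
      (t := Finset.univ.image fun i : Fin N => (i : ℕ) / B) (g := fun i : Fin N => (i : ℕ) / B)
      (fun i _ => Finset.mem_image_of_mem _ (Finset.mem_univ i))]
    refine Finset.sum_congr rfl fun β _ => Finset.sum_congr rfl fun i hi => ?_
    have hi' := (Finset.mem_filter.1 hi).2
    rw [Finset.sum_filter]
    refine Finset.sum_congr rfl fun j _ => ?_
    unfold blockToeplitz
    rw [hi']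
    by_cases hj : (j : ℕ) / B = β
    · rw [if_pos hj.symm, if_pos hj]
    · rw [if_neg (Ne.symm hj), if_neg hj]; simp
  rw [e, Complex.im_sum]
  refine Finset.sum_nonneg fun β hβ => ?_
  obtain ⟨i, -, rfl⟩ := Finset.mem_image.1 hβ
  exact (h _ ((Nat.div_mul_le_self _ _).trans_lt i.2)).im_toeplitz_nonneg hη hz _
    (fun i : Fin N => ((i : ℕ) : ℤ)) u

theorem sum_norm_blockToeplitz_sq_le {K B : ℕ} {η : ℝ} {z : ℂ} {s a : ℕ → ℤ → ℂ}
    (h : ∀ β, β * B < N → IsSolutionAt K η z (s β) (a β)) (i : Fin N) :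
    ∑ k, ‖blockToeplitz N B a i k‖ ^ 2 ≤ 1 / η ^ 2 := by
  refine le_trans ?_ ((h ((i : ℕ) / B) ((Nat.div_mul_le_self _ _).trans_lt i.2)).sum_sq_le
    (Finset.univ.image fun k : Fin N => ((k : ℕ) : ℤ) - ((i : ℕ) : ℤ)))
  rw [Finset.sum_image fun k _ k' _ hk => by ext; simpa using hk]
  refine Finset.sum_le_sum fun k _ => ?_
  unfold blockToeplitz
  split_ifs
  · rfl
  · simp

theorem norm_blockToeplitz_le {K B : ℕ} {η : ℝ} (hη : 0 < η) {z : ℂ} {s a : ℕ → ℤ → ℂ}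
    (h : ∀ β, β * B < N → IsSolutionAt K η z (s β) (a β)) (i k : Fin N) :
    ‖blockToeplitz N B a i k‖ ≤ 1 / η := by
  unfold blockToeplitz
  split_ifs
  · exact (h _ ((Nat.div_mul_le_self _ _).trans_lt i.2)).norm_le hη _
  · simp; positivity

/-- In an interior row the whole band lies inside one block, so the convolution equation holds there
exactly with the symbol $s$ in place of $\Xi(W)$; only their difference remains. -/
theorem IsKernel.mul_blockToeplitz_sub_one_apply {K B : ℕ} {c : ℝ}
    {ξ : Fin N → Fin N → Fin N → Fin N → ℝ} (hξ : IsKernel K c ξ) {η : ℝ} {z : ℂ}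
    {s a : ℕ → ℤ → ℂ} (h : ∀ β, β * B < N → IsSolutionAt K η z (s β) (a β)) {i : Fin N}
    (hi : IsInterior K B i) (W : Matrix (Fin N) (Fin N) ℂ) (b : Fin N) :
    ((-(z • (1 : Matrix (Fin N) (Fin N) ℂ)) - Xi ξ W) * blockToeplitz N B a - 1) i b =
      ∑ k ∈ nbhd K i, (s ((i : ℕ) / B) (((k : ℕ) : ℤ) - ((i : ℕ) : ℤ)) - Xi ξ W i k) *
        blockToeplitz N B a k b := by
  have hsol := h _ ((Nat.div_mul_le_self (i : ℕ) B).trans_lt i.2)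
  set A := -(z • (1 : Matrix (Fin N) (Fin N) ℂ)) - Xi ξ W with hA
  set T := blockToeplitz N B a with hT
  have hAT : (A * T) i b = ∑ k ∈ nbhd K i, A i k * T k b := by
    rw [Matrix.mul_apply, Finset.sum_subset (Finset.subset_univ (nbhd K i))]
    intro k _ hk
    have hne : i ≠ k := by rintro rfl; exact hk (self_mem_nbhd K i)
    rw [hA, Matrix.sub_apply, hξ.Xi_apply_eq_zero W hk, Matrix.neg_apply, Matrix.smul_apply,
      Matrix.one_apply_ne hne]
    simp
  have hone : ∑ k ∈ nbhd K i, operand z (s ((i : ℕ) / B)) (((k : ℕ) : ℤ) - ((i : ℕ) : ℤ)) * T k b =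
      (1 : Matrix (Fin N) (Fin N) ℂ) i b := by
    by_cases hb : (i : ℕ) / B = (b : ℕ) / B
    · have h1 := hsol.conv (((b : ℕ) : ℤ) - ((i : ℕ) : ℤ))
      rw [← hi.sum_nbhd] at h1
      rw [Matrix.one_apply]
      have e : (if i = b then (1 : ℂ) else 0) =
          if ((b : ℕ) : ℤ) - ((i : ℕ) : ℤ) = 0 then 1 else 0 := by
        refine if_congr ⟨?_, fun h => ?_⟩ rfl rfl
        · rintro rfl; simp
        · ext; omega
      rw [e, ← h1]
      refine Finset.sum_congr rfl fun k hk => ?_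
      have hk' := hi.div_eq hk
      rw [hT, blockToeplitz, hk', if_pos hb, sub_sub_sub_cancel_right, mul_comm]
    · rw [Matrix.one_apply_ne (by rintro rfl; exact hb rfl)]
      refine Finset.sum_eq_zero fun k hk => ?_
      rw [hT, blockToeplitz, hi.div_eq hk, if_neg hb, mul_zero]
  rw [Matrix.sub_apply, hAT, ← hone, ← Finset.sum_sub_distrib]
  refine Finset.sum_congr rfl fun k _ => ?_
  rw [← sub_mul]
  congr 1
  rw [hA, operand, Matrix.sub_apply, Matrix.neg_apply, Matrix.smul_apply, Matrix.one_apply]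
  by_cases hk : i = k
  · subst hk; simp
  · have : ((k : ℕ) : ℤ) - ((i : ℕ) : ℤ) ≠ 0 := fun h0 => hk (by ext; omega)
    rw [if_neg hk, if_neg this]
    simp; ring

/-! ### Counting exceptional indices -/

-- With blocks of length about $\sqrt N$ there are at most $\sqrt N+3$ blocks, each with at most
-- $2K$ boundary positions, and the last $K$ indices are added.
open Classical in
theorem card_not_isInterior_le (K N : ℕ) :
    (Finset.univ.filter fun i : Fin N => ¬ IsInterior K N.sqrt i).card ≤
      2 * K * (N.sqrt + 3) + K := by
  set B := N.sqrt with hB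
  rcases Nat.eq_zero_or_pos N with h0 | h0
  · subst h0
    simp
  have hB0 : 0 < B := Nat.sqrt_pos.2 h0
  have hlt : N < (B + 1) * (B + 1) := Nat.lt_succ_sqrt N
  set S : Finset (ℕ × ℕ) := (Finset.range K ∪ Finset.Ico (B - K) B) ×ˢ Finset.range (B + 3)
  have hsub : (Finset.univ.filter fun i : Fin N => ¬ IsInterior K B i).image
      (fun i : Fin N => (i : ℕ)) ⊆ S.image (fun p => B * p.2 + p.1) ∪ Finset.Ico (N - K) N := by
    intro x hx
    obtain ⟨i, hi, rfl⟩ := Finset.mem_image.1 hx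
    have hi' := (Finset.mem_filter.1 hi).2
    rw [Finset.mem_union, Finset.mem_image, Finset.mem_Ico]
    by_cases h1 : (i : ℕ) + K < N
    · left
      have hm := Nat.mod_lt (i : ℕ) hB0
      have hi2 := i.2
      refine ⟨((i : ℕ) % B, (i : ℕ) / B), ?_, Nat.div_add_mod _ _⟩
      refine Finset.mem_product.2 ⟨?_, ?_⟩
      · rw [Finset.mem_union, Finset.mem_range, Finset.mem_Ico]
        by_contra h2
        refine hi' ⟨?_, ?_, h1⟩
        · dsimp only at h2; omega
        · dsimp only at h2; omega
      · rw [Finset.mem_range, Nat.div_lt_iff_lt_mul hB0]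
        nlinarith
    · right
      have hi2 := i.2
      omega
  have h1 := Finset.card_le_card hsub
  rw [Finset.card_image_of_injective _ Fin.val_injective] at h1
  refine h1.trans ((Finset.card_union_le _ _).trans (add_le_add ?_ ?_))
  · refine Finset.card_image_le.trans ?_
    rw [Finset.card_product, Finset.card_range]
    refine Nat.mul_le_mul_right _ ((Finset.card_union_le _ _).trans ?_)
    rw [Finset.card_range, Nat.card_Ico]
    omega
  · rw [Nat.card_Ico]
    omega

open Classical in
theorem card_not_far_le (E : Finset ℝ) (N R : ℕ) :
    (Finset.univ.filter fun i : Fin N => ¬ Far E (R / N) (gridPoint i)).card ≤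
      E.card * (2 * R + 1) := by
  rcases Nat.eq_zero_or_pos N with h0 | h0
  · subst h0
    simp
  have hN : (0 : ℝ) < N := by exact_mod_cast h0
  have hsub : (Finset.univ.filter fun i : Fin N => ¬ Far E (R / N) (gridPoint i)) ⊆
      E.biUnion fun e => Finset.univ.filter fun i : Fin N => |gridPoint i - e| ≤ R / N := by
    intro i hi
    have hi' := (Finset.mem_filter.1 hi).2
    unfold Far at hi'
    push Not at hi'
    obtain ⟨e, he, h⟩ := hi'
    exact Finset.mem_biUnion.2 ⟨e, he, Finset.mem_filter.2 ⟨Finset.mem_univ _, h⟩⟩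
  refine (Finset.card_le_card hsub).trans (Finset.card_biUnion_le_card_mul _ _ _ fun e _ => ?_)
  have hinj : (Finset.univ.filter fun i : Fin N => |gridPoint i - e| ≤ R / N).card ≤
      (Finset.Icc ⌈e * N - R - 1⌉ ⌊e * N + R - 1⌋).card := by
    refine Finset.card_le_card_of_injOn (fun i : Fin N => ((i : ℕ) : ℤ)) (fun i hi => ?_)
      fun i _ j _ hij => by ext; simpa using hij
    have hi' := (Finset.mem_filter.1 (Finset.mem_coe.1 hi)).2
    rw [le_div_iff₀ hN, ← abs_of_pos hN, ← abs_mul, gridPoint, sub_mul,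
      div_mul_cancel₀ _ hN.ne', abs_le] at hi'
    rw [Finset.coe_Icc, Set.mem_Icc, Int.ceil_le, Int.le_floor]
    push_cast
    constructor <;> linarith [hi'.1, hi'.2]
  refine hinj.trans ?_
  rw [Int.card_Icc]
  have h1 := Int.floor_le (e * N + R - 1)
  have h2 := Int.le_ceil (e * N - R - 1)
  have h3 : ((⌊e * N + R - 1⌋ - ⌈e * N - R - 1⌉ : ℤ) : ℝ) ≤ ((2 * R : ℤ) : ℝ) := by
    push_cast; linarith
  have h4 : ⌊e * N + R - 1⌋ - ⌈e * N - R - 1⌉ ≤ 2 * R := by exact_mod_cast h3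
  omega

end

section

/-! ### Riemann sums -/

/-- The integral is split into cells of length $1/N$; the cells in `S` are charged with the trivial
bound $2A$. -/
theorem norm_avg_sub_integral_le {N : ℕ} (hN : 0 < N) {f : Fin N → ℂ} {F : ℝ → ℂ}
    (hF : Integrable F unitMeasure) {A δ : ℝ} (hδ : 0 ≤ δ) (S : Finset (Fin N))
    (hf : ∀ j, ‖f j‖ ≤ A) (hFA : ∀ᵐ φ ∂unitMeasure, ‖F φ‖ ≤ A)
    (hd : ∀ j ∉ S, ∀ᵐ φ ∂unitMeasure, ((j : ℕ) : ℝ) / N ≤ φ → φ ≤ (((j : ℕ) : ℝ) + 1) / N →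
      ‖f j - F φ‖ ≤ δ) :
    ‖(1 / (N : ℂ)) * ∑ j, f j - ∫ φ in Set.Ico (0 : ℝ) 1, F φ‖ ≤ δ + 2 * A * (S.card / N) := by
  classical
  have hNR : (0 : ℝ) < N := by exact_mod_cast hN
  have hA : 0 ≤ A := (norm_nonneg _).trans (hf ⟨0, hN⟩)
  set a : ℕ → ℝ := fun j => (j : ℝ) / N with ha
  have hmono : ∀ j, a j ≤ a (j + 1) := fun j => by
    simp only [ha]; push_cast; gcongr; linarith
  have hlen : ∀ j, a (j + 1) - a j = 1 / N := fun j => by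
    simp only [ha]; push_cast; ring
  have hsub : ∀ j < N, ∀ x ∈ Set.uIoc (a j) (a (j + 1)), x ≠ 1 →
      x ∈ Set.Ico (0 : ℝ) 1 ∧ a j ≤ x ∧ x ≤ a (j + 1) := fun j hj x hx hx1 => by
    rw [Set.uIoc_of_le (hmono j)] at hx
    have h0 : 0 ≤ a j := by simp only [ha]; positivity
    have h1 : a (j + 1) ≤ 1 := by
      simp only [ha]; rw [div_le_one hNR]; exact_mod_cast hj
    exact ⟨⟨h0.trans hx.1.le, lt_of_le_of_ne (hx.2.trans h1) hx1⟩, hx.1.le, hx.2⟩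
  have hvol : IntegrableOn F (Set.Ioc 0 1) := by
    exact (IntegrableOn.congr_set_ae hF Ico_ae_eq_Ioc.symm)
  have hII : ∀ j < N, IntervalIntegrable F volume (a j) (a (j + 1)) := fun j hj => by
    rw [intervalIntegrable_iff_integrableOn_Ioc_of_le (hmono j)]
    refine hvol.mono_set fun x hx => ⟨lt_of_le_of_lt (by simp only [ha]; positivity) hx.1,
      hx.2.trans ?_⟩
    simp only [ha]; rw [div_le_one hNR]; exact_mod_cast hj
  have hsum : ∫ φ in Set.Ico (0 : ℝ) 1, F φ = ∑ j : Fin N, ∫ φ in a j..a (j + 1), F φ := by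
    rw [integral_Ico_eq_integral_Ioc, ← intervalIntegral.integral_of_le zero_le_one,
      ← Finset.sum_range fun j => ∫ φ in a j..a (j + 1), F φ,
      intervalIntegral.sum_integral_adjacent_intervals hII]
    simp [ha, hNR.ne']
  have hcell : ∀ j : Fin N, ‖(1 / (N : ℂ)) * f j - ∫ φ in a j..a (j + 1), F φ‖ ≤
      (δ + if j ∈ S then 2 * A else 0) * (1 / N) := fun j => by
    have e : (1 / (N : ℂ)) * f j - ∫ φ in a j..a (j + 1), F φ =
        ∫ φ in a j..a (j + 1), (f j - F φ) := by
      rw [intervalIntegral.integral_sub intervalIntegrable_const (hII j j.2),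
        intervalIntegral.integral_const, hlen, Complex.real_smul]
      push_cast; ring
    have hae : ∀ᵐ φ : ℝ, φ ∈ Set.uIoc (a j) (a (j + 1)) →
        ‖f j - F φ‖ ≤ δ + if j ∈ S then 2 * A else 0 := by
      have h1 : ∀ᵐ φ : ℝ, φ ∉ ({1} : Set ℝ) := (Set.countable_singleton (1 : ℝ)).ae_notMem _
      by_cases hj : j ∈ S
      · rw [if_pos hj]
        filter_upwards [h1, (ae_restrict_iff' measurableSet_Ico).1 hFA] with φ h2 h3 h4
        obtain ⟨h5, -, -⟩ := hsub j j.2 φ h4 h2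
        linarith [norm_sub_le (f j) (F φ), hf j, h3 h5]
      · rw [if_neg hj, add_zero]
        filter_upwards [h1, (ae_restrict_iff' measurableSet_Ico).1 (hd j hj)] with φ h2 h3 h4
        obtain ⟨h5, h6, h7⟩ := hsub j j.2 φ h4 h2
        exact h3 h5 h6 (h7.trans_eq (by simp only [ha]; push_cast; ring))
    rw [e]
    have := intervalIntegral.norm_integral_le_of_norm_le_const_ae hae
    rwa [hlen, abs_of_pos (by positivity)] at this
  rw [hsum, Finset.mul_sum, ← Finset.sum_sub_distrib]
  refine (norm_sum_le _ _).trans ((Finset.sum_le_sum fun j _ => hcell j).trans_eq ?_)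
  rw [← Finset.sum_mul, Finset.sum_add_distrib, ← Finset.sum_filter, Finset.filter_univ_mem]
  simp only [Finset.sum_const, Finset.card_univ, Fintype.card_fin, nsmul_eq_mul]
  field_simp

/-! ### Regularity of solutions of the limiting equation -/

/-- `θ` is not a break point, and `m(θ)` inverts `-z - Ψ(m)(θ)`. -/
structure IsGoodPoint (K : ℕ) (η : ℝ) (z : ℂ) (E : Finset ℝ) (ψ : ℝ → ℝ → ℤ → ℤ → ℝ)
    (m : ℝ → ℤ → ℂ) (θ : ℝ) : Prop where
  mem_Ico : θ ∈ Set.Ico (0 : ℝ) 1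
  notMem : θ ∉ E
  isSolutionAt : IsSolutionAt K η z (Psi ψ m θ) (m θ)

namespace IsLimitProfile

variable {K : ℕ} {c : ℝ} {E : Finset ℝ} {L : ℤ → ℤ → ℝ} {ψ : ℝ → ℝ → ℤ → ℤ → ℝ} {η Λ : ℝ}
  {z : ℂ} {m : ℝ → ℤ → ℂ}

theorem ae_isGoodPoint (h : IsLimitProfile K c E L ψ) (hη : 0 < η) (hz : η ≤ z.im)
    (hm : SolvesLimit ψ z m) : ∀ᵐ θ ∂unitMeasure, IsGoodPoint K η z E ψ m θ := by
  filter_upwards [h.ae_isSolutionAt hη hz hm] with θ hθ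
  exact ⟨hθ.1, hθ.2.1, hθ.2.2⟩

theorem exists_isGoodPoint (h : IsLimitProfile K c E L ψ) (hη : 0 < η) (hz : η ≤ z.im)
    (hm : SolvesLimit ψ z m) {x y : ℝ} (hx : 0 ≤ x) (hx1 : x < 1) (hxy : x < y) :
    ∃ θ, IsGoodPoint K η z E ψ m θ ∧ x ≤ θ ∧ θ ≤ y := by
  have h1 := (ae_restrict_iff' measurableSet_Ico).1 (h.ae_isGoodPoint hη hz hm)
  have h2 : ∀ᵐ θ ∂volume.restrict (Set.Ioo x (min 1 y)), IsGoodPoint K η z E ψ m θ ∧ x ≤ θ ∧ θ ≤ y := by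
    rw [ae_restrict_iff' measurableSet_Ioo]
    filter_upwards [h1] with θ hθ hm
    exact ⟨hθ ⟨hx.trans hm.1.le, hm.2.trans_le (min_le_left _ _)⟩, hm.1.le,
      hm.2.le.trans (min_le_right _ _)⟩
  have : (ae (volume.restrict (Set.Ioo x (min 1 y)))).NeBot := by
    rw [ae_restrict_neBot, Real.volume_Ioo]
    simp [hx1, hxy]
  exact h2.exists

theorem norm_Psi_sub_le (h : IsLimitProfile K c E L ψ) (hη : 0 < η) (hz : η ≤ z.im)
    (hm : SolvesLimit ψ z m) (hΛ : ∀ k ∈ band K, ∀ l ∈ band K, L k l ≤ Λ) {θ θ' : ℝ}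
    (hθ : IsGoodPoint K η z E ψ m θ) (hθ' : IsGoodPoint K η z E ψ m θ') (ha : Avoids E θ θ')
    {k : ℤ} (hk : k ∈ band K) :
    ‖Psi ψ m θ k - Psi ψ m θ' k‖ ≤ (2 * K + 1) * (Λ * (1 / η) * |θ - θ'|) := by
  have hgood := h.ae_isGoodPoint hη hz hm
  have hb : ∀ l, ∀ᵐ φ ∂unitMeasure, ‖m φ l‖ ≤ 1 / η := fun l => by
    filter_upwards [hgood] with φ hφ using hφ.isSolutionAt.norm_le hη l
  have i1 := fun l => h.integrable_mul hθ.mem_Ico hθ.notMem (hm.1.1.1 l) (hb l) k l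
  have i2 := fun l => h.integrable_mul hθ'.mem_Ico hθ'.notMem (hm.1.1.1 l) (hb l) k l
  rw [h.Psi_eq hθ.mem_Ico hθ.notMem, h.Psi_eq hθ'.mem_Ico hθ'.notMem, ← Finset.sum_sub_distrib,
    ← sum_band_const_le]
  refine (norm_sum_le _ _).trans (Finset.sum_le_sum fun l hl => ?_)
  rw [← integral_sub (i1 l) (i2 l)]
  have h1 : ∀ᵐ φ ∂unitMeasure, ‖(ψ θ φ k l : ℂ) * m φ l - (ψ θ' φ k l : ℂ) * m φ l‖ ≤
      Λ * (1 / η) * |θ - θ'| := by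
    filter_upwards [hgood] with φ hφ
    rw [← sub_mul, norm_mul, ← Complex.ofReal_sub, Complex.norm_real, Real.norm_eq_abs]
    have h2 := h.abs_sub_le θ hθ.mem_Ico θ' hθ'.mem_Ico φ hφ.mem_Ico φ hφ.mem_Ico ha
      (fun e he hm => by
        rw [Set.uIcc_self, Set.mem_singleton_iff] at hm
        exact hφ.notMem (hm ▸ he)) k l
    rw [sub_self, abs_zero, add_zero] at h2
    have h3 := h2.trans (mul_le_mul_of_nonneg_right (hΛ k hk l hl) (abs_nonneg _))
    calc _ ≤ Λ * |θ - θ'| * (1 / η) :=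
          mul_le_mul h3 (hφ.isSolutionAt.norm_le hη l) (norm_nonneg _) ((abs_nonneg _).trans h3)
      _ = _ := by ring
  have h2 := norm_integral_le_of_norm_le_const h1
  simpa using h2

/-- No continuity of $m$ in $\theta$ is assumed. It is gained from the equation: $\Psi(m)$ inherits
the Lipschitz bound of $\psi$, and inversion preserves it. -/
theorem norm_sub_le (h : IsLimitProfile K c E L ψ) (hη : 0 < η) (hz : η ≤ z.im)
    (hm : SolvesLimit ψ z m) (hΛ : ∀ k ∈ band K, ∀ l ∈ band K, L k l ≤ Λ) {θ θ' : ℝ}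
    (hθ : IsGoodPoint K η z E ψ m θ) (hθ' : IsGoodPoint K η z E ψ m θ') (ha : Avoids E θ θ')
    (l : ℤ) :
    ‖m θ l - m θ' l‖ ≤ 1 / η ^ 2 * ((2 * K + 1) * ((2 * K + 1) * (Λ * (1 / η)))) * |θ - θ'| := by
  refine (hθ.isSolutionAt.norm_sub_le hθ'.isSolutionAt hη hz
    (fun k hk => h.norm_Psi_sub_le hη hz hm hΛ hθ hθ' ha hk) l).trans_eq ?_
  ring

end IsLimitProfile

end

section

/-! ### Discretization of the limiting equation -/

/-- Transposing both pairs exchanges the two sorted cases of `covTensor`. The diagonal is excluded,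
because there only one of the two orders is strict. -/
theorem covTensor_swap {N : ℕ} {Ω : Type*} [MeasurableSpace Ω] (P : Measure Ω)
    (x : UpperIndex N → Ω → ℝ) {i j k l : Fin N} (hij : i ≠ j) (hkl : k ≠ l) :
    covTensor P x i j k l = covTensor P x j i l k := by
  unfold covTensor
  have e : ∀ (y : UpperIndex N → ℝ) (a b : Fin N), symMatrix y a b = symMatrix y b a :=
    fun y a b => by simp only [symMatrix, min_comm, max_comm]
  simp only [fun ω => e (fun a => x a ω) i j, fun ω => e (fun a => x a ω) k l]
  refine if_congr ?_ rfl rfl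
  have h1 : i ≤ j ↔ ¬ j < i := not_lt.symm
  have h2 : j ≤ i ↔ ¬ i < j := not_lt.symm
  have h3 : k ≤ l ↔ ¬ l < k := not_lt.symm
  have h4 : l ≤ k ↔ ¬ k < l := not_lt.symm
  rcases lt_or_gt_of_ne hij with h5 | h5 <;> rcases lt_or_gt_of_ne hkl with h6 | h6 <;>
    simp [h5, h6, h1, h2, h3, h4, h5.not_gt, h6.not_gt]

theorem gridPoint_sub_le {N B : ℕ} (hB : 0 < B) (i : Fin N) {θ : ℝ}
    (h1 : ((((i : ℕ) / B : ℕ) : ℝ) * B) / N ≤ θ) (h2 : θ ≤ (((((i : ℕ) / B : ℕ) : ℝ) + 1) * B) / N)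
    {φ : ℝ} (h3 : ((i : ℕ) : ℝ) / N ≤ φ) (h4 : φ ≤ (((i : ℕ) : ℝ) + 1) / N) :
    |φ - θ| ≤ (B : ℝ) / N := by
  have e := Nat.div_add_mod (i : ℕ) B
  have hm := Nat.mod_lt (i : ℕ) hB
  have a1 : (((i : ℕ) / B : ℕ) : ℝ) * B ≤ ((i : ℕ) : ℝ) := by
    exact_mod_cast Nat.div_mul_le_self (i : ℕ) B
  have a2 : ((i : ℕ) : ℝ) + 1 ≤ ((((i : ℕ) / B : ℕ) : ℝ) + 1) * B := by
    have : (i : ℕ) + 1 ≤ ((i : ℕ) / B + 1) * B := by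
      rw [add_mul, one_mul, mul_comm]; omega
    exact_mod_cast this
  have b1 : (((i : ℕ) : ℝ) + 1) / N ≤ (((((i : ℕ) / B : ℕ) : ℝ) + 1) * B) / N := by gcongr
  have b2 : ((((i : ℕ) / B : ℕ) : ℝ) * B) / N ≤ ((i : ℕ) : ℝ) / N := by gcongr
  have b3 : (((((i : ℕ) / B : ℕ) : ℝ) + 1) * B) / N =
    ((((i : ℕ) / B : ℕ) : ℝ) * B) / N + (B : ℝ) / N := by ring
  rw [abs_le]
  constructor <;> linarith

/-- A choice of one good point in each of the intervals `[βB/N, (β+1)B/N]`. -/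
structure IsSample (K : ℕ) (η : ℝ) (z : ℂ) (E : Finset ℝ) (ψ : ℝ → ℝ → ℤ → ℤ → ℝ)
    (m : ℝ → ℤ → ℂ) (N B : ℕ) (ϑ : ℕ → ℝ) : Prop where
  isGoodPoint : ∀ β, β * B < N → IsGoodPoint K η z E ψ m (ϑ β)
  le : ∀ β, β * B < N → ((β : ℝ) * B) / N ≤ ϑ β
  ge : ∀ β, β * B < N → ϑ β ≤ (((β : ℝ) + 1) * B) / N

variable {K : ℕ} {c : ℝ} {E : Finset ℝ} {L : ℤ → ℤ → ℝ} {ψ : ℝ → ℝ → ℤ → ℤ → ℝ} {η Λ : ℝ}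
  {z : ℂ} {m : ℝ → ℤ → ℂ} {N B : ℕ} {ϑ : ℕ → ℝ}

theorem IsLimitProfile.exists_isSample (h : IsLimitProfile K c E L ψ) (hη : 0 < η)
    (hz : η ≤ z.im) (hm : SolvesLimit ψ z m) (hB : 0 < B) :
    ∃ ϑ, IsSample K η z E ψ m N B ϑ := by
  have h1 : ∀ β : ℕ, ∃ θ, β * B < N → IsGoodPoint K η z E ψ m θ ∧ ((β : ℝ) * B) / N ≤ θ ∧
      θ ≤ (((β : ℝ) + 1) * B) / N := fun β => by
    by_cases hβ : β * B < N
    · have hN : (0 : ℝ) < N := by exact_mod_cast (Nat.zero_le _).trans_lt hβ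
      have hBR : (0 : ℝ) < B := by exact_mod_cast hB
      obtain ⟨θ, hθ⟩ := h.exists_isGoodPoint hη hz hm (x := ((β : ℝ) * B) / N)
        (y := (((β : ℝ) + 1) * B) / N) (by positivity)
        (by rw [div_lt_one hN]; exact_mod_cast hβ) (by gcongr; linarith)
      exact ⟨θ, fun _ => hθ⟩
    · exact ⟨0, fun h => absurd h hβ⟩
  choose ϑ hϑ using h1
  exact ⟨ϑ, fun β hβ => (hϑ β hβ).1, fun β hβ => (hϑ β hβ).2.1, fun β hβ => (hϑ β hβ).2.2⟩

namespace IsSample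

theorem lt_of_fin (i : Fin N) : (i : ℕ) / B * B < N := (Nat.div_mul_le_self _ _).trans_lt i.2

theorem abs_sub_le (hs : IsSample K η z E ψ m N B ϑ) (hB : 0 < B) (i : Fin N) {φ : ℝ}
    (h3 : ((i : ℕ) : ℝ) / N ≤ φ) (h4 : φ ≤ (((i : ℕ) : ℝ) + 1) / N) :
    |φ - ϑ ((i : ℕ) / B)| ≤ (B : ℝ) / N :=
  gridPoint_sub_le hB i (hs.le _ (lt_of_fin i)) (hs.ge _ (lt_of_fin i)) h3 h4

theorem abs_gridPoint_sub_le (hs : IsSample K η z E ψ m N B ϑ) (hB : 0 < B) (i : Fin N) :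
    |gridPoint i - ϑ ((i : ℕ) / B)| ≤ (B : ℝ) / N :=
  hs.abs_sub_le hB i (by unfold gridPoint; gcongr; linarith) le_rfl

theorem isSolutionAt (hs : IsSample K η z E ψ m N B ϑ) (β : ℕ) (hβ : β * B < N) :
    IsSolutionAt K η z (Psi ψ m (ϑ β)) (m (ϑ β)) := (hs.isGoodPoint β hβ).isSolutionAt

theorem norm_sub_le (hs : IsSample K η z E ψ m N B ϑ) (h : IsLimitProfile K c E L ψ)
    (hη : 0 < η) (hz : η ≤ z.im) (hm : SolvesLimit ψ z m)
    (hΛ : ∀ k ∈ band K, ∀ l ∈ band K, L k l ≤ Λ) (hΛ0 : 0 ≤ Λ) (hB : 0 < B) {j : Fin N}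
    (hj : Far E ((3 * B + K : ℕ) / N) (gridPoint j)) {φ : ℝ} (hφ : IsGoodPoint K η z E ψ m φ)
    (h3 : ((j : ℕ) : ℝ) / N ≤ φ) (h4 : φ ≤ (((j : ℕ) : ℝ) + 1) / N) (l : ℤ) :
    ‖m (ϑ ((j : ℕ) / B)) l - m φ l‖ ≤
      1 / η ^ 2 * ((2 * K + 1) * ((2 * K + 1) * (Λ * (1 / η)))) * ((B : ℝ) / N) := by
  have d1 := hs.abs_sub_le hB j h3 h4
  have d2 := hs.abs_gridPoint_sub_le hB j
  rw [abs_sub_comm] at d1 d2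
  have hav : Avoids E (ϑ ((j : ℕ) / B)) φ := (hj.of_abs_sub_le d2).avoids (by
    rw [abs_sub_comm]
    refine d1.trans ?_
    have : (0 : ℝ) ≤ B / N := by positivity
    have : (0 : ℝ) ≤ K / N := by positivity
    have e : ((3 * B + K : ℕ) : ℝ) / N = 3 * (B / N) + K / N := by push_cast; ring
    linarith)
  refine (h.norm_sub_le hη hz hm hΛ (hs.isGoodPoint _ (lt_of_fin j)) hφ hav l).trans ?_
  gcongr

theorem norm_trace_sub_le (hs : IsSample K η z E ψ m N B ϑ) (h : IsLimitProfile K c E L ψ)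
    (hη : 0 < η) (hz : η ≤ z.im) (hm : SolvesLimit ψ z m)
    (hΛ : ∀ k ∈ band K, ∀ l ∈ band K, L k l ≤ Λ) (hΛ0 : 0 ≤ Λ) (hB : 0 < B) (hN : 0 < N)
    {S : Finset (Fin N)} (hS : ∀ j ∉ S, Far E ((3 * B + K : ℕ) / N) (gridPoint j)) :
    ‖(1 / (N : ℂ)) * (blockToeplitz N B fun β => m (ϑ β)).trace - limitTrace m‖ ≤
      1 / η ^ 2 * ((2 * K + 1) * ((2 * K + 1) * (Λ * (1 / η)))) * ((B : ℝ) / N) +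
        2 * (1 / η) * (S.card / N) := by
  have hgood := h.ae_isGoodPoint hη hz hm
  have hb : ∀ᵐ φ ∂unitMeasure, ‖m φ 0‖ ≤ 1 / η := by
    filter_upwards [hgood] with φ hφ using hφ.isSolutionAt.norm_le hη 0
  unfold Matrix.trace limitTrace
  have e : ∀ j : Fin N, (blockToeplitz N B fun β => m (ϑ β)).diag j = m (ϑ ((j : ℕ) / B)) 0 :=
    fun j => by simp [Matrix.diag, blockToeplitz]
  simp only [e]
  refine norm_avg_sub_integral_le hN (Integrable.of_bound (hm.1.1.1 0) (1 / η) hb) (by positivity)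
    S (fun j => (hs.isSolutionAt _ (lt_of_fin j)).norm_le hη 0) hb fun j hj => ?_
  filter_upwards [hgood] with φ hφ h3 h4
  exact hs.norm_sub_le h hη hz hm hΛ hΛ0 hB (hS j hj) hφ h3 h4 0

/-- The self-energy of the discretized solution is the discretization of the self-energy. -/
theorem norm_Psi_sub_Xi_le (hs : IsSample K η z E ψ m N B ϑ) (h : IsLimitProfile K c E L ψ)
    (hψ : IsProfile ψ) (hη : 0 < η) (hz : η ≤ z.im) (hm : SolvesLimit ψ z m)
    (hΛ : ∀ k ∈ band K, ∀ l ∈ band K, L k l ≤ Λ) (hΛ0 : 0 ≤ Λ) (hB : 0 < B) {C : ℝ} (hC : 0 ≤ C)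
    {ξ : Fin N → Fin N → Fin N → Fin N → ℝ} (hξ : IsKernel K c ξ)
    (hdis : IsDiscretization K C ψ ξ)
    (hswap : ∀ i j k l, i ≠ j → k ≠ l → ξ i j k l = ξ j i l k)
    {S : Finset (Fin N)} (hSi : ∀ j ∉ S, IsInterior K B j)
    (hS : ∀ j ∉ S, Far E ((3 * B + K : ℕ) / N) (gridPoint j))
    {i k : Fin N} (hi : i ∉ S) (hk : k ∈ nbhd K i) :
    ‖Psi ψ m (ϑ ((i : ℕ) / B)) (((k : ℕ) : ℤ) - ((i : ℕ) : ℤ)) -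
        Xi ξ (blockToeplitz N B fun β => m (ϑ β)) i k‖ ≤
      (2 * K + 1) * ((C / N + Λ * (2 * (B / N))) * (1 / η) +
        c * (1 / η ^ 2 * ((2 * K + 1) * ((2 * K + 1) * (Λ * (1 / η)))) * ((B : ℝ) / N))) +
      2 * ((2 * K + 1) * (c * (1 / η))) * ((S.card + (4 * K + 1)) / N) := by
  classical
  have hN : 0 < N := (Nat.zero_le _).trans_lt i.2
  have hNR : (0 : ℝ) < N := by exact_mod_cast hN
  have hc := hξ.nonneg
  have hgood := h.ae_isGoodPoint hη hz hm
  set θ := ϑ ((i : ℕ) / B) with hθdef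
  have hθ : IsGoodPoint K η z E ψ m θ := hs.isGoodPoint _ (lt_of_fin i)
  set d : ℤ := ((k : ℕ) : ℤ) - ((i : ℕ) : ℤ) with hd
  have hdK : d ∈ band K := by
    rw [mem_nbhd, _root_.abs_le] at hk
    rw [Finset.mem_Icc]; omega
  set W := blockToeplitz N B fun β => m (ϑ β) with hW
  have hb : ∀ l, ∀ᵐ φ ∂unitMeasure, ‖m φ l‖ ≤ 1 / η := fun l => by
    filter_upwards [hgood] with φ hφ using hφ.isSolutionAt.norm_le hη l
  have hint : ∀ l, Integrable (fun φ => (ψ θ φ d l : ℂ) * m φ l) unitMeasure := fun l =>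
    h.integrable_mul hθ.mem_Ico hθ.notMem (hm.1.1.1 l) (hb l) d l
  set F : ℝ → ℂ := fun φ => ∑ l ∈ band K, (ψ θ φ d l : ℂ) * m φ l with hF
  have hFi : Integrable F unitMeasure := integrable_finsetSum _ fun l _ => hint l
  have hPsi : Psi ψ m θ d = ∫ φ in Set.Ico (0 : ℝ) 1, F φ := by
    rw [h.Psi_eq hθ.mem_Ico hθ.notMem]
    exact (integral_finsetSum _ fun l _ => hint l).symm
  set f : Fin N → ℂ := fun j => ∑ l ∈ nbhd K j, (ξ i j k l : ℂ) * W j l with hf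
  have hXi : Xi ξ W i k = (1 / (N : ℂ)) * ∑ j, f j := by
    unfold Xi
    congr 1
    refine Finset.sum_congr rfl fun j _ => ?_
    rw [hf]
    refine (Finset.sum_subset (Finset.subset_univ _) fun l _ hl => ?_).symm
    have : ξ i j k l = 0 := by
      by_contra h0
      exact hl (hξ.near i j k l h0).2
    simp [this]
  have hWle : ∀ j l, ‖W j l‖ ≤ 1 / η := norm_blockToeplitz_le hη hs.isSolutionAt
  have hfA : ∀ j, ‖f j‖ ≤ (2 * K + 1) * (c * (1 / η)) := fun j => by
    refine ((norm_sum_le _ _).trans (Finset.sum_le_sum fun l _ => ?_)).trans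
      (sum_nbhd_const_le K j (by positivity))
    rw [norm_mul, Complex.norm_real]
    exact mul_le_mul (hξ.abs_le i j k l) (hWle j l) (norm_nonneg _) hc
  have hFA : ∀ᵐ φ ∂unitMeasure, ‖F φ‖ ≤ (2 * K + 1) * (c * (1 / η)) := by
    filter_upwards [hgood, IsLimitProfile.ae_generic θ E] with φ hφ hg
    rw [← sum_band_const_le]
    refine (norm_sum_le _ _).trans (Finset.sum_le_sum fun l _ => ?_)
    rw [norm_mul, Complex.norm_real]
    exact mul_le_mul (h.abs_le θ hθ.mem_Ico φ hg.1 hθ.notMem hg.2.1 hg.2.2 d l)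
      (hφ.isSolutionAt.norm_le hη l) (norm_nonneg _) hc
  have hcard : (((S ∪ nbhd (2 * K) i).card : ℕ) : ℝ) ≤ S.card + (4 * K + 1) := by
    have h1 := (Finset.card_union_le S (nbhd (2 * K) i)).trans
      (Nat.add_le_add_left (card_nbhd_le (2 * K) i) _)
    have h2 : (((S ∪ nbhd (2 * K) i).card : ℕ) : ℝ) ≤
      ((S.card + (2 * (2 * K) + 1) : ℕ) : ℝ) := by exact_mod_cast h1
    push_cast at h2
    linarith
  have eR : ((3 * B + K : ℕ) : ℝ) / N = 3 * (B / N) + K / N := by push_cast; ring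
  have hBN : (0 : ℝ) ≤ B / N := by positivity
  have hBN1 : (1 : ℝ) / N ≤ B / N := by gcongr; exact_mod_cast hB
  have hfar : ∀ (j : Fin N), j ∉ S → ∀ φ, |φ - gridPoint j| ≤ B / N → Far E (B / N + K / N) φ :=
    fun j hj φ hφ => ((hS j hj).of_abs_sub_le hφ).mono (by rw [eR]; linarith)
  have hθfar : Far E (B / N + K / N) θ := hfar i hi θ (by
    rw [abs_sub_comm]; exact hs.abs_gridPoint_sub_le hB i)
  rw [hPsi, hXi, norm_sub_rev]
  set Δ : ℝ := (C / N + Λ * (2 * (B / N))) * (1 / η) +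
    c * (1 / η ^ 2 * ((2 * K + 1) * ((2 * K + 1) * (Λ * (1 / η)))) * ((B : ℝ) / N)) with hΔ
  have hΔ0 : 0 ≤ Δ := by positivity
  -- Indices $j$ within $2K$ of $i$ join the exceptional set. For the others $(i,j)$ and $(k,l)$ are
  -- ordered in the same way, so the tensor is described by the profile.
  refine (norm_avg_sub_integral_le (δ := (2 * K + 1) * Δ) hN hFi (by positivity) (S ∪ nbhd (2 * K) i) hfA hFA
    fun j hj => ?_).trans (by gcongr)
  rw [Finset.mem_union, not_or, mem_nbhd, not_le] at hj
  obtain ⟨hjS, hij⟩ := hj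
  filter_upwards [hgood, IsLimitProfile.ae_generic θ E] with φ hφ hg h3 h4
  have dφ : |gridPoint j - φ| ≤ B / N := by
    refine le_trans ?_ hBN1
    have e : (((j : ℕ) : ℝ) + 1) / N = ((j : ℕ) : ℝ) / N + 1 / N := by ring
    rw [gridPoint, _root_.abs_le]
    constructor <;> linarith
  have hφfar : Far E (B / N + K / N) φ := hfar j hjS φ (by rw [abs_sub_comm]; exact dφ)
  have hFeq : F φ = ∑ l ∈ nbhd K j, (ψ θ φ d (((l : ℕ) : ℤ) - ((j : ℕ) : ℤ)) : ℂ) *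
      m φ (((l : ℕ) : ℤ) - ((j : ℕ) : ℤ)) :=
    ((hSi j hjS).sum_nbhd fun l => (ψ θ φ d l : ℂ) * m φ l).symm
  rw [hFeq, hf, ← Finset.sum_sub_distrib]
  refine ((norm_sum_le _ _).trans (Finset.sum_le_sum fun l hl => ?_)).trans
    (sum_nbhd_const_le K j hΔ0)
  set e : ℤ := ((l : ℕ) : ℤ) - ((j : ℕ) : ℤ) with he
  have heK : e ∈ band K := by
    rw [mem_nbhd, _root_.abs_le] at hl
    rw [Finset.mem_Icc]; omega
  have hWe : W j l = m (ϑ ((j : ℕ) / B)) e := by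
    rw [hW, blockToeplitz, if_pos ((hSi j hjS).div_eq hl).symm]
  have hξψ : |ξ i j k l - ψ θ φ d e| ≤ C / N + Λ * (2 * (B / N)) := by
    have hLde : L d e * (B / N + B / N) ≤ Λ * (2 * (B / N)) := by
      rw [← two_mul]
      exact mul_le_mul_of_nonneg_right (hΛ d hdK e heK) (by positivity)
    have hLed : L e d * (B / N + B / N) ≤ Λ * (2 * (B / N)) := by
      rw [← two_mul]
      exact mul_le_mul_of_nonneg_right (hΛ e heK d hdK) (by positivity)
    have dθ := hs.abs_gridPoint_sub_le hB i
    rw [mem_nbhd, _root_.abs_le] at hk hl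
    -- Below the diagonal the discretization hypothesis says nothing; the exchange symmetries of the
    -- tensor and of $\psi$ reduce this case to the one above.
    rcases lt_abs.1 hij with hlt | hlt
    · have h1 : j < i := by rw [Fin.lt_def]; push_cast at hlt; omega
      have h2 : l < k := by rw [Fin.lt_def]; push_cast at hlt; omega
      rw [hswap i j k l h1.ne' h2.ne', hψ.symm_swap θ hθ.mem_Ico φ hφ.mem_Ico]
      have := h.abs_sub_le_of_isDiscretization hdis h1.le h2.le hφ.mem_Ico hθ.mem_Ico hφfar hθfar
        dφ dθ
      linarith
    · have h1 : i < j := by rw [Fin.lt_def]; push_cast at hlt; omega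
      have h2 : k < l := by rw [Fin.lt_def]; push_cast at hlt; omega
      have := h.abs_sub_le_of_isDiscretization hdis h1.le h2.le hθ.mem_Ico hφ.mem_Ico hθfar hφfar
        dθ dφ
      linarith
  rw [hWe]
  have hsplit : (ξ i j k l : ℂ) * m (ϑ ((j : ℕ) / B)) e - (ψ θ φ d e : ℂ) * m φ e =
      ((ξ i j k l - ψ θ φ d e : ℝ) : ℂ) * m (ϑ ((j : ℕ) / B)) e +
        (ψ θ φ d e : ℂ) * (m (ϑ ((j : ℕ) / B)) e - m φ e) := by
    push_cast; ring
  rw [hsplit]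
  refine (norm_add_le _ _).trans (add_le_add ?_ ?_)
  · rw [norm_mul, Complex.norm_real]
    exact mul_le_mul hξψ ((hs.isSolutionAt _ (lt_of_fin j)).norm_le hη e) (norm_nonneg _)
      (by positivity)
  · rw [norm_mul, Complex.norm_real]
    exact mul_le_mul (h.abs_le θ hθ.mem_Ico φ hg.1 hθ.notMem hg.2.1 hg.2.2 d e)
      (hs.norm_sub_le h hη hz hm hΛ hΛ0 hB (hS j hjS) hφ h3 h4 e) (norm_nonneg _) hc

end IsSample

end

/-! ### The law for the trace -/

theorem IsApproxSolution.mono {N : ℕ} {ξ : Fin N → Fin N → Fin N → Fin N → ℝ} {z : ℂ} {δ δ' : ℝ}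
    {M : Matrix (Fin N) (Fin N) ℂ} (h : IsApproxSolution ξ z δ M) (hδ : δ ≤ δ') :
    IsApproxSolution ξ z δ' M := by
  obtain ⟨h1, D, hD, e⟩ := h
  exact ⟨h1, D, hD.mono hδ, e⟩

theorem norm_trace_le_bandAvg {N : ℕ} (K : ℕ) (X : Matrix (Fin N) (Fin N) ℂ) :
    ‖(1 / (N : ℂ)) * X.trace‖ ≤ bandAvg K X := by
  unfold bandAvg Matrix.trace
  rw [norm_mul, norm_div, norm_one, Complex.norm_natCast]
  gcongr
  exact (norm_sum_le _ _).trans (Finset.sum_le_sum fun j _ =>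
    Finset.single_le_sum (f := fun l => ‖X j l‖) (fun _ _ => norm_nonneg _) (self_mem_nbhd K j))

theorem norm_trace_sub_le_of_forall {N : ℕ} {X Y : Matrix (Fin N) (Fin N) ℂ} {b : ℝ} (hb : 0 ≤ b)
    (h : ∀ i, ‖X i i - Y i i‖ ≤ b) :
    ‖(1 / (N : ℂ)) * X.trace - (1 / (N : ℂ)) * Y.trace‖ ≤ b := by
  rw [← mul_sub, ← Matrix.trace_sub, norm_mul, norm_div, norm_one, Complex.norm_natCast,
    Matrix.trace]
  have h1 : ‖∑ i, (X - Y).diag i‖ ≤ N * b := by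
    refine (norm_sum_le _ _).trans ((Finset.sum_le_sum fun i _ => h i).trans_eq ?_)
    simp
  rcases Nat.eq_zero_or_pos N with h0 | h0
  · subst h0
    simpa using hb
  · have hN : (0 : ℝ) < N := by exact_mod_cast h0
    rw [one_div, inv_mul_le_iff₀ hN]
    exact h1

theorem exceptional_count_le (K n : ℕ) {B w : ℝ} (hB : 1 ≤ B) (hw : B ≤ w) :
    (2 * K * (B + 3) + K) + n * (2 * (3 * B + K) + 1) ≤ (9 * K + n * (7 + 2 * K) : ℝ) * w := by
  have h3 : 2 * K * (B + 3) + K ≤ 9 * K * w := by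
    have : (0 : ℝ) ≤ K := by positivity
    nlinarith
  have h4 : 2 * (3 * B + K) + 1 ≤ (7 + 2 * K) * w := by
    have : (0 : ℝ) ≤ K := by positivity
    nlinarith
  have h5 := mul_le_mul_of_nonneg_left h4 (by positivity : (0 : ℝ) ≤ n)
  linarith

set_option maxHeartbeats 800000 in
/-- A solution of the limiting equation yields approximate solutions of the finite equations. -/
theorem IsLimitProfile.exists_discretization {K : ℕ} {c : ℝ} {E : Finset ℝ} {L : ℤ → ℤ → ℝ}
    {ψ : ℝ → ℝ → ℤ → ℤ → ℝ} (h : IsLimitProfile K c E L ψ) (hψ : IsProfile ψ) (hc : 0 ≤ c)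
    {η : ℝ} (hη : 0 < η) {Z C : ℝ} (hZ0 : 0 ≤ Z) (hC : 0 ≤ C) :
    ∃ b : ℝ, 0 ≤ b ∧ ∀ N : ℕ, 0 < N → ∀ ξ : Fin N → Fin N → Fin N → Fin N → ℝ,
      IsKernel K c ξ → IsDiscretization K C ψ ξ →
      (∀ i j k l, i ≠ j → k ≠ l → ξ i j k l = ξ j i l k) →
      ∀ z : ℂ, η ≤ z.im → ‖z‖ ≤ Z → ∀ m, SolvesLimit ψ z m →
      ∃ M, IsApproxSolution ξ z (b / √N) M ∧
        ‖(1 / (N : ℂ)) * M.trace - limitTrace m‖ ≤ b / √N := by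
  classical
  set Λ : ℝ := ∑ k ∈ band K, ∑ l ∈ band K, L k l with hΛdef
  have hL := h.nonneg
  have hΛ0 : 0 ≤ Λ := Finset.sum_nonneg fun k _ => Finset.sum_nonneg fun l _ => hL k l
  have hΛ : ∀ k ∈ band K, ∀ l ∈ band K, L k l ≤ Λ := fun k hk l hl =>
    (Finset.single_le_sum (f := fun l => L k l) (fun l _ => hL k l) hl).trans
      (Finset.single_le_sum (f := fun k => ∑ l ∈ band K, L k l)
        (fun k _ => Finset.sum_nonneg fun l _ => hL k l) hk)
  set ℓ : ℝ := 1 / η ^ 2 * ((2 * K + 1) * ((2 * K + 1) * (Λ * (1 / η)))) with hℓ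
  have hℓ0 : 0 ≤ ℓ := by positivity
  set s₀ : ℝ := 9 * K + E.card * (7 + 2 * K) with hs₀
  have hs₀0 : 0 ≤ s₀ := by positivity
  set δ₀ : ℝ := (2 * K + 1) * ((C + Λ * 2) * (1 / η) + c * ℓ) +
    2 * ((2 * K + 1) * (c * (1 / η))) * (s₀ + (4 * K + 1)) with hδ₀
  have hδ₀0 : 0 ≤ δ₀ := by positivity
  set ε₀ : ℝ := (2 * K + 1) / η * ((2 * K + 1) * δ₀ / η + s₀ *
      (2 * ((2 * K + 1) * (Z + c * ((2 * K + 1) * (1 / η))) / η + 1))) with hε₀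
  have hε₀0 : 0 ≤ ε₀ := by positivity
  clear_value Λ ℓ s₀ δ₀ ε₀
  refine ⟨(2 * K + 1) * (c * ε₀) + (ε₀ + (ℓ + 2 * (1 / η) * s₀)), by positivity, ?_⟩
  intro N hN ξ hξ hdis hswap z hz hzZ m hm
  have hNR : (1 : ℝ) ≤ N := by exact_mod_cast hN
  have hN0 : (0 : ℝ) < N := by linarith
  -- The block length balances the Lipschitz error $B/N$ against the fraction $K/B$ of rows near a
  -- block boundary.
  set B := N.sqrt with hB
  have hB0 : 0 < B := Nat.sqrt_pos.2 hN
  have hB1 : (1 : ℝ) ≤ B := by exact_mod_cast hB0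
  set w : ℝ := √N with hw
  have hw1 : 1 ≤ w := Real.one_le_sqrt.2 hNR
  have hw0 : 0 < w := by linarith
  have hww : w * w = N := Real.mul_self_sqrt hN0.le
  have hBw : (B : ℝ) ≤ w := by
    rw [hw]
    refine Real.le_sqrt_of_sq_le ?_
    rw [sq]
    exact_mod_cast Nat.sqrt_le N
  have hdiv : ∀ {x a : ℝ}, x ≤ a * w → x / N ≤ a / w := fun {x a} hx => by
    rw [div_le_div_iff₀ hN0 hw0, ← hww, ← mul_assoc]
    exact mul_le_mul_of_nonneg_right hx hw0.le
  obtain ⟨ϑ, hs⟩ := h.exists_isSample (N := N) hη hz hm hB0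
  set S : Finset (Fin N) := (Finset.univ.filter fun i : Fin N => ¬ IsInterior K B i) ∪
    (Finset.univ.filter fun i : Fin N => ¬ Far E ((3 * B + K : ℕ) / N) (gridPoint i)) with hS
  have hSi : ∀ j ∉ S, IsInterior K B j := fun j hj => by
    by_contra h'
    exact hj (Finset.mem_union_left _ (Finset.mem_filter.2 ⟨Finset.mem_univ _, h'⟩))
  have hSf : ∀ j ∉ S, Far E ((3 * B + K : ℕ) / N) (gridPoint j) := fun j hj => by
    by_contra h'
    exact hj (Finset.mem_union_right _ (Finset.mem_filter.2 ⟨Finset.mem_univ _, h'⟩))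
  have hScard : (S.card : ℝ) ≤ s₀ * w := by
    have h1 : S.card ≤ (2 * K * (B + 3) + K) + E.card * (2 * (3 * B + K) + 1) :=
      (Finset.card_union_le _ _).trans
        (add_le_add (card_not_isInterior_le K N) (card_not_far_le E N (3 * B + K)))
    have h2 : (S.card : ℝ) ≤ (2 * K * (B + 3) + K) + E.card * (2 * (3 * B + K) + 1) := by
      exact_mod_cast h1
    exact h2.trans (exceptional_count_le K E.card hB1 hBw |>.trans_eq (by rw [hs₀]))
  have hSN : (S.card : ℝ) / N ≤ s₀ / w := hdiv hScard
  have hBN : (B : ℝ) / N ≤ 1 / w := hdiv (by linarith)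
  set W := blockToeplitz N B fun β => m (ϑ β) with hW
  have hδ : ∀ i ∉ S, ∀ k ∈ nbhd K i, ‖Psi ψ m (ϑ ((i : ℕ) / B)) (((k : ℕ) : ℤ) - ((i : ℕ) : ℤ)) -
      Xi ξ W i k‖ ≤ δ₀ / w := fun i hi k hk => by
    have h0 := hs.norm_Psi_sub_Xi_le h hψ hη hz hm hΛ hΛ0 hB0 hC hξ hdis hswap hSi hSf hi hk
    rw [← hℓ] at h0
    refine h0.trans ?_
    have h1 : C / N ≤ C / w := hdiv (le_mul_of_one_le_right hC hw1)
    have h2 : ((S.card : ℝ) + (4 * K + 1)) / N ≤ (s₀ + (4 * K + 1)) / w := hdiv (by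
      rw [add_mul]
      exact add_le_add hScard (le_mul_of_one_le_right (by positivity) hw1))
    calc _ ≤ (2 * K + 1) * ((C / w + Λ * (2 * (1 / w))) * (1 / η) + c * (ℓ * (1 / w))) +
        2 * ((2 * K + 1) * (c * (1 / η))) * ((s₀ + (4 * K + 1)) / w) := by gcongr
      _ = _ := by rw [hδ₀]; ring
  obtain ⟨M, hM, hWM⟩ := exists_isApproxSolution (δ := δ₀ / w) (ε := ε₀ / w) hη (by positivity) hξ
    hz hzZ (im_form_blockToeplitz_nonneg hη hz hs.isSolutionAt)
    (sum_norm_blockToeplitz_sq_le hs.isSolutionAt) S _ hδ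
    (fun i hi b => hξ.mul_blockToeplitz_sub_one_apply hs.isSolutionAt (hSi i hi) W b) (by
      calc _ ≤ (2 * K + 1) / η * ((2 * K + 1) * (δ₀ / w) / η + s₀ / w *
            (2 * ((2 * K + 1) * (Z + c * ((2 * K + 1) * (1 / η))) / η + 1))) := by gcongr
        _ = _ := by rw [hε₀]; ring)
  refine ⟨M, hM.mono ?_, ?_⟩
  · have e : (2 * K + 1) * (c * (ε₀ / w)) = ((2 * K + 1) * (c * ε₀)) / w := by ring
    rw [e]
    gcongr
    exact le_add_of_nonneg_right (by positivity)
  · have h1 := hs.norm_trace_sub_le h hη hz hm hΛ hΛ0 hB0 hN hSf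
    rw [← hℓ] at h1
    have h2 := (norm_trace_le_bandAvg K (W - M)).trans hWM
    rw [Matrix.trace_sub, mul_sub, norm_sub_rev] at h2
    have h3 := norm_sub_le_norm_sub_add_norm_sub ((1 / (N : ℂ)) * M.trace)
      ((1 / (N : ℂ)) * W.trace) (limitTrace m)
    calc _ ≤ ε₀ / w + (ℓ * (1 / w) + 2 * (1 / η) * (s₀ / w)) := by
          refine h3.trans (add_le_add h2 (h1.trans ?_))
          gcongr
      _ = (0 + (ε₀ + (ℓ + 2 * (1 / η) * s₀))) / w := by ring
      _ ≤ _ := by gcongr; positivity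

theorem IsDiscretization.mono {N K : ℕ} {C C' : ℝ} {ψ : ℝ → ℝ → ℤ → ℤ → ℝ}
    {ξ : Fin N → Fin N → Fin N → Fin N → ℝ} (h : IsDiscretization K C ψ ξ) (hC : C ≤ C') :
    IsDiscretization K C' ψ ξ := fun i j k l h1 h2 h3 h4 h5 =>
  (h i j k l h1 h2 h3 h4 h5).trans (by gcongr)

theorem CorrelatedModel.isKernel {K : ℕ} {τ : ℝ} {μ : ℕ → ℝ} {ψ : ℝ → ℝ → ℤ → ℤ → ℝ} {C : ℝ}
    (X : CorrelatedModel K τ μ ψ C) (N : ℕ) :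
    IsKernel K (μ 2 ^ 2) (covTensor (X.P N) (X.x N)) :=
  have := X.isProb N
  (X.isArray N).isKernel (sq_nonneg _)

theorem CorrelatedModel.exists_isLimitProfile {K : ℕ} {τ : ℝ} {μ : ℕ → ℝ}
    {ψ : ℝ → ℝ → ℤ → ℤ → ℝ} (hψ : IsProfile ψ) {C : ℝ} (X : CorrelatedModel K τ μ ψ C) :
    ∃ E L, IsLimitProfile K (μ 2 ^ 2) E L ψ :=
  hψ.exists_isLimitProfile X.isKernel X.discretization

/-- With very high probability, the normalized trace of the Green's function is close to the
trace of the solution of the limiting equation. -/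
theorem exists_trace_prob_le {K : ℕ} {τ : ℝ} (hτ : τ ∈ Set.Ioc (0 : ℝ) 1) (μ : ℕ → ℝ)
    {ψ : ℝ → ℝ → ℤ → ℤ → ℝ} (hψ : IsProfile ψ) (C : ℝ) {η Z ν A : ℝ} (hη : 0 < η) (hZ : 0 ≤ Z)
    (hν : 0 < ν) (hA : 0 ≤ A) :
    ∃ N₀ : ℕ, ∀ (X : CorrelatedModel K τ μ ψ C) (D : Set ℂ), (∀ z ∈ D, η ≤ z.im ∧ ‖z‖ ≤ Z) →
      ∀ m : ℂ → ℝ → ℤ → ℂ, (∀ z ∈ D, SolvesLimit ψ z (m z)) → ∀ N ≥ N₀,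
      (X.P N).real {ω | ∃ z ∈ D, (N : ℝ) ^ (ν - τ / 2) ≤
        ‖(1 / (N : ℂ)) * (green (fun a => X.x N a ω) z).trace - limitTrace (m z)‖} ≤
          (N : ℝ) ^ (-A) := by
  -- The threshold must not depend on the model, but the properties of $\psi$ as a limit of kernels
  -- are derived from some model. If none exists the claim is empty.
  by_cases hne : Nonempty (CorrelatedModel K τ μ ψ C)
  swap
  · exact ⟨0, fun X => absurd ⟨X⟩ hne⟩
  obtain ⟨X₀⟩ := hne
  obtain ⟨E, L, hE⟩ := X₀.exists_isLimitProfile hψ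
  obtain ⟨b, hb, happ⟩ := hE.exists_discretization hψ (sq_nonneg _) hη hZ (abs_nonneg C)
  obtain ⟨N₁, h₁⟩ := exists_green_prob_le hη Z (μ 2 ^ 2) τ (ν / 2) A b hZ (sq_nonneg _) hτ
    (by linarith) hA hb K μ
  obtain ⟨N₂, h₂⟩ := Filter.eventually_atTop.1 (eventually_le_rpow (half_pos hν) (1 + b + 1))
  refine ⟨max N₁ (max N₂ 1), fun X D hD m hm N hN => ?_⟩
  have hN1 : N₁ ≤ N := (le_max_left _ _).trans hN
  have hN2 : N₂ ≤ N := (le_max_left _ _).trans ((le_max_right _ _).trans hN)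
  have hN3 : 1 ≤ N := (le_max_right _ _).trans ((le_max_right _ _).trans hN)
  have hNR : (1 : ℝ) ≤ N := by exact_mod_cast hN3
  have hN0 : (0 : ℝ) < N := by linarith
  have := X.isProb N
  have hex : ∀ z, ∃ M : Matrix (Fin N) (Fin N) ℂ, z ∈ D →
      IsApproxSolution (covTensor (X.P N) (X.x N)) z (b / √N) M ∧
        ‖(1 / (N : ℂ)) * M.trace - limitTrace (m z)‖ ≤ b / √N := fun z => by
    by_cases hz : z ∈ D
    · obtain ⟨M, hM⟩ := happ N hN3 _ (X.isKernel N) ((X.discretization N).mono (le_abs_self C))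
        (fun i j k l => covTensor_swap _ _) z (hD z hz).1 (hD z hz).2 (m z) (hm z hz)
      exact ⟨M, fun _ => hM⟩
    · exact ⟨0, fun h => absurd h hz⟩
  choose M hM using hex
  refine (measureReal_mono ?_).trans (h₁ N hN1 D hD (X.Ω N) (X.P N) (X.x N) (X.isArray N)
    (X.hasMoments N) M fun z hz => (hM z hz).1)
  rintro ω ⟨z, hz, hω⟩
  by_contra hcon
  have hcl : ∀ i j, ‖green (fun a => X.x N a ω) z i j - M z i j‖ < (N : ℝ) ^ (ν / 2 - τ / 2) :=
    fun i j => by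
      by_contra h'
      exact hcon ⟨z, hz, i, j, not_lt.1 h'⟩
  have h3 := norm_trace_sub_le_of_forall (by positivity) fun i => (hcl i i).le
  have h4 := (hM z hz).2
  have h5 := norm_sub_le_norm_sub_add_norm_sub
    ((1 / (N : ℂ)) * (green (fun a => X.x N a ω) z).trace) ((1 / (N : ℂ)) * (M z).trace)
    (limitTrace (m z))
  have hs2 : b / √N ≤ b * (N : ℝ) ^ (ν / 2 - τ / 2) := by
    rw [div_eq_mul_inv, Real.sqrt_eq_rpow, ← Real.rpow_neg hN0.le]
    gcongr
    linarith [hτ.2]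
  have h6 : (N : ℝ) ^ (ν - τ / 2) = (N : ℝ) ^ (ν / 2) * (N : ℝ) ^ (ν / 2 - τ / 2) := by
    rw [← Real.rpow_add hN0]; congr 1; ring
  have h7 : 0 < (N : ℝ) ^ (ν / 2 - τ / 2) := by positivity
  have h8 := h₂ N hN2
  rw [h6] at hω
  nlinarith

theorem limit_law {K : ℕ} {τ : ℝ} (hτ : τ ∈ Set.Ioc (0 : ℝ) 1) (μ : ℕ → ℝ)
    {D : Set ℂ} (hDc : IsCompact (closure D)) (hD : closure D ⊆ {z : ℂ | 0 < z.im})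
    {ψ : ℝ → ℝ → ℤ → ℤ → ℝ} (hψ : IsProfile ψ) (C : ℝ) {ν : ℝ} (hν : 0 < ν) (p : ℕ) :
    ∃ N₀ : ℕ, ∀ (X : CorrelatedModel K τ μ ψ C) (m : ℂ → ℝ → ℤ → ℂ),
      (∀ z ∈ D, SolvesLimit ψ z (m z)) → ∀ N ≥ N₀,
        X.P N {ω | ENNReal.ofReal ((N : ℝ) ^ ν) ≤ ⨆ z ∈ D, ENNReal.ofReal
            (‖(1 / (N : ℂ)) * (green (fun a => X.x N a ω) z).trace - limitTrace (m z)‖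
              / controlPhi τ N z)}
          ≤ ENNReal.ofReal ((N : ℝ) ^ (-(ν * (p : ℝ)))) := by
  obtain ⟨η, Z, hη, hZ, hDb⟩ := exists_bounds_of_isCompact_closure hDc hD
  obtain ⟨N₁, h₁⟩ := exists_trace_prob_le (K := K) hτ μ hψ C (A := ν * p) hη hZ (half_pos hν)
    (by positivity)
  refine ⟨max N₁ 2, fun X m hm N hN => ?_⟩
  have hN2 : 2 ≤ N := (le_max_right _ _).trans hN
  have := X.isProb N
  refine measure_le_ofReal_of_subset ?_ (h₁ X D hDb m hm N ((le_max_left _ _).trans hN))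
  intro ω hω
  have h2 := (ofReal_rpow_half_lt hN2 hν).trans_le hω
  simp only [lt_iSup_iff] at h2
  obtain ⟨z, hz, h3⟩ := h2
  exact ⟨z, hz, rpow_le_of_lt_div_controlPhi (by omega) h3⟩

/-! ### Stieltjes transforms -/

/-- The Stieltjes transform of a measure on the real line. -/
def stieltjes (ρ : Measure ℝ) (z : ℂ) : ℂ := ∫ t : ℝ, 1 / ((t : ℂ) - z) ∂ρ

theorem im_le_norm_ofReal_sub (z : ℂ) (t : ℝ) : z.im ≤ ‖(t : ℂ) - z‖ := by
  have h := Complex.abs_im_le_norm ((t : ℂ) - z)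
  simp only [Complex.sub_im, Complex.ofReal_im, zero_sub, abs_neg] at h
  exact (le_abs_self _).trans h

theorem ofReal_sub_ne_zero {z : ℂ} (hz : 0 < z.im) (t : ℝ) : (t : ℂ) - z ≠ 0 :=
  norm_pos_iff.1 (hz.trans_le (im_le_norm_ofReal_sub z t))

/-- The function `t ↦ 1 / (t - z)` for `z` in the upper half-plane. -/
def resolventFun (z : ℂ) (hz : 0 < z.im) : ℝ →ᵇ ℂ :=
  BoundedContinuousFunction.ofNormedAddCommGroup (fun t : ℝ => 1 / ((t : ℂ) - z))
    (continuous_const.div (Complex.continuous_ofReal.sub continuous_const)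
      (ofReal_sub_ne_zero hz)) (1 / z.im) fun t => by
    rw [norm_div, norm_one]
    exact one_div_le_one_div_of_le hz (im_le_norm_ofReal_sub z t)

theorem integrable_resolventFun (ρ : Measure ℝ) [IsFiniteMeasure ρ] {z : ℂ} (hz : 0 < z.im) :
    Integrable (fun t : ℝ => 1 / ((t : ℂ) - z)) ρ := (resolventFun z hz).integrable ρ

theorem trace_green {N : ℕ} (x : UpperIndex N → ℝ) {z : ℂ} (hz : 0 < z.im) :
    (green x z).trace =
      ∑ i, 1 / (((normMatrix_isHermitian x).eigenvalues i : ℂ) - z) := by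
  set hH := normMatrix_isHermitian x
  set U : Matrix (Fin N) (Fin N) ℝ := hH.eigenvectorUnitary.1
  set P := U.map (algebraMap ℝ ℂ) with hP
  set Q := (star U).map (algebraMap ℝ ℂ) with hQ
  have hQP : Q * P = 1 := by
    rw [hP, hQ, ← Matrix.map_mul, Unitary.coe_star_mul_self]
    exact Matrix.map_one _ (map_zero _) (map_one _)
  have hPQ : P * Q = 1 := mul_eq_one_comm.1 hQP
  have hspec : (normMatrix x).map (fun r : ℝ => (r : ℂ)) =
      P * Matrix.diagonal (fun i => (hH.eigenvalues i : ℂ)) * Q := by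
    have h1 := hH.spectral_theorem
    rw [Unitary.conjStarAlgAut_apply] at h1
    have h2 := congrArg (fun A : Matrix (Fin N) (Fin N) ℝ => A.map (algebraMap ℝ ℂ)) h1
    simp only [Matrix.map_mul] at h2
    refine h2.trans ?_
    rw [Matrix.diagonal_map (map_zero _)]
    rfl
  set R := Matrix.diagonal fun i => 1 / ((hH.eigenvalues i : ℂ) - z) with hR
  have hinv : ((normMatrix x).map (fun r : ℝ => (r : ℂ)) - z • (1 : Matrix (Fin N) (Fin N) ℂ)) *
      (P * R * Q) = 1 := by
    have e : (normMatrix x).map (fun r : ℝ => (r : ℂ)) - z • (1 : Matrix (Fin N) (Fin N) ℂ) =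
        P * (Matrix.diagonal (fun i => (hH.eigenvalues i : ℂ) - z)) * Q := by
      have e1 : Matrix.diagonal (fun i => (hH.eigenvalues i : ℂ) - z) =
          Matrix.diagonal (fun i => (hH.eigenvalues i : ℂ)) -
            z • (1 : Matrix (Fin N) (Fin N) ℂ) := by
        rw [Matrix.smul_one_eq_diagonal, Matrix.diagonal_sub]
      rw [e1, hspec, mul_sub, sub_mul, mul_smul_comm, mul_one, smul_mul_assoc, hPQ]
    rw [e]
    calc _ = P * (Matrix.diagonal (fun i => (hH.eigenvalues i : ℂ) - z) * ((Q * P) * R)) * Q := by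
          simp only [mul_assoc]
      _ = 1 := by
          rw [hQP, one_mul, hR, Matrix.diagonal_mul_diagonal]
          have : (fun i => ((hH.eigenvalues i : ℂ) - z) * (1 / ((hH.eigenvalues i : ℂ) - z))) =
              fun _ => 1 := funext fun i => mul_one_div_cancel (ofReal_sub_ne_zero hz _)
          rw [this, Matrix.diagonal_one, mul_one, hPQ]
  rw [green, Matrix.inv_eq_right_inv hinv, Matrix.trace_mul_comm, ← mul_assoc, hQP, one_mul, hR,
    Matrix.trace_diagonal]

theorem integral_empiricalMeasure {N : ℕ} (x : UpperIndex N → ℝ) {F : Type*} [NormedAddCommGroup F]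
    [NormedSpace ℝ F] [CompleteSpace F] (f : ℝ → F) :
    ∫ t, f t ∂(empiricalMeasure x) =
      (N : ℝ)⁻¹ • ∑ i, f ((normMatrix_isHermitian x).eigenvalues i) := by
  rw [empiricalMeasure, integral_smul_measure, integral_finsetSum_measure fun i _ => ?_]
  · simp
  · exact integrable_dirac (by simp)

theorem stieltjes_empiricalMeasure {N : ℕ} (x : UpperIndex N → ℝ) {z : ℂ} (hz : 0 < z.im) :
    stieltjes (empiricalMeasure x) z = (1 / (N : ℂ)) * (green x z).trace := by
  rw [stieltjes, integral_empiricalMeasure, trace_green x hz, Complex.real_smul]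
  simp

theorem isProbabilityMeasure_empiricalMeasure {N : ℕ} (hN : 0 < N) (x : UpperIndex N → ℝ) :
    IsProbabilityMeasure (empiricalMeasure x) := ⟨by
  simp only [empiricalMeasure, Measure.smul_apply, Measure.finsetSum_apply, measure_univ,
    Finset.sum_const, Finset.card_univ, Fintype.card_fin, smul_eq_mul, nsmul_eq_mul, mul_one]
  exact ENNReal.inv_mul_cancel (by exact_mod_cast hN.ne') (by simp)⟩

/-! ### Uniqueness -/

/-- The Cauchy kernel, up to normalization. -/
def cauchyKernel (y w : ℝ) : ℝ := y⁻¹ * (1 + (w / y) ^ 2)⁻¹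

theorem integrable_cauchyKernel {y : ℝ} (hy : 0 < y) : Integrable (cauchyKernel y) :=
  (integrable_inv_one_add_sq.comp_div hy.ne').const_mul _

theorem integral_cauchyKernel_eq_im (ρ : Measure ℝ) [IsFiniteMeasure ρ] {y : ℝ} (hy : 0 < y)
    (x : ℝ) : ∫ t, cauchyKernel y (x - t) ∂ρ = (stieltjes ρ (x + y * Complex.I)).im := by
  have hz : 0 < ((x : ℂ) + y * Complex.I).im := by simpa using hy
  rw [stieltjes]
  refine Eq.trans ?_ (integral_im (𝕜 := ℂ) (integrable_resolventFun ρ hz))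
  refine integral_congr_ae (.of_forall fun t => ?_)
  change cauchyKernel y (x - t) = (1 / ((t : ℂ) - (x + y * Complex.I))).im
  have h1 : (0 : ℝ) < (t - x) * (t - x) + y * y := by nlinarith [mul_self_nonneg (t - x)]
  have e1 : (1 / ((t : ℂ) - (x + y * Complex.I))).im = y / ((t - x) * (t - x) + y * y) := by
    rw [one_div, Complex.inv_im, Complex.normSq_apply]
    simp
  have e2 : 1 + ((x - t) / y) ^ 2 = ((t - x) * (t - x) + y * y) / y ^ 2 := by
    field_simp
    ring
  rw [e1, cauchyKernel, e2, inv_div]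
  field_simp

theorem integral_mul_cauchyKernel (f : ℝ →ᵇ ℝ) {y : ℝ} (hy : 0 < y) (t : ℝ) :
    ∫ x, f x * cauchyKernel y (x - t) = ∫ u, f (t + y * u) * (1 + u ^ 2)⁻¹ := by
  rw [← integral_add_right_eq_self _ t]
  have h := Measure.integral_comp_div (fun u => f (t + y * u) * (1 + u ^ 2)⁻¹) y
  rw [abs_of_pos hy, smul_eq_mul] at h
  rw [← mul_right_inj' hy.ne', ← h, ← integral_const_mul]
  refine integral_congr_ae (.of_forall fun w => ?_)
  simp only [cauchyKernel, mul_div_cancel₀ _ hy.ne', add_comm w t, add_sub_cancel_left]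
  field_simp

/-- A finite measure is determined by its Stieltjes transform. -/
theorem ext_of_stieltjes_eq {ρ ν : Measure ℝ} [IsFiniteMeasure ρ] [IsFiniteMeasure ν]
    (h : ∀ z : ℂ, 0 < z.im → stieltjes ρ z = stieltjes ν z) : ρ = ν := by
  refine ext_of_forall_integral_eq_of_IsFiniteMeasure fun f => ?_
  have hfb : ∀ t, |f t| ≤ ‖f‖ := f.norm_coe_le_norm
  -- This is $\pi$ times the Poisson smoothing of `f` at height `y`. By Fubini its integral against
  -- a measure depends only on the imaginary part of the Stieltjes transform, and it converges
  -- boundedly to $\pi f$ as $y\to0$.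
  set F : ℝ → ℝ → ℝ := fun y t => ∫ u, f (t + y * u) * (1 + u ^ 2)⁻¹ with hF
  have hbound : ∀ (y t u : ℝ), ‖f (t + y * u) * (1 + u ^ 2)⁻¹‖ ≤ ‖f‖ * (1 + u ^ 2)⁻¹ :=
    fun y t u => by
      rw [norm_mul, norm_inv, Real.norm_of_nonneg (by positivity : (0 : ℝ) ≤ 1 + u ^ 2)]
      gcongr
      exact hfb _
  have hmeas : ∀ y t, AEStronglyMeasurable (fun u : ℝ => f (t + y * u) * (1 + u ^ 2)⁻¹) volume :=
    fun y t => Measurable.aestronglyMeasurable (by fun_prop)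
  have hgi : Integrable (fun u : ℝ => ‖f‖ * (1 + u ^ 2)⁻¹) :=
    integrable_inv_one_add_sq.const_mul _
  have hFc : ∀ y, Continuous (F y) := fun y =>
    continuous_of_dominated (fun t => hmeas y t) (fun t => .of_forall (hbound y t)) hgi
      (.of_forall fun u => by fun_prop)
  have hFb : ∀ y t, ‖F y t‖ ≤ ‖f‖ * Real.pi := fun y t => by
    refine (norm_integral_le_of_norm_le hgi (.of_forall (hbound y t))).trans_eq ?_
    rw [integral_const_mul, integral_univ_inv_one_add_sq]
  have hy0 : ∀ n : ℕ, (0 : ℝ) < 1 / ((n : ℝ) + 1) := fun n => Nat.one_div_pos_of_nat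
  have hlim : ∀ t, Filter.Tendsto (fun n : ℕ => F (1 / ((n : ℝ) + 1)) t) Filter.atTop
      (nhds (f t * Real.pi)) := fun t => by
    have e : f t * Real.pi = ∫ u, f (t + 0 * u) * (1 + u ^ 2)⁻¹ := by
      simp only [zero_mul, add_zero]
      rw [integral_const_mul, integral_univ_inv_one_add_sq]
    rw [e]
    refine tendsto_integral_of_dominated_convergence (fun u => ‖f‖ * (1 + u ^ 2)⁻¹)
      (fun n => hmeas _ t) hgi (fun n => .of_forall (hbound _ t)) (.of_forall fun u => ?_)
    have hc : Continuous fun y : ℝ => f (t + y * u) * (1 + u ^ 2)⁻¹ := by fun_prop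
    exact (hc.tendsto 0).comp tendsto_one_div_add_atTop_nhds_zero_nat
  have hint : ∀ (κ : Measure ℝ) [IsFiniteMeasure κ], Filter.Tendsto
      (fun n : ℕ => ∫ t, F (1 / ((n : ℝ) + 1)) t ∂κ) Filter.atTop
        (nhds (∫ t, f t * Real.pi ∂κ)) := fun κ _ =>
    tendsto_integral_of_dominated_convergence (fun _ => ‖f‖ * Real.pi)
      (fun n => (hFc _).aestronglyMeasurable) (integrable_const _)
      (fun n => .of_forall (hFb _)) (.of_forall hlim)
  have hfub : ∀ (κ : Measure ℝ) [IsFiniteMeasure κ] (y : ℝ), 0 < y →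
      ∫ t, F y t ∂κ = ∫ x, f x * (stieltjes κ (x + y * Complex.I)).im := fun κ _ y hy => by
    have h1 : Integrable (fun p : ℝ × ℝ => f p.1 * cauchyKernel y (p.1 - p.2))
        (volume.prod κ) := by
      have h2 := (integrable_const (1 : ℝ) (μ := κ)).convolution_integrand
        (ContinuousLinearMap.mul ℝ ℝ) (integrable_cauchyKernel hy)
      simp only [ContinuousLinearMap.mul_apply', one_mul] at h2
      exact h2.bdd_mul (f.continuous.comp continuous_fst).aestronglyMeasurable
        (.of_forall fun p => hfb p.1)
    calc _ = ∫ t, (∫ x, f x * cauchyKernel y (x - t)) ∂κ :=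
          integral_congr_ae (.of_forall fun t => (integral_mul_cauchyKernel f hy t).symm)
      _ = ∫ x, ∫ t, f x * cauchyKernel y (x - t) ∂κ :=
          (integral_integral_swap (f := fun x t => f x * cauchyKernel y (x - t)) h1).symm
      _ = _ := integral_congr_ae (.of_forall fun x => by
          dsimp only
          rw [integral_const_mul, integral_cauchyKernel_eq_im κ hy])
  have heq : ∀ n : ℕ, ∫ t, F (1 / ((n : ℝ) + 1)) t ∂ρ = ∫ t, F (1 / ((n : ℝ) + 1)) t ∂ν :=
    fun n => by
      rw [hfub ρ _ (hy0 n), hfub ν _ (hy0 n)]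
      refine integral_congr_ae (.of_forall fun x => ?_)
      dsimp only
      rw [h _ (by
        rw [Complex.add_im, Complex.ofReal_im, Complex.im_ofReal_mul]
        simpa using hy0 n)]
  have h3 := tendsto_nhds_unique (hint ρ) (by simpa only [heq] using hint ν)
  rw [integral_mul_const, integral_mul_const] at h3
  exact mul_right_cancel₀ Real.pi_ne_zero h3

/-! ### Convergence of measures from convergence of Stieltjes transforms -/

theorem integral_sq_div_eq (ρ : Measure ℝ) [IsProbabilityMeasure ρ] {y : ℝ} (hy : 0 < y) :
    ∫ t, t ^ 2 / (t ^ 2 + y ^ 2) ∂ρ =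
      (1 + (y * Complex.I) * stieltjes ρ (y * Complex.I)).re := by
  have hz : 0 < ((y : ℂ) * Complex.I).im := by simpa using hy
  have hi := (integrable_resolventFun ρ hz).const_mul ((y : ℂ) * Complex.I)
  have hi' : Integrable (fun t : ℝ => (1 : ℂ) + (y : ℂ) * Complex.I *
    (1 / ((t : ℂ) - y * Complex.I))) ρ := (integrable_const _).add hi
  have e : 1 + (y * Complex.I) * stieltjes ρ (y * Complex.I) =
      ∫ t : ℝ, ((1 : ℂ) + (y : ℂ) * Complex.I * (1 / ((t : ℂ) - y * Complex.I))) ∂ρ := by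
    rw [integral_add (integrable_const _) hi, integral_const_mul, stieltjes]
    simp
  rw [e]
  refine Eq.trans ?_ (integral_re (𝕜 := ℂ) hi')
  refine integral_congr_ae (.of_forall fun t => ?_)
  change t ^ 2 / (t ^ 2 + y ^ 2) =
    ((1 : ℂ) + (y : ℂ) * Complex.I * (1 / ((t : ℂ) - y * Complex.I))).re
  have h1 : (0 : ℝ) < t * t + y * y := by nlinarith [mul_self_nonneg t]
  have e1 : ((1 : ℂ) + (y : ℂ) * Complex.I * (1 / ((t : ℂ) - y * Complex.I))).re =
      1 - y * (y / (t * t + y * y)) := by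
    rw [one_div, Complex.add_re, Complex.one_re, mul_assoc, Complex.re_ofReal_mul,
      Complex.I_mul_re, Complex.inv_im, Complex.normSq_apply]
    simp
    ring
  rw [e1]
  have h2 : (0 : ℝ) < t ^ 2 + y ^ 2 := by positivity
  have h3 : t * t + y * y = t ^ 2 + y ^ 2 := by ring
  rw [h3]
  field_simp
  ring

/-- The function $t^2/(t^2+y^2)$ exceeds $1/2$ for $|t|>y$, and its integral is read off from the
Stieltjes transform at $\mathrm iy$. -/
theorem measureReal_lt_abs_le (ρ : Measure ℝ) [IsProbabilityMeasure ρ] {y : ℝ} (hy : 0 < y) :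
    ρ.real {t | y < ‖t‖} ≤ 2 * ‖1 + (y * Complex.I) * stieltjes ρ (y * Complex.I)‖ := by
  have hi : Integrable (fun t : ℝ => t ^ 2 / (t ^ 2 + y ^ 2)) ρ := by
    refine Integrable.of_bound (Measurable.aestronglyMeasurable (by fun_prop)) 1
      (.of_forall fun t => ?_)
    have h2 : (0 : ℝ) < t ^ 2 + y ^ 2 := by positivity
    rw [Real.norm_of_nonneg (by positivity), div_le_one h2]
    nlinarith
  have h1 := mul_meas_ge_le_integral_of_nonneg (.of_forall fun t => by positivity) hi (1 / 2)
  rw [integral_sq_div_eq ρ hy] at h1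
  have h2 := Complex.re_le_norm (1 + (y * Complex.I) * stieltjes ρ (y * Complex.I))
  have h3 : ρ.real {t | y < ‖t‖} ≤ ρ.real {t | 1 / 2 ≤ t ^ 2 / (t ^ 2 + y ^ 2)} := by
    refine measureReal_mono fun t ht => ?_
    rw [Set.mem_ofPred_eq, Real.norm_eq_abs] at ht
    have h4 : (0 : ℝ) < t ^ 2 + y ^ 2 := by positivity
    rw [Set.mem_ofPred_eq, le_div_iff₀ h4]
    have := sq_lt_sq' (by linarith [abs_nonneg t]) ht
    rw [sq_abs] at this
    linarith
  linarith

/-- The decay of $1+\mathrm iy\,s(\mathrm iy)$ prevents loss of mass, so Prokhorov's theorem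
applies. The limit along an ultrafilter replaces the choice of a subsequence. -/
theorem exists_stieltjes_eq_of_tendsto {s : ℂ → ℂ} {b : ℝ}
    (hs : ∀ y : ℝ, 0 < y → ‖1 + (y * Complex.I) * s (y * Complex.I)‖ ≤ b / y ^ 2)
    (ρ : ℕ → ProbabilityMeasure ℝ)
    (hS : ∀ z : ℂ, 0 < z.im →
      Filter.Tendsto (fun n => stieltjes (ρ n) z) Filter.atTop (nhds (s z))) :
    ∃ κ : ProbabilityMeasure ℝ, (∀ z : ℂ, 0 < z.im → stieltjes κ z = s z) ∧
      Filter.Tendsto ρ (Filter.hyperfilter ℕ) (nhds κ) := by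
  have hU : (Filter.hyperfilter ℕ : Filter ℕ) ≤ Filter.atTop := by
    rw [← Nat.cofinite_eq_atTop]; exact Filter.hyperfilter_le_cofinite
  have htight : IsTightMeasureSet (Set.range fun n => (ρ n : Measure ℝ)) := by
    refine isTightMeasureSet_range_of_tendsto_limsup_measure_norm_gt ?_
    have hup : Filter.Tendsto (fun r : ℝ => ENNReal.ofReal (2 * (b / r ^ 2))) Filter.atTop
        (nhds 0) := by
      rw [← ENNReal.ofReal_zero]
      refine ENNReal.tendsto_ofReal ?_
      have := ((Filter.tendsto_pow_atTop (α := ℝ) two_ne_zero).const_div_atTop b).const_mul 2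
      simpa using this
    refine tendsto_of_tendsto_of_tendsto_of_le_of_le' tendsto_const_nhds hup
      (.of_forall fun _ => zero_le) ?_
    filter_upwards [Filter.eventually_gt_atTop 0] with r hr
    have hz : 0 < ((r : ℂ) * Complex.I).im := by simpa using hr
    have h1 : Filter.Tendsto (fun n => ENNReal.ofReal (2 * ‖1 + (r * Complex.I) *
        stieltjes (ρ n) (r * Complex.I)‖)) Filter.atTop
        (nhds (ENNReal.ofReal (2 * ‖1 + (r * Complex.I) * s (r * Complex.I)‖))) :=
      ENNReal.tendsto_ofReal ((((hS _ hz).const_mul _).const_add _).norm.const_mul _)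
    calc _ ≤ Filter.limsup (fun n => ENNReal.ofReal (2 * ‖1 + (r * Complex.I) *
            stieltjes (ρ n) (r * Complex.I)‖)) Filter.atTop := by
          refine Filter.limsup_le_limsup (.of_forall fun n => ?_)
          dsimp only
          rw [← ofReal_measureReal]
          exact ENNReal.ofReal_le_ofReal (measureReal_lt_abs_le _ hr)
      _ = _ := h1.limsup_eq
      _ ≤ _ := ENNReal.ofReal_le_ofReal (by linarith [hs r hr])
  have hc : IsCompact (closure (Set.range ρ)) :=
    isCompact_closure_of_isTightMeasureSet (by
      convert htight using 1
      ext κ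
      simp)
  obtain ⟨κ, -, hκ⟩ := hc.ultrafilter_le_nhds ((Filter.hyperfilter ℕ).map ρ)
    (.trans (by simp) (Filter.monotone_principal subset_closure))
  have hκ' : Filter.Tendsto ρ (Filter.hyperfilter ℕ) (nhds κ) := hκ
  refine ⟨κ, fun z hz => ?_, hκ'⟩
  exact tendsto_nhds_unique
    ((ProbabilityMeasure.tendsto_iff_forall_integral_rclike_tendsto ℂ).1 hκ' (resolventFun z hz))
    ((hS z hz).mono_left hU)

/-- The Stieltjes transform of `κ` is close to `s` on a large subset of the upper half-plane. -/
def IsClose (s : ℂ → ℂ) (n : ℕ) (κ : Measure ℝ) : Prop :=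
  ∀ z : ℂ, 1 / ((n : ℝ) + 1) ≤ z.im → ‖z‖ ≤ n + 1 → ‖stieltjes κ z - s z‖ < 1 / ((n : ℝ) + 1)

theorem tendsto_of_isClose {s : ℂ → ℂ} {ρ : ℕ → Measure ℝ} (h : ∀ n, IsClose s n (ρ n)) {z : ℂ}
    (hz : 0 < z.im) :
    Filter.Tendsto (fun n => stieltjes (ρ n) z) Filter.atTop (nhds (s z)) := by
  rw [tendsto_iff_norm_sub_tendsto_zero]
  refine tendsto_of_tendsto_of_tendsto_of_le_of_le' tendsto_const_nhds
    (tendsto_one_div_add_atTop_nhds_zero_nat (𝕜 := ℝ)) (.of_forall fun _ => norm_nonneg _) ?_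
  have h1 := (tendsto_one_div_add_atTop_nhds_zero_nat (𝕜 := ℝ)).eventually (ge_mem_nhds hz)
  have h2 := (tendsto_natCast_atTop_atTop (R := ℝ)).eventually_ge_atTop ‖z‖
  filter_upwards [h1, h2] with n h3 h4
  exact (h n z h3 (by linarith)).le

/-- The measure is determined by its Stieltjes transform in a quantitative sense. -/
theorem exists_isClose_imp {s : ℂ → ℂ} {b : ℝ}
    (hs : ∀ y : ℝ, 0 < y → ‖1 + (y * Complex.I) * s (y * Complex.I)‖ ≤ b / y ^ 2)
    {ρ : ProbabilityMeasure ℝ} (hρ : ∀ z : ℂ, 0 < z.im → stieltjes ρ z = s z) (f : ℝ →ᵇ ℝ) {ε : ℝ}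
    (hε : 0 < ε) : ∃ n, ∀ κ : Measure ℝ, IsProbabilityMeasure κ → IsClose s n κ →
      |∫ t, f t ∂κ - ∫ t, f t ∂(ρ : Measure ℝ)| < ε := by
  -- Counterexamples for every $n$ would converge, along an ultrafilter, to a measure with transform
  -- $s$, which by uniqueness is $\rho$.
  by_contra hcon
  push Not at hcon
  choose κ hκp hκ hκε using hcon
  obtain ⟨κ', h1, h2⟩ := exists_stieltjes_eq_of_tendsto hs (fun n => ⟨κ n, hκp n⟩)
    fun z hz => tendsto_of_isClose hκ hz
  have h3 : (κ' : Measure ℝ) = ρ := ext_of_stieltjes_eq fun z hz => (h1 z hz).trans (hρ z hz).symm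
  have h4 := ProbabilityMeasure.tendsto_iff_forall_integral_tendsto.1 h2 f
  rw [h3] at h4
  obtain ⟨n, hn⟩ := (h4.eventually (Metric.ball_mem_nhds _ hε)).exists
  exact absurd hn (not_lt.2 (hκε n))

/-! ### Convergence of the empirical spectral measures -/

theorem IsLimitProfile.norm_Psi_le {K : ℕ} {c : ℝ} {E : Finset ℝ} {L : ℤ → ℤ → ℝ}
    {ψ : ℝ → ℝ → ℤ → ℤ → ℝ} (h : IsLimitProfile K c E L ψ) (hc : 0 ≤ c) {η : ℝ} (hη : 0 < η)
    {z : ℂ} (hz : η ≤ z.im) {m : ℝ → ℤ → ℂ} (hm : SolvesLimit ψ z m) {θ : ℝ}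
    (hθ : IsGoodPoint K η z E ψ m θ) (k : ℤ) :
    ‖Psi ψ m θ k‖ ≤ (2 * K + 1) * (c * (1 / η)) := by
  rw [h.Psi_eq hθ.mem_Ico hθ.notMem, ← sum_band_const_le]
  refine (norm_sum_le _ _).trans (Finset.sum_le_sum fun l _ => ?_)
  have h1 : ∀ᵐ φ ∂unitMeasure, ‖(ψ θ φ k l : ℂ) * m φ l‖ ≤ c * (1 / η) := by
    filter_upwards [h.ae_isGoodPoint hη hz hm, ae_generic θ E] with φ hφ hg
    rw [norm_mul, Complex.norm_real]
    exact mul_le_mul (h.abs_le θ hθ.mem_Ico φ hg.1 hθ.notMem hg.2.1 hg.2.2 k l)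
      (hφ.isSolutionAt.norm_le hη l) (norm_nonneg _) hc
  simpa using norm_integral_le_of_norm_le_const h1

/-- The coefficient at $0$ of the convolution equation expresses $1+zm(\theta,0)$ as a finite sum of
products of coefficients of $m$ and $\Psi(m)$, each of which is $O(1/\operatorname{Im}z)$. -/
theorem IsLimitProfile.norm_one_add_mul_limitTrace_le {K : ℕ} {c : ℝ} {E : Finset ℝ}
    {L : ℤ → ℤ → ℝ} {ψ : ℝ → ℝ → ℤ → ℤ → ℝ} (h : IsLimitProfile K c E L ψ) (hc : 0 ≤ c) {z : ℂ}
    (hz : 0 < z.im) {m : ℝ → ℤ → ℂ} (hm : SolvesLimit ψ z m) :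
    ‖1 + z * limitTrace m‖ ≤ (2 * K + 1) * ((2 * K + 1) * c) / z.im ^ 2 := by
  have hgood := h.ae_isGoodPoint hz le_rfl hm
  have hi : Integrable (fun θ => m θ 0) unitMeasure :=
    Integrable.of_bound (hm.1.1.1 0) (1 / z.im) (by
      filter_upwards [hgood] with θ hθ using hθ.isSolutionAt.norm_le hz 0)
  have hi' : Integrable (fun θ => z * m θ 0) unitMeasure := hi.const_mul z
  have e : 1 + z * limitTrace m = ∫ θ in Set.Ico (0 : ℝ) 1, (1 + z * m θ 0) := by
    rw [integral_add (integrable_const _) hi', integral_const_mul, limitTrace]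
    simp
  have h1 : ∀ᵐ θ ∂unitMeasure, ‖1 + z * m θ 0‖ ≤
      (2 * K + 1) * ((2 * K + 1) * c) / z.im ^ 2 := by
    filter_upwards [hgood] with θ hθ
    have h2 := hθ.isSolutionAt.conv 0
    simp only [operand, mul_sub, Finset.sum_sub_distrib, zero_sub, mul_neg, mul_ite, mul_zero,
      Finset.sum_neg_distrib, if_true] at h2
    rw [Finset.sum_ite_eq' , if_pos (by simp), neg_zero] at h2
    have h3 : 1 + z * m θ 0 = -∑ k ∈ band K, m θ (-k) * Psi ψ m θ k := by
      rw [← h2]; ring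
    rw [h3, norm_neg]
    calc _ ≤ ∑ _k ∈ band K, 1 / z.im * ((2 * K + 1) * (c * (1 / z.im))) :=
          (norm_sum_le _ _).trans (Finset.sum_le_sum fun k _ => by
            rw [norm_mul]
            exact mul_le_mul (hθ.isSolutionAt.norm_le hz _)
              (h.norm_Psi_le hc hz le_rfl hm hθ k) (norm_nonneg _) (by positivity))
      _ = _ := by rw [sum_band_const_le]; ring
  rw [e]
  simpa using norm_integral_le_of_norm_le_const h1

theorem exists_isClose_prob_le {K : ℕ} {τ : ℝ} (hτ : τ ∈ Set.Ioc (0 : ℝ) 1) {μ : ℕ → ℝ}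
    {ψ : ℝ → ℝ → ℤ → ℤ → ℝ} (hψ : IsProfile ψ) {C : ℝ} (X : CorrelatedModel K τ μ ψ C)
    {m : ℂ → ℝ → ℤ → ℂ} (hm : ∀ z : ℂ, 0 < z.im → SolvesLimit ψ z (m z)) (n : ℕ) {A : ℝ}
    (hA : 0 ≤ A) : ∃ N₀ : ℕ, ∀ N ≥ N₀, (X.P N).real {ω | ¬ IsClose (fun z => limitTrace (m z)) n
      (empiricalMeasure fun a => X.x N a ω)} ≤ (N : ℝ) ^ (-A) := by
  have hτ4 : 0 < τ / 4 := by linarith [hτ.1]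
  have hn : (0 : ℝ) < 1 / ((n : ℝ) + 1) := Nat.one_div_pos_of_nat
  obtain ⟨N₁, h₁⟩ := exists_trace_prob_le (K := K) (Z := n + 1) hτ μ hψ C hn (by positivity) hτ4 hA
  obtain ⟨N₂, h₂⟩ := Filter.eventually_atTop.1 (eventually_le_rpow hτ4 ((n : ℝ) + 1))
  refine ⟨max N₁ (max N₂ 1), fun N hN => ?_⟩
  have hN2 : N₂ ≤ N := (le_max_left _ _).trans ((le_max_right _ _).trans hN)
  have hN3 : 1 ≤ N := (le_max_right _ _).trans ((le_max_right _ _).trans hN)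
  have hN0 : (0 : ℝ) < N := by exact_mod_cast hN3
  have := X.isProb N
  refine (measureReal_mono ?_).trans (h₁ X {z | 1 / ((n : ℝ) + 1) ≤ z.im ∧ ‖z‖ ≤ n + 1}
    (fun z hz => hz) m (fun z hz => hm z (hn.trans_le hz.1)) N ((le_max_left _ _).trans hN))
  intro ω hω
  simp only [Set.mem_ofPred_eq, IsClose, not_forall, not_lt] at hω
  obtain ⟨z, hz1, hz2, h3⟩ := hω
  refine ⟨z, ⟨hz1, hz2⟩, ?_⟩
  rw [stieltjes_empiricalMeasure _ (hn.trans_le hz1)] at h3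
  refine le_trans ?_ h3
  have e : (N : ℝ) ^ (τ / 4 - τ / 2) = 1 / (N : ℝ) ^ (τ / 4) := by
    rw [one_div, ← Real.rpow_neg hN0.le]; congr 1; ring
  rw [e]
  exact one_div_le_one_div_of_le (by positivity) (h₂ N hN2)

/-- The measure $\rho$ is obtained from the model itself, as a limit of realizations of the
empirical measure whose Stieltjes transforms approach $\operatorname{tr}m$. Convergence in the
required sense then follows from the quantitative uniqueness in `exists_isClose_imp`. -/
theorem exists_limit_measure {K : ℕ} {τ : ℝ} (hτ : τ ∈ Set.Ioc (0 : ℝ) 1) {μ : ℕ → ℝ}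
    {ψ : ℝ → ℝ → ℤ → ℤ → ℝ} (hψ : IsProfile ψ) {C : ℝ} (X : CorrelatedModel K τ μ ψ C)
    {m : ℂ → ℝ → ℤ → ℂ} (hm : ∀ z : ℂ, 0 < z.im → SolvesLimit ψ z (m z)) :
    ∃ ρ : Measure ℝ, IsProbabilityMeasure ρ ∧
      (∀ z : ℂ, 0 < z.im → limitTrace (m z) = ∫ t : ℝ, 1 / ((t : ℂ) - z) ∂ρ) ∧
      ∀ (f : ℝ →ᵇ ℝ) (ε : ℝ), 0 < ε → ∀ A : ℝ, ∃ N₀ : ℕ, ∀ N ≥ N₀,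
        X.P N {ω | ε ≤ |∫ t, f t ∂(empiricalMeasure (fun a => X.x N a ω)) - ∫ t, f t ∂ρ|}
          ≤ ENNReal.ofReal ((N : ℝ) ^ (-A)) := by
  set s : ℂ → ℂ := fun z => limitTrace (m z) with hs_def
  obtain ⟨E, L, hE⟩ := X.exists_isLimitProfile hψ
  have hs : ∀ y : ℝ, 0 < y → ‖1 + (y * Complex.I) * s (y * Complex.I)‖ ≤
      (2 * K + 1) * ((2 * K + 1) * μ 2 ^ 2) / y ^ 2 := fun y hy => by
    have hz : 0 < ((y : ℂ) * Complex.I).im := by simpa using hy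
    have h1 := hE.norm_one_add_mul_limitTrace_le (sq_nonneg _) hz (hm _ hz)
    have e : ((y : ℂ) * Complex.I).im = y := by simp
    rwa [e] at h1
  -- With $N\ge2$ the exceptional event has probability at most $1/2$, so some outcome lies outside
  -- it and provides a deterministic measure.
  have hex : ∀ n, ∃ κ : Measure ℝ, IsProbabilityMeasure κ ∧ IsClose s n κ := fun n => by
    obtain ⟨N₀, h₀⟩ := exists_isClose_prob_le hτ hψ X hm n zero_le_one
    set N := max N₀ 2
    have hN2 : 2 ≤ N := le_max_right _ _
    have hN2' : (2 : ℝ) ≤ N := by exact_mod_cast hN2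
    have := X.isProb N
    by_contra hcon
    have h1 := h₀ N (le_max_left _ _)
    have h2 : {ω | ¬ IsClose s n (empiricalMeasure fun a => X.x N a ω)} = Set.univ :=
      Set.eq_univ_of_forall fun ω hω =>
        hcon ⟨_, isProbabilityMeasure_empiricalMeasure (by omega) _, hω⟩
    rw [h2, probReal_univ, Real.rpow_neg_one] at h1
    have h3 := inv_anti₀ (by norm_num) hN2'
    norm_num at h3
    linarith
  choose κ hκp hκ using hex
  obtain ⟨ρ, hρ, -⟩ := exists_stieltjes_eq_of_tendsto hs (fun n => ⟨κ n, hκp n⟩)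
    fun z hz => tendsto_of_isClose hκ hz
  refine ⟨ρ, inferInstance, fun z hz => (hρ z hz).symm, fun f ε hε A => ?_⟩
  obtain ⟨n, hn⟩ := exists_isClose_imp hs hρ f hε
  obtain ⟨N₀, h₀⟩ := exists_isClose_prob_le hτ hψ X hm n (le_max_right A 0)
  refine ⟨max N₀ 1, fun N hN => ?_⟩
  have hN1 : 1 ≤ N := (le_max_right _ _).trans hN
  have hNR : (1 : ℝ) ≤ N := by exact_mod_cast hN1
  have := X.isProb N
  refine measure_le_ofReal_of_subset ?_ ((h₀ N ((le_max_left _ _).trans hN)).trans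
    (Real.rpow_le_rpow_of_exponent_le hNR (neg_le_neg (le_max_left A 0))))
  intro ω hω hcl
  exact absurd (hn _ (isProbabilityMeasure_empiricalMeasure hN1 _) hcl) (not_lt.2 hω)

end CorrelatedRM

end

open CorrelatedRM in
theorem mainTheorem3 (K : ℕ) (τ : ℝ) (hτ : τ ∈ Set.Ioc (0 : ℝ) 1) (μ : ℕ → ℝ)
    (D : Set ℂ) (hDc : IsCompact (closure D)) (hD : closure D ⊆ {z : ℂ | 0 < z.im}) :
    (∀ ν : ℝ, 0 < ν → ∀ p : ℕ, ∃ N₀ : ℕ,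
      ∀ (ψ : ℝ → ℝ → ℤ → ℤ → ℝ), IsProfile ψ → ∀ (C : ℝ) (X : CorrelatedModel K τ μ ψ C),
      ∀ N ≥ N₀, ∀ M : ℂ → Matrix (Fin N) (Fin N) ℂ,
        (∀ z ∈ D, SolvesFinite (covTensor (X.P N) (X.x N)) z (M z)) →
        X.P N {ω | ENNReal.ofReal ((N : ℝ) ^ ν) ≤ ⨆ z ∈ D, ⨆ i : Fin N, ⨆ j : Fin N,
            ENNReal.ofReal
              (‖green (fun a => X.x N a ω) z i j - M z i j‖ / controlPhi τ N z)}
          ≤ ENNReal.ofReal ((N : ℝ) ^ (-(ν * (p : ℝ))))) ∧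
    (∀ (ψ : ℝ → ℝ → ℤ → ℤ → ℝ), IsProfile ψ → ∀ C : ℝ,
      (∀ ν : ℝ, 0 < ν → ∀ p : ℕ, ∃ N₀ : ℕ,
        ∀ (X : CorrelatedModel K τ μ ψ C) (m : ℂ → ℝ → ℤ → ℂ),
        (∀ z ∈ D, SolvesLimit ψ z (m z)) →
        ∀ N ≥ N₀,
          X.P N {ω | ENNReal.ofReal ((N : ℝ) ^ ν) ≤ ⨆ z ∈ D,
              ENNReal.ofReal
                (‖(1 / (N : ℂ)) * (green (fun a => X.x N a ω) z).trace - limitTrace (m z)‖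
                  / controlPhi τ N z)}
            ≤ ENNReal.ofReal ((N : ℝ) ^ (-(ν * (p : ℝ))))) ∧
      (∀ (X : CorrelatedModel K τ μ ψ C) (m : ℂ → ℝ → ℤ → ℂ),
        (∀ z : ℂ, 0 < z.im → SolvesLimit ψ z (m z)) →
        ∃ ρ : MeasureTheory.Measure ℝ, MeasureTheory.IsProbabilityMeasure ρ ∧
          (∀ z : ℂ, 0 < z.im → limitTrace (m z) = ∫ t : ℝ, 1 / ((t : ℂ) - z) ∂ρ) ∧
          ∀ (f : ℝ →ᵇ ℝ) (ε : ℝ), 0 < ε → ∀ A : ℝ, ∃ N₀ : ℕ, ∀ N ≥ N₀,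
            X.P N {ω | ε ≤ |∫ t, f t ∂(empiricalMeasure (fun a => X.x N a ω)) - ∫ t, f t ∂ρ|}
              ≤ ENNReal.ofReal ((N : ℝ) ^ (-A)))) := by
  refine ⟨fun ν hν p => ?_, fun ψ hψ C => ⟨fun ν hν p => ?_, fun X m hm => ?_⟩⟩
  · obtain ⟨N₀, h⟩ := finite_law (K := K) hτ μ hDc hD hν p
    exact ⟨N₀, fun ψ _ C X => h ψ C X⟩
  · exact limit_law hτ μ hDc hD hψ C hν p
  · exact exists_limit_measure hτ hψ X hm
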